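/- Let $\varphi:(0,\infty)\to[1,\infty)$ be measurable and sub-additive. For $p\ge 0$ let $B_p$ be the space of measurable $f:(0,\infty)\to\mathbb R$ with $\sup|f|/\varphi^p<\infty$, and for a finite signed measure $\rho$ on $(0,\infty)$ put $\|\rho\|_p=\int\varphi^p\,d|\rho|$, $\mathcal M_p=\{\rho:\|\rho\|_p<\infty\}$. Write $(f,\rho)=\int f\,d\rho$ and $\{f\}(x,y)=f(x+y)-f(x)-f(y)$. Let $\mathcal U\subset\mathbb R^d$ be open and let $K^\lambda(x,y)$, $\lambda\in\mathcal U$, be non-negative symmetric measurable kernels on $(0,\infty)^2$, of class $C^2$ in $\lambda$, with $K^\lambda(x,y)\le\varphi(x)\varphi(y)$ and $|\partial_\lambda K^\lambda(x,y)|\le\varphi(x)\varphi(y)$. Let $K^{\lambda;N}$, $N\ge0$, be families of kernels with the same properties such that moreover, for each $N$, $K^{\lambda;N}$, $\partial_\lambda K^{\lambda;N}$ and $\partial^2_\lambda K^{\lambda;N}$ are bounded uniformly in $(\lambda,x,y)$, and such that $K^{\lambda;N}\to K^\lambda$ and $\partial_\lambda K^{\lambda;N}\to\partial_\lambda K^\lambda$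 pointwise as $N\to\infty$. Fix $\lambda\in\mathcal U$, $\varepsilon>0$, $T\ge0$ and a finite non-negative measure $\mu_0$. Let $(\mu_t)_{0\le t\le T}$ be a path of finite non-negative measures started from $\mu_0$ that solves Smoluchowski's equation $$(f,\mu_t)=(f,\mu_0)+\tfrac12\int_0^t\!\int\{f\}(x,y)K^\lambda(x,y)\,\mu_s(dx)\mu_s(dy)\,ds\qquad(f\text{ bounded measurable}),$$ with $\sup_{t\le T}(\varphi^{4+\varepsilon},\mu_t)<\infty$. For each $N$ and each $\lambda'\in\mathcal U$ let $(\mu_t^{\lambda';N})_{0\le t\le T}$ be the solution of the same equation with kernel $K^{\lambda';N}$, started from $\mu_0$. For $0\le s\le t\le T$ let $U_{s,t}$ be the propagator of the backward equation $\dot f_s=-\Lambda_sf_s$, where $\Lambda_sf(x)=\int\{f\}(x,y)K^\lambda(x,y)\,\mu_s(dy)$. Explicitly, put $M_sf(x)=\int f(y)K^\lambda(x,y)\,\mu_s(dy)$, $L_sf(x)=\int f(x+y)K^\lambda(x,y)\,\mu_s(dy)$, $T_s(x)=\int_0^s\!\int K^\lambda(x,y)\,\mu_r(dy)\,dr$,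 let $f_s=S_{s,t}f$ be the sum of the Picard series of $$f_s=e^{T_s-T_t}f+\int_s^te^{T_s-T_r}L_rf_r\,dr$$ (its minimal solution when $f\ge0$), and let $$U_{s,t}f=\sum_{n\ge0}(-1)^n\int_{s\le r_1\le\dots\le r_n\le t}S_{s,r_1}M_{r_1}S_{r_1,r_2}\cdots M_{r_n}S_{r_n,t}f\;dr_1\cdots dr_n.$$ Put $\Lambda_s^{\partial\lambda}f(x)=\int\{f\}(x,y)\,\partial_\lambda K^\lambda(x,y)\,\mu_s(dy)$. Then: 1. for $f\in B_{1+\varepsilon}$ and $0\le s\le t\le T$ the two series converge pointwise and $U_{s,t}f\in B_{1+\varepsilon}$; 2. for every $N$ and $t\in[0,T]$ the map $\lambda'\mapsto\mu_t^{\lambda';N}$ is differentiable at $\lambda$ in total variation norm, and its derivative $\sigma_t^N$ (a linear map from $\mathbb R^d$ to signed measures) takes values in $\mathcal M_1$; 3. for every $t\in[0,T]$ there is $\sigma_t$, linear on $\mathbb R^d$ with values in $\mathcal M_1$, such that $$(f,\sigma_t)=\frac12\int_0^t\bigl(\Lambda_s^{\partial\lambda}U_{s,t}f,\mu_s\bigr)\,ds\qquad\text{for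 all }f\in B_{1+\varepsilon},$$ the integrand being integrable on $[0,t]$; 4. $\sigma_t^N\to\sigma_t$ in $(\mathcal M_1,\|\cdot\|_1)$, uniformly in $t\in[0,T]$: $$\lim_{N\to\infty}\ \sup_{0\le t\le T}\ \sup_{|v|\le1}\ \|\sigma_t^N(v)-\sigma_t(v)\|_1=0 .$$ -/

import Mathlib

open MeasureTheory Set Filter Topology Asymptotics
open scoped ENNReal NNReal

noncomputable section

namespace Smoluchowski

/-- The space of masses, the open half-line of positive reals, with its addition and Borel sets. -/
abbrev Mass : Type := {x : ℝ // 0 < x}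

/-- The parameter space, Euclidean space of dimension `d`. -/
abbrev Param (d : ℕ) : Type := EuclideanSpace ℝ (Fin d)

/-- A coagulation kernel (or the derivative of one in a direction). -/
abbrev Kern : Type := Mass → Mass → ℝ

/-- The symbol `{f}(x, y) = f (x + y) - f x - f y`. -/
def bracket (f : Mass → ℝ) (x y : Mass) : ℝ := f (x + y) - f x - f y

/-! ### Weights, weighted function spaces and weighted norms of signed measures -/

/-- A measurable sub-additive function that is at least `1`. -/
structure IsWeight (φ : Mass → ℝ) : Prop where
  measurable : Measurable φ
  one_le : ∀ x, 1 ≤ φ x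
  subadd : ∀ x y, φ (x + y) ≤ φ x + φ y

/-- `f ∈ B_p`: `f` is measurable and `|f| / φ ^ p` is bounded. -/
def MemB (φ : Mass → ℝ) (p : ℝ) (f : Mass → ℝ) : Prop :=
  Measurable f ∧ ∃ C : ℝ, ∀ x, |f x| ≤ C * φ x ^ p

/-- `‖ρ‖_p = (φ ^ p, |ρ|)`. The signed measure `ρ` is in `M_p` when this is finite. -/
def normM (φ : Mass → ℝ) (p : ℝ) (ρ : SignedMeasure Mass) : ℝ≥0∞ :=
  ∫⁻ x, ENNReal.ofReal (φ x ^ p) ∂ρ.totalVariation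

/-- The total variation norm `‖ρ‖_0` of a (finite) signed measure. -/
def normTV (ρ : SignedMeasure Mass) : ℝ := (ρ.totalVariation univ).toReal

/-- `(f, ρ)`, the integral of `f` against the signed measure `ρ`. -/
def pairing (f : Mass → ℝ) (ρ : SignedMeasure Mass) : ℝ :=
  ∫ x, f x ∂ρ.toJordanDecomposition.posPart - ∫ x, f x ∂ρ.toJordanDecomposition.negPart

/-! ### Smoluchowski's equation -/

/-- `(f, K(μ, μ)) = ∫ {f}(x, y) K(x, y) μ(dx) μ(dy)`. -/
def coagulation (K : Kern) (μ : Measure Mass) (f : Mass → ℝ) : ℝ :=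
  ∫ p : Mass × Mass, bracket f p.1 p.2 * K p.1 p.2 ∂(μ.prod μ)

/-- The path `μ` of finite non-negative measures solves Smoluchowski's equation with kernel `K`
on `[0, T]`, started from `μ₀`: for all bounded measurable `f`,
`(f, μ_t) = (f, μ₀) + 1/2 ∫_0^t ∫ {f}(x, y) K(x, y) μ_s(dx) μ_s(dy) ds`. -/
structure IsSolution (K : Kern) (T : ℝ) (μ₀ : FiniteMeasure Mass)
    (μ : ℝ → FiniteMeasure Mass) : Prop where
  initial : μ 0 = μ₀
  integrable : ∀ t ∈ Icc 0 T, Integrable (fun p : Mass × Mass => K p.1 p.2)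
    ((μ t : Measure Mass).prod (μ t : Measure Mass))
  intervalIntegrable : ∀ f : Mass → ℝ, Measurable f → (∃ C : ℝ, ∀ x, |f x| ≤ C) →
    IntervalIntegrable (fun s => coagulation K (μ s) f) volume 0 T
  weak_eq : ∀ f : Mass → ℝ, Measurable f → (∃ C : ℝ, ∀ x, |f x| ≤ C) → ∀ t ∈ Icc 0 T,
    ∫ x, f x ∂(μ t : Measure Mass) = ∫ x, f x ∂(μ₀ : Measure Mass) +
      (1 / 2 : ℝ) * ∫ s in (0 : ℝ)..t, coagulation K (μ s) f

/-! ### Kernels depending on a parameter -/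

/-- The derivative of `ℓ ↦ K ℓ x y` at `ℓ`, in the direction `v`. -/
def dKern {d : ℕ} (K : Param d → Kern) (ℓ v : Param d) : Kern :=
  fun x y => fderiv ℝ (fun ℓ' => K ℓ' x y) ℓ v

/-- A family of non-negative symmetric measurable kernels, depending in a `C²` way on the parameter
in the open set `𝒰`, such that `K` and its differential in the parameter are dominated by
`φ(x) φ(y)`. -/
structure IsKernelFamily {d : ℕ} (𝒰 : Set (Param d)) (φ : Mass → ℝ)
    (K : Param d → Kern) : Prop where
  nonneg : ∀ ℓ ∈ 𝒰, ∀ x y, 0 ≤ K ℓ x y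
  symm : ∀ ℓ ∈ 𝒰, ∀ x y, K ℓ x y = K ℓ y x
  measurable : ∀ ℓ ∈ 𝒰, Measurable fun p : Mass × Mass => K ℓ p.1 p.2
  contDiffOn : ∀ x y, ContDiffOn ℝ 2 (fun ℓ => K ℓ x y) 𝒰
  le : ∀ ℓ ∈ 𝒰, ∀ x y, K ℓ x y ≤ φ x * φ y
  norm_fderiv_le : ∀ ℓ ∈ 𝒰, ∀ x y, ‖fderiv ℝ (fun ℓ' => K ℓ' x y) ℓ‖ ≤ φ x * φ y

/-- The kernels and their first two derivatives in the parameter are bounded, uniformly in the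
parameter and in the masses. -/
def IsBoundedFamily {d : ℕ} (𝒰 : Set (Param d)) (K : Param d → Kern) : Prop :=
  ∃ M : ℝ, ∀ ℓ ∈ 𝒰, ∀ x y, |K ℓ x y| ≤ M ∧ ‖fderiv ℝ (fun ℓ' => K ℓ' x y) ℓ‖ ≤ M ∧
    ‖fderiv ℝ (fderiv ℝ fun ℓ' => K ℓ' x y) ℓ‖ ≤ M

/-- `K N → K` as `N → ∞`, pointwise, together with the first derivative in the parameter. -/
def KernelsConverge {d : ℕ} (𝒰 : Set (Param d)) (KN : ℕ → Param d → Kern)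
    (K : Param d → Kern) : Prop :=
  ∀ ℓ ∈ 𝒰, ∀ x y, Tendsto (fun N => KN N ℓ x y) atTop (𝓝 (K ℓ x y)) ∧
    Tendsto (fun N => fderiv ℝ (fun ℓ' => KN N ℓ' x y) ℓ) atTop
      (𝓝 (fderiv ℝ (fun ℓ' => K ℓ' x y) ℓ))

/-- `σ` is the (Fréchet) derivative at `ℓ`, in the space of signed measures with the total variation
norm, of the measure-valued function `m` of the parameter. The value `σ v` is the derivative in the
direction `v`. -/
def HasSensitivityAt {d : ℕ} (m : Param d → FiniteMeasure Mass)
    (σ : Param d →ₗ[ℝ] SignedMeasure Mass) (ℓ : Param d) : Prop :=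
  (fun h : Param d => normTV ((m (ℓ + h) : Measure Mass).toSignedMeasure -
    (m ℓ : Measure Mass).toSignedMeasure - σ h)) =o[𝓝 0] fun h : Param d => h

/-! ### The dual linearised equation and its propagator -/

/-- `Λ f (x) = ∫ {f}(x, y) K(x, y) μ(dy)`. -/
def Lam (K : Kern) (μ : Measure Mass) (f : Mass → ℝ) (x : Mass) : ℝ :=
  ∫ y, bracket f x y * K x y ∂μ

/-- `L f (x) = ∫ f (x + y) K(x, y) μ(dy)`. -/
def gain (K : Kern) (μ : Measure Mass) (f : Mass → ℝ) (x : Mass) : ℝ :=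
  ∫ y, f (x + y) * K x y ∂μ

/-- `M f (x) = ∫ f (y) K(x, y) μ(dy)`. -/
def pert (K : Kern) (μ : Measure Mass) (f : Mass → ℝ) (x : Mass) : ℝ :=
  ∫ y, f y * K x y ∂μ

/-- `τ (x) = ∫ K(x, y) μ(dy)`. With this, `Λ f = L f - τ f - M f`. -/
def rate (K : Kern) (μ : Measure Mass) (x : Mass) : ℝ := ∫ y, K x y ∂μ

/-- `T_s(x) = ∫_0^s τ_r(x) dr`. -/
def cumRate (K : Kern) (μ : ℝ → FiniteMeasure Mass) (s : ℝ) (x : Mass) : ℝ :=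
  ∫ r in (0 : ℝ)..s, rate K (μ r) x

/-- The terms of the Picard series of the backward integral equation
`f_s = e^{T_s - T_t} f + ∫_s^t e^{T_s - T_r} L_r f_r dr`. -/
def transportTerm (K : Kern) (μ : ℝ → FiniteMeasure Mass) :
    ℕ → ℝ → ℝ → (Mass → ℝ) → Mass → ℝ
  | 0, s, t, f, x => Real.exp (cumRate K μ s x - cumRate K μ t x) * f x
  | n + 1, s, t, f, x => ∫ r in s..t, Real.exp (cumRate K μ s x - cumRate K μ r x) *
      gain K (μ r) (transportTerm K μ n r t f) x

/-- `S_{s,t} f`. For `f ≥ 0` all terms are non-negative and the sum is the minimal non-negative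
solution of `f_s = e^{T_s - T_t} f + ∫_s^t e^{T_s - T_r} L_r f_r dr`, that is of
`f_s' = -J_s f_s`, `f_t = f`, with `J_s = L_s - τ_s`. -/
def transport (K : Kern) (μ : ℝ → FiniteMeasure Mass) (s t : ℝ) (f : Mass → ℝ) (x : Mass) : ℝ :=
  ∑' n, transportTerm K μ n s t f x

/-- The terms `(-1)^n ∫_{s ≤ r₁ ≤ … ≤ r_n ≤ t} S_{s,r₁} M_{r₁} S_{r₁,r₂} … M_{r_n} S_{r_n,t} f`
of the perturbation series. -/
def propagatorTerm (K : Kern) (μ : ℝ → FiniteMeasure Mass) :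
    ℕ → ℝ → ℝ → (Mass → ℝ) → Mass → ℝ
  | 0, s, t, f, x => transport K μ s t f x
  | n + 1, s, t, f, x =>
      -∫ r in s..t, transport K μ s r (pert K (μ r) (propagatorTerm K μ n r t f)) x

/-- The propagator `U_{s,t}` of the backward equation `f_s' = -Λ_s f_s`, `f_t = f`,
where `Λ_s = J_s - M_s`. -/
def propagator (K : Kern) (μ : ℝ → FiniteMeasure Mass) (s t : ℝ) (f : Mass → ℝ) (x : Mass) : ℝ :=
  ∑' n, propagatorTerm K μ n s t f x

/-- For `f ∈ B_p` and `0 ≤ s ≤ t ≤ T` the two series that define `U_{s,t} f` converge, and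
`U_{s,t} f ∈ B_p`. -/
def PropagatorActsOn (φ : Mass → ℝ) (p : ℝ) (K : Kern) (μ : ℝ → FiniteMeasure Mass)
    (T : ℝ) : Prop :=
  ∀ f, MemB φ p f → ∀ s t, 0 ≤ s → s ≤ t → t ≤ T →
    (∀ x, Summable fun n => transportTerm K μ n s t f x) ∧
    (∀ x, Summable fun n => propagatorTerm K μ n s t f x) ∧
    MemB φ p (propagator K μ s t f)

/-- The integrand `(Λ^∂_s U_{s,t} f, μ_s)`, where `Λ^∂_s` is built with the kernel `G`. -/
def sensIntegrand (K G : Kern) (μ : ℝ → FiniteMeasure Mass) (t : ℝ) (f : Mass → ℝ) (s : ℝ) : ℝ :=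
  ∫ x, Lam G (μ s) (propagator K μ s t f) x ∂(μ s : Measure Mass)

/-- The signed measure `ρ` is in `M_1` and is given by the representation formula
`(f, ρ) = 1/2 ∫_0^t (Λ^∂_s U_{s,t} f, μ_s) ds` for all `f ∈ B_p`. -/
def IsRepresented (φ : Mass → ℝ) (p : ℝ) (K G : Kern) (μ : ℝ → FiniteMeasure Mass) (t : ℝ)
    (ρ : SignedMeasure Mass) : Prop :=
  normM φ 1 ρ < ∞ ∧ ∀ f, MemB φ p f →
    IntervalIntegrable (sensIntegrand K G μ t f) volume 0 t ∧
    pairing f ρ = (1 / 2 : ℝ) * ∫ s in (0 : ℝ)..t, sensIntegrand K G μ t f s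

end Smoluchowski

end

noncomputable section

namespace Smoluchowski

/-! ### Measurability -/

instance : MeasurableAdd₂ Mass :=
  ⟨((measurable_subtype_coe.comp measurable_fst).add
    (measurable_subtype_coe.comp measurable_snd)).subtype_mk⟩

lemma measurable_setIntegral_Ioc {α : Type*} [MeasurableSpace α] {F : α → ℝ → ℝ}
    (hF : Measurable (Function.uncurry F)) {a b : α → ℝ} (ha : Measurable a) (hb : Measurable b) :
    Measurable fun x => ∫ r in Ioc (a x) (b x), F x r := by
  have : (fun x => ∫ r in Ioc (a x) (b x), F x r) = fun x => ∫ r,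
      Set.indicator {p : α × ℝ | a p.1 < p.2 ∧ p.2 ≤ b p.1} (Function.uncurry F) (x, r) := by
    ext x
    rw [← integral_indicator measurableSet_Ioc]
    rfl
  rw [this]
  have hm : MeasurableSet {p : α × ℝ | a p.1 < p.2 ∧ p.2 ≤ b p.1} :=
    (measurableSet_lt (ha.comp measurable_fst) measurable_snd).inter
      (measurableSet_le measurable_snd (hb.comp measurable_fst))
  exact (hF.indicator hm).stronglyMeasurable.integral_prod_right'.measurable

lemma measurable_intervalIntegral {α : Type*} [MeasurableSpace α] {F : α → ℝ → ℝ}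
    (hF : Measurable (Function.uncurry F)) {a b : α → ℝ} (ha : Measurable a) (hb : Measurable b) :
    Measurable fun x => ∫ r in (a x)..(b x), F x r :=
  (measurable_setIntegral_Ioc hF ha hb).sub (measurable_setIntegral_Ioc hF hb ha)

lemma measurable_setLIntegral_Ioc {α : Type*} [MeasurableSpace α] {F : α → ℝ → ℝ≥0∞}
    (hF : Measurable (Function.uncurry F)) {a b : α → ℝ} (ha : Measurable a) (hb : Measurable b) :
    Measurable fun x => ∫⁻ r in Ioc (a x) (b x), F x r := by
  have : (fun x => ∫⁻ r in Ioc (a x) (b x), F x r) = fun x => ∫⁻ r,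
      Set.indicator {p : α × ℝ | a p.1 < p.2 ∧ p.2 ≤ b p.1} (Function.uncurry F) (x, r) := by
    ext x
    rw [← lintegral_indicator measurableSet_Ioc]
    rfl
  rw [this]
  have hm : MeasurableSet {p : α × ℝ | a p.1 < p.2 ∧ p.2 ≤ b p.1} :=
    (measurableSet_lt (ha.comp measurable_fst) measurable_snd).inter
      (measurableSet_le measurable_snd (hb.comp measurable_fst))
  exact (hF.indicator hm).lintegral_prod_right'

/-! ### Interval integrals of bounded measurable functions -/

lemma intervalIntegrable_of_bound {f : ℝ → ℝ} (hf : Measurable f) {s t b : ℝ} (hst : s ≤ t)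
    (hb : ∀ r ∈ Ioc s t, |f r| ≤ b) : IntervalIntegrable f volume s t := by
  rw [intervalIntegrable_iff_integrableOn_Ioc_of_le hst]
  exact Measure.integrableOn_of_bounded (M := b) (by simp) hf.aestronglyMeasurable
    ((ae_restrict_iff' measurableSet_Ioc).2 (ae_of_all _ hb))

lemma abs_intervalIntegral_le_const {f : ℝ → ℝ} {s t b : ℝ} (hst : s ≤ t)
    (hb : ∀ r ∈ Ioc s t, |f r| ≤ b) : |∫ r in s..t, f r| ≤ b * (t - s) := by
  have := intervalIntegral.norm_integral_le_of_norm_le_const (f := f) (a := s) (b := t) (C := b)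
    (by rwa [uIoc_of_le hst])
  rwa [abs_of_nonneg (sub_nonneg.2 hst)] at this

lemma integral_triangle {F : ℝ → ℝ → ℝ} (hF : Measurable (Function.uncurry F)) {s t b : ℝ}
    (hst : s ≤ t) (hb : ∀ r ∈ Ioc s t, ∀ q ∈ Ioc s t, |F r q| ≤ b) :
    ∫ r in s..t, ∫ q in r..t, F r q = ∫ q in s..t, ∫ r in s..q, F r q := by
  set D : Set (ℝ × ℝ) := {p | p.1 < p.2} with hD
  have hDm : MeasurableSet D := measurableSet_lt measurable_fst measurable_snd
  set G : ℝ → ℝ → ℝ := fun r q => D.indicator (Function.uncurry F) (r, q) with hG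
  have hGm : Measurable (Function.uncurry G) := hF.indicator hDm
  have h1 : ∀ r ∈ Ioc s t, ∫ q in r..t, F r q = ∫ q in Ioc s t, G r q := by
    intro r hr
    rw [intervalIntegral.integral_of_le hr.2]
    have : ∀ q ∈ Ioc s t, G r q = (Ioc r t).indicator (F r) q := by
      intro q hq
      simp only [hG, hD, indicator, mem_ofPred_eq, mem_Ioc, hq.2, and_true, Function.uncurry_apply_pair]
    rw [setIntegral_congr_fun measurableSet_Ioc this, setIntegral_indicator measurableSet_Ioc]
    congr 2
    rw [inter_eq_right.2 (Ioc_subset_Ioc_left hr.1.le)]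
  have h2 : ∀ q ∈ Ioc s t, ∫ r in s..q, F r q = ∫ r in Ioc s t, G r q := by
    intro q hq
    rw [intervalIntegral.integral_of_le hq.1.le, integral_Ioc_eq_integral_Ioo]
    have : ∀ r ∈ Ioc s t, G r q = (Ioo s q).indicator (fun r => F r q) r := by
      intro r hr
      simp only [hG, hD, indicator, mem_ofPred_eq, mem_Ioo, hr.1, true_and, Function.uncurry_apply_pair]
    rw [setIntegral_congr_fun measurableSet_Ioc this, setIntegral_indicator measurableSet_Ioo]
    congr 2
    rw [inter_eq_right.2 ((Ioo_subset_Ioc_self).trans (Ioc_subset_Ioc_right hq.2))]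
  rw [intervalIntegral.integral_of_le hst, intervalIntegral.integral_of_le hst,
    setIntegral_congr_fun measurableSet_Ioc h1, setIntegral_congr_fun measurableSet_Ioc h2]
  refine integral_integral_swap ?_
  rw [Measure.prod_restrict]
  refine Measure.integrableOn_of_bounded (M := max b 0) ?_ hGm.aestronglyMeasurable
    ((ae_restrict_iff' (measurableSet_Ioc.prod measurableSet_Ioc)).2 (ae_of_all _ ?_))
  · rw [Measure.prod_prod]
    simp [ENNReal.mul_eq_top]
  · rintro ⟨r, q⟩ ⟨hr, hq⟩
    by_cases h : (r, q) ∈ D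
    · simp only [hG, Function.uncurry_apply_pair, indicator_of_mem h, Real.norm_eq_abs]
      exact (hb r hr q hq).trans (le_max_left _ _)
    · simp [hG, indicator_of_notMem h]

lemma integral_mul_tail {θ Θ j : ℝ → ℝ} (hθ : Continuous θ) (hΘ : ∀ r, HasDerivAt Θ (θ r) r)
    (hj : Measurable j) {s t b : ℝ} (hst : s ≤ t) (hb : ∀ r ∈ Ioc s t, |j r| ≤ b) :
    ∫ r in s..t, θ r * ∫ q in r..t, j q = ∫ q in s..t, j q * (Θ q - Θ s) := by
  obtain ⟨B, hB⟩ := (isCompact_Icc (a := s) (b := t)).exists_bound_of_continuousOn hθ.continuousOn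
  have h0 : ∀ r, θ r * ∫ q in r..t, j q = ∫ q in r..t, θ r * j q := fun r => by
    rw [intervalIntegral.integral_const_mul]
  rw [intervalIntegral.integral_congr fun r _ => h0 r]
  rw [integral_triangle (F := fun r q => θ r * j q) (b := B * b) (by
    exact (hθ.measurable.comp measurable_fst).mul (hj.comp measurable_snd)) hst]
  · refine intervalIntegral.integral_congr fun q _ => ?_
    rw [intervalIntegral.integral_mul_const, mul_comm,
      intervalIntegral.integral_eq_sub_of_hasDerivAt (fun r _ => hΘ r) (hθ.intervalIntegrable _ _)]
  · intro r hr q hq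
    rw [abs_mul]
    exact mul_le_mul (hB r ⟨hr.1.le, hr.2⟩) (hb q hq) (abs_nonneg _)
      ((norm_nonneg _).trans (hB r ⟨hr.1.le, hr.2⟩))

/-! ### Mild and integrated forms of a scalar linear equation -/

section Scalar

variable {τ : ℝ → ℝ} {k u : ℝ → ℝ} {a s t b : ℝ}

lemma integral_decay (hτ : Continuous τ) (c : ℝ) :
    ∫ r in s..t, Real.exp ((∫ q in (0 : ℝ)..s, τ q) - ∫ q in (0 : ℝ)..r, τ q) *
        ((τ r + c) * Real.exp (c * (t - r))) =
      Real.exp (c * (t - s)) - Real.exp ((∫ q in (0 : ℝ)..s, τ q) - ∫ q in (0 : ℝ)..t, τ q) := by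
  have hT : ∀ r, HasDerivAt (fun r => ∫ q in (0 : ℝ)..r, τ q) (τ r) r := fun r =>
    hτ.integral_hasStrictDerivAt 0 r |>.hasDerivAt
  have hTc : Continuous fun r => ∫ q in (0 : ℝ)..r, τ q :=
    continuous_iff_continuousAt.2 fun r => (hT r).continuousAt
  have h : ∀ r, HasDerivAt (fun r => -(Real.exp ((∫ q in (0 : ℝ)..s, τ q) -
      ∫ q in (0 : ℝ)..r, τ q) * Real.exp (c * (t - r))))
      (Real.exp ((∫ q in (0 : ℝ)..s, τ q) - ∫ q in (0 : ℝ)..r, τ q) *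
        ((τ r + c) * Real.exp (c * (t - r)))) r := by
    intro r
    have h1 := ((hT r).const_sub (∫ q in (0 : ℝ)..s, τ q)).exp
    have h2 : HasDerivAt (fun r => Real.exp (c * (t - r))) (Real.exp (c * (t - r)) * (c * -1)) r := by
      exact (((hasDerivAt_id r).const_sub t).const_mul c).exp
    exact (h1.mul h2).neg.congr_deriv (by ring)
  rw [intervalIntegral.integral_eq_sub_of_hasDerivAt (fun r _ => h r)]
  · simp
    ring
  · apply Continuous.intervalIntegrable
    fun_prop

lemma integrated_of_mild (hτ : Continuous τ) (hk : Measurable k) (hst : s ≤ t)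
    (hb : ∀ r ∈ Ioc s t, |k r| ≤ b)
    (h : ∀ r ∈ Icc s t, u r = Real.exp ((∫ q in (0 : ℝ)..r, τ q) - ∫ q in (0 : ℝ)..t, τ q) * a +
      ∫ q in r..t, Real.exp ((∫ q in (0 : ℝ)..r, τ q) - ∫ q' in (0 : ℝ)..q, τ q') * k q) :
    u s = a + ∫ r in s..t, (k r - τ r * u r) := by
  set Θ : ℝ → ℝ := fun r => ∫ q in (0 : ℝ)..r, τ q with hΘ
  have hT : ∀ r, HasDerivAt Θ (τ r) r := fun r =>
    hτ.integral_hasStrictDerivAt 0 r |>.hasDerivAt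
  have hTc : Continuous Θ := continuous_iff_continuousAt.2 fun r => (hT r).continuousAt
  have hE : ∀ r, HasDerivAt (fun r => Real.exp (Θ r)) (τ r * Real.exp (Θ r)) r := fun r => by
    rw [mul_comm]; exact (hT r).exp
  have hkI : ∀ r ∈ Icc s t, IntervalIntegrable k volume r t := fun r hr =>
    intervalIntegrable_of_bound hk hr.2 fun q hq => hb q ⟨hr.1.trans_lt hq.1, hq.2⟩
  obtain ⟨B, hB⟩ := (isCompact_Icc (a := s) (b := t)).exists_bound_of_continuousOn
    (f := fun r => Real.exp (-Θ r)) (by fun_prop)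
  set j : ℝ → ℝ := fun r => Real.exp (-Θ r) * k r with hj
  have hjm : Measurable j := by
    exact (Real.measurable_exp.comp hTc.measurable.neg).mul hk
  have hjb : ∀ r ∈ Ioc s t, |j r| ≤ B * b := fun r hr => by
    rw [hj, abs_mul]
    exact mul_le_mul (hB r ⟨hr.1.le, hr.2⟩) (hb r hr) (abs_nonneg _)
      ((norm_nonneg _).trans (hB r ⟨hr.1.le, hr.2⟩))
  have hu : ∀ r ∈ Icc s t, u r = Real.exp (Θ r) * (Real.exp (-Θ t) * a) +
      Real.exp (Θ r) * ∫ q in r..t, j q := by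
    intro r hr
    rw [h r hr, sub_eq_add_neg, Real.exp_add, mul_assoc, ← intervalIntegral.integral_const_mul]
    congr 1
    refine intervalIntegral.integral_congr fun q _ => ?_
    simp only [hj]
    rw [sub_eq_add_neg, Real.exp_add, mul_assoc]
  have key := integral_mul_tail (θ := fun r => τ r * Real.exp (Θ r)) (Θ := fun r => Real.exp (Θ r))
    (by fun_prop) hE hjm hst hjb
  have h1 : ∫ r in s..t, τ r * u r = (∫ r in s..t, (τ r * Real.exp (Θ r)) * (Real.exp (-Θ t) * a)) +
      ∫ r in s..t, (τ r * Real.exp (Θ r)) * ∫ q in r..t, j q := by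
    rw [← intervalIntegral.integral_add]
    · refine intervalIntegral.integral_congr fun r hr => ?_
      rw [uIcc_of_le hst] at hr
      simp only [hu r hr]
      ring
    · apply Continuous.intervalIntegrable
      fun_prop
    · apply ContinuousOn.intervalIntegrable
      refine ContinuousOn.mul (by fun_prop) ?_
      have := intervalIntegral.continuousOn_primitive_interval_left (μ := volume) (f := j)
        (a := s) (b := t) ?_
      · exact this
      · rw [uIcc_of_le hst, integrableOn_Icc_iff_integrableOn_Ioc,
          ← intervalIntegrable_iff_integrableOn_Ioc_of_le hst]
        exact intervalIntegrable_of_bound hjm hst hjb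
  have h1' : IntervalIntegrable (fun r => τ r * u r) volume s t := by
    have : IntervalIntegrable (fun r => τ r * (Real.exp (Θ r) * (Real.exp (-Θ t) * a) +
      Real.exp (Θ r) * ∫ q in r..t, j q)) volume s t := by
      apply ContinuousOn.intervalIntegrable
      have := intervalIntegral.continuousOn_primitive_interval_left (μ := volume) (f := j)
        (a := s) (b := t) (by
          rw [uIcc_of_le hst, integrableOn_Icc_iff_integrableOn_Ioc,
            ← intervalIntegrable_iff_integrableOn_Ioc_of_le hst]
          exact intervalIntegrable_of_bound hjm hst hjb)
      have h3 : ContinuousOn (fun r => Real.exp (Θ r)) (uIcc s t) := by fun_prop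
      exact hτ.continuousOn.mul ((h3.mul continuousOn_const).add (h3.mul this))
    refine this.congr fun r hr => ?_
    rw [uIoc_of_le hst] at hr
    simp only [hu r ⟨hr.1.le, hr.2⟩]
  rw [intervalIntegral.integral_sub (hkI s ⟨le_rfl, hst⟩) h1', h1, key,
    intervalIntegral.integral_mul_const,
    intervalIntegral.integral_eq_sub_of_hasDerivAt (fun r _ => hE r)
      (Continuous.intervalIntegrable (by fun_prop) _ _), hu s ⟨le_rfl, hst⟩]
  have h2 : ∫ q in s..t, j q * (Real.exp (Θ q) - Real.exp (Θ s)) =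
      (∫ q in s..t, k q) - Real.exp (Θ s) * ∫ q in s..t, j q := by
    rw [← intervalIntegral.integral_const_mul, ← intervalIntegral.integral_sub
      (hkI s ⟨le_rfl, hst⟩) ((intervalIntegrable_of_bound hjm hst hjb).const_mul _)]
    refine intervalIntegral.integral_congr fun q _ => ?_
    simp only [hj]
    have : Real.exp (-Θ q) * Real.exp (Θ q) = 1 := by rw [← Real.exp_add]; simp
    linear_combination (k q) * this
  rw [h2]
  have : Real.exp (Θ t) * Real.exp (-Θ t) = 1 := by rw [← Real.exp_add]; simp
  linear_combination a * this

lemma mild_of_integrated (hτ : Continuous τ) (hk : Measurable k) (hu : Measurable u) (hst : s ≤ t)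
    (hb : ∀ r ∈ Ioc s t, |k r| ≤ b) {b' : ℝ} (hb' : ∀ r ∈ Ioc s t, |u r| ≤ b')
    (h : ∀ r ∈ Icc s t, u r = a + ∫ q in r..t, (k q - τ q * u q)) :
    u s = Real.exp ((∫ q in (0 : ℝ)..s, τ q) - ∫ q in (0 : ℝ)..t, τ q) * a +
      ∫ q in s..t, Real.exp ((∫ q in (0 : ℝ)..s, τ q) - ∫ q' in (0 : ℝ)..q, τ q') * k q := by
  set Θ : ℝ → ℝ := fun r => ∫ q in (0 : ℝ)..r, τ q with hΘ
  have hT : ∀ r, HasDerivAt Θ (τ r) r := fun r =>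
    hτ.integral_hasStrictDerivAt 0 r |>.hasDerivAt
  have hTc : Continuous Θ := continuous_iff_continuousAt.2 fun r => (hT r).continuousAt
  set N : ℝ → ℝ := fun r => -Real.exp (-Θ r) with hN
  have hE : ∀ r, HasDerivAt N (τ r * Real.exp (-Θ r)) r := fun r => by
    exact ((hT r).neg.exp).neg.congr_deriv (by simp only [Pi.neg_apply]; ring)
  obtain ⟨B, hB⟩ := (isCompact_Icc (a := s) (b := t)).exists_bound_of_continuousOn
    (f := fun r => Real.exp (-Θ r)) (by fun_prop)
  obtain ⟨Bτ, hBτ⟩ := (isCompact_Icc (a := s) (b := t)).exists_bound_of_continuousOn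
    (f := τ) (by fun_prop)
  set j : ℝ → ℝ := fun r => k r - τ r * u r with hj
  have hjm : Measurable j := hk.sub (hτ.measurable.mul hu)
  have hjb : ∀ r ∈ Ioc s t, |j r| ≤ b + Bτ * b' := fun r hr => by
    refine (abs_sub _ _).trans (add_le_add (hb r hr) ?_)
    rw [abs_mul]
    exact mul_le_mul (hBτ r ⟨hr.1.le, hr.2⟩) (hb' r hr) (abs_nonneg _)
      ((norm_nonneg _).trans (hBτ r ⟨hr.1.le, hr.2⟩))
  have hjI := intervalIntegrable_of_bound hjm hst hjb
  have hexp : Measurable fun r => Real.exp (-Θ r) := Real.measurable_exp.comp hTc.measurable.neg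
  have hejI : IntervalIntegrable (fun r => Real.exp (-Θ r) * j r) volume s t := by
    refine intervalIntegrable_of_bound (hexp.mul hjm) hst (b := B * (b + Bτ * b')) fun r hr => ?_
    rw [Pi.mul_apply, abs_mul]
    exact mul_le_mul (hB r ⟨hr.1.le, hr.2⟩) (hjb r hr) (abs_nonneg _)
      ((norm_nonneg _).trans (hB r ⟨hr.1.le, hr.2⟩))
  have hcont := intervalIntegral.continuousOn_primitive_interval_left (μ := volume) (f := j)
        (a := s) (b := t) (by
          rw [uIcc_of_le hst, integrableOn_Icc_iff_integrableOn_Ioc,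
            ← intervalIntegrable_iff_integrableOn_Ioc_of_le hst]
          exact hjI)
  have hθc : Continuous fun r => τ r * Real.exp (-Θ r) := by fun_prop
  have key := integral_mul_tail (θ := fun r => τ r * Real.exp (-Θ r)) (Θ := N) hθc hE hjm hst hjb
  have h1 : ∫ r in s..t, Real.exp (-Θ r) * k r = (∫ r in s..t, Real.exp (-Θ r) * j r) +
      ((∫ r in s..t, (τ r * Real.exp (-Θ r)) * a) +
      ∫ r in s..t, (τ r * Real.exp (-Θ r)) * ∫ q in r..t, j q) := by
    have e1 : IntervalIntegrable (fun r => (τ r * Real.exp (-Θ r)) * a) volume s t :=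
      (hθc.mul continuous_const).intervalIntegrable _ _
    have e2 : IntervalIntegrable (fun r => (τ r * Real.exp (-Θ r)) * ∫ q in r..t, j q) volume s t :=
      ContinuousOn.intervalIntegrable (hθc.continuousOn.mul hcont)
    rw [← intervalIntegral.integral_add e1 e2, ← intervalIntegral.integral_add hejI (e1.add e2)]
    refine intervalIntegral.integral_congr fun r hr => ?_
    rw [uIcc_of_le hst] at hr
    have := h r hr
    simp only [hj] at this ⊢
    rw [mul_sub]
    linear_combination (τ r * Real.exp (-Θ r)) * this
  have h2 : ∫ q in s..t, j q * (N q - N s) =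
      -(∫ q in s..t, Real.exp (-Θ q) * j q) + Real.exp (-Θ s) * ∫ q in s..t, j q := by
    rw [← intervalIntegral.integral_const_mul, ← intervalIntegral.integral_neg,
      ← intervalIntegral.integral_add (by exact hejI.neg) (hjI.const_mul _)]
    refine intervalIntegral.integral_congr fun q _ => ?_
    simp only [hN]
    ring
  rw [key, h2, intervalIntegral.integral_mul_const,
    intervalIntegral.integral_eq_sub_of_hasDerivAt (fun r _ => hE r) (hθc.intervalIntegrable _ _)]
    at h1
  have h3 : ∫ q in s..t, Real.exp (Θ s - Θ q) * k q =
      Real.exp (Θ s) * ∫ r in s..t, Real.exp (-Θ r) * k r := by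
    rw [← intervalIntegral.integral_const_mul]
    refine intervalIntegral.integral_congr fun q _ => ?_
    simp only [sub_eq_add_neg, Real.exp_add]
    ring
  have h4 : Real.exp (Θ s) * Real.exp (-Θ s) = 1 := by rw [← Real.exp_add]; simp
  rw [h3, h1, sub_eq_add_neg, Real.exp_add, h s ⟨le_rfl, hst⟩]
  simp only [hN, hj]
  linear_combination (-(∫ q in s..t, (k q - τ q * u q)) - a) * h4

end Scalar

/-! ### Measurable paths of measures -/

/-- A measurable path of finite measures with uniformly bounded mass. -/
structure IsMeasurablePath (m : ℝ → FiniteMeasure Mass) : Prop where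
  measurable : Measurable fun r => (m r : Measure Mass)
  bounded : ∃ B : ℝ≥0, ∀ r, (m r : Measure Mass) univ ≤ B

namespace IsMeasurablePath

variable {m : ℝ → FiniteMeasure Mass} {α : Type*} [MeasurableSpace α]

/-- The path as a transition kernel. -/
def kernel (hm : IsMeasurablePath m) : ProbabilityTheory.Kernel ℝ Mass :=
  ⟨fun r => (m r : Measure Mass), hm.measurable⟩

instance (hm : IsMeasurablePath m) : ProbabilityTheory.IsFiniteKernel hm.kernel := by
  obtain ⟨B, hB⟩ := hm.bounded
  exact ⟨B, ENNReal.coe_lt_top, hB⟩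

lemma kernel_apply (hm : IsMeasurablePath m) (r : ℝ) : hm.kernel r = (m r : Measure Mass) := rfl

lemma measurable_integral (hm : IsMeasurablePath m) {F : α → Mass → ℝ}
    (hF : Measurable (Function.uncurry F)) {ρ : α → ℝ} (hρ : Measurable ρ) :
    Measurable fun a => ∫ y, F a y ∂(m (ρ a) : Measure Mass) :=
  (hF.stronglyMeasurable.integral_kernel_prod_right (κ := hm.kernel.comap ρ hρ)).measurable

lemma measurable_lintegral (hm : IsMeasurablePath m) {F : α → Mass → ℝ≥0∞}
    (hF : Measurable (Function.uncurry F)) {ρ : α → ℝ} (hρ : Measurable ρ) :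
    Measurable fun a => ∫⁻ y, F a y ∂(m (ρ a) : Measure Mass) :=
  hF.lintegral_kernel_prod_right (κ := hm.kernel.comap ρ hρ)

lemma measurable_integral_prod (hm : IsMeasurablePath m) {F : α → Mass × Mass → ℝ}
    (hF : Measurable (Function.uncurry F)) {ρ : α → ℝ} (hρ : Measurable ρ) :
    Measurable fun a => ∫ p, F a p ∂((m (ρ a) : Measure Mass).prod (m (ρ a) : Measure Mass)) := by
  have := (hF.stronglyMeasurable.integral_kernel_prod_right
    (κ := (hm.kernel.comap ρ hρ).prod (hm.kernel.comap ρ hρ))).measurable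
  simpa only [ProbabilityTheory.Kernel.prod_apply, ProbabilityTheory.Kernel.comap_apply,
    kernel_apply] using this

lemma measurable_lintegral_prod (hm : IsMeasurablePath m) {F : α → Mass × Mass → ℝ≥0∞}
    (hF : Measurable (Function.uncurry F)) {ρ : α → ℝ} (hρ : Measurable ρ) :
    Measurable fun a => ∫⁻ p, F a p ∂((m (ρ a) : Measure Mass).prod (m (ρ a) : Measure Mass)) := by
  have := (hF.lintegral_kernel_prod_right
    (κ := (hm.kernel.comap ρ hρ).prod (hm.kernel.comap ρ hρ)))
  simpa only [ProbabilityTheory.Kernel.prod_apply, ProbabilityTheory.Kernel.comap_apply,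
    kernel_apply] using this

end IsMeasurablePath

/-! ### Coagulation paths and Lyapunov weights -/

/-- A non-negative measurable kernel together with a measurable path of measures, such that the rate
is finite and continuous in time. -/
structure CoagPath (K : Kern) (m : ℝ → FiniteMeasure Mass) : Prop extends IsMeasurablePath m where
  measurable_kern : Measurable fun p : Mass × Mass => K p.1 p.2
  nonneg : ∀ x y, 0 ≤ K x y
  integrable : ∀ r x, Integrable (K x) (m r : Measure Mass)
  continuous_rate : ∀ x, Continuous fun r => rate K (m r) x

/-- A weight that the operators `L - τ` and `M` multiply by at most `c`. -/
structure Lyap (K : Kern) (m : ℝ → FiniteMeasure Mass) (w : Mass → ℝ) (c : ℝ) : Prop where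
  measurable : Measurable w
  nonneg : ∀ x, 0 ≤ w x
  const_nonneg : 0 ≤ c
  gain_integrable : ∀ r x, Integrable (fun y => w (x + y) * K x y) (m r : Measure Mass)
  gain_le : ∀ r x, gain K (m r) w x ≤ (rate K (m r) x + c) * w x
  pert_integrable : ∀ r x, Integrable (fun y => w y * K x y) (m r : Measure Mass)
  pert_le : ∀ r x, pert K (m r) w x ≤ c * w x

/-- `f` is measurable and bounded by `C` times the weight `w`. -/
def Dom (w : Mass → ℝ) (C : ℝ) (f : Mass → ℝ) : Prop :=
  Measurable f ∧ ∀ x, |f x| ≤ C * w x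

lemma Dom.sub {w : Mass → ℝ} {C C' : ℝ} {f g : Mass → ℝ} (hf : Dom w C f) (hg : Dom w C' g) :
    Dom w (C + C') (fun x => f x - g x) :=
  ⟨hf.1.sub hg.1, fun x => (abs_sub _ _).trans (by linarith [hf.2 x, hg.2 x])⟩

lemma Dom.add {w : Mass → ℝ} {C C' : ℝ} {f g : Mass → ℝ} (hf : Dom w C f) (hg : Dom w C' g) :
    Dom w (C + C') (fun x => f x + g x) :=
  ⟨hf.1.add hg.1, fun x => (abs_add_le _ _).trans (by linarith [hf.2 x, hg.2 x])⟩

lemma Dom.mono {w : Mass → ℝ} (hw : ∀ x, 0 ≤ w x) {C C' : ℝ} {f : Mass → ℝ} (hf : Dom w C f)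
    (h : C ≤ C') : Dom w C' f :=
  ⟨hf.1, fun x => (hf.2 x).trans (mul_le_mul_of_nonneg_right h (hw x))⟩

section

variable {K : Kern} {m : ℝ → FiniteMeasure Mass} {α : Type*} [MeasurableSpace α]

namespace CoagPath

lemma measurable_gain (hP : CoagPath K m) {F : α → Mass → ℝ}
    (hF : Measurable (Function.uncurry F)) {ρ : α → ℝ} (hρ : Measurable ρ) {ξ : α → Mass}
    (hξ : Measurable ξ) : Measurable fun a => gain K (m (ρ a)) (F a) (ξ a) := by
  refine hP.measurable_integral (F := fun a y => F a (ξ a + y) * K (ξ a) y) ?_ hρ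
  have h1 : Measurable fun p : α × Mass => (p.1, ξ p.1 + p.2) := by fun_prop
  have h2 : Measurable fun p : α × Mass => (ξ p.1, p.2) := by fun_prop
  exact (hF.comp h1).mul (hP.measurable_kern.comp h2)

lemma measurable_pert (hP : CoagPath K m) {F : α → Mass → ℝ}
    (hF : Measurable (Function.uncurry F)) {ρ : α → ℝ} (hρ : Measurable ρ) {ξ : α → Mass}
    (hξ : Measurable ξ) : Measurable fun a => pert K (m (ρ a)) (F a) (ξ a) := by
  refine hP.measurable_integral (F := fun a y => F a y * K (ξ a) y) ?_ hρ
  have h2 : Measurable fun p : α × Mass => (ξ p.1, p.2) := by fun_prop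
  exact hF.mul (hP.measurable_kern.comp h2)

lemma measurable_rate (hP : CoagPath K m) {ρ : α → ℝ} (hρ : Measurable ρ) {ξ : α → Mass}
    (hξ : Measurable ξ) : Measurable fun a => rate K (m (ρ a)) (ξ a) := by
  refine hP.measurable_integral (F := fun a y => K (ξ a) y) ?_ hρ
  have h2 : Measurable fun p : α × Mass => (ξ p.1, p.2) := by fun_prop
  exact hP.measurable_kern.comp h2

lemma rate_nonneg (hP : CoagPath K m) (r : ℝ) (x : Mass) : 0 ≤ rate K (m r) x :=
  integral_nonneg fun y => hP.nonneg x y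

lemma continuous_cumRate (hP : CoagPath K m) (x : Mass) : Continuous fun s => cumRate K m s x :=
  continuous_iff_continuousAt.2 fun r =>
    ((hP.continuous_rate x).integral_hasStrictDerivAt 0 r).hasDerivAt.continuousAt

lemma measurable_cumRate (hP : CoagPath K m) {ρ : α → ℝ} (hρ : Measurable ρ) {ξ : α → Mass}
    (hξ : Measurable ξ) : Measurable fun a => cumRate K m (ρ a) (ξ a) := by
  refine measurable_intervalIntegral (F := fun a r => rate K (m r) (ξ a)) ?_ measurable_const hρ
  exact hP.measurable_rate measurable_snd (hξ.comp measurable_fst)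

lemma measurable_decay (hP : CoagPath K m) {ρ ρ' : α → ℝ} (hρ : Measurable ρ) (hρ' : Measurable ρ')
    {ξ : α → Mass} (hξ : Measurable ξ) :
    Measurable fun a => Real.exp (cumRate K m (ρ a) (ξ a) - cumRate K m (ρ' a) (ξ a)) :=
  Real.measurable_exp.comp ((hP.measurable_cumRate hρ hξ).sub (hP.measurable_cumRate hρ' hξ))

lemma measurable_transportTerm (hP : CoagPath K m) {h : ℝ → Mass → ℝ}
    (hh : Measurable (Function.uncurry h)) (n : ℕ) : Measurable fun q : ℝ × ℝ × Mass =>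
      transportTerm K m n q.1 q.2.1 (h q.2.1) q.2.2 := by
  induction n with
  | zero =>
    exact (hP.measurable_decay measurable_fst (measurable_fst.comp measurable_snd)
      (measurable_snd.comp measurable_snd)).mul (hh.comp measurable_snd)
  | succ n ih =>
    refine measurable_intervalIntegral (F := fun (q : ℝ × ℝ × Mass) r =>
      Real.exp (cumRate K m q.1 q.2.2 - cumRate K m r q.2.2) *
      gain K (m r) (transportTerm K m n r q.2.1 (h q.2.1)) q.2.2) ?_ measurable_fst
      (measurable_fst.comp measurable_snd)
    refine (hP.measurable_decay (by fun_prop) measurable_snd (by fun_prop)).mul ?_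
    refine hP.measurable_gain (α := (ℝ × ℝ × Mass) × ℝ)
      (F := fun a => transportTerm K m n a.2 a.1.2.1 (h a.1.2.1)) ?_ measurable_snd (by fun_prop)
    have : Measurable fun p : ((ℝ × ℝ × Mass) × ℝ) × Mass => (p.1.2, p.1.1.2.1, p.2) := by fun_prop
    exact ih.comp this

lemma measurable_transport (hP : CoagPath K m) {h : ℝ → Mass → ℝ}
    (hh : Measurable (Function.uncurry h)) : Measurable fun q : ℝ × ℝ × Mass =>
      transport K m q.1 q.2.1 (h q.2.1) q.2.2 :=
  Measurable.tsum fun n => hP.measurable_transportTerm hh n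

lemma measurable_transport_const (hP : CoagPath K m) {f : Mass → ℝ} (hf : Measurable f) (t : ℝ) :
    Measurable fun q : ℝ × Mass => transport K m q.1 t f q.2 := by
  have h1 := hP.measurable_transport (h := fun _ => f) (hf.comp measurable_snd)
  have : Measurable fun q : ℝ × Mass => (q.1, t, q.2) := by fun_prop
  exact h1.comp this

lemma measurable_transportTerm_const (hP : CoagPath K m) {f : Mass → ℝ} (hf : Measurable f) (n : ℕ)
    (t : ℝ) : Measurable fun q : ℝ × Mass => transportTerm K m n q.1 t f q.2 := by
  have h1 := hP.measurable_transportTerm (h := fun _ => f) (hf.comp measurable_snd) n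
  have : Measurable fun q : ℝ × Mass => (q.1, t, q.2) := by fun_prop
  exact h1.comp this

lemma measurable_propagatorTerm (hP : CoagPath K m) {f : Mass → ℝ} (hf : Measurable f) (t : ℝ)
    (n : ℕ) : Measurable fun q : ℝ × Mass => propagatorTerm K m n q.1 t f q.2 := by
  induction n with
  | zero => exact hP.measurable_transport_const hf t
  | succ n ih =>
    refine (measurable_intervalIntegral (F := fun (q : ℝ × Mass) r =>
      transport K m q.1 r (pert K (m r) (propagatorTerm K m n r t f)) q.2) ?_
      measurable_fst measurable_const).neg
    have h1 := hP.measurable_transport (h := fun r => pert K (m r) (propagatorTerm K m n r t f))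
      (hP.measurable_pert (α := ℝ × Mass) (F := fun a => propagatorTerm K m n a.1 t f)
        (ih.comp (by fun_prop : Measurable fun p : (ℝ × Mass) × Mass => (p.1.1, p.2)))
        measurable_fst measurable_snd)
    have : Measurable fun q : (ℝ × Mass) × ℝ => (q.1.1, q.2, q.1.2) := by fun_prop
    exact h1.comp this

lemma measurable_propagator (hP : CoagPath K m) {f : Mass → ℝ} (hf : Measurable f) (t : ℝ) :
    Measurable fun q : ℝ × Mass => propagator K m q.1 t f q.2 :=
  Measurable.tsum fun n => hP.measurable_propagatorTerm hf t n

lemma decay_le_one (hP : CoagPath K m) {s t : ℝ} (hst : s ≤ t) (x : Mass) :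
    Real.exp (cumRate K m s x - cumRate K m t x) ≤ 1 := by
  rw [Real.exp_le_one_iff, cumRate, cumRate, sub_nonpos, ← sub_nonneg,
    intervalIntegral.integral_interval_sub_left ((hP.continuous_rate x).intervalIntegrable _ _)
      ((hP.continuous_rate x).intervalIntegrable _ _)]
  exact intervalIntegral.integral_nonneg hst fun r _ => hP.rate_nonneg r x

lemma measurable_gain_time (hP : CoagPath K m) {h : ℝ → Mass → ℝ}
    (hh : Measurable fun q : ℝ × Mass => h q.1 q.2) (x : Mass) :
    Measurable fun r => gain K (m r) (h r) x :=
  hP.measurable_gain (α := ℝ) (F := h) hh measurable_id measurable_const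

lemma measurable_decay_time (hP : CoagPath K m) (s : ℝ) (x : Mass) :
    Measurable fun r => Real.exp (cumRate K m s x - cumRate K m r x) :=
  hP.measurable_decay measurable_const measurable_id measurable_const

end CoagPath

namespace Lyap

variable {w : Mass → ℝ} {c : ℝ} {C : ℝ} {f g : Mass → ℝ}

lemma abs_gain_le (hw : Lyap K m w c) (hP : CoagPath K m) (hC : 0 ≤ C) (hf : ∀ x, |f x| ≤ C * w x)
    (r : ℝ) (x : Mass) : |gain K (m r) f x| ≤ C * ((rate K (m r) x + c) * w x) := by
  refine (norm_integral_le_of_norm_le (f := fun y => f (x + y) * K x y)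
    ((hw.gain_integrable r x).const_mul C)
    (ae_of_all _ fun y => ?_)).trans ?_
  · rw [Real.norm_eq_abs, abs_mul, abs_of_nonneg (hP.nonneg x y), ← mul_assoc]
    exact mul_le_mul_of_nonneg_right (hf _) (hP.nonneg x y)
  · rw [integral_const_mul]
    exact mul_le_mul_of_nonneg_left (hw.gain_le r x) hC

lemma abs_pert_le (hw : Lyap K m w c) (hP : CoagPath K m) (hC : 0 ≤ C) (hf : ∀ x, |f x| ≤ C * w x)
    (r : ℝ) (x : Mass) : |pert K (m r) f x| ≤ C * (c * w x) := by
  refine (norm_integral_le_of_norm_le (f := fun y => f y * K x y)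
    ((hw.pert_integrable r x).const_mul C)
    (ae_of_all _ fun y => ?_)).trans ?_
  · rw [Real.norm_eq_abs, abs_mul, abs_of_nonneg (hP.nonneg x y), ← mul_assoc]
    exact mul_le_mul_of_nonneg_right (hf _) (hP.nonneg x y)
  · rw [integral_const_mul]
    exact mul_le_mul_of_nonneg_left (hw.pert_le r x) hC

lemma integrable_gain (hw : Lyap K m w c) (hP : CoagPath K m) (hf : Dom w C f) (r : ℝ) (x : Mass) :
    Integrable (fun y => f (x + y) * K x y) (m r : Measure Mass) := by
  refine ((hw.gain_integrable r x).const_mul C).mono' ?_ (ae_of_all _ fun y => ?_)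
  · have h1 : Measurable fun y : Mass => x + y := by fun_prop
    have h2 : Measurable fun y : Mass => (x, y) := by fun_prop
    exact ((hf.1.comp h1).mul (hP.measurable_kern.comp h2)).aestronglyMeasurable
  · rw [Real.norm_eq_abs, abs_mul, abs_of_nonneg (hP.nonneg x y), ← mul_assoc]
    exact mul_le_mul_of_nonneg_right (hf.2 _) (hP.nonneg x y)

lemma integrable_pert (hw : Lyap K m w c) (hP : CoagPath K m) (hf : Dom w C f) (r : ℝ) (x : Mass) :
    Integrable (fun y => f y * K x y) (m r : Measure Mass) := by
  refine ((hw.pert_integrable r x).const_mul C).mono' ?_ (ae_of_all _ fun y => ?_)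
  · have h2 : Measurable fun y : Mass => (x, y) := by fun_prop
    exact (hf.1.mul (hP.measurable_kern.comp h2)).aestronglyMeasurable
  · rw [Real.norm_eq_abs, abs_mul, abs_of_nonneg (hP.nonneg x y), ← mul_assoc]
    exact mul_le_mul_of_nonneg_right (hf.2 _) (hP.nonneg x y)

lemma gain_add (hw : Lyap K m w c) (hP : CoagPath K m) {C' : ℝ} (hf : Dom w C f) (hg : Dom w C' g)
    (r : ℝ) (x : Mass) : gain K (m r) (fun x => f x + g x) x =
      gain K (m r) f x + gain K (m r) g x := by
  rw [gain, gain, gain, ← integral_add (hw.integrable_gain hP hf r x)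
    (hw.integrable_gain hP hg r x)]
  simp only [add_mul]

lemma gain_sub (hw : Lyap K m w c) (hP : CoagPath K m) {C' : ℝ} (hf : Dom w C f) (hg : Dom w C' g)
    (r : ℝ) (x : Mass) : gain K (m r) (fun x => f x - g x) x =
      gain K (m r) f x - gain K (m r) g x := by
  rw [gain, gain, gain, ← integral_sub (hw.integrable_gain hP hf r x)
    (hw.integrable_gain hP hg r x)]
  simp only [sub_mul]

lemma pert_add (hw : Lyap K m w c) (hP : CoagPath K m) {C' : ℝ} (hf : Dom w C f) (hg : Dom w C' g)
    (r : ℝ) (x : Mass) : pert K (m r) (fun x => f x + g x) x =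
      pert K (m r) f x + pert K (m r) g x := by
  rw [pert, pert, pert, ← integral_add (hw.integrable_pert hP hf r x)
    (hw.integrable_pert hP hg r x)]
  simp only [add_mul]

lemma pert_sub (hw : Lyap K m w c) (hP : CoagPath K m) {C' : ℝ} (hf : Dom w C f) (hg : Dom w C' g)
    (r : ℝ) (x : Mass) : pert K (m r) (fun x => f x - g x) x =
      pert K (m r) f x - pert K (m r) g x := by
  rw [pert, pert, pert, ← integral_sub (hw.integrable_pert hP hf r x)
    (hw.integrable_pert hP hg r x)]
  simp only [sub_mul]

lemma tendsto_gain (hw : Lyap K m w c) (hP : CoagPath K m) {F : ℕ → Mass → ℝ}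
    (hF : ∀ n, Dom w C (F n)) (hlim : ∀ x, Tendsto (fun n => F n x) atTop (𝓝 (f x))) (r : ℝ)
    (x : Mass) : Tendsto (fun n => gain K (m r) (F n) x) atTop (𝓝 (gain K (m r) f x)) := by
  refine tendsto_integral_of_dominated_convergence (fun y => C * (w (x + y) * K x y))
    (fun n => (hw.integrable_gain hP (hF n) r x).aestronglyMeasurable)
    ((hw.gain_integrable r x).const_mul C) (fun n => ae_of_all _ fun y => ?_)
    (ae_of_all _ fun y => (hlim _).mul_const _)
  rw [Real.norm_eq_abs, abs_mul, abs_of_nonneg (hP.nonneg x y), ← mul_assoc]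
  exact mul_le_mul_of_nonneg_right ((hF n).2 _) (hP.nonneg x y)

lemma integral_decay_eq (hP : CoagPath K m) (c : ℝ) (s t : ℝ) (x : Mass) :
    ∫ r in s..t, Real.exp (cumRate K m s x - cumRate K m r x) *
      ((rate K (m r) x + c) * Real.exp (c * (t - r))) =
      Real.exp (c * (t - s)) - Real.exp (cumRate K m s x - cumRate K m t x) :=
  integral_decay (hP.continuous_rate x) c

end Lyap

end

section

variable {K : Kern} {m : ℝ → FiniteMeasure Mass} {w : Mass → ℝ} {c C : ℝ} {f g : Mass → ℝ}

lemma exp_const_sub_le (hc : 0 ≤ c) {s r t : ℝ} (hsr : s ≤ r) :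
    Real.exp (c * (t - r)) ≤ Real.exp (c * (t - s)) :=
  Real.exp_le_exp.2 (mul_le_mul_of_nonneg_left (by linarith) hc)

/-! ### The transport series -/

namespace Lyap

lemma sum_abs_gain_le (hw : Lyap K m w c) (hP : CoagPath K m) (hC : 0 ≤ C) {F : ℕ → Mass → ℝ}
    (hF : ∀ k, Measurable (F k)) {n : ℕ} (hs : ∀ z, ∑ k ∈ Finset.range n, |F k z| ≤ C * w z)
    (r : ℝ) (x : Mass) :
    ∑ k ∈ Finset.range n, |gain K (m r) (F k) x| ≤ C * ((rate K (m r) x + c) * w x) := by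
  have hd : ∀ k ∈ Finset.range n, Dom w C (fun z => |F k z|) := fun k hk =>
    ⟨(hF k).abs, fun z => by
      rw [abs_abs]
      exact (Finset.single_le_sum (f := fun k => |F k z|) (fun _ _ => abs_nonneg _) hk).trans (hs z)⟩
  calc ∑ k ∈ Finset.range n, |gain K (m r) (F k) x|
      ≤ ∑ k ∈ Finset.range n, ∫ y, |F k (x + y)| * K x y ∂(m r : Measure Mass) := by
        refine Finset.sum_le_sum fun k _ => ?_
        refine (abs_integral_le_integral_abs).trans (le_of_eq ?_)
        simp only [abs_mul, abs_of_nonneg (hP.nonneg x _)]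
    _ = ∫ y, ∑ k ∈ Finset.range n, |F k (x + y)| * K x y ∂(m r : Measure Mass) :=
        (integral_finsetSum _ fun k hk => hw.integrable_gain hP (hd k hk) r x).symm
    _ ≤ ∫ y, C * (w (x + y) * K x y) ∂(m r : Measure Mass) := by
        refine integral_mono (integrable_finsetSum _ fun k hk => hw.integrable_gain hP (hd k hk) r x)
          ((hw.gain_integrable r x).const_mul C) fun y => ?_
        simp only
        rw [← Finset.sum_mul, ← mul_assoc]
        exact mul_le_mul_of_nonneg_right (hs _) (hP.nonneg x y)
    _ ≤ _ := by
        rw [integral_const_mul]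
        exact mul_le_mul_of_nonneg_left (hw.gain_le r x) hC

lemma continuous_decay_bound (hP : CoagPath K m) (a : ℝ) (c s t : ℝ) (x : Mass) :
    Continuous fun r => Real.exp (cumRate K m s x - cumRate K m r x) *
      (a * ((rate K (m r) x + c) * Real.exp (c * (t - r)))) := by
  have h1 := hP.continuous_rate x
  have h2 := hP.continuous_cumRate x
  fun_prop

lemma sum_abs_transportTerm_le (hw : Lyap K m w c) (hP : CoagPath K m) (hC : 0 ≤ C)
    (hf : Dom w C f) {t : ℝ} (n : ℕ) : ∀ {s : ℝ}, s ≤ t → ∀ x,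
    ∑ k ∈ Finset.range n, |transportTerm K m k s t f x| ≤ C * Real.exp (c * (t - s)) * w x := by
  induction n with
  | zero =>
    intro s _ x
    simp only [Finset.range_zero, Finset.sum_empty]
    have := hw.nonneg x
    positivity
  | succ n ih =>
    intro s hst x
    rw [Finset.sum_range_succ']
    set b : ℝ → ℝ := fun r => Real.exp (cumRate K m s x - cumRate K m r x) *
      (C * w x * ((rate K (m r) x + c) * Real.exp (c * (t - r)))) with hb
    have hbc : Continuous b := continuous_decay_bound hP _ _ _ _ _
    set J : ℕ → ℝ → ℝ := fun k r => Real.exp (cumRate K m s x - cumRate K m r x) *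
      gain K (m r) (transportTerm K m k r t f) x with hJ
    have hJm : ∀ k, Measurable (J k) := fun k =>
      (hP.measurable_decay_time s x).mul
        (hP.measurable_gain_time (hP.measurable_transportTerm_const hf.1 k t) x)
    have hJb : ∀ r ∈ Ioc s t, ∑ k ∈ Finset.range n, |J k r| ≤ b r := by
      intro r hr
      simp only [hJ, abs_mul, Real.abs_exp, ← Finset.mul_sum]
      refine mul_le_mul_of_nonneg_left ?_ (Real.exp_nonneg _)
      refine (hw.sum_abs_gain_le hP (mul_nonneg hC (Real.exp_nonneg (c * (t - r))))
        (fun k => (hP.measurable_transportTerm_const hf.1 k t).comp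
          (measurable_const.prodMk measurable_id)) (ih hr.2) r x).trans (le_of_eq (by ring))
    have hJI : ∀ k ∈ Finset.range n, IntervalIntegrable (fun r => |J k r|) volume s t := by
      intro k hk
      refine (hbc.intervalIntegrable s t).mono_fun' (hJm k).abs.aestronglyMeasurable ?_
      rw [uIoc_of_le hst]
      refine (ae_restrict_iff' measurableSet_Ioc).2 (ae_of_all _ fun r hr => ?_)
      simp only [Real.norm_eq_abs, abs_abs]
      exact (Finset.single_le_sum (f := fun k => |J k r|) (fun _ _ => abs_nonneg _) hk).trans (hJb r hr)
    have h1 : ∑ k ∈ Finset.range n, |transportTerm K m (k + 1) s t f x| ≤ ∫ r in s..t, b r := by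
      calc ∑ k ∈ Finset.range n, |transportTerm K m (k + 1) s t f x|
          ≤ ∑ k ∈ Finset.range n, ∫ r in s..t, |J k r| :=
            Finset.sum_le_sum fun k _ => intervalIntegral.abs_integral_le_integral_abs hst
        _ = ∫ r in s..t, ∑ k ∈ Finset.range n, |J k r| :=
            (intervalIntegral.integral_finsetSum hJI).symm
        _ ≤ ∫ r in s..t, b r := by
            refine intervalIntegral.integral_mono_on_of_le_Ioo hst
              (by simpa only [Finset.sum_fn] using IntervalIntegrable.sum _ hJI) (hbc.intervalIntegrable _ _) ?_
            exact fun r hr => hJb r ⟨hr.1, hr.2.le⟩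
    have h2 : ∫ r in s..t, b r = C * w x * (Real.exp (c * (t - s)) -
        Real.exp (cumRate K m s x - cumRate K m t x)) := by
      rw [← integral_decay_eq hP, ← intervalIntegral.integral_const_mul]
      refine intervalIntegral.integral_congr fun r _ => ?_
      simp only [hb]
      ring
    have h3 : |transportTerm K m 0 s t f x| ≤
        Real.exp (cumRate K m s x - cumRate K m t x) * (C * w x) := by
      rw [transportTerm, abs_mul, Real.abs_exp]
      exact mul_le_mul_of_nonneg_left (hf.2 x) (Real.exp_nonneg _)
    rw [h2] at h1
    linarith

lemma abs_transportTerm_le (hw : Lyap K m w c) (hP : CoagPath K m) (hC : 0 ≤ C)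
    (hf : Dom w C f) {s t : ℝ} (hst : s ≤ t) (n : ℕ) (x : Mass) :
    |transportTerm K m n s t f x| ≤ C * Real.exp (c * (t - s)) * w x :=
  (Finset.single_le_sum (f := fun k => |transportTerm K m k s t f x|) (fun _ _ => abs_nonneg _)
    (Finset.self_mem_range_succ n)).trans (hw.sum_abs_transportTerm_le hP hC hf (n + 1) hst x)

lemma summable_abs_transportTerm (hw : Lyap K m w c) (hP : CoagPath K m) (hC : 0 ≤ C)
    (hf : Dom w C f) {s t : ℝ} (hst : s ≤ t) (x : Mass) :
    Summable fun n => |transportTerm K m n s t f x| :=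
  summable_of_sum_range_le (fun _ => abs_nonneg _) fun n =>
    hw.sum_abs_transportTerm_le hP hC hf n hst x

lemma summable_transportTerm (hw : Lyap K m w c) (hP : CoagPath K m) (hC : 0 ≤ C)
    (hf : Dom w C f) {s t : ℝ} (hst : s ≤ t) (x : Mass) :
    Summable fun n => transportTerm K m n s t f x :=
  (hw.summable_abs_transportTerm hP hC hf hst x).of_abs

lemma abs_transport_le (hw : Lyap K m w c) (hP : CoagPath K m) (hC : 0 ≤ C)
    (hf : Dom w C f) {s t : ℝ} (hst : s ≤ t) (x : Mass) :
    |transport K m s t f x| ≤ C * Real.exp (c * (t - s)) * w x := by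
  refine le_of_tendsto (hw.summable_transportTerm hP hC hf hst x).hasSum.tendsto_sum_nat.abs
    (Eventually.of_forall fun n => ?_)
  exact (Finset.abs_sum_le_sum_abs _ _).trans (hw.sum_abs_transportTerm_le hP hC hf n hst x)

lemma dom_transport (hw : Lyap K m w c) (hP : CoagPath K m) (hC : 0 ≤ C)
    (hf : Dom w C f) {s t : ℝ} (hst : s ≤ t) :
    Dom w (C * Real.exp (c * (t - s))) (transport K m s t f) :=
  ⟨(hP.measurable_transport_const hf.1 t).comp (measurable_const.prodMk measurable_id),
    hw.abs_transport_le hP hC hf hst⟩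

lemma dom_transportTerm (hw : Lyap K m w c) (hP : CoagPath K m) (hC : 0 ≤ C)
    (hf : Dom w C f) {s t : ℝ} (hst : s ≤ t) (n : ℕ) :
    Dom w (C * Real.exp (c * (t - s))) (transportTerm K m n s t f) :=
  ⟨(hP.measurable_transportTerm_const hf.1 n t).comp (measurable_const.prodMk measurable_id),
    hw.abs_transportTerm_le hP hC hf hst n⟩

/-- Integrability in time, and a bound, for `E_{s,r} L_r h_r`. -/
lemma exists_decay_gain_bound (hw : Lyap K m w c) (hP : CoagPath K m) (hC : 0 ≤ C) {h : ℝ → Mass → ℝ}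
    {s t : ℝ} (hh : ∀ r ∈ Ioc s t, ∀ x, |h r x| ≤ C * w x) (x : Mass) :
    ∃ B, ∀ r ∈ Ioc s t, |Real.exp (cumRate K m s x - cumRate K m r x) * gain K (m r) (h r) x| ≤ B := by
  have h1 := hP.continuous_rate x
  obtain ⟨B, hB⟩ := (isCompact_Icc (a := s) (b := t)).exists_bound_of_continuousOn
    (f := fun r => C * ((rate K (m r) x + c) * w x)) (by fun_prop : Continuous _).continuousOn
  refine ⟨B, fun r hr => ?_⟩
  rw [abs_mul, Real.abs_exp]
  calc _ ≤ 1 * |gain K (m r) (h r) x| :=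
        mul_le_mul_of_nonneg_right (hP.decay_le_one hr.1.le x) (abs_nonneg _)
    _ ≤ C * ((rate K (m r) x + c) * w x) := by
        rw [one_mul]; exact hw.abs_gain_le hP hC (hh r hr) r x
    _ ≤ B := (le_abs_self _).trans (hB r ⟨hr.1.le, hr.2⟩)

lemma sum_transportTerm_succ (hw : Lyap K m w c) (hP : CoagPath K m) (hC : 0 ≤ C)
    (hf : Dom w C f) {s t : ℝ} (hst : s ≤ t) (n : ℕ) (x : Mass) :
    ∑ k ∈ Finset.range (n + 1), transportTerm K m k s t f x =
      Real.exp (cumRate K m s x - cumRate K m t x) * f x +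
      ∫ r in s..t, Real.exp (cumRate K m s x - cumRate K m r x) *
        gain K (m r) (fun z => ∑ k ∈ Finset.range n, transportTerm K m k r t f z) x := by
  rw [Finset.sum_range_succ', add_comm]
  congr 1
  simp only [transportTerm]
  rw [← intervalIntegral.integral_finsetSum]
  · refine intervalIntegral.integral_congr_ae (ae_of_all _ fun r hr => ?_)
    rw [uIoc_of_le hst] at hr
    rw [← Finset.mul_sum]
    congr 1
    simp only [gain]
    rw [← integral_finsetSum _ fun k _ =>
      hw.integrable_gain hP (hw.dom_transportTerm hP hC hf hr.2 k) r x]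
    simp only [Finset.sum_mul]
  · intro k _
    have hm : Measurable fun r => Real.exp (cumRate K m s x - cumRate K m r x) *
        gain K (m r) (transportTerm K m k r t f) x :=
      (hP.measurable_decay_time s x).mul
        (hP.measurable_gain_time (hP.measurable_transportTerm_const hf.1 k t) x)
    obtain ⟨B, hB⟩ := hw.exists_decay_gain_bound hP (C := C * Real.exp (c * (t - s)))
      (h := fun r => transportTerm K m k r t f) (s := s) (t := t) (by positivity)
      (fun r hr z => (hw.abs_transportTerm_le hP hC hf hr.2 k z).trans
        (mul_le_mul_of_nonneg_right (mul_le_mul_of_nonneg_left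
          (exp_const_sub_le hw.const_nonneg hr.1.le) hC) (hw.nonneg z))) x
    exact intervalIntegrable_of_bound hm hst hB

lemma transport_mild (hw : Lyap K m w c) (hP : CoagPath K m) (hC : 0 ≤ C)
    (hf : Dom w C f) {s t : ℝ} (hst : s ≤ t) (x : Mass) :
    transport K m s t f x = Real.exp (cumRate K m s x - cumRate K m t x) * f x +
      ∫ r in s..t, Real.exp (cumRate K m s x - cumRate K m r x) *
        gain K (m r) (transport K m r t f) x := by
  have h1 := ((tendsto_add_atTop_iff_nat 1).2
    (hw.summable_transportTerm hP hC hf hst x).hasSum.tendsto_sum_nat)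
  refine tendsto_nhds_unique h1 ?_
  simp only [hw.sum_transportTerm_succ hP hC hf hst _ x]
  refine Tendsto.const_add _ ?_
  have hS : ∀ n, ∀ r ∈ Ioc s t, Dom w (C * Real.exp (c * (t - s)))
      (fun z => ∑ k ∈ Finset.range n, transportTerm K m k r t f z) := fun n r hr =>
    ⟨Finset.measurable_fun_sum _ fun k _ => (hw.dom_transportTerm hP hC hf hr.2 k).1, fun z =>
      (Finset.abs_sum_le_sum_abs _ _).trans ((hw.sum_abs_transportTerm_le hP hC hf n hr.2 z).trans
        (mul_le_mul_of_nonneg_right (mul_le_mul_of_nonneg_left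
          (exp_const_sub_le hw.const_nonneg hr.1.le) hC) (hw.nonneg z)))⟩
  have hC' : 0 ≤ C * Real.exp (c * (t - s)) := by positivity
  have hrate := hP.continuous_rate x
  refine intervalIntegral.tendsto_integral_filter_of_dominated_convergence
    (fun r => C * Real.exp (c * (t - s)) * ((rate K (m r) x + c) * w x))
    (Eventually.of_forall fun n => ?_) (Eventually.of_forall fun n => ae_of_all _ fun r hr => ?_)
    ((by fun_prop : Continuous _).intervalIntegrable _ _) (ae_of_all _ fun r hr => ?_)
  · refine Measurable.aestronglyMeasurable ?_
    refine (hP.measurable_decay_time s x).mul (hP.measurable_gain_time ?_ x)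
    exact Finset.measurable_fun_sum _ fun k _ => hP.measurable_transportTerm_const hf.1 k t
  · rw [uIoc_of_le hst] at hr
    rw [Real.norm_eq_abs, abs_mul, Real.abs_exp]
    calc _ ≤ 1 * |gain K (m r) (fun z => ∑ k ∈ Finset.range n, transportTerm K m k r t f z) x| :=
          mul_le_mul_of_nonneg_right (hP.decay_le_one hr.1.le x) (abs_nonneg _)
      _ ≤ _ := by rw [one_mul]; exact hw.abs_gain_le hP hC' (hS n r hr).2 r x
  · rw [uIoc_of_le hst] at hr
    refine Tendsto.const_mul _ (hw.tendsto_gain hP (fun n => hS n r hr) (fun z => ?_) r x)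
    exact (hw.summable_transportTerm hP hC hf hr.2 z).hasSum.tendsto_sum_nat

lemma transportTerm_add (hw : Lyap K m w c) (hP : CoagPath K m) {C' : ℝ} (hC : 0 ≤ C) (hC' : 0 ≤ C')
    (hf : Dom w C f) (hg : Dom w C' g) {t : ℝ} (n : ℕ) : ∀ {s : ℝ}, s ≤ t → ∀ x,
    transportTerm K m n s t (fun x => f x + g x) x =
      transportTerm K m n s t f x + transportTerm K m n s t g x := by
  induction n with
  | zero => intro s _ x; simp only [transportTerm]; ring
  | succ n ih =>
    intro s hst x
    have hI : ∀ {C} {f : Mass → ℝ}, 0 ≤ C → Dom w C f → IntervalIntegrable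
        (fun r => Real.exp (cumRate K m s x - cumRate K m r x) *
          gain K (m r) (transportTerm K m n r t f) x) volume s t := by
      intro C f hC hf
      obtain ⟨B, hB⟩ := hw.exists_decay_gain_bound hP (C := C * Real.exp (c * (t - s)))
        (h := fun r => transportTerm K m n r t f) (s := s) (t := t) (by positivity)
        (fun r hr z => (hw.abs_transportTerm_le hP hC hf hr.2 n z).trans
          (mul_le_mul_of_nonneg_right (mul_le_mul_of_nonneg_left
            (exp_const_sub_le hw.const_nonneg hr.1.le) hC) (hw.nonneg z))) x
      exact intervalIntegrable_of_bound
        ((hP.measurable_decay_time s x).mul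
          (hP.measurable_gain_time (hP.measurable_transportTerm_const hf.1 n t) x)) hst hB
    simp only [transportTerm]
    rw [← intervalIntegral.integral_add (hI hC hf) (hI hC' hg)]
    refine intervalIntegral.integral_congr_ae (ae_of_all _ fun r hr => ?_)
    rw [uIoc_of_le hst] at hr
    rw [← mul_add, ← hw.gain_add hP (hw.dom_transportTerm hP hC hf hr.2 n)
      (hw.dom_transportTerm hP hC' hg hr.2 n)]
    congr 2
    ext z
    exact ih hr.2 z

lemma transport_add (hw : Lyap K m w c) (hP : CoagPath K m) {C' : ℝ} (hC : 0 ≤ C) (hC' : 0 ≤ C')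
    (hf : Dom w C f) (hg : Dom w C' g) {s t : ℝ} (hst : s ≤ t) (x : Mass) :
    transport K m s t (fun x => f x + g x) x = transport K m s t f x + transport K m s t g x := by
  simp only [transport]
  rw [← (hw.summable_transportTerm hP hC hf hst x).tsum_add
    (hw.summable_transportTerm hP hC' hg hst x)]
  exact tsum_congr fun n => hw.transportTerm_add hP hC hC' hf hg n hst x

lemma transport_sub (hw : Lyap K m w c) (hP : CoagPath K m) {C' : ℝ} (hC : 0 ≤ C) (hC' : 0 ≤ C')
    (hf : Dom w C f) (hg : Dom w C' g) {s t : ℝ} (hst : s ≤ t) (x : Mass) :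
    transport K m s t (fun x => f x - g x) x = transport K m s t f x - transport K m s t g x := by
  have := hw.transport_add hP (add_nonneg hC hC') hC' (hf.sub hg) hg hst x
  simp only [sub_add_cancel] at this
  linarith

end Lyap

end

section

variable {K : Kern} {m : ℝ → FiniteMeasure Mass} {w : Mass → ℝ} {c C : ℝ} {f g : Mass → ℝ}
  {h : ℝ → Mass → ℝ}

namespace CoagPath

lemma measurable_pert_time (hP : CoagPath K m) (hh : Measurable fun q : ℝ × Mass => h q.1 q.2)
    (x : Mass) : Measurable fun r => pert K (m r) (h r) x :=
  hP.measurable_pert (α := ℝ) (F := h) hh measurable_id measurable_const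

lemma measurable_pert_joint (hP : CoagPath K m) (hh : Measurable fun q : ℝ × Mass => h q.1 q.2) :
    Measurable fun q : ℝ × Mass => pert K (m q.1) (h q.1) q.2 :=
  hP.measurable_pert (α := ℝ × Mass) (F := fun q => h q.1)
    (hh.comp (by fun_prop : Measurable fun p : (ℝ × Mass) × Mass => (p.1.1, p.2)))
    measurable_fst measurable_snd

lemma measurable_transport_end (hP : CoagPath K m) (hh : Measurable fun q : ℝ × Mass => h q.1 q.2)
    (s : ℝ) (x : Mass) : Measurable fun r => transport K m s r (h r) x :=
  (hP.measurable_transport hh).comp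
    (by fun_prop : Measurable fun r : ℝ => (s, r, x))

lemma measurable_integral_transport (hP : CoagPath K m)
    (hh : Measurable fun q : ℝ × Mass => h q.1 q.2) (t : ℝ) :
    Measurable fun q : ℝ × Mass => ∫ r in q.1..t, transport K m q.1 r (h r) q.2 := by
  refine measurable_intervalIntegral (F := fun (q : ℝ × Mass) r => transport K m q.1 r (h r) q.2)
    ?_ measurable_fst measurable_const
  exact (hP.measurable_transport hh).comp
    (by fun_prop : Measurable fun q : (ℝ × Mass) × ℝ => (q.1.1, q.2, q.1.2))

end CoagPath

namespace Lyap

lemma gain_intervalIntegral (hw : Lyap K m w c) (hP : CoagPath K m)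
    (hh : Measurable fun q : ℝ × Mass => h q.1 q.2) {s t : ℝ} (hst : s ≤ t)
    (hb : ∀ r ∈ Ioc s t, ∀ x, |h r x| ≤ C * w x) (q : ℝ) (x : Mass) :
    ∫ r in s..t, gain K (m q) (h r) x = gain K (m q) (fun z => ∫ r in s..t, h r z) x := by
  simp only [gain, intervalIntegral.integral_of_le hst]
  simp only [← integral_mul_const]
  refine integral_integral_swap ?_
  have hi : Integrable (fun p : ℝ × Mass => (1 : ℝ) * (C * (w (x + p.2) * K x p.2)))
      ((volume.restrict (Ioc s t)).prod (m q : Measure Mass)) :=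
    (integrable_const (1 : ℝ)).mul_prod ((hw.gain_integrable q x).const_mul C)
  refine hi.mono' ?_ ?_
  · have h1 : Measurable fun p : ℝ × Mass => (p.1, x + p.2) := by fun_prop
    have h2 : Measurable fun p : ℝ × Mass => (x, p.2) := by fun_prop
    exact ((hh.comp h1).mul (hP.measurable_kern.comp h2)).aestronglyMeasurable
  · have : ∀ᵐ r ∂(volume.restrict (Ioc s t)), r ∈ Ioc s t := ae_restrict_mem measurableSet_Ioc
    filter_upwards [Measure.quasiMeasurePreserving_fst.ae this] with p hp
    simp only [Function.uncurry, one_mul]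
    rw [Real.norm_eq_abs, abs_mul, abs_of_nonneg (hP.nonneg x p.2), ← mul_assoc]
    exact mul_le_mul_of_nonneg_right (hb _ hp _) (hP.nonneg x p.2)

lemma abs_transport_time_le (hw : Lyap K m w c) (hP : CoagPath K m) (hC : 0 ≤ C)
    (hh : Measurable fun q : ℝ × Mass => h q.1 q.2) {s t : ℝ}
    (hb : ∀ r ∈ Ioc s t, ∀ x, |h r x| ≤ C * w x) {q r : ℝ} (hq : s ≤ q) (hqr : q ≤ r)
    (hr : r ∈ Ioc s t) (x : Mass) :
    |transport K m q r (h r) x| ≤ C * Real.exp (c * (t - s)) * w x := by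
  refine (hw.abs_transport_le hP hC
    ⟨hh.comp (measurable_const.prodMk measurable_id), hb r hr⟩ hqr x).trans ?_
  refine mul_le_mul_of_nonneg_right (mul_le_mul_of_nonneg_left (Real.exp_le_exp.2 ?_) hC)
    (hw.nonneg x)
  exact mul_le_mul_of_nonneg_left (by linarith [hr.2]) hw.const_nonneg

lemma integral_transport_mild (hw : Lyap K m w c) (hP : CoagPath K m) (hC : 0 ≤ C)
    (hh : Measurable fun q : ℝ × Mass => h q.1 q.2) {s t : ℝ} (hst : s ≤ t)
    (hb : ∀ r ∈ Ioc s t, ∀ x, |h r x| ≤ C * w x) (x : Mass) :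
    ∫ r in s..t, transport K m s r (h r) x =
      ∫ r in s..t, Real.exp (cumRate K m s x - cumRate K m r x) *
        (h r x + gain K (m r) (fun z => ∫ q in r..t, transport K m r q (h q) z) x) := by
  have hC' : 0 ≤ C * Real.exp (c * (t - s)) := by positivity
  have hhx : Measurable fun r => h r x := hh.comp (measurable_id.prodMk measurable_const)
  set E : ℝ → ℝ := fun r => Real.exp (cumRate K m s x - cumRate K m r x) with hE
  have hEm : Measurable E := hP.measurable_decay_time s x
  have hE1 : ∀ r ∈ Ioc s t, |E r| ≤ 1 := fun r hr => by
    rw [hE, Real.abs_exp]; exact hP.decay_le_one hr.1.le x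
  -- the double integrand
  set Z : ℝ → ℝ → ℝ := fun q r => if q ≤ r then E q * gain K (m q) (transport K m q r (h r)) x else 0
    with hZ
  have hZm : Measurable (Function.uncurry Z) := by
    refine Measurable.ite (measurableSet_le measurable_fst measurable_snd) ?_ measurable_const
    refine (hEm.comp measurable_fst).mul ?_
    refine hP.measurable_gain (α := ℝ × ℝ) (F := fun p => transport K m p.1 p.2 (h p.2)) ?_
      measurable_fst measurable_const
    exact (hP.measurable_transport hh).comp
      (by fun_prop : Measurable fun p : (ℝ × ℝ) × Mass => (p.1.1, p.1.2, p.2))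
  obtain ⟨B, hB⟩ := (isCompact_Icc (a := s) (b := t)).exists_bound_of_continuousOn
    (f := fun r => C * Real.exp (c * (t - s)) * ((rate K (m r) x + c) * w x))
    (by have := hP.continuous_rate x; exact (by fun_prop : Continuous _).continuousOn)
  have hZb : ∀ q ∈ Ioc s t, ∀ r ∈ Ioc s t, |Z q r| ≤ max B 0 := by
    intro q hq r hr
    simp only [hZ]
    split_ifs with hqr
    · refine le_max_of_le_left ?_
      rw [abs_mul]
      refine (mul_le_of_le_one_left (abs_nonneg _) (hE1 q hq)).trans ?_
      refine (hw.abs_gain_le hP hC' (fun z => hw.abs_transport_time_le hP hC hh hb hq.1.le hqr hr z)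
        q x).trans ?_
      exact (le_abs_self _).trans (hB q ⟨hq.1.le, hq.2⟩)
    · simp
  have h1 : ∀ r ∈ Ioc s t, transport K m s r (h r) x = E r * h r x + ∫ q in s..r, Z q r := by
    intro r hr
    have hd : Dom w C (h r) := ⟨hh.comp (measurable_const.prodMk measurable_id), hb r hr⟩
    rw [hw.transport_mild hP hC hd hr.1.le x]
    congr 1
    refine intervalIntegral.integral_congr fun q hq => ?_
    rw [uIcc_of_le hr.1.le] at hq
    simp only [hZ, if_pos hq.2]
    rfl
  have h2 : ∀ q ∈ Ioc s t, ∫ r in q..t, Z q r =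
      E q * gain K (m q) (fun z => ∫ r in q..t, transport K m q r (h r) z) x := by
    intro q hq
    rw [← hw.gain_intervalIntegral hP (C := C * Real.exp (c * (t - s)))
      ((hP.measurable_transport hh).comp (by fun_prop : Measurable fun p : ℝ × Mass => (q, p.1, p.2)))
      hq.2 (fun r hr z => hw.abs_transport_time_le hP hC hh hb hq.1.le hr.1.le
        ⟨hq.1.trans hr.1, hr.2⟩ z) q x, ← intervalIntegral.integral_const_mul]
    refine intervalIntegral.integral_congr fun r hr => ?_
    rw [uIcc_of_le hq.2] at hr
    simp only [hZ, if_pos hr.1]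
  have hI1 : IntervalIntegrable (fun r => E r * h r x) volume s t :=
    intervalIntegrable_of_bound (hEm.mul hhx) hst (b := C * w x) fun r hr => by
      rw [Pi.mul_apply, abs_mul]
      exact (mul_le_of_le_one_left (abs_nonneg _) (hE1 r hr)).trans (hb r hr x)
  have hI2 : IntervalIntegrable (fun r => ∫ q in s..r, Z q r) volume s t := by
    refine intervalIntegrable_of_bound (measurable_intervalIntegral (F := fun r q => Z q r)
      (hZm.comp measurable_swap) measurable_const measurable_id) hst (b := max B 0 * (t - s))
      fun r hr => ?_
    refine (abs_intervalIntegral_le_const (b := max B 0) hr.1.le fun q hq => ?_).trans ?_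
    · exact hZb q ⟨hq.1, hq.2.trans hr.2⟩ r hr
    · exact mul_le_mul_of_nonneg_left (by linarith [hr.2]) (le_max_right _ _)
  have hI3 : IntervalIntegrable (fun q => ∫ r in q..t, Z q r) volume s t := by
    refine intervalIntegrable_of_bound (measurable_intervalIntegral (F := fun q r => Z q r)
      hZm measurable_id measurable_const) hst (b := max B 0 * (t - s)) fun q hq => ?_
    refine (abs_intervalIntegral_le_const (b := max B 0) hq.2 fun r hr => ?_).trans ?_
    · exact hZb q hq r ⟨hq.1.trans hr.1, hr.2⟩
    · exact mul_le_mul_of_nonneg_left (by linarith [hq.1]) (le_max_right _ _)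
  calc ∫ r in s..t, transport K m s r (h r) x
      = ∫ r in s..t, (E r * h r x + ∫ q in s..r, Z q r) := by
        refine intervalIntegral.integral_congr_ae (ae_of_all _ fun r hr => ?_)
        rw [uIoc_of_le hst] at hr
        exact h1 r hr
    _ = (∫ r in s..t, E r * h r x) + ∫ q in s..t, ∫ r in q..t, Z q r := by
        rw [intervalIntegral.integral_add hI1 hI2, integral_triangle hZm hst hZb]
    _ = _ := by
        rw [← intervalIntegral.integral_add hI1 hI3]
        refine intervalIntegral.integral_congr_ae (ae_of_all _ fun r hr => ?_)
        rw [uIoc_of_le hst] at hr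
        rw [h2 r hr, mul_add]

/-! ### The perturbation series -/

lemma abs_propagatorTerm_le (hw : Lyap K m w c) (hP : CoagPath K m) (hC : 0 ≤ C)
    (hf : Dom w C f) {t : ℝ} (n : ℕ) : ∀ {s : ℝ}, s ≤ t → ∀ x,
    |propagatorTerm K m n s t f x| ≤
      C * Real.exp (c * (t - s)) * ((c * (t - s)) ^ n / n.factorial) * w x := by
  have hc := hw.const_nonneg
  induction n with
  | zero =>
    intro s hst x
    simpa [propagatorTerm] using hw.abs_transport_le hP hC hf hst x
  | succ n ih =>
    intro s hst x
    have hwx := hw.nonneg x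
    simp only [propagatorTerm, abs_neg]
    set a : ℝ := C * Real.exp (c * (t - s)) * (c ^ (n + 1) / n.factorial) * w x with ha
    have hbd : ∀ r ∈ Ioo s t, ‖transport K m s r (pert K (m r) (propagatorTerm K m n r t f)) x‖ ≤
        a * (t - r) ^ n := by
      intro r hr
      have htr : 0 ≤ t - r := by linarith [hr.2]
      have hp : Dom w (C * Real.exp (c * (t - r)) * ((c * (t - r)) ^ n / n.factorial) * c)
          (pert K (m r) (propagatorTerm K m n r t f)) := by
        refine ⟨(hP.measurable_pert_joint (h := fun r => propagatorTerm K m n r t f)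
          (hP.measurable_propagatorTerm hf.1 t n)).comp
          (measurable_const.prodMk measurable_id : Measurable fun z : Mass => (r, z)), fun z => ?_⟩
        rw [mul_assoc _ c]
        exact hw.abs_pert_le hP (by positivity) (ih hr.2.le) r z
      refine (hw.abs_transport_le hP (by positivity) hp hr.1.le x).trans (le_of_eq ?_)
      rw [ha]
      have : Real.exp (c * (t - s)) = Real.exp (c * (t - r)) * Real.exp (c * (r - s)) := by
        rw [← Real.exp_add]; congr 1; ring
      rw [this, mul_pow]
      ring
    have hint : ∫ r in s..t, a * (t - r) ^ n = a * ((t - s) ^ (n + 1) / (n + 1)) := by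
      rw [intervalIntegral.integral_const_mul]
      congr 1
      rw [intervalIntegral.integral_comp_sub_left (fun r => r ^ n) t]
      simp [integral_pow]
    rw [← Real.norm_eq_abs]
    refine (intervalIntegral.norm_integral_le_of_norm_le hst (g := fun r => a * (t - r) ^ n) ?_
      (Continuous.intervalIntegrable (by fun_prop) _ _)).trans ?_
    · have : ∀ᵐ r : ℝ, r ≠ t := by simp [ae_iff]
      filter_upwards [this] with r hr1 hr
      exact hbd r ⟨hr.1, lt_of_le_of_ne hr.2 hr1⟩
    · rw [hint, ha, Nat.factorial_succ, Nat.cast_mul, Nat.cast_succ, mul_pow]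
      refine le_of_eq ?_
      field_simp

lemma summable_propagatorTerm (hw : Lyap K m w c) (hP : CoagPath K m) (hC : 0 ≤ C)
    (hf : Dom w C f) {s t : ℝ} (hst : s ≤ t) (x : Mass) :
    Summable fun n => propagatorTerm K m n s t f x := by
  refine Summable.of_norm_bounded
    (((Real.summable_pow_div_factorial (c * (t - s))).mul_left (C * Real.exp (c * (t - s)))).mul_right
      (w x)) fun n => hw.abs_propagatorTerm_le hP hC hf n hst x

lemma abs_propagator_sub_le (hw : Lyap K m w c) (hP : CoagPath K m) (hC : 0 ≤ C)
    (hf : Dom w C f) {s r t : ℝ} (hsr : s ≤ r) (hst : r ≤ t) (n : ℕ) (x : Mass) :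
    |propagator K m r t f x - ∑ k ∈ Finset.range n, propagatorTerm K m k r t f x| ≤
      C * Real.exp (c * (t - s)) * (∑' k, (c * (t - s)) ^ (k + n) / (k + n).factorial) * w x := by
  have hc := hw.const_nonneg
  have hwx := hw.nonneg x
  have hsum := hw.summable_propagatorTerm hP hC hf hst x
  rw [propagator, ← hsum.sum_add_tsum_nat_add n, add_sub_cancel_left, ← tsum_mul_left,
    ← tsum_mul_right]
  rw [← Real.norm_eq_abs]
  refine tsum_of_norm_bounded (Summable.hasSum ?_) fun k => ?_
  · exact ((((summable_nat_add_iff n).2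
      (Real.summable_pow_div_factorial (c * (t - s)))).mul_left _).mul_right _)
  · refine (hw.abs_propagatorTerm_le hP hC hf (k + n) hst x).trans ?_
    have h0 : 0 ≤ t - r := by linarith
    have h1 : t - r ≤ t - s := by linarith
    gcongr

lemma abs_propagator_le (hw : Lyap K m w c) (hP : CoagPath K m) (hC : 0 ≤ C)
    (hf : Dom w C f) {s t : ℝ} (hst : s ≤ t) (x : Mass) :
    |propagator K m s t f x| ≤ C * Real.exp (2 * c * (t - s)) * w x := by
  have := hw.abs_propagator_sub_le hP hC hf le_rfl hst 0 x
  have h2 : ∑' k : ℕ, (c * (t - s)) ^ k / k.factorial = Real.exp (c * (t - s)) := by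
    rw [Real.exp_eq_exp_ℝ, NormedSpace.exp_eq_tsum_div]
  simp only [Finset.range_zero, Finset.sum_empty, sub_zero, add_zero, h2] at this
  refine this.trans (le_of_eq ?_)
  rw [mul_assoc C, ← Real.exp_add]
  ring_nf

lemma dom_propagator (hw : Lyap K m w c) (hP : CoagPath K m) (hC : 0 ≤ C)
    (hf : Dom w C f) {s t : ℝ} (hst : s ≤ t) :
    Dom w (C * Real.exp (2 * c * (t - s))) (propagator K m s t f) :=
  ⟨(hP.measurable_propagator hf.1 t).comp (measurable_const.prodMk measurable_id),
    hw.abs_propagator_le hP hC hf hst⟩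

lemma dom_propagator_uniform (hw : Lyap K m w c) (hP : CoagPath K m) (hC : 0 ≤ C)
    (hf : Dom w C f) {s r t : ℝ} (hsr : s ≤ r) (hrt : r ≤ t) :
    Dom w (C * Real.exp (2 * c * (t - s))) (propagator K m r t f) :=
  (hw.dom_propagator hP hC hf hrt).mono hw.nonneg (mul_le_mul_of_nonneg_left
    (exp_const_sub_le (mul_nonneg two_pos.le hw.const_nonneg) hsr) hC)

lemma dom_propagatorTerm (hw : Lyap K m w c) (hP : CoagPath K m) (hC : 0 ≤ C)
    (hf : Dom w C f) {s r t : ℝ} (hsr : s ≤ r) (hrt : r ≤ t) (n : ℕ) :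
    Dom w (C * Real.exp (c * (t - s)) * ((c * (t - s)) ^ n / n.factorial))
      (propagatorTerm K m n r t f) := by
  refine ⟨(hP.measurable_propagatorTerm hf.1 t n).comp (measurable_const.prodMk measurable_id),
    fun x => (hw.abs_propagatorTerm_le hP hC hf n hrt x).trans ?_⟩
  have hc := hw.const_nonneg
  have hwx := hw.nonneg x
  have h0 : 0 ≤ t - r := by linarith
  have h1 : t - r ≤ t - s := by linarith
  gcongr

lemma dom_sum_propagatorTerm (hw : Lyap K m w c) (hP : CoagPath K m) (hC : 0 ≤ C)
    (hf : Dom w C f) {s r t : ℝ} (hsr : s ≤ r) (hrt : r ≤ t) (n : ℕ) :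
    Dom w (∑ k ∈ Finset.range n, C * Real.exp (c * (t - s)) * ((c * (t - s)) ^ k / k.factorial))
      (fun x => ∑ k ∈ Finset.range n, propagatorTerm K m k r t f x) := by
  refine ⟨Finset.measurable_fun_sum _ fun k _ => (hw.dom_propagatorTerm hP hC hf hsr hrt k).1,
    fun x => (Finset.abs_sum_le_sum_abs _ _).trans ?_⟩
  rw [Finset.sum_mul]
  exact Finset.sum_le_sum fun k _ => (hw.dom_propagatorTerm hP hC hf hsr hrt k).2 x

lemma dom_pert (hw : Lyap K m w c) (hP : CoagPath K m) (hC : 0 ≤ C) (hf : Dom w C f) (r : ℝ) :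
    Dom w (C * c) (pert K (m r) f) :=
  ⟨(hP.measurable_pert_joint (h := fun _ => f) (hf.1.comp measurable_snd)).comp
    (measurable_const.prodMk measurable_id : Measurable fun x : Mass => (r, x)), fun x => by
      rw [mul_assoc]; exact hw.abs_pert_le hP hC hf.2 r x⟩

lemma transport_pert_bound (hw : Lyap K m w c) (hP : CoagPath K m) (hC : 0 ≤ C)
    {s r t : ℝ} (hr : r ∈ Ioc s t) (hf : Dom w C f) (x : Mass) :
    |transport K m s r (pert K (m r) f) x| ≤ C * c * Real.exp (c * (t - s)) * w x := by
  have hc := hw.const_nonneg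
  have hwx := hw.nonneg x
  refine (hw.abs_transport_le hP (by positivity) (hw.dom_pert hP hC hf r) hr.1.le x).trans ?_
  have h1 : r - s ≤ t - s := by linarith [hr.2]
  gcongr

lemma sum_propagatorTerm_succ (hw : Lyap K m w c) (hP : CoagPath K m) (hC : 0 ≤ C)
    (hf : Dom w C f) {s t : ℝ} (hst : s ≤ t) (n : ℕ) (x : Mass) :
    ∑ k ∈ Finset.range (n + 1), propagatorTerm K m k s t f x =
      transport K m s t f x - ∫ r in s..t, transport K m s r
        (pert K (m r) (fun z => ∑ k ∈ Finset.range n, propagatorTerm K m k r t f z)) x := by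
  have hc := hw.const_nonneg
  have h0 : 0 ≤ t - s := by linarith
  induction n with
  | zero =>
    have : ∀ r ∈ Ioc s t, transport K m s r
        (pert K (m r) (fun z => ∑ k ∈ Finset.range 0, propagatorTerm K m k r t f z)) x = 0 := by
      intro r hr
      have := hw.transport_pert_bound hP le_rfl hr (f := fun z : Mass =>
        ∑ k ∈ Finset.range 0, propagatorTerm K m k r t f z) ⟨by simp, by simp⟩ x
      simpa using this
    rw [intervalIntegral.integral_congr_ae (g := fun _ => (0 : ℝ)) (ae_of_all _ fun r hr => this r
      (by rwa [uIoc_of_le hst] at hr))]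
    simp [propagatorTerm]
  | succ n ih =>
    rw [Finset.sum_range_succ, ih]
    simp only [propagatorTerm]
    rw [← sub_eq_add_neg, sub_sub, ← intervalIntegral.integral_add]
    · congr 1
      refine intervalIntegral.integral_congr_ae (ae_of_all _ fun r hr => ?_)
      rw [uIoc_of_le hst] at hr
      have hd1 := hw.dom_sum_propagatorTerm hP hC hf hr.1.le hr.2 n
      have hd2 := hw.dom_propagatorTerm hP hC hf hr.1.le hr.2 n
      rw [← hw.transport_add hP (by positivity) (by positivity)
        (hw.dom_pert hP (by positivity) hd1 r) (hw.dom_pert hP (by positivity) hd2 r) hr.1.le x]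
      congr 1
      ext z
      rw [← hw.pert_add hP hd1 hd2]
      congr 1
      ext z'
      rw [Finset.sum_range_succ]
    · refine intervalIntegrable_of_bound (hP.measurable_transport_end (h := fun r => pert K (m r)
        (fun z => ∑ k ∈ Finset.range n, propagatorTerm K m k r t f z)) ?_ s x) hst fun r hr =>
        hw.transport_pert_bound hP ?_ hr (hw.dom_sum_propagatorTerm hP hC hf hr.1.le hr.2 n) x
      · exact hP.measurable_pert_joint (h := fun r z => ∑ k ∈ Finset.range n,
          propagatorTerm K m k r t f z)
          (Finset.measurable_fun_sum _ fun k _ => hP.measurable_propagatorTerm hf.1 t k)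
      · positivity
    · refine intervalIntegrable_of_bound (hP.measurable_transport_end (h := fun r => pert K (m r)
        (propagatorTerm K m n r t f)) (hP.measurable_pert_joint
          (h := fun r => propagatorTerm K m n r t f) (hP.measurable_propagatorTerm hf.1 t n)) s x) hst fun r hr =>
        hw.transport_pert_bound hP ?_ hr (hw.dom_propagatorTerm hP hC hf hr.1.le hr.2 n) x
      positivity

lemma propagator_eq_transport_sub (hw : Lyap K m w c) (hP : CoagPath K m) (hC : 0 ≤ C)
    (hf : Dom w C f) {s t : ℝ} (hst : s ≤ t) (x : Mass) :
    propagator K m s t f x = transport K m s t f x -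
      ∫ r in s..t, transport K m s r (pert K (m r) (propagator K m r t f)) x := by
  have hc := hw.const_nonneg
  have hwx := hw.nonneg x
  have h0 : 0 ≤ t - s := by linarith
  have h1 := ((tendsto_add_atTop_iff_nat 1).2
    (hw.summable_propagatorTerm hP hC hf hst x).hasSum.tendsto_sum_nat)
  refine tendsto_nhds_unique h1 ?_
  simp only [hw.sum_propagatorTerm_succ hP hC hf hst _ x]
  refine Tendsto.const_sub _ ?_
  set tail : ℕ → ℝ := fun n => ∑' k, (c * (t - s)) ^ (k + n) / (k + n).factorial with htail
  have htail0 : Tendsto tail atTop (𝓝 0) :=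
    tendsto_sum_nat_add fun k => (c * (t - s)) ^ k / k.factorial
  have htailn : ∀ n, 0 ≤ tail n := fun n => tsum_nonneg fun k => by positivity
  set A : ℝ := C * Real.exp (c * (t - s)) with hA
  have hA0 : 0 ≤ A := by positivity
  have key : ∀ n, ‖(∫ r in s..t, transport K m s r
        (pert K (m r) (fun z => ∑ k ∈ Finset.range n, propagatorTerm K m k r t f z)) x) -
      ∫ r in s..t, transport K m s r (pert K (m r) (propagator K m r t f)) x‖ ≤
      A * tail n * c * Real.exp (c * (t - s)) * w x * |t - s| := by
    intro n
    rw [← intervalIntegral.integral_sub]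
    · refine intervalIntegral.norm_integral_le_of_norm_le_const fun r hr => ?_
      rw [uIoc_of_le hst] at hr
      have hd1 := hw.dom_sum_propagatorTerm hP hC hf hr.1.le hr.2 n
      have hd2 := hw.dom_propagator_uniform hP hC hf hr.1.le hr.2
      rw [← hw.transport_sub hP (by positivity) (by positivity)
        (hw.dom_pert hP (by positivity) hd1 r) (hw.dom_pert hP (by positivity) hd2 r) hr.1.le x]
      have : ∀ z, pert K (m r) (fun z => ∑ k ∈ Finset.range n, propagatorTerm K m k r t f z) z -
          pert K (m r) (propagator K m r t f) z = pert K (m r) (fun z => (∑ k ∈ Finset.range n,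
            propagatorTerm K m k r t f z) - propagator K m r t f z) z := fun z => by
        rw [← hw.pert_sub hP hd1 hd2]
      simp only [this]
      refine hw.transport_pert_bound hP (mul_nonneg hA0 (htailn n)) hr ⟨(hd1.sub hd2).1, fun z => ?_⟩ x
      rw [abs_sub_comm]
      exact hw.abs_propagator_sub_le hP hC hf hr.1.le hr.2 n z
    · refine intervalIntegrable_of_bound (hP.measurable_transport_end (h := fun r => pert K (m r)
        (fun z => ∑ k ∈ Finset.range n, propagatorTerm K m k r t f z)) ?_ s x) hst fun r hr =>
        hw.transport_pert_bound hP ?_ hr (hw.dom_sum_propagatorTerm hP hC hf hr.1.le hr.2 n) x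
      · exact hP.measurable_pert_joint (h := fun r z => ∑ k ∈ Finset.range n,
          propagatorTerm K m k r t f z)
          (Finset.measurable_fun_sum _ fun k _ => hP.measurable_propagatorTerm hf.1 t k)
      · positivity
    · refine intervalIntegrable_of_bound (hP.measurable_transport_end (h := fun r => pert K (m r)
        (propagator K m r t f)) (hP.measurable_pert_joint
          (h := fun r => propagator K m r t f) (hP.measurable_propagator hf.1 t)) s x) hst
        fun r hr => hw.transport_pert_bound hP ?_ hr (hw.dom_propagator_uniform hP hC hf hr.1.le hr.2) x
      positivity
  rw [tendsto_iff_norm_sub_tendsto_zero]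
  refine squeeze_zero (fun _ => norm_nonneg _) key ?_
  have := ((((htail0.const_mul A).mul_const c).mul_const (Real.exp (c * (t - s)))).mul_const
    (w x)).mul_const |t - s|
  simpa using this

/-- The mild form of the backward equation. -/
lemma propagator_mild (hw : Lyap K m w c) (hP : CoagPath K m) (hC : 0 ≤ C)
    (hf : Dom w C f) {s t : ℝ} (hst : s ≤ t) (x : Mass) :
    propagator K m s t f x = Real.exp (cumRate K m s x - cumRate K m t x) * f x +
      ∫ r in s..t, Real.exp (cumRate K m s x - cumRate K m r x) *
        (gain K (m r) (propagator K m r t f) x - pert K (m r) (propagator K m r t f) x) := by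
  have hc := hw.const_nonneg
  have hwx := hw.nonneg x
  have h0 : 0 ≤ t - s := by linarith
  set A : ℝ := C * Real.exp (2 * c * (t - s)) with hA
  have hA0 : 0 ≤ A := by positivity
  set h : ℝ → Mass → ℝ := fun r => pert K (m r) (propagator K m r t f) with hh
  have hhm : Measurable fun q : ℝ × Mass => h q.1 q.2 :=
    hP.measurable_pert_joint (h := fun r => propagator K m r t f) (hP.measurable_propagator hf.1 t)
  have hhb : ∀ r ∈ Ioc s t, ∀ x, |h r x| ≤ A * c * w x := fun r hr =>
    (hw.dom_pert hP hA0 (hw.dom_propagator_uniform hP hC hf hr.1.le hr.2) r).2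
  have hWb : ∀ r ∈ Ioc s t, ∀ z, |∫ q in r..t, transport K m r q (h q) z| ≤
      A * c * Real.exp (c * (t - s)) * (t - s) * w z := by
    intro r hr z
    refine (abs_intervalIntegral_le_const
      (b := A * c * Real.exp (c * (t - s)) * w z) hr.2 fun q hq => ?_).trans ?_
    · exact hw.abs_transport_time_le hP (by positivity) hhm hhb hr.1.le hq.1.le
        ⟨hr.1.trans hq.1, hq.2⟩ z
    · rw [mul_right_comm]
      have := hw.nonneg z
      have : t - r ≤ t - s := by linarith [hr.1]
      gcongr
  have hWm : Measurable fun q : ℝ × Mass => ∫ r in q.1..t, transport K m q.1 r (h r) q.2 :=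
    hP.measurable_integral_transport hhm t
  rw [hw.propagator_eq_transport_sub hP hC hf hst x, hw.transport_mild hP hC hf hst x,
    hw.integral_transport_mild hP (mul_nonneg hA0 hc) hhm hst hhb x, add_sub_assoc]
  congr 1
  have hSd : ∀ r ∈ Ioc s t, Dom w (C * Real.exp (c * (t - s))) (transport K m r t f) := fun r hr =>
    (hw.dom_transport hP hC hf hr.2).mono hw.nonneg
      (mul_le_mul_of_nonneg_left (exp_const_sub_le hc hr.1.le) hC)
  have hWd : ∀ r ∈ Ioc s t, Dom w (A * c * Real.exp (c * (t - s)) * (t - s))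
      (fun z => ∫ q in r..t, transport K m r q (h q) z) := fun r hr =>
    ⟨hWm.comp (measurable_const.prodMk measurable_id), hWb r hr⟩
  rw [← intervalIntegral.integral_sub]
  · refine intervalIntegral.integral_congr_ae (ae_of_all _ fun r hr => ?_)
    rw [uIoc_of_le hst] at hr
    rw [← mul_sub]
    congr 1
    have : gain K (m r) (propagator K m r t f) x = gain K (m r) (fun z => transport K m r t f z -
        ∫ q in r..t, transport K m r q (h q) z) x := by
      congr 1
      ext z
      exact hw.propagator_eq_transport_sub hP hC hf hr.2 z
    rw [this, hw.gain_sub hP (hSd r hr) (hWd r hr)]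
    ring
  · obtain ⟨B, hB⟩ := hw.exists_decay_gain_bound hP (by positivity)
      (h := fun r => transport K m r t f) (s := s) (t := t) (fun r hr => (hSd r hr).2) x
    exact intervalIntegrable_of_bound ((hP.measurable_decay_time s x).mul
      (hP.measurable_gain_time (hP.measurable_transport_const hf.1 t) x)) hst hB
  · simp only [mul_add]
    obtain ⟨B, hB⟩ := hw.exists_decay_gain_bound hP (by positivity)
      (h := fun r z => ∫ q in r..t, transport K m r q (h q) z) (s := s) (t := t)
      (fun r hr => (hWd r hr).2) x
    refine IntervalIntegrable.add ?_ ?_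
    · refine intervalIntegrable_of_bound ((hP.measurable_decay_time s x).mul
        (hhm.comp (measurable_id.prodMk measurable_const))) hst (b := A * c * w x) fun r hr => ?_
      rw [Pi.mul_apply, abs_mul, Real.abs_exp]
      exact (mul_le_of_le_one_left (abs_nonneg _) (hP.decay_le_one hr.1.le x)).trans (hhb r hr x)
    · exact intervalIntegrable_of_bound ((hP.measurable_decay_time s x).mul
        (hP.measurable_gain_time hWm x)) hst hB

end Lyap

end

section

variable {K : Kern} {m : ℝ → FiniteMeasure Mass} {w W : Mass → ℝ} {c c' C : ℝ} {f g : Mass → ℝ}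
  {h : ℝ → Mass → ℝ}

namespace Lyap

/-! ### The integrated form of the backward equation -/

lemma Lam_eq (hw : Lyap K m w c) (hP : CoagPath K m) (hf : Dom w C f) (r : ℝ) (x : Mass) :
    Lam K (m r) f x = gain K (m r) f x - pert K (m r) f x - rate K (m r) x * f x := by
  have h1 := hw.integrable_gain hP hf r x
  have h2 := hw.integrable_pert hP hf r x
  have h3 : Integrable (fun y => f x * K x y) (m r : Measure Mass) := (hP.integrable r x).const_mul _
  simp only [Lam, gain, pert, rate, bracket]
  rw [mul_comm _ (f x), ← integral_const_mul, ← integral_sub h1 h2, ← integral_sub _ h3]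
  · congr 1
    ext y
    ring
  · exact h1.sub h2

lemma exists_source_bound (hw : Lyap K m w c) (hP : CoagPath K m) (hC : 0 ≤ C)
    {s t : ℝ} (hb : ∀ r ∈ Ioc s t, ∀ x, |h r x| ≤ C * w x) (x : Mass) :
    ∃ B, ∀ r ∈ Ioc s t, |gain K (m r) (h r) x - pert K (m r) (h r) x| ≤ B := by
  have h1 := hP.continuous_rate x
  obtain ⟨B, hB⟩ := (isCompact_Icc (a := s) (b := t)).exists_bound_of_continuousOn
    (f := fun r => C * ((rate K (m r) x + c) * w x) + C * (c * w x))
    (by fun_prop : Continuous _).continuousOn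
  refine ⟨B, fun r hr => (abs_sub _ _).trans ?_⟩
  exact (add_le_add (hw.abs_gain_le hP hC (hb r hr) r x) (hw.abs_pert_le hP hC (hb r hr) r x)).trans
    ((le_abs_self _).trans (hB r ⟨hr.1.le, hr.2⟩))

/-- The integrated form of the backward equation. -/
lemma propagator_integrated (hw : Lyap K m w c) (hP : CoagPath K m) (hC : 0 ≤ C)
    (hf : Dom w C f) {s t : ℝ} (hst : s ≤ t) (x : Mass) :
    propagator K m s t f x = f x + ∫ r in s..t, Lam K (m r) (propagator K m r t f) x := by
  have hc := hw.const_nonneg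
  have hd : ∀ r ∈ Ioc s t, Dom w (C * Real.exp (2 * c * (t - s))) (propagator K m r t f) :=
    fun r hr => hw.dom_propagator_uniform hP hC hf hr.1.le hr.2
  obtain ⟨B, hB⟩ := hw.exists_source_bound hP (h := fun r => propagator K m r t f) (s := s) (t := t)
    (by positivity) (fun r hr => (hd r hr).2) x
  have hm := hP.measurable_propagator hf.1 t
  rw [integrated_of_mild (τ := fun r => rate K (m r) x) (u := fun r => propagator K m r t f x)
    (a := f x) (k := fun r => gain K (m r) (propagator K m r t f) x -
      pert K (m r) (propagator K m r t f) x) (hP.continuous_rate x)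
    ((hP.measurable_gain_time (h := fun r => propagator K m r t f) hm x).sub
      (hP.measurable_pert_time (h := fun r => propagator K m r t f) hm x)) hst hB
    (fun r hr => hw.propagator_mild hP hC hf hr.2 x)]
  congr 1
  refine intervalIntegral.integral_congr_ae (ae_of_all _ fun r hr => ?_)
  rw [uIoc_of_le hst] at hr
  rw [hw.Lam_eq hP (hd r hr)]

/-- Integrated equations with a source can be put in mild form. -/
lemma mild_of_integrated_source (hw : Lyap K m w c) (hP : CoagPath K m) (hC : 0 ≤ C)
    {D : ℝ → Mass → ℝ} (hD : Measurable fun q : ℝ × Mass => D q.1 q.2) {s t : ℝ} (hst : s ≤ t)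
    (hb : ∀ r ∈ Ioc s t, ∀ x, |D r x| ≤ C * w x) {x : Mass} {a B : ℝ} {k : ℝ → ℝ} (hk : Measurable k)
    (hkb : ∀ r ∈ Ioc s t, |k r| ≤ B)
    (heq : ∀ r ∈ Icc s t, D r x = a + ∫ q in r..t, (Lam K (m q) (D q) x + k q)) :
    D s x = Real.exp (cumRate K m s x - cumRate K m t x) * a +
      ∫ r in s..t, Real.exp (cumRate K m s x - cumRate K m r x) *
        (gain K (m r) (D r) x - pert K (m r) (D r) x + k r) := by
  obtain ⟨B', hB'⟩ := hw.exists_source_bound hP hC hb x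
  refine mild_of_integrated (τ := fun r => rate K (m r) x) (u := fun r => D r x)
    (k := fun r => gain K (m r) (D r) x - pert K (m r) (D r) x + k r) (b := B' + B)
    (hP.continuous_rate x)
    (((hP.measurable_gain_time hD x).sub (hP.measurable_pert_time hD x)).add hk)
    (hD.comp (measurable_id.prodMk measurable_const)) hst
    (fun r hr => (abs_add_le _ _).trans (add_le_add (hB' r hr) (hkb r hr)))
    (fun r hr => hb r hr x) fun r hr => ?_
  rw [heq r hr]
  congr 1
  refine intervalIntegral.integral_congr_ae (ae_of_all _ fun q hq => ?_)
  rw [uIoc_of_le hr.2] at hq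
  have hq' : q ∈ Ioc s t := ⟨hr.1.trans_lt hq.1, hq.2⟩
  have hd : Dom w C (D q) := ⟨hD.comp (measurable_const.prodMk measurable_id), hb q hq'⟩
  rw [hw.Lam_eq hP hd]
  ring

end Lyap

/-! ### The positive potential operator -/

/-- One step of the positive backward equation with generator `L + M - τ` and horizon `T`. -/
def posStep (K : Kern) (m : ℝ → FiniteMeasure Mass) (T : ℝ) (F : ℝ → Mass → ℝ≥0∞) (s : ℝ)
    (x : Mass) : ℝ≥0∞ :=
  ∫⁻ r in Ioc s T, ENNReal.ofReal (Real.exp (cumRate K m s x - cumRate K m r x)) *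
    ∫⁻ y, (F r (x + y) + F r y) * ENNReal.ofReal (K x y) ∂(m r : Measure Mass)

/-- The effect of a source `H` before the first step. -/
def posSource (K : Kern) (m : ℝ → FiniteMeasure Mass) (T : ℝ) (H : ℝ → Mass → ℝ≥0∞) (s : ℝ)
    (x : Mass) : ℝ≥0∞ :=
  ∫⁻ r in Ioc s T, ENNReal.ofReal (Real.exp (cumRate K m s x - cumRate K m r x)) * H r x

/-- The potential of the positive equation. -/
def potential (K : Kern) (m : ℝ → FiniteMeasure Mass) (T : ℝ) (G : ℝ → Mass → ℝ≥0∞) (s : ℝ)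
    (x : Mass) : ℝ≥0∞ :=
  ∑' k : ℕ, (posStep K m T)^[k] G s x

/-- The source and terminal value that the weight `W` controls. -/
def baseSource (K : Kern) (m : ℝ → FiniteMeasure Mass) (T : ℝ) (W : Mass → ℝ) (s : ℝ)
    (x : Mass) : ℝ≥0∞ :=
  (if s ≤ T then ENNReal.ofReal (Real.exp (cumRate K m s x - cumRate K m T x) * W x) else 0) +
    posSource K m T (fun _ x => ENNReal.ofReal (W x)) s x

/-- A supersolution of the positive equation. -/
def superSol (W : Mass → ℝ) (c T s : ℝ) (x : Mass) : ℝ≥0∞ :=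
  if s ≤ T then ENNReal.ofReal (Real.exp ((2 * c + 1) * (T - s)) * W x) else 0

lemma posStep_mono {T : ℝ} {F G : ℝ → Mass → ℝ≥0∞} (h : ∀ s x, F s x ≤ G s x) (s : ℝ) (x : Mass) :
    posStep K m T F s x ≤ posStep K m T G s x := by
  refine lintegral_mono fun r => ?_
  dsimp only
  gcongr with y
  · exact h r _
  · exact h r _

namespace CoagPath

lemma measurable_inner (hP : CoagPath K m) {F : ℝ → Mass → ℝ≥0∞}
    (hF : Measurable fun q : ℝ × Mass => F q.1 q.2) : Measurable fun q : ℝ × Mass =>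
      ∫⁻ y, (F q.1 (q.2 + y) + F q.1 y) * ENNReal.ofReal (K q.2 y) ∂(m q.1 : Measure Mass) := by
  refine hP.measurable_lintegral (α := ℝ × Mass) (F := fun q y => (F q.1 (q.2 + y) + F q.1 y) *
    ENNReal.ofReal (K q.2 y)) ?_ measurable_fst
  have h1 : Measurable fun p : (ℝ × Mass) × Mass => (p.1.1, p.1.2 + p.2) := by fun_prop
  have h2 : Measurable fun p : (ℝ × Mass) × Mass => (p.1.1, p.2) := by fun_prop
  have h3 : Measurable fun p : (ℝ × Mass) × Mass => (p.1.2, p.2) := by fun_prop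
  exact ((hF.comp h1).add (hF.comp h2)).mul (hP.measurable_kern.comp h3).ennreal_ofReal

lemma measurable_posSource (hP : CoagPath K m) {F : ℝ → Mass → ℝ≥0∞} (T : ℝ)
    (hF : Measurable fun q : ℝ × Mass => F q.1 q.2) :
    Measurable fun q : ℝ × Mass => posSource K m T F q.1 q.2 := by
  refine measurable_setLIntegral_Ioc (α := ℝ × Mass) (F := fun q r => ENNReal.ofReal
    (Real.exp (cumRate K m q.1 q.2 - cumRate K m r q.2)) * F r q.2) ?_ measurable_fst
    measurable_const
  refine (hP.measurable_decay (α := (ℝ × Mass) × ℝ) (by fun_prop) measurable_snd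
    (by fun_prop)).ennreal_ofReal.mul ?_
  exact hF.comp (by fun_prop : Measurable fun p : (ℝ × Mass) × ℝ => (p.2, p.1.2))

lemma measurable_posStep (hP : CoagPath K m) {F : ℝ → Mass → ℝ≥0∞} (T : ℝ)
    (hF : Measurable fun q : ℝ × Mass => F q.1 q.2) :
    Measurable fun q : ℝ × Mass => posStep K m T F q.1 q.2 :=
  hP.measurable_posSource T (F := fun r x => ∫⁻ y, (F r (x + y) + F r y) * ENNReal.ofReal (K x y)
    ∂(m r : Measure Mass)) (hP.measurable_inner hF)

lemma measurable_iterate_posStep (hP : CoagPath K m) {F : ℝ → Mass → ℝ≥0∞} (T : ℝ)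
    (hF : Measurable fun q : ℝ × Mass => F q.1 q.2) (k : ℕ) :
    Measurable fun q : ℝ × Mass => (posStep K m T)^[k] F q.1 q.2 := by
  induction k with
  | zero => exact hF
  | succ k ih =>
    simp only [Function.iterate_succ_apply']
    exact hP.measurable_posStep T ih

lemma measurable_potential (hP : CoagPath K m) {F : ℝ → Mass → ℝ≥0∞} (T : ℝ)
    (hF : Measurable fun q : ℝ × Mass => F q.1 q.2) :
    Measurable fun q : ℝ × Mass => potential K m T F q.1 q.2 :=
  Measurable.tsum fun k => hP.measurable_iterate_posStep T hF k

lemma measurable_decay_ofReal (hP : CoagPath K m) (s : ℝ) (x : Mass) :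
    Measurable fun r => ENNReal.ofReal (Real.exp (cumRate K m s x - cumRate K m r x)) :=
  (hP.measurable_decay_time s x).ennreal_ofReal

lemma posSource_add (hP : CoagPath K m) {F : ℝ → Mass → ℝ≥0∞} (G : ℝ → Mass → ℝ≥0∞) (T : ℝ)
    (hF : Measurable fun q : ℝ × Mass => F q.1 q.2) (s : ℝ) (x : Mass) :
    posSource K m T (fun r x => F r x + G r x) s x =
      posSource K m T F s x + posSource K m T G s x := by
  simp only [posSource, mul_add]
  exact lintegral_add_left ((hP.measurable_decay_ofReal s x).mul
    (hF.comp (measurable_id.prodMk measurable_const))) _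

lemma posStep_add (hP : CoagPath K m) {F : ℝ → Mass → ℝ≥0∞} (G : ℝ → Mass → ℝ≥0∞) (T : ℝ)
    (hF : Measurable fun q : ℝ × Mass => F q.1 q.2) (s : ℝ) (x : Mass) :
    posStep K m T (fun r x => F r x + G r x) s x = posStep K m T F s x + posStep K m T G s x := by
  have key : ∀ r x, ∫⁻ y, (F r (x + y) + G r (x + y) + (F r y + G r y)) * ENNReal.ofReal (K x y)
      ∂(m r : Measure Mass) = (∫⁻ y, (F r (x + y) + F r y) * ENNReal.ofReal (K x y)
      ∂(m r : Measure Mass)) + ∫⁻ y, (G r (x + y) + G r y) * ENNReal.ofReal (K x y)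
      ∂(m r : Measure Mass) := by
    intro r x
    rw [← lintegral_add_left]
    · congr 1; ext y; ring
    · have h1 : Measurable fun y : Mass => (r, x + y) := by fun_prop
      have h2 : Measurable fun y : Mass => (r, y) := by fun_prop
      have h3 : Measurable fun y : Mass => (x, y) := by fun_prop
      exact ((hF.comp h1).add (hF.comp h2)).mul (hP.measurable_kern.comp h3).ennreal_ofReal
  simp only [posStep, key]
  exact hP.posSource_add (F := fun r x => ∫⁻ y, (F r (x + y) + F r y) * ENNReal.ofReal (K x y)
      ∂(m r : Measure Mass)) (fun r x => ∫⁻ y, (G r (x + y) + G r y) * ENNReal.ofReal (K x y)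
      ∂(m r : Measure Mass)) T (hP.measurable_inner hF) s x

lemma posStep_sum (hP : CoagPath K m) {F : ℕ → ℝ → Mass → ℝ≥0∞} (T : ℝ)
    (hF : ∀ k, Measurable fun q : ℝ × Mass => F k q.1 q.2) (n : ℕ) (s : ℝ) (x : Mass) :
    posStep K m T (fun r x => ∑ k ∈ Finset.range n, F k r x) s x =
      ∑ k ∈ Finset.range n, posStep K m T (F k) s x := by
  induction n with
  | zero => simp [posStep]
  | succ n ih =>
    simp only [Finset.sum_range_succ, ← ih]
    exact hP.posStep_add (F := fun r x => ∑ k ∈ Finset.range n, F k r x) (F n) T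
      (Finset.measurable_fun_sum _ fun k _ => hF k) s x

end CoagPath

lemma posStep_const_mul {T : ℝ} {F : ℝ → Mass → ℝ≥0∞} {β : ℝ≥0∞} (hβ : β ≠ ∞) (s : ℝ) (x : Mass) :
    posStep K m T (fun r x => β * F r x) s x = β * posStep K m T F s x := by
  simp only [posStep]
  rw [← lintegral_const_mul' _ _ hβ]
  congr 1
  ext r
  rw [mul_left_comm, ← lintegral_const_mul' _ _ hβ]
  congr 2
  ext y
  ring

lemma iterate_posStep_le {T : ℝ} {F G : ℝ → Mass → ℝ≥0∞} {β : ℝ≥0∞} (hβ : β ≠ ∞)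
    (h : ∀ s x, F s x ≤ β * G s x) (k : ℕ) (s : ℝ) (x : Mass) :
    (posStep K m T)^[k] F s x ≤ β * (posStep K m T)^[k] G s x := by
  induction k generalizing s x with
  | zero => exact h s x
  | succ k ih =>
    simp only [Function.iterate_succ_apply']
    rw [← posStep_const_mul hβ]
    exact posStep_mono ih s x

lemma potential_le_mul {T : ℝ} {F G : ℝ → Mass → ℝ≥0∞} {β : ℝ≥0∞} (hβ : β ≠ ∞)
    (h : ∀ s x, F s x ≤ β * G s x) (s : ℝ) (x : Mass) :
    potential K m T F s x ≤ β * potential K m T G s x := by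
  simp only [potential]
  rw [← ENNReal.tsum_mul_left]
  exact ENNReal.tsum_le_tsum fun k => iterate_posStep_le hβ h k s x

lemma CoagPath.sum_iterate_succ (hP : CoagPath K m) {G : ℝ → Mass → ℝ≥0∞} (T : ℝ)
    (hG : Measurable fun q : ℝ × Mass => G q.1 q.2) (n : ℕ) (s : ℝ) (x : Mass) :
    ∑ k ∈ Finset.range (n + 1), (posStep K m T)^[k] G s x = G s x +
      posStep K m T (fun r x => ∑ k ∈ Finset.range n, (posStep K m T)^[k] G r x) s x := by
  rw [hP.posStep_sum T (fun k => hP.measurable_iterate_posStep T hG k), Finset.sum_range_succ']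
  simp only [Function.iterate_succ_apply', Function.iterate_zero, id_eq]
  rw [add_comm]

lemma CoagPath.potential_le_of_superSol (hP : CoagPath K m) {T : ℝ} {G v : ℝ → Mass → ℝ≥0∞}
    (hG : Measurable fun q : ℝ × Mass => G q.1 q.2)
    (hv : ∀ s x, G s x + posStep K m T v s x ≤ v s x) (s : ℝ) (x : Mass) :
    potential K m T G s x ≤ v s x := by
  have key : ∀ n s x, ∑ k ∈ Finset.range n, (posStep K m T)^[k] G s x ≤ v s x := by
    intro n
    induction n with
    | zero => simp
    | succ n ih =>
      intro s x
      rw [hP.sum_iterate_succ T hG]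
      exact (add_le_add le_rfl (posStep_mono ih s x)).trans (hv s x)
  exact ENNReal.tsum_le_of_sum_range_le fun n => key n s x

/-- Comparison: a subsolution of the positive equation is at most the potential of its source. -/
lemma CoagPath.le_potential (hP : CoagPath K m) {T : ℝ} {D G Ψ : ℝ → Mass → ℝ≥0∞}
    (hG : Measurable fun q : ℝ × Mass => G q.1 q.2)
    (hD : ∀ s x, D s x ≤ G s x + posStep K m T D s x) (hΨ : ∀ s x, D s x ≤ Ψ s x) {s : ℝ} {x : Mass}
    (hfin : potential K m T Ψ s x ≠ ∞) : D s x ≤ potential K m T G s x := by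
  have key : ∀ n s x, D s x ≤ ∑ k ∈ Finset.range n, (posStep K m T)^[k] G s x +
      (posStep K m T)^[n] Ψ s x := by
    intro n
    induction n with
    | zero => simpa using hΨ
    | succ n ih =>
      intro s x
      refine (hD s x).trans ?_
      rw [hP.sum_iterate_succ T hG, add_assoc, Function.iterate_succ_apply']
      gcongr
      rw [← hP.posStep_add (F := fun r x => ∑ k ∈ Finset.range n, (posStep K m T)^[k] G r x) _ T
        (Finset.measurable_fun_sum _ fun k _ => hP.measurable_iterate_posStep T hG k)]
      exact posStep_mono ih s x
  have h0 : Tendsto (fun n => (posStep K m T)^[n] Ψ s x) atTop (𝓝 0) :=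
    ENNReal.tendsto_atTop_zero_of_tsum_ne_top hfin
  have := h0.const_add (potential K m T G s x)
  rw [add_zero] at this
  exact ge_of_tendsto this (Eventually.of_forall fun n => (key n s x).trans
    (add_le_add (ENNReal.sum_le_tsum _) le_rfl))

namespace Lyap

lemma measurable_baseSource (hW : Lyap K m W c) (hP : CoagPath K m) (T : ℝ) :
    Measurable fun q : ℝ × Mass => baseSource K m T W q.1 q.2 := by
  have : Measurable fun q : ℝ × Mass => W q.2 := hW.measurable.comp measurable_snd
  refine (Measurable.ite (measurableSet_le measurable_fst measurable_const) ?_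
    measurable_const).add (hP.measurable_posSource T this.ennreal_ofReal)
  exact ((hP.measurable_decay (α := ℝ × Mass) measurable_fst measurable_const
    measurable_snd).mul this).ennreal_ofReal

lemma inner_superSol_le (hW : Lyap K m W c) (hP : CoagPath K m) {T r : ℝ} (hr : r ≤ T) (x : Mass) :
    ∫⁻ y, (superSol W c T r (x + y) + superSol W c T r y) * ENNReal.ofReal (K x y)
      ∂(m r : Measure Mass) ≤ ENNReal.ofReal (Real.exp ((2 * c + 1) * (T - r)) *
        ((rate K (m r) x + 2 * c) * W x)) := by
  have h1 : ∀ y, (superSol W c T r (x + y) + superSol W c T r y) * ENNReal.ofReal (K x y) =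
      ENNReal.ofReal (Real.exp ((2 * c + 1) * (T - r)) * (W (x + y) * K x y + W y * K x y)) := by
    intro y
    simp only [superSol, if_pos hr]
    have hw1 := hW.nonneg (x + y)
    have hw2 := hW.nonneg y
    have hk := hP.nonneg x y
    rw [← ENNReal.ofReal_add (by positivity) (by positivity), ← ENNReal.ofReal_mul (by positivity)]
    congr 1
    ring
  simp only [h1]
  rw [← ofReal_integral_eq_lintegral_ofReal]
  · refine ENNReal.ofReal_le_ofReal ?_
    rw [integral_const_mul, integral_add (hW.gain_integrable r x) (hW.pert_integrable r x)]
    refine mul_le_mul_of_nonneg_left ?_ (Real.exp_nonneg _)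
    have a1 := hW.gain_le r x
    have a2 := hW.pert_le r x
    rw [gain] at a1
    rw [pert] at a2
    linarith
  · exact ((hW.gain_integrable r x).add (hW.pert_integrable r x)).const_mul _
  · refine ae_of_all _ fun y => ?_
    have hw1 := hW.nonneg (x + y)
    have hw2 := hW.nonneg y
    have hk := hP.nonneg x y
    simp only [Pi.zero_apply]
    positivity

lemma baseSource_add_posStep_le (hW : Lyap K m W c) (hP : CoagPath K m) (T s : ℝ) (x : Mass) :
    baseSource K m T W s x + posStep K m T (superSol W c T) s x ≤ superSol W c T s x := by
  by_cases hs : s ≤ T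
  · have hWx := hW.nonneg x
    have hc := hW.const_nonneg
    have hrate := fun r => hP.rate_nonneg r x
    simp only [baseSource, superSol, if_pos hs]
    rw [add_assoc]
    have h1 : posSource K m T (fun _ x => ENNReal.ofReal (W x)) s x +
        posStep K m T (superSol W c T) s x ≤ ∫⁻ r in Ioc s T, ENNReal.ofReal (
          Real.exp (cumRate K m s x - cumRate K m r x) *
          (W x * ((rate K (m r) x + (2 * c + 1)) * Real.exp ((2 * c + 1) * (T - r))))) := by
      simp only [posStep]
      rw [posSource, ← lintegral_add_left]
      · refine lintegral_mono_ae ((ae_restrict_iff' measurableSet_Ioc).2 (ae_of_all _ fun r hr => ?_))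
        have h2 := hW.inner_superSol_le hP hr.2 x
        refine (add_le_add le_rfl (mul_le_mul_right h2 _)).trans ?_
        rw [← ENNReal.ofReal_mul (Real.exp_nonneg _), ← ENNReal.ofReal_mul (Real.exp_nonneg _),
          ← ENNReal.ofReal_add (by positivity) (by have := hrate r; positivity)]
        refine ENNReal.ofReal_le_ofReal ?_
        rw [← mul_add]
        refine mul_le_mul_of_nonneg_left ?_ (Real.exp_nonneg _)
        have h3 : 1 ≤ Real.exp ((2 * c + 1) * (T - r)) := by
          rw [Real.one_le_exp_iff]
          have := hr.2
          exact mul_nonneg (by positivity) (by linarith)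
        nlinarith [mul_le_mul_of_nonneg_left h3 hWx]
      · exact (hP.measurable_decay_ofReal s x).mul measurable_const
    refine (add_le_add le_rfl h1).trans ?_
    rw [← ofReal_integral_eq_lintegral_ofReal, ← intervalIntegral.integral_of_le hs]
    · have h4 : ∫ r in s..T, Real.exp (cumRate K m s x - cumRate K m r x) *
          (W x * ((rate K (m r) x + (2 * c + 1)) * Real.exp ((2 * c + 1) * (T - r)))) =
          W x * (Real.exp ((2 * c + 1) * (T - s)) -
            Real.exp (cumRate K m s x - cumRate K m T x)) := by
        rw [← integral_decay_eq hP, ← intervalIntegral.integral_const_mul]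
        refine intervalIntegral.integral_congr fun r _ => ?_
        ring
      have h5 : 0 ≤ ∫ r in s..T, Real.exp (cumRate K m s x - cumRate K m r x) *
          (W x * ((rate K (m r) x + (2 * c + 1)) * Real.exp ((2 * c + 1) * (T - r)))) :=
        intervalIntegral.integral_nonneg hs fun r _ => by have := hrate r; positivity
      rw [← ENNReal.ofReal_add (by positivity) h5, h4]
      exact ENNReal.ofReal_le_ofReal (le_of_eq (by ring))
    · rw [← IntegrableOn, ← intervalIntegrable_iff_integrableOn_Ioc_of_le hs]
      exact (continuous_decay_bound hP _ _ _ _ _).intervalIntegrable _ _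
    · refine ae_of_all _ fun r => ?_
      have := hrate r
      simp only [Pi.zero_apply]
      positivity
  · have : Ioc s T = ∅ := Ioc_eq_empty (fun h => hs h.le)
    simp [baseSource, posSource, posStep, superSol, hs, this]

lemma potential_baseSource_le (hW : Lyap K m W c) (hP : CoagPath K m) (T s : ℝ) (x : Mass) :
    potential K m T (baseSource K m T W) s x ≤ superSol W c T s x :=
  hP.potential_le_of_superSol (hW.measurable_baseSource hP T)
    (hW.baseSource_add_posStep_le hP T) s x

lemma potential_le_superSol (hW : Lyap K m W c) (hP : CoagPath K m) {T : ℝ} {G : ℝ → Mass → ℝ≥0∞}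
    {β : ℝ≥0∞} (hβ : β ≠ ∞) (hG : ∀ s x, G s x ≤ β * baseSource K m T W s x) (s : ℝ) (x : Mass) :
    potential K m T G s x ≤ β * superSol W c T s x :=
  (potential_le_mul hβ hG s x).trans (mul_le_mul_right (hW.potential_baseSource_le hP T s x) _)

lemma superSol_ne_top (W : Mass → ℝ) (c T s : ℝ) (x : Mass) : superSol W c T s x ≠ ∞ := by
  rw [superSol]; split_ifs <;> simp

/-- Dominated convergence for the potential. -/
lemma tendsto_potential (hW : Lyap K m W c) (hP : CoagPath K m) {T : ℝ} {G : ℕ → ℝ → Mass → ℝ≥0∞}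
    (hGm : ∀ n, Measurable fun q : ℝ × Mass => G n q.1 q.2) {β : ℝ≥0∞} (hβ : β ≠ ∞)
    (hG : ∀ n s x, G n s x ≤ β * baseSource K m T W s x)
    (hlim : ∀ s x, Tendsto (fun n => G n s x) atTop (𝓝 0)) (s : ℝ) (x : Mass) :
    Tendsto (fun n => potential K m T (G n) s x) atTop (𝓝 0) := by
  have hbase : ∀ k s x, (posStep K m T)^[k] (baseSource K m T W) s x ≤ superSol W c T s x :=
    fun k s x => (ENNReal.le_tsum k).trans (hW.potential_baseSource_le hP T s x)
  have hdom : ∀ n k s x, (posStep K m T)^[k] (G n) s x ≤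
      β * (posStep K m T)^[k] (baseSource K m T W) s x :=
    fun n k s x => iterate_posStep_le hβ (hG n) k s x
  have key : ∀ k s x, Tendsto (fun n => (posStep K m T)^[k] (G n) s x) atTop (𝓝 0) := by
    intro k
    induction k with
    | zero => exact hlim
    | succ k ih =>
      intro s x
      simp only [Function.iterate_succ_apply']
      have hle : ∀ n s x, (posStep K m T)^[k] (G n) s x ≤ β * superSol W c T s x := fun n s x =>
        (hdom n k s x).trans (mul_le_mul_right (hbase k s x) _)
      have hmk : ∀ n, Measurable fun q : ℝ × Mass => (posStep K m T)^[k] (G n) q.1 q.2 :=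
        fun n => hP.measurable_iterate_posStep T (hGm n) k
      have hinner : ∀ r ≤ T, Tendsto (fun n => ∫⁻ y, ((posStep K m T)^[k] (G n) r (x + y) +
          (posStep K m T)^[k] (G n) r y) * ENNReal.ofReal (K x y) ∂(m r : Measure Mass)) atTop
          (𝓝 0) := by
        intro r hr
        have := tendsto_lintegral_of_dominated_convergence (μ := (m r : Measure Mass))
          (F := fun n y => ((posStep K m T)^[k] (G n) r (x + y) +
          (posStep K m T)^[k] (G n) r y) * ENNReal.ofReal (K x y)) (f := fun _ => 0)
          (fun y => β * ((superSol W c T r (x + y) + superSol W c T r y) * ENNReal.ofReal (K x y)))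
          (fun n => ?_) (fun n => ae_of_all _ fun y => ?_) ?_ (ae_of_all _ fun y => ?_)
        · simpa using this
        · have h1 : Measurable fun y : Mass => (r, x + y) := by fun_prop
          have h2 : Measurable fun y : Mass => (r, y) := by fun_prop
          have h3 : Measurable fun y : Mass => (x, y) := by fun_prop
          exact (((hmk n).comp h1).add ((hmk n).comp h2)).mul
            (hP.measurable_kern.comp h3).ennreal_ofReal
        · dsimp only
          rw [← mul_assoc, mul_add]
          exact mul_le_mul_left (add_le_add (hle n r _) (hle n r _)) _
        · rw [lintegral_const_mul' _ _ hβ]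
          exact ENNReal.mul_ne_top hβ ((hW.inner_superSol_le hP hr x).trans_lt
            ENNReal.ofReal_lt_top).ne
        · have := ENNReal.Tendsto.mul_const ((ih r (x + y)).add (ih r y))
            (b := ENNReal.ofReal (K x y)) (Or.inr ENNReal.ofReal_ne_top)
          simpa using this
      have := tendsto_lintegral_of_dominated_convergence (μ := volume.restrict (Ioc s T))
        (F := fun n r => ENNReal.ofReal (Real.exp (cumRate K m s x - cumRate K m r x)) *
          ∫⁻ y, ((posStep K m T)^[k] (G n) r (x + y) + (posStep K m T)^[k] (G n) r y) *
            ENNReal.ofReal (K x y) ∂(m r : Measure Mass)) (f := fun _ => 0)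
        (fun r => β * (ENNReal.ofReal (Real.exp (cumRate K m s x - cumRate K m r x)) *
          ∫⁻ y, (superSol W c T r (x + y) + superSol W c T r y) * ENNReal.ofReal (K x y)
            ∂(m r : Measure Mass)))
        (fun n => ?_) (fun n => ae_of_all _ fun r => ?_) ?_
        ((ae_restrict_iff' measurableSet_Ioc).2 (ae_of_all _ fun r hr => ?_))
      · simpa [posStep] using this
      · exact (hP.measurable_decay_ofReal s x).mul ((hP.measurable_inner (hmk n)).comp
          (measurable_id.prodMk measurable_const : Measurable fun r : ℝ => (r, x)))
      · dsimp only
        rw [mul_left_comm, ← lintegral_const_mul' _ _ hβ]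
        refine mul_le_mul_right (lintegral_mono fun y => ?_) _
        dsimp only
        rw [← mul_assoc, mul_add]
        exact mul_le_mul_left (add_le_add (hle n r _) (hle n r _)) _
      · rw [lintegral_const_mul' _ _ hβ]
        refine ENNReal.mul_ne_top hβ (ne_top_of_le_ne_top (superSol_ne_top W c T s x)
          ((le_add_self).trans (hW.baseSource_add_posStep_le hP T s x)))
      · have := ENNReal.Tendsto.const_mul (hinner r hr.2)
          (a := ENNReal.ofReal (Real.exp (cumRate K m s x - cumRate K m r x)))
          (Or.inr ENNReal.ofReal_ne_top)
        simpa using this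
  have := tendsto_lintegral_of_dominated_convergence (μ := Measure.count)
    (F := fun n (k : ℕ) => (posStep K m T)^[k] (G n) s x) (f := fun _ => 0)
    (fun k => β * (posStep K m T)^[k] (baseSource K m T W) s x)
    (fun n => measurable_from_top) (fun n => ae_of_all _ fun k => hdom n k s x) ?_
    (ae_of_all _ fun k => key k s x)
  · simpa [lintegral_count, potential] using this
  · rw [lintegral_count, ENNReal.tsum_mul_left]
    exact ENNReal.mul_ne_top hβ (ne_top_of_le_ne_top (superSol_ne_top W c T s x)
      (hW.potential_baseSource_le hP T s x))

end Lyap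

end

section

variable {K K' : Kern} {m m' : ℝ → FiniteMeasure Mass} {w W : Mass → ℝ} {c c' C : ℝ}
  {f g : Mass → ℝ} {h : ℝ → Mass → ℝ}

/-- The contribution of a terminal value `a` and a source `H` before the first step. -/
def fullSource (K : Kern) (m : ℝ → FiniteMeasure Mass) (T : ℝ) (a : Mass → ℝ≥0∞)
    (H : ℝ → Mass → ℝ≥0∞) (s : ℝ) (x : Mass) : ℝ≥0∞ :=
  (if s ≤ T then ENNReal.ofReal (Real.exp (cumRate K m s x - cumRate K m T x)) * a x else 0) +
    posSource K m T H s x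

lemma CoagPath.measurable_fullSource (hP : CoagPath K m) (T : ℝ) {a : Mass → ℝ≥0∞}
    (ha : Measurable a) {H : ℝ → Mass → ℝ≥0∞} (hH : Measurable fun q : ℝ × Mass => H q.1 q.2) :
    Measurable fun q : ℝ × Mass => fullSource K m T a H q.1 q.2 := by
  refine (Measurable.ite (measurableSet_le measurable_fst measurable_const) ?_
    measurable_const).add (hP.measurable_posSource T hH)
  exact (hP.measurable_decay (α := ℝ × Mass) measurable_fst measurable_const
    measurable_snd).ennreal_ofReal.mul (ha.comp measurable_snd)

lemma fullSource_le {T : ℝ} {a : Mass → ℝ≥0∞} {H : ℝ → Mass → ℝ≥0∞} {β : ℝ≥0∞} (hβ : β ≠ ∞)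
    (ha : ∀ x, a x ≤ β * ENNReal.ofReal (W x))
    (hH : ∀ r x, H r x ≤ β * ENNReal.ofReal (W x)) (s : ℝ) (x : Mass) :
    fullSource K m T a H s x ≤ β * baseSource K m T W s x := by
  rw [fullSource, baseSource, mul_add]
  refine add_le_add ?_ ?_
  · split_ifs
    · rw [ENNReal.ofReal_mul (Real.exp_nonneg _), mul_left_comm]
      exact mul_le_mul_right (ha x) _
    · simp
  · rw [posSource, posSource, ← lintegral_const_mul' _ _ hβ]
    refine lintegral_mono fun r => ?_
    dsimp only
    rw [mul_left_comm]
    exact mul_le_mul_right (hH r x) _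

lemma CoagPath.tendsto_fullSource (hP : CoagPath K m) {T : ℝ} {a : ℕ → Mass → ℝ≥0∞}
    (ha : ∀ x, Tendsto (fun n => a n x) atTop (𝓝 0)) {H : ℕ → ℝ → Mass → ℝ≥0∞}
    (hHm : ∀ n, Measurable fun q : ℝ × Mass => H n q.1 q.2) {B : Mass → ℝ≥0∞}
    (hB : ∀ x, B x ≠ ∞) (hHB : ∀ n r x, H n r x ≤ B x)
    (hH : ∀ r x, Tendsto (fun n => H n r x) atTop (𝓝 0)) (s : ℝ) (x : Mass) :
    Tendsto (fun n => fullSource K m T (a n) (H n) s x) atTop (𝓝 0) := by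
  have h1 : Tendsto (fun n => if s ≤ T then ENNReal.ofReal (Real.exp (cumRate K m s x -
      cumRate K m T x)) * a n x else 0) atTop (𝓝 0) := by
    split_ifs
    · simpa using ENNReal.Tendsto.const_mul (ha x) (Or.inr ENNReal.ofReal_ne_top)
    · exact tendsto_const_nhds
  have h2 : Tendsto (fun n => posSource K m T (H n) s x) atTop (𝓝 0) := by
    have := tendsto_lintegral_of_dominated_convergence (μ := volume.restrict (Ioc s T))
      (F := fun n r => ENNReal.ofReal (Real.exp (cumRate K m s x - cumRate K m r x)) * H n r x)
      (f := fun _ => 0) (fun _ => B x)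
      (fun n => (hP.measurable_decay_ofReal s x).mul
        ((hHm n).comp (measurable_id.prodMk measurable_const : Measurable fun r : ℝ => (r, x))))
      (fun n => (ae_restrict_iff' measurableSet_Ioc).2 (ae_of_all _ fun r hr => ?_)) ?_
      (ae_of_all _ fun r => ?_)
    · simpa [posSource] using this
    · refine (mul_le_of_le_one_left (zero_le) ?_).trans (hHB n r x)
      rw [ENNReal.ofReal_le_one]
      exact hP.decay_le_one hr.1.le x
    · simp [ENNReal.mul_eq_top, hB x]
    · simpa using ENNReal.Tendsto.const_mul (hH r x) (Or.inr ENNReal.ofReal_ne_top)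
  simpa [fullSource] using h1.add h2

/-- Solutions of the mild equation are controlled by the potential of the positive equation. -/
theorem Lyap.ofReal_abs_le_potential (hw : Lyap K m w c) (hW : Lyap K m W c') (hP : CoagPath K m)
    (hC : 0 ≤ C) {t T : ℝ} (htT : t ≤ T) {D : ℝ → Mass → ℝ}
    (hb : ∀ r ∈ Icc 0 t, ∀ x, |D r x| ≤ C * w x)
    {a : Mass → ℝ} (ham : Measurable a) (haT : t = T ∨ ∀ x, a x = 0) {H : ℝ → Mass → ℝ≥0∞}
    (hHm : Measurable fun q : ℝ × Mass => H q.1 q.2)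
    (hH : ∀ r ∈ Ioc 0 t, ∀ x, ENNReal.ofReal |h r x| ≤ H r x)
    (hmild : ∀ s ∈ Icc 0 t, ∀ x, D s x = Real.exp (cumRate K m s x - cumRate K m t x) * a x +
      ∫ r in s..t, Real.exp (cumRate K m s x - cumRate K m r x) *
        (gain K (m r) (D r) x - pert K (m r) (D r) x + h r x))
    {β : ℝ≥0∞} (hβ : β ≠ ∞) (haW : ∀ x, ENNReal.ofReal |a x| ≤ β * ENNReal.ofReal (W x))
    (hwW : ∀ r x, ENNReal.ofReal (C * ((rate K (m r) x + c) * w x)) +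
      ENNReal.ofReal (C * (c * w x)) + H r x ≤ β * ENNReal.ofReal (W x))
    {s : ℝ} (hs : s ∈ Icc 0 t) (x : Mass) :
    ENNReal.ofReal |D s x| ≤ potential K m T (fullSource K m T (fun x => ENNReal.ofReal |a x|) H)
      s x := by
  set D' : ℝ → Mass → ℝ≥0∞ := fun r x => if r ∈ Icc 0 t then ENNReal.ofReal |D r x| else 0 with hD'
  -- the mild equation as an inequality
  have hineq : ∀ s ∈ Icc 0 t, ∀ x, ENNReal.ofReal |D s x| ≤
      ENNReal.ofReal (Real.exp (cumRate K m s x - cumRate K m t x)) * ENNReal.ofReal |a x| +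
      ∫⁻ r in Ioc s t, ENNReal.ofReal (Real.exp (cumRate K m s x - cumRate K m r x)) *
        (ENNReal.ofReal |gain K (m r) (D r) x| + ENNReal.ofReal |pert K (m r) (D r) x| +
          ENNReal.ofReal |h r x|) := by
    intro s hs x
    rw [hmild s hs x, intervalIntegral.integral_of_le hs.2]
    refine (ENNReal.ofReal_le_ofReal (abs_add_le _ _)).trans ?_
    rw [ENNReal.ofReal_add (abs_nonneg _) (abs_nonneg _), abs_mul, Real.abs_exp,
      ENNReal.ofReal_mul (Real.exp_nonneg _)]
    refine add_le_add le_rfl ?_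
    rw [← Real.enorm_eq_ofReal_abs]
    refine (enorm_integral_le_lintegral_enorm _).trans (lintegral_mono fun r => ?_)
    rw [Real.enorm_eq_ofReal_abs, abs_mul, Real.abs_exp, ENNReal.ofReal_mul (Real.exp_nonneg _)]
    refine mul_le_mul_right ?_ _
    rw [← ENNReal.ofReal_add (abs_nonneg _) (abs_nonneg _), ← ENNReal.ofReal_add
      (add_nonneg (abs_nonneg _) (abs_nonneg _)) (abs_nonneg _)]
    refine ENNReal.ofReal_le_ofReal ((abs_add_le _ _).trans (add_le_add (abs_sub _ _) le_rfl))
  have hterm : ∀ s ∈ Icc 0 t, ∀ x, ENNReal.ofReal (Real.exp (cumRate K m s x - cumRate K m t x)) *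
      ENNReal.ofReal |a x| ≤ if s ≤ T then ENNReal.ofReal (Real.exp (cumRate K m s x -
      cumRate K m T x)) * ENNReal.ofReal |a x| else 0 := by
    intro s hs x
    rw [if_pos (hs.2.trans htT)]
    rcases haT with rfl | ha0
    · exact le_rfl
    · simp [ha0 x]
  have hD1 : ∀ s x, D' s x ≤ fullSource K m T (fun x => ENNReal.ofReal |a x|) H s x +
      posStep K m T D' s x := by
    intro s x
    simp only [hD']
    split_ifs with hs
    swap
    · exact zero_le
    refine (hineq s hs x).trans ?_
    rw [fullSource, add_assoc]
    refine add_le_add (hterm s hs x) ?_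
    simp only [posSource, posStep]
    have hmH : Measurable fun r => ENNReal.ofReal (Real.exp (cumRate K m s x - cumRate K m r x)) *
        H r x := (hP.measurable_decay_ofReal s x).mul
      (hHm.comp (measurable_id.prodMk measurable_const : Measurable fun r : ℝ => (r, x)))
    rw [← lintegral_add_left hmH]
    refine (lintegral_mono_ae ((ae_restrict_iff' measurableSet_Ioc).2 (ae_of_all _ fun r hr => ?_))).trans
      (lintegral_mono_set (Ioc_subset_Ioc_right htT))
    rw [← mul_add, add_comm]
    refine mul_le_mul_right ?_ _
    have hr0 : r ∈ Icc 0 t := ⟨hs.1.trans hr.1.le, hr.2⟩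
    refine add_le_add (hH r ⟨hs.1.trans_lt hr.1, hr.2⟩ x) ?_
    have hdr : ∀ y, D' r y = ENNReal.ofReal |D r y| := fun y => if_pos hr0
    rw [← Real.enorm_eq_ofReal_abs, ← Real.enorm_eq_ofReal_abs]
    have key1 : ‖gain K (m r) (D r) x‖ₑ ≤ ∫⁻ y, D' r (x + y) * ENNReal.ofReal (K x y)
        ∂(m r : Measure Mass) := by
      refine (enorm_integral_le_lintegral_enorm _).trans (lintegral_mono fun y => ?_)
      rw [Real.enorm_eq_ofReal_abs, abs_mul, abs_of_nonneg (hP.nonneg x y),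
        ENNReal.ofReal_mul (abs_nonneg _), hdr]
    have key2 : ‖pert K (m r) (D r) x‖ₑ ≤ ∫⁻ y, D' r y * ENNReal.ofReal (K x y)
        ∂(m r : Measure Mass) := by
      refine (enorm_integral_le_lintegral_enorm _).trans (lintegral_mono fun y => ?_)
      rw [Real.enorm_eq_ofReal_abs, abs_mul, abs_of_nonneg (hP.nonneg x y),
        ENNReal.ofReal_mul (abs_nonneg _), hdr]
    refine (add_le_add key1 key2).trans ((le_lintegral_add _ _).trans (le_of_eq ?_))
    simp only [← add_mul]
    simp only [hD', if_pos hr0]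
  have hD2 : ∀ s x, D' s x ≤ β * baseSource K m T W s x := by
    intro s x
    simp only [hD']
    split_ifs with hs
    swap
    · exact zero_le
    refine (hineq s hs x).trans (le_trans ?_ (fullSource_le (a := fun x => ENNReal.ofReal |a x|)
      (H := fun r x => β * ENNReal.ofReal (W x)) hβ haW (fun _ _ => le_rfl) s x))
    rw [fullSource]
    refine add_le_add (hterm s hs x) ?_
    rw [posSource]
    refine (lintegral_mono_ae ((ae_restrict_iff' measurableSet_Ioc).2 (ae_of_all _ fun r hr => ?_))).trans
      (lintegral_mono_set (Ioc_subset_Ioc_right htT))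
    refine mul_le_mul_right ((add_le_add (add_le_add ?_ ?_)
      (hH r ⟨hs.1.trans_lt hr.1, hr.2⟩ x)).trans (hwW r x)) _
    · exact ENNReal.ofReal_le_ofReal
        (hw.abs_gain_le hP hC (hb r ⟨hs.1.trans hr.1.le, hr.2⟩) r x)
    · exact ENNReal.ofReal_le_ofReal
        (hw.abs_pert_le hP hC (hb r ⟨hs.1.trans hr.1.le, hr.2⟩) r x)
  have := hP.le_potential (hP.measurable_fullSource T ham.abs.ennreal_ofReal hHm) hD1 hD2
    (s := s) (x := x) (ne_top_of_le_ne_top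
      (ENNReal.mul_ne_top hβ (Lyap.superSol_ne_top W c' T s x))
      (hW.potential_le_superSol hP hβ (fun _ _ => le_rfl) s x))
  simpa only [hD', if_pos hs] using this

namespace Lyap

/-! ### Linearity and continuity of the propagator -/

lemma propagatorTerm_add (hw : Lyap K m w c) (hP : CoagPath K m) {C' : ℝ} (hC : 0 ≤ C) (hC' : 0 ≤ C')
    (hf : Dom w C f) (hg : Dom w C' g) {t : ℝ} (n : ℕ) : ∀ {s : ℝ}, s ≤ t → ∀ x,
    propagatorTerm K m n s t (fun x => f x + g x) x =
      propagatorTerm K m n s t f x + propagatorTerm K m n s t g x := by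
  have hc := hw.const_nonneg
  induction n with
  | zero => exact fun hst x => hw.transport_add hP hC hC' hf hg hst x
  | succ n ih =>
    intro s hst x
    have h0 : 0 ≤ t - s := by linarith
    have hI : ∀ {C} {f : Mass → ℝ}, 0 ≤ C → Dom w C f → IntervalIntegrable
        (fun r => transport K m s r (pert K (m r) (propagatorTerm K m n r t f)) x) volume s t := by
      intro C f hC hf
      refine intervalIntegrable_of_bound (hP.measurable_transport_end (h := fun r => pert K (m r)
        (propagatorTerm K m n r t f)) (hP.measurable_pert_joint
          (h := fun r => propagatorTerm K m n r t f)
          (hP.measurable_propagatorTerm hf.1 t n)) s x) hst fun r hr =>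
        hw.transport_pert_bound hP ?_ hr (hw.dom_propagatorTerm hP hC hf hr.1.le hr.2 n) x
      positivity
    simp only [propagatorTerm]
    rw [← neg_add, ← intervalIntegral.integral_add (hI hC hf) (hI hC' hg)]
    congr 1
    refine intervalIntegral.integral_congr_ae (ae_of_all _ fun r hr => ?_)
    rw [uIoc_of_le hst] at hr
    have hd1 := hw.dom_propagatorTerm hP hC hf hr.1.le hr.2 n
    have hd2 := hw.dom_propagatorTerm hP hC' hg hr.1.le hr.2 n
    rw [← hw.transport_add hP (by positivity) (by positivity)
      (hw.dom_pert hP (by positivity) hd1 r) (hw.dom_pert hP (by positivity) hd2 r) hr.1.le x]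
    congr 1
    ext z
    rw [← hw.pert_add hP hd1 hd2]
    congr 1
    ext z'
    exact ih hr.2 z'

lemma propagator_add (hw : Lyap K m w c) (hP : CoagPath K m) {C' : ℝ} (hC : 0 ≤ C) (hC' : 0 ≤ C')
    (hf : Dom w C f) (hg : Dom w C' g) {s t : ℝ} (hst : s ≤ t) (x : Mass) :
    propagator K m s t (fun x => f x + g x) x = propagator K m s t f x + propagator K m s t g x := by
  simp only [propagator]
  rw [← (hw.summable_propagatorTerm hP hC hf hst x).tsum_add
    (hw.summable_propagatorTerm hP hC' hg hst x)]
  exact tsum_congr fun n => hw.propagatorTerm_add hP hC hC' hf hg n hst x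

end Lyap

lemma transportTerm_const_mul (a : ℝ) (f : Mass → ℝ) (t : ℝ) (n : ℕ) (s : ℝ) (x : Mass) :
    transportTerm K m n s t (fun x => a * f x) x = a * transportTerm K m n s t f x := by
  induction n generalizing s x with
  | zero => simp only [transportTerm]; ring
  | succ n ih =>
    simp only [transportTerm]
    rw [← intervalIntegral.integral_const_mul]
    refine intervalIntegral.integral_congr fun r _ => ?_
    have : transportTerm K m n r t (fun x => a * f x) = fun x => a * transportTerm K m n r t f x := by
      ext z; exact ih r z
    simp only [this, gain, mul_assoc]
    rw [integral_const_mul]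
    ring

lemma transport_const_mul (a : ℝ) (f : Mass → ℝ) (s t : ℝ) (x : Mass) :
    transport K m s t (fun x => a * f x) x = a * transport K m s t f x := by
  simp only [transport, transportTerm_const_mul, tsum_mul_left]

lemma propagatorTerm_const_mul (a : ℝ) (f : Mass → ℝ) (t : ℝ) (n : ℕ) (s : ℝ) (x : Mass) :
    propagatorTerm K m n s t (fun x => a * f x) x = a * propagatorTerm K m n s t f x := by
  induction n generalizing s x with
  | zero => exact transport_const_mul a f s t x
  | succ n ih =>
    simp only [propagatorTerm]
    rw [mul_neg, ← intervalIntegral.integral_const_mul]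
    congr 1
    refine intervalIntegral.integral_congr fun r _ => ?_
    have : propagatorTerm K m n r t (fun x => a * f x) =
        fun x => a * propagatorTerm K m n r t f x := by
      ext z; exact ih r z
    rw [← transport_const_mul, this]
    congr 1
    ext z
    simp only [pert, mul_assoc]
    rw [integral_const_mul]

lemma propagator_const_mul (a : ℝ) (f : Mass → ℝ) (s t : ℝ) (x : Mass) :
    propagator K m s t (fun x => a * f x) x = a * propagator K m s t f x := by
  simp only [propagator, propagatorTerm_const_mul, tsum_mul_left]

/-- `W` controls the weight `w` times the rate. -/
def Controls (K : Kern) (m : ℝ → FiniteMeasure Mass) (w W : Mass → ℝ) (A : ℝ) : Prop :=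
  0 ≤ A ∧ ∀ r x, (rate K (m r) x + 1) * w x ≤ A * W x

namespace Lyap

lemma controls_bound (hw : Lyap K m w c) (hP : CoagPath K m) {A : ℝ}
    (hA : Controls K m w W A) (hC : 0 ≤ C) (r : ℝ) (x : Mass) :
    ENNReal.ofReal (C * ((rate K (m r) x + c) * w x)) + ENNReal.ofReal (C * (c * w x)) ≤
      ENNReal.ofReal (C * ((1 + 2 * c) * A)) * ENNReal.ofReal (W x) := by
  have hwx := hw.nonneg x
  have hc := hw.const_nonneg
  have hr := hP.rate_nonneg r x
  have hA0 := hA.1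
  rw [← ENNReal.ofReal_add (by positivity) (by positivity), ← ENNReal.ofReal_mul (by positivity)]
  refine ENNReal.ofReal_le_ofReal ?_
  rw [← mul_add, mul_assoc, mul_assoc]
  refine mul_le_mul_of_nonneg_left ?_ hC
  have h1 : (1 + 2 * c) * ((rate K (m r) x + 1) * w x) ≤ (1 + 2 * c) * (A * W x) :=
    mul_le_mul_of_nonneg_left (hA.2 r x) (by positivity)
  have h2 : 0 ≤ c * (rate K (m r) x * w x) := by positivity
  nlinarith

lemma le_of_controls (hw : Lyap K m w c) (hP : CoagPath K m) {A : ℝ}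
    (hA : Controls K m w W A) (x : Mass) : w x ≤ A * W x := by
  have := hA.2 0 x
  have := mul_nonneg (hP.rate_nonneg 0 x) (hw.nonneg x)
  linarith

lemma mul_le_of_controls (hw : Lyap K m w c) (hP : CoagPath K m) {A : ℝ}
    (hA : Controls K m w W A) (hC : 0 ≤ C) {y : ℝ} {x : Mass} (hy : y ≤ C * w x) :
    ENNReal.ofReal y ≤ ENNReal.ofReal (C * ((1 + 2 * c) * A)) * ENNReal.ofReal (W x) := by
  have hc := hw.const_nonneg
  have hA0 := hA.1
  have h1 := hw.le_of_controls hP hA x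
  have hwx := hw.nonneg x
  rw [← ENNReal.ofReal_mul (by positivity)]
  refine ENNReal.ofReal_le_ofReal (hy.trans ?_)
  rw [mul_assoc, mul_assoc]
  refine mul_le_mul_of_nonneg_left ?_ hC
  nlinarith [mul_nonneg hc (hwx.trans h1)]

/-- The propagator is continuous under dominated convergence. -/
lemma tendsto_propagator_zero (hw : Lyap K m w c) (hW : Lyap K m W c') (hP : CoagPath K m) {A : ℝ}
    (hA : Controls K m w W A) (hC : 0 ≤ C) {F : ℕ → Mass → ℝ} (hF : ∀ n, Dom w C (F n))
    (hlim : ∀ x, Tendsto (fun n => F n x) atTop (𝓝 0)) {s t : ℝ} (hs : s ∈ Icc 0 t) (x : Mass) :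
    Tendsto (fun n => propagator K m s t (F n) x) atTop (𝓝 0) := by
  have hc := hw.const_nonneg
  have ht : 0 ≤ t := hs.1.trans hs.2
  set C₁ : ℝ := C * Real.exp (2 * c * (t - 0)) with hC₁
  have hC₁0 : 0 ≤ C₁ := by positivity
  have hCC₁ : C ≤ C₁ := le_mul_of_one_le_right hC (Real.one_le_exp (by positivity))
  set β : ℝ≥0∞ := ENNReal.ofReal (C₁ * ((1 + 2 * c) * A)) with hβ
  have hsrc : ∀ n x, ENNReal.ofReal |F n x| ≤ β * ENNReal.ofReal (W x) := fun n x =>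
    hw.mul_le_of_controls hP hA hC₁0 (((hF n).mono hw.nonneg hCC₁).2 x)
  have key : ∀ n, ENNReal.ofReal |propagator K m s t (F n) x| ≤ potential K m t
      (fullSource K m t (fun x => ENNReal.ofReal |F n x|) (fun _ _ => 0)) s x := by
    intro n
    refine hw.ofReal_abs_le_potential hW hP hC₁0 le_rfl (h := fun _ _ => 0)
      (D := fun r => propagator K m r t (F n))
      (fun r hr x => (hw.dom_propagator_uniform hP hC (hF n) hr.1 hr.2).2 x)
      (hF n).1 (Or.inl rfl) measurable_const (by simp) (fun s hs x => ?_)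
      ENNReal.ofReal_ne_top (hsrc n) (fun r x => ?_) hs x
    · simpa using hw.propagator_mild hP hC (hF n) hs.2 x
    · simpa using hw.controls_bound hP hA hC₁0 r x
  have h0 := hW.tendsto_potential hP (T := t)
    (G := fun n => fullSource K m t (fun x => ENNReal.ofReal |F n x|) (fun _ _ => 0))
    (fun n => hP.measurable_fullSource t (hF n).1.abs.ennreal_ofReal measurable_const)
    (β := β) ENNReal.ofReal_ne_top
    (fun n => fullSource_le ENNReal.ofReal_ne_top (hsrc n) (fun _ _ => zero_le))
    (fun s x => hP.tendsto_fullSource (fun x => ?_) (fun _ => measurable_const) (B := fun _ => 0)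
      (by simp) (by simp) (by simp) s x) s x
  · have h1 := tendsto_of_tendsto_of_tendsto_of_le_of_le tendsto_const_nhds h0
      (fun n => zero_le) key
    rw [tendsto_zero_iff_abs_tendsto_zero]
    have := (ENNReal.tendsto_toReal ENNReal.zero_ne_top).comp h1
    simpa [Function.comp_def, ENNReal.toReal_ofReal] using this
  · have := (hlim x).abs
    simpa using ENNReal.tendsto_ofReal this

lemma tendsto_propagator (hw : Lyap K m w c) (hW : Lyap K m W c') (hP : CoagPath K m) {A : ℝ}
    (hA : Controls K m w W A) (hC : 0 ≤ C) {F : ℕ → Mass → ℝ} (hF : ∀ n, Dom w C (F n))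
    (hlim : ∀ x, Tendsto (fun n => F n x) atTop (𝓝 (f x))) {s t : ℝ} (hs : s ∈ Icc 0 t) (x : Mass) :
    Tendsto (fun n => propagator K m s t (F n) x) atTop (𝓝 (propagator K m s t f x)) := by
  have hf : Dom w C f := ⟨measurable_of_tendsto_metrizable (fun n => (hF n).1)
    (tendsto_pi_nhds.2 hlim), fun x => le_of_tendsto (hlim x).abs
      (Eventually.of_forall fun n => (hF n).2 x)⟩
  have h1 := hw.tendsto_propagator_zero hW hP hA (add_nonneg hC hC) (fun n => (hF n).sub hf)
    (fun x => by simpa using (hlim x).sub_const (f x)) hs x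
  have h2 : ∀ n, propagator K m s t (F n) x = propagator K m s t (fun x => F n x - f x) x +
      propagator K m s t f x := by
    intro n
    rw [← hw.propagator_add hP (add_nonneg hC hC) hC ((hF n).sub hf) hf hs.2]
    simp
  simp only [h2]
  simpa using h1.add_const (propagator K m s t f x)

lemma Lam_sub (hw : Lyap K m w c) (hP : CoagPath K m) {C' : ℝ} (hf : Dom w C f) (hg : Dom w C' g)
    (r : ℝ) (x : Mass) : Lam K (m r) (fun x => f x - g x) x = Lam K (m r) f x - Lam K (m r) g x := by
  rw [hw.Lam_eq hP (hf.sub hg), hw.Lam_eq hP hf, hw.Lam_eq hP hg, hw.gain_sub hP hf hg,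
    hw.pert_sub hP hf hg]
  ring

/-- The difference of two propagators is controlled by the difference of their generators. -/
lemma propagator_difference (hw : Lyap K m w c) (hW : Lyap K m W c') (hP : CoagPath K m)
    {A : ℝ} (hA : Controls K m w W A) {c₁ : ℝ} (hw' : Lyap K' m' w c₁) (hP' : CoagPath K' m')
    (hC : 0 ≤ C) (hf : Dom w C f) {t T : ℝ} (ht : t ≤ T)
    {H : ℝ → Mass → ℝ≥0∞} (hHm : Measurable fun q : ℝ × Mass => H q.1 q.2)
    (hH : ∀ r ∈ Ioc 0 t, ∀ x, ENNReal.ofReal |Lam K' (m' r) (propagator K' m' r t f) x -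
      Lam K (m r) (propagator K' m' r t f) x| ≤ H r x)
    {β : ℝ≥0∞} (hβ : β ≠ ∞) (hHW : ∀ r x, H r x ≤ β * ENNReal.ofReal (W x))
    {s : ℝ} (hs : s ∈ Icc 0 t) (x : Mass) :
    ENNReal.ofReal |propagator K' m' s t f x - propagator K m s t f x| ≤
      potential K m T (fullSource K m T (fun _ => 0) H) s x := by
  have hc := hw.const_nonneg
  have hc₁ := hw'.const_nonneg
  have ht0 : 0 ≤ t := hs.1.trans hs.2
  set C₁ : ℝ := C * Real.exp (2 * c₁ * (t - 0)) + C * Real.exp (2 * c * (t - 0)) with hC₁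
  have hC₁0 : 0 ≤ C₁ := by positivity
  have hd1 : ∀ r ∈ Icc 0 t, Dom w (C * Real.exp (2 * c₁ * (t - 0))) (propagator K' m' r t f) :=
    fun r hr => hw'.dom_propagator_uniform hP' hC hf hr.1 hr.2
  have hd2 : ∀ r ∈ Icc 0 t, Dom w (C * Real.exp (2 * c * (t - 0))) (propagator K m r t f) :=
    fun r hr => hw.dom_propagator_uniform hP hC hf hr.1 hr.2
  have hmU' := hP'.measurable_propagator hf.1 t
  have hmU := hP.measurable_propagator hf.1 t
  set D : ℝ → Mass → ℝ := fun r x => propagator K' m' r t f x - propagator K m r t f x with hD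
  have hDm : Measurable fun q : ℝ × Mass => D q.1 q.2 := hmU'.sub hmU
  have hDd : ∀ r ∈ Icc 0 t, Dom w C₁ (D r) := fun r hr => (hd1 r hr).sub (hd2 r hr)
  set h : ℝ → Mass → ℝ := fun r x => Lam K' (m' r) (propagator K' m' r t f) x -
      Lam K (m r) (propagator K' m' r t f) x with hh
  have hLam : ∀ {K : Kern} {m : ℝ → FiniteMeasure Mass}, CoagPath K m → ∀ {g : ℝ → Mass → ℝ},
      (Measurable fun q : ℝ × Mass => g q.1 q.2) → ∀ x,
      Measurable fun r => Lam K (m r) (g r) x := by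
    intro K m hP g hg x
    refine hP.measurable_integral (α := ℝ) (F := fun r y => bracket (g r) x y * K x y) ?_
      measurable_id
    have h1 : Measurable fun p : ℝ × Mass => (p.1, x + p.2) := by fun_prop
    have h2 : Measurable fun p : ℝ × Mass => (p.1, x) := by fun_prop
    have h3 : Measurable fun p : ℝ × Mass => (x, p.2) := by fun_prop
    exact (((hg.comp h1).sub (hg.comp h2)).sub hg).mul (hP.measurable_kern.comp h3)
  have hhm : ∀ x, Measurable fun r => h r x := fun x => (hLam hP' hmU' x).sub (hLam hP hmU' x)
  have hhb : ∀ r ∈ Ioc 0 t, ∀ x, |h r x| ≤ (β * ENNReal.ofReal (W x)).toReal := by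
    intro r hr x
    have := (hH r hr x).trans (hHW r x)
    rwa [← ENNReal.ofReal_le_iff_le_toReal (ENNReal.mul_ne_top hβ ENNReal.ofReal_ne_top)]
  have hLb : ∀ {K : Kern} {m : ℝ → FiniteMeasure Mass} {c C : ℝ} {g : ℝ → Mass → ℝ},
      CoagPath K m → Lyap K m w c → (0 ≤ C) → (Measurable fun q : ℝ × Mass => g q.1 q.2) →
      (∀ r ∈ Icc 0 t, Dom w C (g r)) → ∀ s ∈ Icc 0 t, ∀ x,
      IntervalIntegrable (fun r => Lam K (m r) (g r) x) volume s t := by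
    intro K m c C g hP hw hC hgm hg s hs x
    obtain ⟨B, hB⟩ := hw.exists_source_bound hP (h := g) (s := s) (t := t) hC
      (fun r hr => (hg r ⟨hs.1.trans hr.1.le, hr.2⟩).2) x
    obtain ⟨B', hB'⟩ := (isCompact_Icc (a := s) (b := t)).exists_bound_of_continuousOn
      (f := fun r => rate K (m r) x) (hP.continuous_rate x).continuousOn
    refine intervalIntegrable_of_bound (hLam hP hgm x) hs.2 (b := B + B' * (C * w x)) fun r hr => ?_
    have hr' : r ∈ Icc 0 t := ⟨hs.1.trans hr.1.le, hr.2⟩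
    rw [hw.Lam_eq hP (hg r hr')]
    refine (abs_sub _ _).trans (add_le_add (hB r hr) ?_)
    rw [abs_mul]
    exact mul_le_mul (hB' r ⟨hr.1.le, hr.2⟩) ((hg r hr').2 x) (abs_nonneg _)
      ((norm_nonneg _).trans (hB' r ⟨hr.1.le, hr.2⟩))
  have heq : ∀ s ∈ Icc 0 t, ∀ x, D s x = 0 + ∫ q in s..t, (Lam K (m q) (D q) x + h q x) := by
    intro s hs x
    have i1 := hLb hP' hw' (by positivity) hmU' hd1 s hs x
    have i2 := hLb hP hw (by positivity) hmU hd2 s hs x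
    simp only [hD]
    rw [hw'.propagator_integrated hP' hC hf hs.2 x, hw.propagator_integrated hP hC hf hs.2 x,
      add_sub_add_left_eq_sub, zero_add, ← intervalIntegral.integral_sub i1 i2]
    refine intervalIntegral.integral_congr_ae (ae_of_all _ fun r hr => ?_)
    rw [uIoc_of_le hs.2] at hr
    have hr' : r ∈ Icc 0 t := ⟨hs.1.trans hr.1.le, hr.2⟩
    rw [hw.Lam_sub hP (hd1 r hr') (hd2 r hr')]
    simp only [hh]
    ring
  have main := hw.ofReal_abs_le_potential hW hP hC₁0 ht (D := D) (h := h)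
    (fun r hr => (hDd r hr).2) (a := fun _ => 0) measurable_const (Or.inr fun _ => rfl) hHm hH
    (fun s hs x => ?_) (β := ENNReal.ofReal (C₁ * ((1 + 2 * c) * A)) + β)
    (ENNReal.add_ne_top.2 ⟨ENNReal.ofReal_ne_top, hβ⟩) (by simp) (fun r x => ?_) hs x
  · simpa using main
  · refine hw.mild_of_integrated_source hP hC₁0 hDm hs.2
      (fun r hr => (hDd r ⟨hs.1.trans hr.1.le, hr.2⟩).2) (hhm x)
      (B := (β * ENNReal.ofReal (W x)).toReal)
      (fun r hr => hhb r ⟨hs.1.trans_lt hr.1, hr.2⟩ x)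
      (fun r hr => heq r ⟨hs.1.trans hr.1, hr.2⟩ x)
  · rw [add_mul _ β]
    exact add_le_add (hw.controls_bound hP hA hC₁0 r x) (hHW r x)

end Lyap

end

/-! ### Weights and moments -/

/-- A bound for the moment `(φ ^ q, α)`. -/
def Moment (φ : Mass → ℝ) (q : ℝ) (B : ℝ≥0) (α : Measure Mass) : Prop :=
  ∫⁻ x, ENNReal.ofReal (φ x ^ q) ∂α ≤ B

/-- The power `φ ^ p` of a weight. -/
def wpow (φ : Mass → ℝ) (p : ℝ) (x : Mass) : ℝ := φ x ^ p

section

variable {φ : Mass → ℝ} {p q C D : ℝ} {A B : ℝ≥0} {α β : Measure Mass} {f g : Mass → ℝ}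
  {K G : Kern}

namespace IsWeight

lemma pos (hφ : IsWeight φ) (x : Mass) : 0 < φ x := one_pos.trans_le (hφ.one_le x)

lemma measurable_wpow (hφ : IsWeight φ) (p : ℝ) : Measurable (wpow φ p) :=
  hφ.measurable.pow_const p

lemma wpow_nonneg (hφ : IsWeight φ) (p : ℝ) (x : Mass) : 0 ≤ wpow φ p x :=
  Real.rpow_nonneg (hφ.pos x).le p

lemma one_le_wpow (hφ : IsWeight φ) (hp : 0 ≤ p) (x : Mass) : 1 ≤ wpow φ p x :=
  Real.one_le_rpow (hφ.one_le x) hp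

lemma wpow_mono (hφ : IsWeight φ) (h : p ≤ q) (x : Mass) : wpow φ p x ≤ wpow φ q x :=
  Real.rpow_le_rpow_of_exponent_le (hφ.one_le x) h

lemma wpow_add (hφ : IsWeight φ) (p q : ℝ) (x : Mass) : wpow φ (p + q) x = wpow φ p x * wpow φ q x :=
  Real.rpow_add (hφ.pos x) p q

lemma wpow_add_one (hφ : IsWeight φ) (p : ℝ) (x : Mass) : wpow φ (p + 1) x = wpow φ p x * φ x := by
  rw [hφ.wpow_add, wpow, wpow, Real.rpow_one]

lemma wpow_one (φ : Mass → ℝ) (x : Mass) : wpow φ 1 x = φ x := Real.rpow_one _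

lemma add_le_two_mul (hφ : IsWeight φ) (x y : Mass) : φ x + φ y ≤ 2 * φ x * φ y := by
  nlinarith [hφ.one_le x, hφ.one_le y, mul_nonneg (sub_nonneg.2 (hφ.one_le x))
    (sub_nonneg.2 (hφ.one_le y))]

lemma wpow_apply_add_le (hφ : IsWeight φ) (hp : 0 ≤ p) (x y : Mass) :
    wpow φ p (x + y) ≤ 2 ^ p * (wpow φ p x * wpow φ p y) := by
  have h1 := hφ.pos x
  have h2 := hφ.pos y
  calc wpow φ p (x + y) ≤ (2 * φ x * φ y) ^ p :=
        Real.rpow_le_rpow (hφ.pos _).le ((hφ.subadd x y).trans (hφ.add_le_two_mul x y)) hp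
    _ = _ := by
        rw [Real.mul_rpow (by positivity) h2.le, Real.mul_rpow (by positivity) h1.le, wpow, wpow,
          mul_assoc]

/-- The increment of `φ ^ p` when a particle is added. -/
lemma wpow_increment (hφ : IsWeight φ) (hp : 1 ≤ p) (x y : Mass) :
    wpow φ p (x + y) * (φ x * φ y) ≤ wpow φ p x * (φ x * φ y) +
      p * 2 ^ (p - 1) * (wpow φ p x * wpow φ (p + 1) y) := by
  set a := φ x
  set b := φ y
  have ha : 1 ≤ a := hφ.one_le x
  have hb : 1 ≤ b := hφ.one_le y
  have hab : 0 < a + b := by linarith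
  have h1 : (a + b) ^ p ≤ a ^ p + p * b * (a + b) ^ (p - 1) := by
    have := one_add_mul_self_le_rpow_one_add (s := -(b / (a + b))) (by
      rw [neg_le_neg_iff, div_le_one hab]; linarith) hp
    have h2 : 1 + -(b / (a + b)) = a / (a + b) := by field_simp; ring
    rw [h2, Real.div_rpow (by linarith) hab.le, le_div_iff₀ (Real.rpow_pos_of_pos hab p)] at this
    have h3 : (a + b) ^ p = (a + b) ^ (p - 1) * (a + b) := by
      rw [← Real.rpow_add_one hab.ne']; congr 1; ring
    have h4 : (1 + p * -(b / (a + b))) * (a + b) ^ p = (a + b) ^ p - p * b * (a + b) ^ (p - 1) := by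
      rw [h3]; field_simp; ring
    linarith
  have h5 : (a + b) ^ (p - 1) ≤ 2 ^ (p - 1) * (a ^ (p - 1) * b ^ (p - 1)) := by
    calc (a + b) ^ (p - 1) ≤ (2 * a * b) ^ (p - 1) :=
          Real.rpow_le_rpow hab.le (hφ.add_le_two_mul x y) (by linarith)
      _ = _ := by
          rw [Real.mul_rpow (by positivity) (by linarith), Real.mul_rpow (by positivity) (by linarith),
            mul_assoc]
  have h6 : wpow φ p (x + y) ≤ a ^ p + p * b * (2 ^ (p - 1) * (a ^ (p - 1) * b ^ (p - 1))) :=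
    (Real.rpow_le_rpow (hφ.pos _).le (hφ.subadd x y) (by linarith)).trans
      (h1.trans (by gcongr))
  have h7 : a ^ p = a ^ (p - 1) * a := by
    rw [← Real.rpow_add_one (by linarith : a ≠ 0)]; congr 1; ring
  have h8 : b ^ (p + 1) = b ^ (p - 1) * (b * b) := by
    rw [← mul_assoc, ← Real.rpow_add_one (by linarith : b ≠ 0),
      ← Real.rpow_add_one (by linarith : b ≠ 0)]; congr 1; ring
  calc wpow φ p (x + y) * (a * b)
      ≤ (a ^ p + p * b * (2 ^ (p - 1) * (a ^ (p - 1) * b ^ (p - 1)))) * (a * b) := by gcongr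
    _ = _ := by
        simp only [wpow]
        change _ = a ^ p * (a * b) + p * 2 ^ (p - 1) * (a ^ p * b ^ (p + 1))
        rw [h8, h7]; ring

end IsWeight

namespace Moment

lemma mono (hφ : IsWeight φ) (h : Moment φ q B α) (hpq : p ≤ q) : Moment φ p B α :=
  (lintegral_mono fun x => ENNReal.ofReal_le_ofReal (hφ.wpow_mono hpq x)).trans h

lemma mono_const (h : Moment φ q B α) (hAB : B ≤ A) : Moment φ q A α :=
  h.trans (by exact_mod_cast hAB)

lemma integrable (hφ : IsWeight φ) (h : Moment φ q B α) : Integrable (wpow φ q) α := by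
  refine ⟨(hφ.measurable_wpow q).aestronglyMeasurable, ?_⟩
  rw [hasFiniteIntegral_iff_ofReal (ae_of_all _ (hφ.wpow_nonneg q))]
  exact lt_of_le_of_lt h ENNReal.coe_lt_top

lemma integral_le (hφ : IsWeight φ) (h : Moment φ q B α) : ∫ x, wpow φ q x ∂α ≤ B := by
  rw [integral_eq_lintegral_of_nonneg_ae (ae_of_all _ (hφ.wpow_nonneg q))
    (hφ.measurable_wpow q).aestronglyMeasurable]
  exact ENNReal.toReal_le_coe_of_le_coe h

lemma of_integral_le (hφ : IsWeight φ) (hi : Integrable (wpow φ q) α)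
    (h : ∫ x, wpow φ q x ∂α ≤ B) : Moment φ q B α := by
  rw [Moment, ← ENNReal.ofReal_coe_nnreal]
  change ∫⁻ x, ENNReal.ofReal (wpow φ q x) ∂α ≤ _
  rw [← ofReal_integral_eq_lintegral_ofReal hi (ae_of_all _ (hφ.wpow_nonneg q))]
  exact ENNReal.ofReal_le_ofReal h

lemma measure_univ_le (hφ : IsWeight φ) (hq : 0 ≤ q) (h : Moment φ q B α) : α univ ≤ B := by
  refine le_trans ?_ h
  rw [← lintegral_one]
  refine lintegral_mono fun x => ?_
  rw [← ENNReal.ofReal_one]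
  exact ENNReal.ofReal_le_ofReal (hφ.one_le_wpow hq x)

end Moment

lemma Dom.integrable (hφ : IsWeight φ) (hf : Dom (wpow φ p) C f) (h : Moment φ p B α) :
    Integrable f α :=
  ((h.integrable hφ).const_mul C).mono' hf.1.aestronglyMeasurable (ae_of_all _ hf.2)

lemma Dom.abs_integral_le (hφ : IsWeight φ) (hC : 0 ≤ C) (hf : Dom (wpow φ p) C f)
    (h : Moment φ p B α) : |∫ x, f x ∂α| ≤ C * B := by
  have h1 := norm_integral_le_of_norm_le (f := f) ((h.integrable hφ).const_mul C)
    (ae_of_all _ hf.2)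
  rw [integral_const_mul, Real.norm_eq_abs] at h1
  exact h1.trans (mul_le_mul_of_nonneg_left (h.integral_le hφ) hC)

/-! ### Brackets -/

/-- The constant in `|{f}(x, y)| ≤ C (2 ^ p + 2) φ(x) ^ p φ(y) ^ p`. -/
def bconst (p : ℝ) : ℝ := 2 ^ p + 2

lemma bconst_pos (p : ℝ) : 0 < bconst p := by unfold bconst; positivity

/-- A measurable kernel with `|G(x, y)| ≤ D φ(x) φ(y)`. -/
structure KernDom (φ : Mass → ℝ) (D : ℝ) (G : Kern) : Prop where
  measurable : Measurable fun p : Mass × Mass => G p.1 p.2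
  abs_le : ∀ x y, |G x y| ≤ D * (φ x * φ y)

lemma measurable_bracket (hf : Measurable f) :
    Measurable fun z : Mass × Mass => bracket f z.1 z.2 := by
  unfold bracket
  exact ((hf.comp (by fun_prop : Measurable fun z : Mass × Mass => z.1 + z.2)).sub
    (hf.comp measurable_fst)).sub (hf.comp measurable_snd)

lemma abs_bracket_le (hφ : IsWeight φ) (hp : 0 ≤ p) (hC : 0 ≤ C)
    (hf : ∀ x, |f x| ≤ C * wpow φ p x) (x y : Mass) :
    |bracket f x y| ≤ C * bconst p * (wpow φ p x * wpow φ p y) := by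
  have h1 : |bracket f x y| ≤ |f (x + y)| + |f x| + |f y| := by
    unfold bracket
    exact (abs_sub _ _).trans (add_le_add (abs_sub _ _) le_rfl)
  have h2 := (hf (x + y)).trans (mul_le_mul_of_nonneg_left (hφ.wpow_apply_add_le hp x y) hC)
  have hx := hφ.one_le_wpow hp x
  have hy := hφ.one_le_wpow hp y
  have h3 : C * wpow φ p x ≤ C * (wpow φ p x * wpow φ p y) :=
    mul_le_mul_of_nonneg_left (le_mul_of_one_le_right (by linarith) hy) hC
  have h4 : C * wpow φ p y ≤ C * (wpow φ p x * wpow φ p y) :=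
    mul_le_mul_of_nonneg_left (le_mul_of_one_le_left (by linarith) hx) hC
  have h5 := hf x
  have h6 := hf y
  unfold bconst
  linarith

lemma abs_bracket_mul_le (hφ : IsWeight φ) (hp : 0 ≤ p) (hC : 0 ≤ C)
    (hf : ∀ x, |f x| ≤ C * wpow φ p x) (hG : ∀ x y, |G x y| ≤ D * (φ x * φ y)) (x y : Mass) :
    |bracket f x y * G x y| ≤ C * bconst p * D * (wpow φ (p + 1) x * wpow φ (p + 1) y) := by
  have hb := bconst_pos p
  rw [abs_mul, hφ.wpow_add_one, hφ.wpow_add_one]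
  have hx := hφ.wpow_nonneg p x
  have hy := hφ.wpow_nonneg p y
  calc |bracket f x y| * |G x y| ≤ (C * bconst p * (wpow φ p x * wpow φ p y)) * (D * (φ x * φ y)) :=
        mul_le_mul (abs_bracket_le hφ hp hC hf x y) (hG x y) (abs_nonneg _) (by positivity)
    _ = _ := by ring

lemma integrable_wpow_prod [SFinite α] [SFinite β] (hφ : IsWeight φ) (hα : Moment φ p A α)
    (hβ : Moment φ p B β) :
    Integrable (fun z : Mass × Mass => wpow φ p z.1 * wpow φ p z.2) (α.prod β) :=
  (hα.integrable hφ).mul_prod (hβ.integrable hφ)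

lemma integral_wpow_prod_le [SFinite α] [SFinite β] (hφ : IsWeight φ) (hα : Moment φ p A α)
    (hβ : Moment φ p B β) :
    ∫ z : Mass × Mass, wpow φ p z.1 * wpow φ p z.2 ∂(α.prod β) ≤ A * B := by
  rw [integral_prod_mul]
  exact mul_le_mul (hα.integral_le hφ) (hβ.integral_le hφ)
    (integral_nonneg (hφ.wpow_nonneg p)) A.2

lemma integrable_bracket [SFinite α] [SFinite β] (hφ : IsWeight φ) (hp : 0 ≤ p) (hC : 0 ≤ C)
    (hf : Dom (wpow φ p) C f) (hG : KernDom φ D G) (hα : Moment φ (p + 1) A α)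
    (hβ : Moment φ (p + 1) B β) :
    Integrable (fun z : Mass × Mass => bracket f z.1 z.2 * G z.1 z.2) (α.prod β) :=
  ((integrable_wpow_prod hφ hα hβ).const_mul (C * bconst p * D)).mono'
    ((measurable_bracket hf.1).mul hG.measurable).aestronglyMeasurable
    (ae_of_all _ fun z => abs_bracket_mul_le hφ hp hC hf.2 hG.abs_le z.1 z.2)

lemma abs_integral_bracket_le [SFinite α] [SFinite β] (hφ : IsWeight φ) (hp : 0 ≤ p) (hC : 0 ≤ C)
    (hD : 0 ≤ D) (hf : Dom (wpow φ p) C f) (hG : KernDom φ D G) (hα : Moment φ (p + 1) A α)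
    (hβ : Moment φ (p + 1) B β) :
    |∫ z : Mass × Mass, bracket f z.1 z.2 * G z.1 z.2 ∂(α.prod β)| ≤
      C * bconst p * D * (A * B) := by
  have hb := bconst_pos p
  have h1 := norm_integral_le_of_norm_le
    (f := fun z : Mass × Mass => bracket f z.1 z.2 * G z.1 z.2)
    ((integrable_wpow_prod hφ hα hβ).const_mul (C * bconst p * D))
    (ae_of_all _ fun z : Mass × Mass => abs_bracket_mul_le hφ hp hC hf.2 hG.abs_le z.1 z.2)
  rw [integral_const_mul, Real.norm_eq_abs] at h1
  exact h1.trans (mul_le_mul_of_nonneg_left (integral_wpow_prod_le hφ hα hβ) (by positivity))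

end

/-! ### Lyapunov weights from moments -/

section

variable {φ : Mass → ℝ} {p : ℝ} {B : ℝ≥0} {K : Kern} {m : ℝ → FiniteMeasure Mass}

lemma lyap_wpow (hφ : IsWeight φ) (hp : 1 ≤ p) (hP : CoagPath K m)
    (hK : ∀ x y, K x y ≤ φ x * φ y) (hB : ∀ r, Moment φ (p + 1) B (m r : Measure Mass)) :
    Lyap K m (wpow φ p) (p * 2 ^ (p - 1) * B) := by
  have hp0 : 0 ≤ p := by linarith
  have hc1 : 1 ≤ p * 2 ^ (p - 1) := by
    have : (1 : ℝ) ≤ 2 ^ (p - 1) := Real.one_le_rpow (by norm_num) (by linarith)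
    nlinarith
  have hint : ∀ r, Integrable (wpow φ (p + 1)) (m r : Measure Mass) := fun r => (hB r).integrable hφ
  have hmK : ∀ x, Measurable (K x) := fun x =>
    hP.measurable_kern.comp (measurable_const.prodMk measurable_id)
  have hg : ∀ r x, Integrable (fun y => wpow φ p (x + y) * K x y) (m r : Measure Mass) := by
    intro r x
    refine ((hint r).const_mul (2 ^ p * wpow φ (p + 1) x)).mono'
      (((hφ.measurable_wpow p).comp (by fun_prop : Measurable fun y : Mass => x + y)).mul
        (hmK x)).aestronglyMeasurable (ae_of_all _ fun y => ?_)
    have h1 := hφ.wpow_apply_add_le hp0 x y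
    have h2 := hφ.wpow_nonneg p x
    have h3 := hφ.wpow_nonneg p y
    rw [Real.norm_eq_abs, abs_of_nonneg (mul_nonneg (hφ.wpow_nonneg _ _) (hP.nonneg _ _)),
      hφ.wpow_add_one, hφ.wpow_add_one]
    calc _ ≤ (2 ^ p * (wpow φ p x * wpow φ p y)) * (φ x * φ y) :=
          mul_le_mul h1 (hK x y) (hP.nonneg _ _) (by positivity)
      _ = _ := by ring
  have hpi : ∀ r x, Integrable (fun y => wpow φ p y * K x y) (m r : Measure Mass) := by
    intro r x
    refine ((hint r).const_mul (φ x)).mono'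
      ((hφ.measurable_wpow p).mul (hmK x)).aestronglyMeasurable (ae_of_all _ fun y => ?_)
    rw [Real.norm_eq_abs, abs_of_nonneg (mul_nonneg (hφ.wpow_nonneg _ _) (hP.nonneg _ _)),
      hφ.wpow_add_one]
    calc _ ≤ wpow φ p y * (φ x * φ y) :=
          mul_le_mul_of_nonneg_left (hK x y) (hφ.wpow_nonneg p y)
      _ = _ := by ring
  refine ⟨hφ.measurable_wpow p, hφ.wpow_nonneg p, by positivity, hg, fun r x => ?_, hpi,
    fun r x => ?_⟩
  · have hx := hφ.wpow_nonneg p x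
    have h1 : gain K (m r) (wpow φ p) x ≤ ∫ y, (wpow φ p x * K x y +
        p * 2 ^ (p - 1) * wpow φ p x * wpow φ (p + 1) y) ∂(m r : Measure Mass) := by
      refine integral_mono (hg r x) (((hP.integrable r x).const_mul _).add ((hint r).const_mul _))
        fun y => ?_
      have hxy : 0 < φ x * φ y := mul_pos (hφ.pos x) (hφ.pos y)
      have hinc := hφ.wpow_increment hp x y
      have hKn := hP.nonneg x y
      have hy := hφ.wpow_nonneg (p + 1) y
      simp only
      -- scale the increment inequality from `φ(x) φ(y)` to `K(x, y)`
      have hs : (wpow φ p (x + y) - wpow φ p x) * K x y ≤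
          p * 2 ^ (p - 1) * wpow φ p x * wpow φ (p + 1) y := by
        rcases le_total 0 (wpow φ p (x + y) - wpow φ p x) with h | h
        · calc _ ≤ (wpow φ p (x + y) - wpow φ p x) * (φ x * φ y) :=
                mul_le_mul_of_nonneg_left (hK x y) h
            _ ≤ _ := by linarith
        · exact (mul_nonpos_of_nonpos_of_nonneg h hKn).trans (by positivity)
      linarith
    refine h1.trans ?_
    rw [integral_add ((hP.integrable r x).const_mul _) ((hint r).const_mul _), integral_const_mul,
      integral_const_mul]
    have h2 := mul_le_mul_of_nonneg_left ((hB r).integral_le hφ)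
      (show 0 ≤ p * 2 ^ (p - 1) * wpow φ p x by positivity)
    rw [rate]
    nlinarith
  · have h1 : pert K (m r) (wpow φ p) x ≤ ∫ y, φ x * wpow φ (p + 1) y ∂(m r : Measure Mass) := by
      refine integral_mono (hpi r x) ((hint r).const_mul _) fun y => ?_
      simp only [hφ.wpow_add_one]
      calc _ ≤ wpow φ p y * (φ x * φ y) :=
            mul_le_mul_of_nonneg_left (hK x y) (hφ.wpow_nonneg p y)
        _ = _ := by ring
    rw [integral_const_mul] at h1
    have h2 : φ x ≤ wpow φ p x := by
      have := hφ.wpow_mono hp x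
      rwa [IsWeight.wpow_one] at this
    refine h1.trans ?_
    calc φ x * ∫ y, wpow φ (p + 1) y ∂(m r : Measure Mass) ≤ wpow φ p x * B :=
          mul_le_mul h2 ((hB r).integral_le hφ) (integral_nonneg (hφ.wpow_nonneg _))
            (hφ.wpow_nonneg p x)
      _ ≤ _ := by
          rw [mul_comm _ (B : ℝ), mul_assoc, mul_assoc, ← mul_assoc p]
          have : (B : ℝ) * wpow φ p x ≤ (p * 2 ^ (p - 1)) * (B * wpow φ p x) :=
            le_mul_of_one_le_left (mul_nonneg B.2 (hφ.wpow_nonneg p x)) hc1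
          exact this

lemma rate_le (hφ : IsWeight φ) (hP : CoagPath K m) (hK : ∀ x y, K x y ≤ φ x * φ y)
    (hB : ∀ r, Moment φ 1 B (m r : Measure Mass)) (r : ℝ) (x : Mass) :
    rate K (m r) x ≤ φ x * B := by
  have h1 : rate K (m r) x ≤ ∫ y, φ x * wpow φ 1 y ∂(m r : Measure Mass) :=
    integral_mono (hP.integrable r x) (((hB r).integrable hφ).const_mul _) fun y => by
      simpa only [IsWeight.wpow_one] using hK x y
  rw [integral_const_mul] at h1
  exact h1.trans (mul_le_mul_of_nonneg_left ((hB r).integral_le hφ) (hφ.pos x).le)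

lemma controls_wpow (hφ : IsWeight φ) (hP : CoagPath K m) (hK : ∀ x y, K x y ≤ φ x * φ y)
    (hB : ∀ r, Moment φ 1 B (m r : Measure Mass)) (p : ℝ) :
    Controls K m (wpow φ p) (wpow φ (p + 1)) (B + 1) := by
  refine ⟨by positivity, fun r x => ?_⟩
  rw [hφ.wpow_add_one]
  have h1 := rate_le hφ hP hK hB r x
  have h2 := hφ.one_le x
  have h3 := hφ.wpow_nonneg p x
  calc (rate K (m r) x + 1) * wpow φ p x ≤ ((B + 1) * φ x) * wpow φ p x :=
        mul_le_mul_of_nonneg_right (by linarith) h3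
    _ = _ := by ring

end

/-! ### Paths frozen outside a time interval -/

/-- The nearest point of `[0, T]`. -/
def clamp (T r : ℝ) : ℝ := max 0 (min r T)

lemma clamp_mem {T : ℝ} (hT : 0 ≤ T) (r : ℝ) : clamp T r ∈ Icc 0 T :=
  ⟨le_max_left _ _, max_le hT (min_le_right _ _)⟩

lemma clamp_of_mem {T r : ℝ} (hr : r ∈ Icc 0 T) : clamp T r = r := by
  rw [clamp, min_eq_left hr.2, max_eq_right hr.1]

lemma continuous_clamp (T : ℝ) : Continuous (clamp T) := by
  unfold clamp; fun_prop

section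

variable {K K' : Kern} {T : ℝ} {μ₀ : FiniteMeasure Mass} {μ μ' : ℝ → FiniteMeasure Mass}

lemma IsSolution.congr (h : IsSolution K T μ₀ μ) (hT : 0 ≤ T) {t₀ : ℝ} (ht₀ : t₀ ∈ Icc 0 T)
    (hμ : ∀ r ∈ Icc 0 t₀, μ' r = μ r) : IsSolution K t₀ μ₀ μ' := by
  have hsub : Icc 0 t₀ ⊆ Icc 0 T := Icc_subset_Icc_right ht₀.2
  have hc : ∀ (f : Mass → ℝ), ∀ s ∈ Icc 0 t₀, coagulation K (μ' s) f = coagulation K (μ s) f :=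
    fun f s hs => by rw [hμ s hs]
  refine ⟨by rw [hμ 0 ⟨le_rfl, ht₀.1⟩, h.initial], fun t ht => ?_, fun f hf hb => ?_,
    fun f hf hb t ht => ?_⟩
  · rw [hμ t ht]
    exact h.integrable t (hsub ht)
  · have : IntervalIntegrable (fun s => coagulation K (μ s) f) volume 0 t₀ :=
      (h.intervalIntegrable f hf hb).mono_set (by
        rw [uIcc_of_le hT, uIcc_of_le ht₀.1]; exact hsub)
    refine this.congr fun s hs => ?_
    rw [uIoc_of_le ht₀.1] at hs
    exact (hc f s ⟨hs.1.le, hs.2⟩).symm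
  · rw [hμ t ht, h.weak_eq f hf hb t (hsub ht)]
    congr 2
    refine intervalIntegral.integral_congr fun s hs => ?_
    rw [uIcc_of_le ht.1] at hs
    exact (hc f s ⟨hs.1, hs.2.trans ht.2⟩).symm

end

/-- A non-negative measurable symmetric kernel with `K(x, y) ≤ φ(x) φ(y)`. -/
structure CoagKernel (φ : Mass → ℝ) (K : Kern) : Prop where
  measurable : Measurable fun p : Mass × Mass => K p.1 p.2
  nonneg : ∀ x y, 0 ≤ K x y
  symm : ∀ x y, K x y = K y x
  le : ∀ x y, K x y ≤ φ x * φ y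

lemma CoagKernel.kernDom {φ : Mass → ℝ} {K : Kern} (h : CoagKernel φ K) : KernDom φ 1 K :=
  ⟨h.measurable, fun x y => by rw [abs_of_nonneg (h.nonneg x y), one_mul]; exact h.le x y⟩

/-- A solution on `[0, T]`, frozen outside `[0, T]`, with bounded moment of order `q`. -/
structure MomentSolution (φ : Mass → ℝ) (q : ℝ) (B : ℝ≥0) (K : Kern) (T : ℝ)
    (μ₀ : FiniteMeasure Mass) (μ : ℝ → FiniteMeasure Mass) : Prop extends
    IsSolution K T μ₀ μ, CoagKernel φ K where
  weight : IsWeight φ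
  T_nonneg : 0 ≤ T
  frozen : ∀ r, μ r = μ (clamp T r)
  moment : ∀ r, Moment φ q B (μ r : Measure Mass)

section

variable {K K' : Kern} {T : ℝ} {μ₀ : FiniteMeasure Mass} {μ μ' : ℝ → FiniteMeasure Mass}
  {φ : Mass → ℝ} {p q C : ℝ} {B : ℝ≥0} {f : Mass → ℝ}

/-- The path frozen outside `[0, T]`. -/
def freeze (T : ℝ) (μ : ℝ → FiniteMeasure Mass) (r : ℝ) : FiniteMeasure Mass := μ (clamp T r)

lemma freeze_of_mem {T r : ℝ} (hr : r ∈ Icc 0 T) : freeze T μ r = μ r := by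
  rw [freeze, clamp_of_mem hr]

lemma freeze_clamp (hT : 0 ≤ T) (r : ℝ) : freeze T μ r = freeze T μ (clamp T r) := by
  rw [freeze, freeze, clamp_of_mem (clamp_mem hT r)]

lemma IsSolution.momentSolution (h : IsSolution K T μ₀ μ) (hK : CoagKernel φ K) (hφ : IsWeight φ)
    {t₀ : ℝ} (ht₀ : t₀ ∈ Icc 0 T) (hB : ∀ r ∈ Icc 0 t₀, Moment φ q B (μ r : Measure Mass)) :
    MomentSolution φ q B K t₀ μ₀ (freeze t₀ μ) :=
  { h.congr (ht₀.1.trans ht₀.2) ht₀ (fun _ hr => freeze_of_mem hr), hK with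
    weight := hφ
    T_nonneg := ht₀.1
    frozen := freeze_clamp ht₀.1
    moment := fun r => hB _ (clamp_mem ht₀.1 r) }

namespace MomentSolution

lemma continuous_of_weak (hS : MomentSolution φ q B K T μ₀ μ)
    (hI : IntervalIntegrable (fun s => coagulation K (μ s) f) volume 0 T)
    (hw : ∀ t ∈ Icc 0 T, ∫ x, f x ∂(μ t : Measure Mass) = ∫ x, f x ∂(μ₀ : Measure Mass) +
      (1 / 2 : ℝ) * ∫ s in (0 : ℝ)..t, coagulation K (μ s) f) :
    Continuous fun r => ∫ x, f x ∂(μ r : Measure Mass) := by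
  have h1 : ContinuousOn (fun t => ∫ x, f x ∂(μ₀ : Measure Mass) +
      (1 / 2 : ℝ) * ∫ s in (0 : ℝ)..t, coagulation K (μ s) f) (Icc 0 T) := by
    have := intervalIntegral.continuousOn_primitive_interval' hI (left_mem_uIcc)
    rw [uIcc_of_le hS.T_nonneg] at this
    exact continuousOn_const.add (continuousOn_const.mul this)
  have h2 : (fun r => ∫ x, f x ∂(μ r : Measure Mass)) = (fun t => ∫ x, f x ∂(μ₀ : Measure Mass) +
      (1 / 2 : ℝ) * ∫ s in (0 : ℝ)..t, coagulation K (μ s) f) ∘ clamp T := by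
    ext r
    rw [hS.frozen r]
    exact hw _ (clamp_mem hS.T_nonneg r)
  rw [h2]
  exact h1.comp_continuous (continuous_clamp T) (clamp_mem hS.T_nonneg)

lemma continuous_integral_bounded (hS : MomentSolution φ q B K T μ₀ μ) (hf : Measurable f)
    (hb : ∃ C : ℝ, ∀ x, |f x| ≤ C) : Continuous fun r => ∫ x, f x ∂(μ r : Measure Mass) :=
  hS.continuous_of_weak (hS.intervalIntegrable f hf hb) (hS.weak_eq f hf hb)

lemma isMeasurablePath (hS : MomentSolution φ q B K T μ₀ μ) (hq : 0 ≤ q) : IsMeasurablePath μ := by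
  refine ⟨Measure.measurable_of_measurable_coe _ fun A hA => ?_,
    B, fun r => (hS.moment r).measure_univ_le hS.weight hq⟩
  have h1 := hS.continuous_integral_bounded (f := A.indicator fun _ => (1 : ℝ))
    (measurable_const.indicator hA) ⟨1, fun x => by
      by_cases hx : x ∈ A <;> simp [hx]⟩
  have h2 : (fun r => (μ r : Measure Mass) A) = fun r => ENNReal.ofReal
      (∫ x, A.indicator (fun _ => (1 : ℝ)) x ∂(μ r : Measure Mass)) := by
    ext r
    rw [integral_indicator hA]
    simp only [integral_const, smul_eq_mul, mul_one, measureReal_restrict_apply_univ]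
    rw [Measure.real, ENNReal.ofReal_toReal (measure_ne_top _ _)]
  rw [h2]
  exact h1.measurable.ennreal_ofReal

lemma measurable_coagulation (hS : MomentSolution φ q B K T μ₀ μ) (hq : 0 ≤ q) (hf : Measurable f) :
    Measurable fun s => coagulation K (μ s) f := by
  refine (hS.isMeasurablePath hq).measurable_integral_prod (α := ℝ)
    (F := fun _ z => bracket f z.1 z.2 * K z.1 z.2) ?_ measurable_id
  exact ((measurable_bracket hf).mul hS.measurable).comp measurable_snd

lemma moment_init (hS : MomentSolution φ q B K T μ₀ μ) : Moment φ q B (μ₀ : Measure Mass) := by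
  have := hS.moment 0
  rwa [hS.initial] at this

lemma abs_coagulation_le (hS : MomentSolution φ q B K T μ₀ μ) (hp : 0 ≤ p) (hpq : p + 1 ≤ q)
    (hC : 0 ≤ C) (hf : Dom (wpow φ p) C f) (s : ℝ) :
    |coagulation K (μ s) f| ≤ C * bconst p * (B * B) := by
  have h := (hS.moment s).mono hS.weight hpq
  have := abs_integral_bracket_le hS.weight hp hC zero_le_one hf hS.kernDom h h
  rwa [mul_one] at this

lemma intervalIntegrable_coagulation (hS : MomentSolution φ q B K T μ₀ μ) (hp : 0 ≤ p)
    (hpq : p + 1 ≤ q) (hC : 0 ≤ C) (hf : Dom (wpow φ p) C f) {s t : ℝ} (hst : s ≤ t) :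
    IntervalIntegrable (fun s => coagulation K (μ s) f) volume s t :=
  intervalIntegrable_of_bound (hS.measurable_coagulation (by linarith) hf.1) hst
    fun r _ => hS.abs_coagulation_le hp hpq hC hf r

/-- The weak equation for unbounded test functions. -/
lemma weak_eq_dom (hS : MomentSolution φ q B K T μ₀ μ) (hp : 0 ≤ p) (hpq : p + 1 ≤ q)
    (hC : 0 ≤ C) (hf : Dom (wpow φ p) C f) {t : ℝ} (ht : t ∈ Icc 0 T) :
    ∫ x, f x ∂(μ t : Measure Mass) = ∫ x, f x ∂(μ₀ : Measure Mass) +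
      (1 / 2 : ℝ) * ∫ s in (0 : ℝ)..t, coagulation K (μ s) f := by
  have hφ := hS.weight
  set F : ℕ → Mass → ℝ := fun n => {x | φ x ≤ n}.indicator f with hF
  have hset : ∀ n : ℕ, MeasurableSet {x | φ x ≤ n} := fun n =>
    measurableSet_le hφ.measurable measurable_const
  have hFm : ∀ n, Measurable (F n) := fun n => hf.1.indicator (hset n)
  have hFle : ∀ n x, |F n x| ≤ |f x| := fun n x => by
    by_cases hx : x ∈ {x | φ x ≤ n} <;> simp [hF, hx]
  have hFd : ∀ n, Dom (wpow φ p) C (F n) := fun n => ⟨hFm n, fun x => (hFle n x).trans (hf.2 x)⟩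
  have hFb : ∀ n, ∃ C' : ℝ, ∀ x, |F n x| ≤ C' := fun n => by
    refine ⟨C * (n : ℝ) ^ p, fun x => ?_⟩
    by_cases hx : φ x ≤ n
    · have : F n x = f x := indicator_of_mem (by exact hx) _
      rw [this]
      exact (hf.2 x).trans (mul_le_mul_of_nonneg_left
        (Real.rpow_le_rpow (hφ.pos x).le hx hp) hC)
    · have : F n x = 0 := indicator_of_notMem (by exact hx) _
      rw [this, abs_zero]
      positivity
  have hFlim : ∀ x, Tendsto (fun n => F n x) atTop (𝓝 (f x)) := fun x => by
    refine tendsto_const_nhds.congr' ?_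
    filter_upwards [eventually_ge_atTop ⌈φ x⌉₊] with n hn
    exact (indicator_of_mem (s := {x | φ x ≤ n}) (Nat.ceil_le.1 hn) f).symm
  have hint : ∀ α : Measure Mass, Moment φ q B α →
      Tendsto (fun n => ∫ x, F n x ∂α) atTop (𝓝 (∫ x, f x ∂α)) := fun α hα =>
    tendsto_integral_of_dominated_convergence (fun x => C * wpow φ p x)
      (fun n => (hFm n).aestronglyMeasurable)
      (((hα.mono hφ (by linarith)).integrable hφ).const_mul C)
      (fun n => ae_of_all _ (hFd n).2) (ae_of_all _ hFlim)
  have hcoag : ∀ s, Tendsto (fun n => coagulation K (μ s) (F n)) atTop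
      (𝓝 (coagulation K (μ s) f)) := by
    intro s
    have h := (hS.moment s).mono hφ hpq
    refine tendsto_integral_of_dominated_convergence
      (fun z : Mass × Mass => C * bconst p * 1 * (wpow φ (p + 1) z.1 * wpow φ (p + 1) z.2))
      (fun n => ((measurable_bracket (hFm n)).mul hS.measurable).aestronglyMeasurable)
      ((integrable_wpow_prod hφ h h).const_mul _)
      (fun n => ae_of_all _ fun z =>
        abs_bracket_mul_le hφ hp hC (hFd n).2 hS.kernDom.abs_le z.1 z.2)
      (ae_of_all _ fun z => ?_)
    exact (((hFlim _).sub (hFlim _)).sub (hFlim _)).mul_const _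
  have hR : Tendsto (fun n => ∫ x, F n x ∂(μ₀ : Measure Mass) +
      (1 / 2 : ℝ) * ∫ s in (0 : ℝ)..t, coagulation K (μ s) (F n)) atTop
      (𝓝 (∫ x, f x ∂(μ₀ : Measure Mass) +
      (1 / 2 : ℝ) * ∫ s in (0 : ℝ)..t, coagulation K (μ s) f)) := by
    refine (hint _ hS.moment_init).add (Tendsto.const_mul _ ?_)
    refine intervalIntegral.tendsto_integral_filter_of_dominated_convergence
      (fun _ => C * bconst p * (B * B))
      (Eventually.of_forall fun n =>
        (hS.measurable_coagulation (by linarith) (hFm n)).aestronglyMeasurable)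
      (Eventually.of_forall fun n => ae_of_all _ fun s _ => ?_)
      intervalIntegrable_const (ae_of_all _ fun s _ => hcoag s)
    exact hS.abs_coagulation_le hp hpq hC (hFd n) s
  refine tendsto_nhds_unique ((hint _ (hS.moment t)).congr fun n => ?_) hR
  exact hS.weak_eq (F n) (hFm n) (hFb n) t ht

lemma continuous_integral (hS : MomentSolution φ q B K T μ₀ μ) (hp : 0 ≤ p) (hpq : p + 1 ≤ q)
    (hC : 0 ≤ C) (hf : Dom (wpow φ p) C f) : Continuous fun r => ∫ x, f x ∂(μ r : Measure Mass) :=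
  hS.continuous_of_weak (hS.intervalIntegrable_coagulation hp hpq hC hf hS.T_nonneg)
    fun _ ht => hS.weak_eq_dom hp hpq hC hf ht

lemma dom_section (hK : CoagKernel φ K) (x : Mass) : Dom (wpow φ 1) (φ x) (K x) :=
  ⟨hK.measurable.comp (measurable_const.prodMk measurable_id), fun y => by
    rw [abs_of_nonneg (hK.nonneg x y), IsWeight.wpow_one]; exact hK.le x y⟩

/-- A solution with second moments, with any kernel dominated by the weight, is a coagulation
path. -/
lemma coagPath (hS : MomentSolution φ q B K T μ₀ μ) (hq : 2 ≤ q) (hK' : CoagKernel φ K') :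
    CoagPath K' μ where
  toIsMeasurablePath := hS.isMeasurablePath (by linarith)
  measurable_kern := hK'.measurable
  nonneg := hK'.nonneg
  integrable r x := (dom_section hK' x).integrable hS.weight ((hS.moment r).mono hS.weight (by linarith))
  continuous_rate x := hS.continuous_integral (p := 1) zero_le_one (by linarith)
    (hS.weight.pos x).le (dom_section hK' x)

/-- The weak equation for a time dependent test function. -/
lemma weak_eq_time (hS : MomentSolution φ q B K T μ₀ μ) (hp : 0 ≤ p) (hpq : p + 2 ≤ q) {C' : ℝ}
    (hC : 0 ≤ C) (hC' : 0 ≤ C') (hf : Dom (wpow φ p) C f) {t : ℝ} (ht : t ∈ Icc 0 T)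
    {g k : ℝ → Mass → ℝ}
    (hk : Measurable fun q : ℝ × Mass => k q.1 q.2)
    (hkd : ∀ r ∈ Ioc 0 t, Dom (wpow φ (p + 1)) C' (k r))
    (hgk : ∀ s ∈ Icc 0 t, ∀ x, g s x = f x + ∫ r in s..t, k r x) :
    ∫ x, f x ∂(μ t : Measure Mass) = ∫ x, g 0 x ∂(μ₀ : Measure Mass) +
      ∫ s in (0 : ℝ)..t, ((1 / 2 : ℝ) * coagulation K (μ s) (g s) -
        ∫ x, k s x ∂(μ s : Measure Mass)) := by
  have hφ := hS.weight
  have hmp := hS.isMeasurablePath (by linarith)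
  have hB0 : (0 : ℝ) ≤ B := B.2
  have hbc := bconst_pos (p + 1)
  have hmom : ∀ s, Moment φ (p + 2) B (μ s : Measure Mass) := fun s => (hS.moment s).mono hφ hpq
  have hmom' : ∀ s, Moment φ (p + 1 + 1) B (μ s : Measure Mass) := fun s =>
    (hS.moment s).mono hφ (by linarith)
  -- the double integrand
  set c : ℝ → ℝ → ℝ := fun s r => coagulation K (μ s) (k r) with hc
  have hcm : Measurable (Function.uncurry c) := by
    refine hmp.measurable_integral_prod (α := ℝ × ℝ)
      (F := fun a z => bracket (k a.2) z.1 z.2 * K z.1 z.2) ?_ measurable_fst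
    have h1 : Measurable fun p : (ℝ × ℝ) × Mass × Mass => (p.1.2, p.2.1 + p.2.2) := by fun_prop
    have h2 : Measurable fun p : (ℝ × ℝ) × Mass × Mass => (p.1.2, p.2.1) := by fun_prop
    have h3 : Measurable fun p : (ℝ × ℝ) × Mass × Mass => (p.1.2, p.2.2) := by fun_prop
    exact (((hk.comp h1).sub (hk.comp h2)).sub (hk.comp h3)).mul (hS.measurable.comp measurable_snd)
  set b : ℝ := C' * bconst (p + 1) * (B * B) with hb
  have hcb : ∀ s, ∀ r ∈ Ioc 0 t, |c s r| ≤ b := fun s r hr =>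
    hS.abs_coagulation_le (by linarith) (by linarith) hC' (hkd r hr) s
  have hb0 : 0 ≤ b := by positivity
  -- Fubini for a fixed time
  have hcoag : ∀ s ∈ Icc 0 t, coagulation K (μ s) (g s) =
      coagulation K (μ s) f + ∫ r in s..t, c s r := by
    intro s hs
    have hsub : ∀ r ∈ Ioc s t, r ∈ Ioc 0 t := fun r hr => ⟨hs.1.trans_lt hr.1, hr.2⟩
    have hkI : ∀ x, IntervalIntegrable (fun r => k r x) volume s t := fun x =>
      intervalIntegrable_of_bound (hk.comp (measurable_id.prodMk measurable_const)) hs.2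
        fun r hr => (hkd r (hsub r hr)).2 x
    have h1 : ∀ x y, bracket (g s) x y * K x y = bracket f x y * K x y +
        ∫ r in s..t, bracket (k r) x y * K x y := by
      intro x y
      simp only [bracket]
      rw [hgk s hs, hgk s hs, hgk s hs, intervalIntegral.integral_mul_const,
        intervalIntegral.integral_sub ((hkI _).sub (hkI _)) (hkI _),
        intervalIntegral.integral_sub (hkI _) (hkI _)]
      ring
    simp only [coagulation, h1]
    have hprodI : Integrable (fun q : (Mass × Mass) × ℝ =>
        bracket (k q.2) q.1.1 q.1.2 * K q.1.1 q.1.2)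
        (((μ s : Measure Mass).prod (μ s : Measure Mass)).prod (volume.restrict (Ioc s t))) := by
      have hi := ((integrable_wpow_prod hφ (hmom' s) (hmom' s)).const_mul
        (C' * bconst (p + 1) * 1)).mul_prod (integrable_const (μ := volume.restrict (Ioc s t)) (1 : ℝ))
      refine hi.mono' ?_ ?_
      · have h1 : Measurable fun p : (Mass × Mass) × ℝ => (p.2, p.1.1 + p.1.2) := by fun_prop
        have h2 : Measurable fun p : (Mass × Mass) × ℝ => (p.2, p.1.1) := by fun_prop
        have h3 : Measurable fun p : (Mass × Mass) × ℝ => (p.2, p.1.2) := by fun_prop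
        exact ((((hk.comp h1).sub (hk.comp h2)).sub (hk.comp h3)).mul
          (hS.measurable.comp measurable_fst)).aestronglyMeasurable
      · have : ∀ᵐ r ∂(volume.restrict (Ioc s t)), r ∈ Ioc s t := ae_restrict_mem measurableSet_Ioc
        filter_upwards [Measure.quasiMeasurePreserving_snd.ae this] with q hq
        rw [mul_one]
        exact abs_bracket_mul_le hφ (by linarith) hC' (hkd _ (hsub _ hq)).2 hS.kernDom.abs_le _ _
    rw [integral_add]
    · congr 1
      simp only [intervalIntegral.integral_of_le hs.2]
      exact integral_integral_swap hprodI
    · exact integrable_bracket hφ hp hC hf hS.kernDom ((hmom s).mono hφ (by linarith))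
        ((hmom s).mono hφ (by linarith))
    · simp only [intervalIntegral.integral_of_le hs.2]
      exact hprodI.integral_prod_left
  have hkint : ∀ r ∈ Ioc 0 t, |∫ x, k r x ∂(μ r : Measure Mass)| ≤ C' * B := fun r hr =>
    (hkd r hr).abs_integral_le hφ hC' ((hmom r).mono hφ (by linarith))
  have hkint0 : ∀ r ∈ Ioc 0 t, |∫ x, k r x ∂(μ₀ : Measure Mass)| ≤ C' * B := fun r hr =>
    (hkd r hr).abs_integral_le hφ hC' (hS.moment_init.mono hφ (by linarith))
  have hkm : Measurable fun r => ∫ x, k r x ∂(μ r : Measure Mass) :=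
    hmp.measurable_integral (α := ℝ) (F := k) hk measurable_id
  have hkm0 : Measurable fun r => ∫ x, k r x ∂(μ₀ : Measure Mass) := by
    exact (hk.stronglyMeasurable.integral_prod_right' (ν := (μ₀ : Measure Mass))).measurable
  have hI1 : IntervalIntegrable (fun s => coagulation K (μ s) f) volume 0 t :=
    hS.intervalIntegrable_coagulation hp (by linarith) hC hf ht.1
  have hI2 : IntervalIntegrable (fun s => ∫ r in s..t, c s r) volume 0 t := by
    refine intervalIntegrable_of_bound (measurable_intervalIntegral (F := c) hcm measurable_id
      measurable_const) ht.1 (b := b * t) fun s hs => ?_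
    refine (abs_intervalIntegral_le_const hs.2 fun r hr => hcb s r ⟨hs.1.trans hr.1, hr.2⟩).trans ?_
    exact mul_le_mul_of_nonneg_left (by linarith [hs.1]) hb0
  have hI3 := intervalIntegrable_of_bound hkm ht.1 hkint
  have hI4 := intervalIntegrable_of_bound hkm0 ht.1 hkint0
  have hA : ∫ s in (0 : ℝ)..t, coagulation K (μ s) (g s) =
      (∫ s in (0 : ℝ)..t, coagulation K (μ s) f) + ∫ r in (0 : ℝ)..t, ∫ s in (0 : ℝ)..r, c s r := by
    rw [← integral_triangle hcm ht.1 (fun s _ r hr => hcb s r hr),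
      ← intervalIntegral.integral_add hI1 hI2]
    refine intervalIntegral.integral_congr fun s hs => ?_
    rw [uIcc_of_le ht.1] at hs
    exact hcoag s hs
  have hBB : (1 / 2 : ℝ) * ∫ r in (0 : ℝ)..t, ∫ s in (0 : ℝ)..r, c s r =
      (∫ r in (0 : ℝ)..t, ∫ x, k r x ∂(μ r : Measure Mass)) -
        ∫ r in (0 : ℝ)..t, ∫ x, k r x ∂(μ₀ : Measure Mass) := by
    rw [← intervalIntegral.integral_sub hI3 hI4, ← intervalIntegral.integral_const_mul]
    refine intervalIntegral.integral_congr_ae (ae_of_all _ fun r hr => ?_)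
    rw [uIoc_of_le ht.1] at hr
    have := hS.weak_eq_dom (by linarith) (by linarith) hC' (hkd r hr)
      (t := r) ⟨hr.1.le, hr.2.trans ht.2⟩
    simp only [hc]
    linarith
  have hg0 : ∫ x, g 0 x ∂(μ₀ : Measure Mass) = ∫ x, f x ∂(μ₀ : Measure Mass) +
      ∫ r in (0 : ℝ)..t, ∫ x, k r x ∂(μ₀ : Measure Mass) := by
    have hmom0 := hS.moment_init.mono hφ (show p + 1 ≤ q by linarith)
    have hprodI : Integrable (fun q : Mass × ℝ => k q.2 q.1)
        ((μ₀ : Measure Mass).prod (volume.restrict (Ioc 0 t))) := by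
      have hi := ((hmom0.integrable hφ).const_mul C').mul_prod
        (integrable_const (μ := volume.restrict (Ioc 0 t)) (1 : ℝ))
      refine hi.mono' (hk.comp measurable_swap).aestronglyMeasurable ?_
      have : ∀ᵐ r ∂(volume.restrict (Ioc 0 t)), r ∈ Ioc 0 t := ae_restrict_mem measurableSet_Ioc
      filter_upwards [Measure.quasiMeasurePreserving_snd.ae this] with q hq
      rw [mul_one]
      exact (hkd _ hq).2 _
    simp only [hgk 0 ⟨le_rfl, ht.1⟩]
    rw [integral_add (hf.integrable hφ (hmom0.mono hφ (by linarith)))]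
    · congr 1
      simp only [intervalIntegral.integral_of_le ht.1]
      exact integral_integral_swap hprodI
    · simp only [intervalIntegral.integral_of_le ht.1]
      exact hprodI.integral_prod_left
  have hI5 : IntervalIntegrable (fun s => (1 / 2 : ℝ) * coagulation K (μ s) (g s)) volume 0 t := by
    refine ((hI1.add hI2).const_mul (1 / 2)).congr fun s hs => ?_
    rw [uIoc_of_le ht.1] at hs
    simp only [hcoag s ⟨hs.1.le, hs.2⟩]
  have hmain := hS.weak_eq_dom hp (by linarith) hC hf ht
  rw [intervalIntegral.integral_sub hI5 hI3, intervalIntegral.integral_const_mul, hA, hg0, hmain,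
    mul_add, hBB]
  ring

end MomentSolution

end

/-! ### Bilinear forms of measures -/

/-- `α` and `β` differ by at most `δ` in the norm dual to the weight `φ ^ p`. -/
def Near (φ : Mass → ℝ) (p δ : ℝ) (α β : Measure Mass) : Prop :=
  ∀ C : ℝ, 0 ≤ C → ∀ f, Dom (wpow φ p) C f → |∫ x, f x ∂α - ∫ x, f x ∂β| ≤ C * δ

section

variable {φ : Mass → ℝ} {p q C D E δ : ℝ} {A B R : ℝ≥0} {α β γ : Measure Mass} {f g : Mass → ℝ}
  {K G : Kern} {Φ : Mass × Mass → ℝ} [SFinite α] [SFinite β] [SFinite γ]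

/-- `Φ` is measurable with `|Φ(x, y)| ≤ E φ(x) ^ p φ(y) ^ p`. -/
structure Dom2 (φ : Mass → ℝ) (p E : ℝ) (Φ : Mass × Mass → ℝ) : Prop where
  measurable : Measurable Φ
  abs_le : ∀ x y, |Φ (x, y)| ≤ E * (wpow φ p x * wpow φ p y)

lemma Dom2.swap (h : Dom2 φ p E Φ) : Dom2 φ p E (fun z => Φ z.swap) :=
  ⟨h.measurable.comp measurable_swap, fun x y => by rw [mul_comm (wpow φ p x)]; exact h.abs_le y x⟩

lemma Dom2.section (h : Dom2 φ p E Φ) (x : Mass) :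
    Dom (wpow φ p) (E * wpow φ p x) (fun y => Φ (x, y)) :=
  ⟨h.measurable.comp (measurable_const.prodMk measurable_id), fun y => by
    rw [mul_assoc]; exact h.abs_le x y⟩

lemma Dom2.integrable (hφ : IsWeight φ) (h : Dom2 φ p E Φ) (hα : Moment φ p A α)
    (hβ : Moment φ p B β) : Integrable Φ (α.prod β) :=
  ((integrable_wpow_prod hφ hα hβ).const_mul E).mono' h.measurable.aestronglyMeasurable
    (ae_of_all _ fun z => h.abs_le z.1 z.2)

lemma Dom2.abs_integral_le (hφ : IsWeight φ) (hE : 0 ≤ E) (h : Dom2 φ p E Φ) (hα : Moment φ p A α)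
    (hβ : Moment φ p B β) : |∫ z, Φ z ∂(α.prod β)| ≤ E * (A * B) := by
  have h1 := norm_integral_le_of_norm_le (f := Φ) ((integrable_wpow_prod hφ hα hβ).const_mul E)
    (ae_of_all _ fun z => h.abs_le z.1 z.2)
  rw [integral_const_mul, Real.norm_eq_abs] at h1
  exact h1.trans (mul_le_mul_of_nonneg_left (integral_wpow_prod_le hφ hα hβ) hE)

lemma Dom2.dom_marginal (hφ : IsWeight φ) (hE : 0 ≤ E) (h : Dom2 φ p E Φ) (hβ : Moment φ p B β) :
    Dom (wpow φ p) (E * B) (fun x => ∫ y, Φ (x, y) ∂β) :=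
  ⟨h.measurable.stronglyMeasurable.integral_prod_right'.measurable, fun x => by
    have := (h.section x).abs_integral_le hφ (mul_nonneg hE (hφ.wpow_nonneg p x)) hβ
    rwa [mul_right_comm] at this⟩

lemma dom2_bracket (hφ : IsWeight φ) (hp : 0 ≤ p) (hC : 0 ≤ C) (hf : Dom (wpow φ p) C f)
    (hG : KernDom φ D G) :
    Dom2 φ (p + 1) (C * bconst p * D) (fun z => bracket f z.1 z.2 * G z.1 z.2) :=
  ⟨(measurable_bracket hf.1).mul hG.measurable, fun x y =>
    abs_bracket_mul_le hφ hp hC hf.2 hG.abs_le x y⟩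

lemma Near.abs_left_le (hφ : IsWeight φ) (hE : 0 ≤ E) (hn : Near φ p δ α β) (h : Dom2 φ p E Φ)
    (hα : Moment φ p A α) (hβ : Moment φ p A β) (hγ : Moment φ p B γ) :
    |∫ z, Φ z ∂(α.prod γ) - ∫ z, Φ z ∂(β.prod γ)| ≤ E * B * δ := by
  rw [integral_prod _ (h.integrable hφ hα hγ), integral_prod _ (h.integrable hφ hβ hγ)]
  exact hn _ (mul_nonneg hE B.2) _ (h.dom_marginal hφ hE hγ)

lemma Near.abs_right_le (hφ : IsWeight φ) (hE : 0 ≤ E) (hn : Near φ p δ α β) (h : Dom2 φ p E Φ)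
    (hα : Moment φ p A α) (hβ : Moment φ p A β) (hγ : Moment φ p B γ) :
    |∫ z, Φ z ∂(γ.prod α) - ∫ z, Φ z ∂(γ.prod β)| ≤ E * B * δ := by
  rw [← integral_prod_swap (μ := γ) (ν := α), ← integral_prod_swap (μ := γ) (ν := β)]
  exact hn.abs_left_le hφ hE h.swap hα hβ hγ

lemma Near.abs_diag_le (hφ : IsWeight φ) (hE : 0 ≤ E) (hn : Near φ p δ α β) (h : Dom2 φ p E Φ)
    (hα : Moment φ p A α) (hβ : Moment φ p A β) :
    |∫ z, Φ z ∂(α.prod α) - ∫ z, Φ z ∂(β.prod β)| ≤ 2 * (E * A) * δ := by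
  have h1 := hn.abs_left_le hφ hE h hα hβ hα
  have h2 := hn.abs_right_le hφ hE h hα hβ hβ
  have h3 := abs_add_le (∫ z, Φ z ∂(α.prod α) - ∫ z, Φ z ∂(β.prod α))
    (∫ z, Φ z ∂(β.prod α) - ∫ z, Φ z ∂(β.prod β))
  rw [sub_add_sub_cancel] at h3
  linarith

lemma Near.abs_second_difference_le (hφ : IsWeight φ) (hE : 0 ≤ E) (hδ : 0 ≤ δ)
    (hn : Near φ p δ α β) (h : Dom2 φ p E Φ) (hα : Moment φ p A α) (hβ : Moment φ p A β) :
    |(∫ z, Φ z ∂(α.prod α) - ∫ z, Φ z ∂(α.prod β)) -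
      (∫ z, Φ z ∂(β.prod α) - ∫ z, Φ z ∂(β.prod β))| ≤ E * δ * δ := by
  have hd : Dom (wpow φ p) (E * δ) (fun x => ∫ y, Φ (x, y) ∂α - ∫ y, Φ (x, y) ∂β) := by
    refine ⟨(h.dom_marginal hφ hE hα).1.sub (h.dom_marginal hφ hE hβ).1, fun x => ?_⟩
    have := hn _ (mul_nonneg hE (hφ.wpow_nonneg p x)) _ (h.section x)
    rwa [mul_right_comm] at this
  have hi : ∀ {γ : Measure Mass} {ζ : Measure Mass}, Moment φ p A γ → Moment φ p A ζ →
      [SFinite γ] → [SFinite ζ] → Integrable (fun x => ∫ y, Φ (x, y) ∂ζ) γ :=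
    fun hγ hζ => (h.dom_marginal hφ hE hζ).integrable hφ hγ
  rw [integral_prod _ (h.integrable hφ hα hα), integral_prod _ (h.integrable hφ hα hβ),
    integral_prod _ (h.integrable hφ hβ hα), integral_prod _ (h.integrable hφ hβ hβ),
    ← integral_sub (hi hα hα) (hi hα hβ), ← integral_sub (hi hβ hα) (hi hβ hβ)]
  exact hn _ (mul_nonneg hE hδ) _ hd

lemma integral_Lam (hφ : IsWeight φ) (hp : 0 ≤ p) (hC : 0 ≤ C) (hf : Dom (wpow φ p) C f)
    (hG : KernDom φ D G) (hα : Moment φ (p + 1) A α) (hβ : Moment φ (p + 1) B β) :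
    ∫ x, Lam G β f x ∂α = ∫ z, bracket f z.1 z.2 * G z.1 z.2 ∂(α.prod β) :=
  (integral_prod _ ((dom2_bracket hφ hp hC hf hG).integrable hφ hα hβ)).symm

lemma dom_Lam (hφ : IsWeight φ) (hp : 0 ≤ p) (hC : 0 ≤ C) (hD : 0 ≤ D) (hf : Dom (wpow φ p) C f)
    (hG : KernDom φ D G) (hβ : Moment φ (p + 1) B β) :
    Dom (wpow φ (p + 1)) (C * bconst p * D * B) (Lam G β f) := by
  have hb := bconst_pos p
  exact (dom2_bracket hφ hp hC hf hG).dom_marginal hφ (by positivity) hβ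

lemma integral_bracket_symm (hK : ∀ x y, K x y = K y x) (f : Mass → ℝ) :
    ∫ z, bracket f z.1 z.2 * K z.1 z.2 ∂(α.prod β) =
      ∫ z, bracket f z.1 z.2 * K z.1 z.2 ∂(β.prod α) := by
  rw [← integral_prod_swap (μ := β) (ν := α)]
  congr 1
  ext z
  simp only [Prod.fst_swap, Prod.snd_swap, hK z.2 z.1, bracket, add_comm z.2 z.1]
  ring

end

/-! ### Two solutions -/

section

variable {K K' K'' : Kern} {T : ℝ} {μ₀ : FiniteMeasure Mass} {μ μ' m : ℝ → FiniteMeasure Mass}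
  {φ : Mass → ℝ} {p q C : ℝ} {B R : ℝ≥0} {f : Mass → ℝ} {t : ℝ}

lemma CoagPath.measurable_Lam (hP : IsMeasurablePath m) {G : Kern}
    (hG : Measurable fun z : Mass × Mass => G z.1 z.2) {g : ℝ → Mass → ℝ}
    (hg : Measurable fun q : ℝ × Mass => g q.1 q.2) :
    Measurable fun q : ℝ × Mass => Lam G (m q.1) (g q.1) q.2 := by
  refine hP.measurable_integral (α := ℝ × Mass)
    (F := fun q y => bracket (g q.1) q.2 y * G q.2 y) ?_ measurable_fst
  have h1 : Measurable fun p : (ℝ × Mass) × Mass => (p.1.1, p.1.2 + p.2) := by fun_prop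
  have h2 : Measurable fun p : (ℝ × Mass) × Mass => (p.1.1, p.1.2) := by fun_prop
  have h3 : Measurable fun p : (ℝ × Mass) × Mass => (p.1.1, p.2) := by fun_prop
  have h4 : Measurable fun p : (ℝ × Mass) × Mass => (p.1.2, p.2) := by fun_prop
  exact (((hg.comp h1).sub (hg.comp h2)).sub (hg.comp h3)).mul (hG.comp h4)

/-- The uniform bound for the propagator on `[0, T]`. -/
def growth (p : ℝ) (R : ℝ≥0) (T : ℝ) : ℝ := Real.exp (2 * (p * 2 ^ (p - 1) * R) * T)

lemma growth_pos (p : ℝ) (R : ℝ≥0) (T : ℝ) : 0 < growth p R T := Real.exp_pos _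

lemma dom_propagator_growth (hφ : IsWeight φ) (hp : 1 ≤ p) (hP : CoagPath K m)
    (hK : ∀ x y, K x y ≤ φ x * φ y) (hR : ∀ r, Moment φ (p + 1) R (m r : Measure Mass))
    (hC : 0 ≤ C) (hf : Dom (wpow φ p) C f) {s : ℝ} (hs : 0 ≤ s) (hst : s ≤ t) (htT : t ≤ T) :
    Dom (wpow φ p) (C * growth p R T) (propagator K m s t f) := by
  have hw := lyap_wpow hφ hp hP hK hR
  refine (hw.dom_propagator hP hC hf hst).mono (hφ.wpow_nonneg p) ?_
  refine mul_le_mul_of_nonneg_left (Real.exp_le_exp.2 ?_) hC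
  exact mul_le_mul_of_nonneg_left (by linarith) (mul_nonneg two_pos.le hw.const_nonneg)

namespace MomentSolution

/-- The weak equation tested against a propagator. -/
lemma weak_eq_propagator (hS : MomentSolution φ q B K T μ₀ μ) (hp : 1 ≤ p) (hpq : p + 2 ≤ q)
    (hP : CoagPath K'' m) (hK'' : CoagKernel φ K'')
    (hR : ∀ r, Moment φ (p + 1) R (m r : Measure Mass)) (hC : 0 ≤ C) (hf : Dom (wpow φ p) C f)
    (ht : t ∈ Icc 0 T) :
    ∫ x, f x ∂(μ t : Measure Mass) = ∫ x, propagator K'' m 0 t f x ∂(μ₀ : Measure Mass) +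
      ∫ s in (0 : ℝ)..t, ((1 / 2 : ℝ) * coagulation K (μ s) (propagator K'' m s t f) -
        ∫ x, Lam K'' (m s) (propagator K'' m s t f) x ∂(μ s : Measure Mass)) := by
  have hφ := hS.weight
  have hw := lyap_wpow hφ hp hP hK''.le hR
  have hb := bconst_pos p
  have hgr := growth_pos p R T
  refine hS.weak_eq_time (g := fun s => propagator K'' m s t f)
    (k := fun s => Lam K'' (m s) (propagator K'' m s t f)) (by linarith) hpq
    (C' := C * growth p R T * bconst p * 1 * R) hC (by positivity) hf ht ?_ ?_ ?_
  · exact CoagPath.measurable_Lam (g := fun s => propagator K'' m s t f) hP.toIsMeasurablePath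
      hK''.measurable (hP.measurable_propagator hf.1 t)
  · intro r hr
    exact dom_Lam hφ (by linarith) (by positivity) zero_le_one (dom_propagator_growth hφ hp hP hK''.le
      hR hC hf hr.1.le hr.2 ht.2) hK''.kernDom (hR r)
  · exact fun s hs x => hw.propagator_integrated hP hC hf hs.2 x

lemma measurable_form (hS : MomentSolution φ q B K T μ₀ μ) (hq : 0 ≤ q) {G : Kern}
    (hG : Measurable fun z : Mass × Mass => G z.1 z.2) {g : ℝ → Mass → ℝ}
    (hg : Measurable fun q : ℝ × Mass => g q.1 q.2) :
    Measurable fun s => ∫ z, bracket (g s) z.1 z.2 * G z.1 z.2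
      ∂((μ s : Measure Mass).prod (μ s : Measure Mass)) := by
  refine (hS.isMeasurablePath hq).measurable_integral_prod (α := ℝ)
    (F := fun s z => bracket (g s) z.1 z.2 * G z.1 z.2) ?_ measurable_id
  have h1 : Measurable fun p : ℝ × Mass × Mass => (p.1, p.2.1 + p.2.2) := by fun_prop
  have h2 : Measurable fun p : ℝ × Mass × Mass => (p.1, p.2.1) := by fun_prop
  have h3 : Measurable fun p : ℝ × Mass × Mass => (p.1, p.2.2) := by fun_prop
  exact (((hg.comp h1).sub (hg.comp h2)).sub (hg.comp h3)).mul (hG.comp measurable_snd)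

lemma intervalIntegrable_test (hS : MomentSolution φ q B K T μ₀ μ) (hp : 1 ≤ p) (hpq : p + 2 ≤ q)
    (hP : CoagPath K'' m) (hK'' : CoagKernel φ K'')
    (hR : ∀ r, Moment φ (p + 1) R (m r : Measure Mass)) (hC : 0 ≤ C) (hf : Dom (wpow φ p) C f)
    (ht : t ∈ Icc 0 T) :
    IntervalIntegrable (fun s => (1 / 2 : ℝ) * coagulation K (μ s) (propagator K'' m s t f) -
        ∫ x, Lam K'' (m s) (propagator K'' m s t f) x ∂(μ s : Measure Mass)) volume 0 t := by
  have hφ := hS.weight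
  have hb := bconst_pos p
  have hgr := growth_pos p R T
  have hmU := hP.measurable_propagator hf.1 t
  have hd : ∀ s ∈ Ioc 0 t, Dom (wpow φ p) (C * growth p R T) (propagator K'' m s t f) :=
    fun s hs => dom_propagator_growth hφ hp hP hK''.le hR hC hf hs.1.le hs.2 ht.2
  refine IntervalIntegrable.sub (IntervalIntegrable.const_mul ?_ _) ?_
  · exact intervalIntegrable_of_bound (hS.measurable_form (g := fun s => propagator K'' m s t f)
      (by linarith) hS.measurable hmU) ht.1 fun s hs => hS.abs_coagulation_le (by linarith) (by linarith) (by positivity) (hd s hs) s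
  · have hm : Measurable fun s => ∫ x, Lam K'' (m s) (propagator K'' m s t f) x
        ∂(μ s : Measure Mass) := (hS.isMeasurablePath (by linarith)).measurable_integral (α := ℝ)
      (F := fun s => Lam K'' (m s) (propagator K'' m s t f)) (CoagPath.measurable_Lam
        (g := fun s => propagator K'' m s t f) hP.toIsMeasurablePath hK''.measurable hmU)
      measurable_id
    refine intervalIntegrable_of_bound (b := C * growth p R T * bconst p * 1 * R * B) hm ht.1
      fun s hs => ?_
    exact (dom_Lam hφ (by linarith) (by positivity) zero_le_one (hd s hs) hK''.kernDom
      (hR s)).abs_integral_le hφ (by positivity) ((hS.moment s).mono hφ (by linarith))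

lemma difference (hS : MomentSolution φ q B K T μ₀ μ) (hS' : MomentSolution φ q B K' T μ₀ μ')
    (hp : 1 ≤ p) (hpq : p + 2 ≤ q) (hP : CoagPath K'' m) (hK'' : CoagKernel φ K'')
    (hR : ∀ r, Moment φ (p + 1) R (m r : Measure Mass)) (hC : 0 ≤ C) (hf : Dom (wpow φ p) C f)
    (ht : t ∈ Icc 0 T) :
    ∫ x, f x ∂(μ' t : Measure Mass) - ∫ x, f x ∂(μ t : Measure Mass) =
      ∫ s in (0 : ℝ)..t, (((1 / 2 : ℝ) * coagulation K' (μ' s) (propagator K'' m s t f) -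
        ∫ x, Lam K'' (m s) (propagator K'' m s t f) x ∂(μ' s : Measure Mass)) -
        ((1 / 2 : ℝ) * coagulation K (μ s) (propagator K'' m s t f) -
        ∫ x, Lam K'' (m s) (propagator K'' m s t f) x ∂(μ s : Measure Mass))) := by
  rw [hS.weak_eq_propagator hp hpq hP hK'' hR hC hf ht,
    hS'.weak_eq_propagator hp hpq hP hK'' hR hC hf ht,
    intervalIntegral.integral_sub (hS'.intervalIntegrable_test hp hpq hP hK'' hR hC hf ht)
    (hS.intervalIntegrable_test hp hpq hP hK'' hR hC hf ht)]
  ring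

/-- The average of two paths. -/
def _root_.Smoluchowski.average (μ μ' : ℝ → FiniteMeasure Mass) (r : ℝ) : FiniteMeasure Mass :=
  (1 / 2 : ℝ≥0) • (μ r + μ' r)

lemma _root_.Smoluchowski.average_coe (μ μ' : ℝ → FiniteMeasure Mass) (r : ℝ) :
    (average μ μ' r : Measure Mass) = (1 / 2 : ℝ≥0) • ((μ r : Measure Mass) + (μ' r : Measure Mass)) := by
  rw [average, FiniteMeasure.toMeasure_smul, FiniteMeasure.toMeasure_add]

lemma _root_.Smoluchowski.integral_average (r : ℝ) {h : Mass → ℝ}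
    (h1 : Integrable h (μ r : Measure Mass)) (h2 : Integrable h (μ' r : Measure Mass)) :
    ∫ x, h x ∂(average μ μ' r : Measure Mass) =
      (1 / 2 : ℝ) * (∫ x, h x ∂(μ r : Measure Mass) + ∫ x, h x ∂(μ' r : Measure Mass)) := by
  rw [average_coe, integral_smul_nnreal_measure, integral_add_measure h1 h2]
  simp [NNReal.smul_def]
  ring

lemma _root_.Smoluchowski.moment_average {r : ℝ} (h1 : Moment φ p R (μ r : Measure Mass))
    (h2 : Moment φ p R (μ' r : Measure Mass)) : Moment φ p R (average μ μ' r : Measure Mass) := by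
  rw [Moment, average_coe, lintegral_smul_measure, lintegral_add_measure]
  refine (smul_mono_right _ (add_le_add h1 h2)).trans (le_of_eq ?_)
  rw [ENNReal.smul_def, smul_eq_mul, ← two_mul, ← mul_assoc]
  rw [← ENNReal.coe_ofNat, ← ENNReal.coe_mul]
  norm_num

lemma coagPath_average (hS : MomentSolution φ q B K T μ₀ μ) (hS' : MomentSolution φ q B K' T μ₀ μ')
    (hq : 2 ≤ q) (hK'' : CoagKernel φ K'') : CoagPath K'' (average μ μ') := by
  have hφ := hS.weight
  have h1 := hS.coagPath hq hK''
  have h2 := hS'.coagPath hq hK''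
  have hm : ∀ r, Moment φ q B (average μ μ' r : Measure Mass) := fun r =>
    moment_average (hS.moment r) (hS'.moment r)
  refine ⟨⟨?_, B, fun r => (hm r).measure_univ_le hφ (by linarith)⟩, hK''.measurable, hK''.nonneg,
    fun r x => (dom_section hK'' x).integrable hφ ((hm r).mono hφ (by linarith)), fun x => ?_⟩
  · refine Measure.measurable_of_measurable_coe _ fun A hA => ?_
    simp only [average_coe, Measure.smul_apply, Measure.add_apply]
    exact ((Measure.measurable_coe hA).comp h1.measurable).add
      ((Measure.measurable_coe hA).comp h2.measurable) |>.const_smul _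
  · have : (fun r => rate K'' (average μ μ' r) x) = fun r =>
        (1 / 2 : ℝ) * (rate K'' (μ r) x + rate K'' (μ' r) x) := by
      ext r
      exact integral_average r (h1.integrable r x) (h2.integrable r x)
    rw [this]
    exact continuous_const.mul ((h1.continuous_rate x).add (h2.continuous_rate x))

/-- The difference of two solutions, along the propagator of the symmetrised linearisation. -/
lemma difference_average (hS : MomentSolution φ q B K T μ₀ μ)
    (hS' : MomentSolution φ q B K' T μ₀ μ') (hp : 1 ≤ p) (hpq : p + 2 ≤ q) (hC : 0 ≤ C)
    (hf : Dom (wpow φ p) C f) (ht : t ∈ Icc 0 T) :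
    ∫ x, f x ∂(μ' t : Measure Mass) - ∫ x, f x ∂(μ t : Measure Mass) =
      ∫ s in (0 : ℝ)..t, (1 / 2 : ℝ) * ∫ z, bracket (propagator K' (average μ μ') s t f) z.1 z.2 *
        (K' z.1 z.2 - K z.1 z.2) ∂((μ s : Measure Mass).prod (μ s : Measure Mass)) := by
  have hφ := hS.weight
  have hP := hS.coagPath_average hS' (by linarith) hS'.toCoagKernel
  have hmom : ∀ r, Moment φ (p + 1) B (μ r : Measure Mass) := fun r =>
    (hS.moment r).mono hφ (by linarith)
  have hmom' : ∀ r, Moment φ (p + 1) B (μ' r : Measure Mass) := fun r =>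
    (hS'.moment r).mono hφ (by linarith)
  have hmoma : ∀ r, Moment φ (p + 1) B (average μ μ' r : Measure Mass) := fun r =>
    moment_average (hmom r) (hmom' r)
  have hgr := growth_pos p B T
  rw [hS.difference hS' hp hpq hP hS'.toCoagKernel hmoma hC hf ht]
  refine intervalIntegral.integral_congr fun s hs => ?_
  rw [uIcc_of_le ht.1] at hs
  have hd := dom_propagator_growth hφ hp hP hS'.le hmoma hC hf hs.1 hs.2 ht.2
  set g := propagator K' (average μ μ') s t f with hg
  have hCg : 0 ≤ C * growth p B T := by positivity
  have hp0 : 0 ≤ p := by linarith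
  have hd2' := dom2_bracket hφ hp0 hCg hd hS'.kernDom
  have hd2 := dom2_bracket hφ hp0 hCg hd hS.kernDom
  have hLam : ∀ x, Lam K' (average μ μ' s) g x =
      (1 / 2 : ℝ) * (Lam K' (μ s) g x + Lam K' (μ' s) g x) := fun x =>
    integral_average s ((hd2'.section x).integrable hφ (hmom s))
      ((hd2'.section x).integrable hφ (hmom' s))
  have hLi : ∀ {α β : FiniteMeasure Mass}, Moment φ (p + 1) B (α : Measure Mass) →
      Moment φ (p + 1) B (β : Measure Mass) → Integrable (Lam K' (β : Measure Mass) g) α :=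
    fun hα hβ => (dom_Lam hφ hp0 hCg zero_le_one hd hS'.kernDom hβ).integrable hφ hα
  have e1 : ∫ x, Lam K' (average μ μ' s) g x ∂(μ' s : Measure Mass) = (1 / 2 : ℝ) *
      (∫ z, bracket g z.1 z.2 * K' z.1 z.2 ∂((μ' s : Measure Mass).prod (μ s : Measure Mass)) +
      coagulation K' (μ' s) g) := by
    simp only [hLam]
    rw [integral_const_mul, integral_add (hLi (hmom' s) (hmom s)) (hLi (hmom' s) (hmom' s)),
      integral_Lam hφ hp0 hCg hd hS'.kernDom (hmom' s) (hmom s),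
      integral_Lam hφ hp0 hCg hd hS'.kernDom (hmom' s) (hmom' s)]
    rfl
  have e2 : ∫ x, Lam K' (average μ μ' s) g x ∂(μ s : Measure Mass) = (1 / 2 : ℝ) *
      (∫ z, bracket g z.1 z.2 * K' z.1 z.2 ∂((μ s : Measure Mass).prod (μ s : Measure Mass)) +
      ∫ z, bracket g z.1 z.2 * K' z.1 z.2 ∂((μ' s : Measure Mass).prod (μ s : Measure Mass))) := by
    simp only [hLam]
    rw [integral_const_mul, integral_add (hLi (hmom s) (hmom s)) (hLi (hmom s) (hmom' s)),
      integral_Lam hφ hp0 hCg hd hS'.kernDom (hmom s) (hmom s),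
      integral_Lam hφ hp0 hCg hd hS'.kernDom (hmom s) (hmom' s),
      integral_bracket_symm (α := (μ s : Measure Mass)) (β := (μ' s : Measure Mass)) hS'.symm]
  have e3 : ∫ z, bracket g z.1 z.2 * (K' z.1 z.2 - K z.1 z.2)
      ∂((μ s : Measure Mass).prod (μ s : Measure Mass)) =
      ∫ z, bracket g z.1 z.2 * K' z.1 z.2 ∂((μ s : Measure Mass).prod (μ s : Measure Mass)) -
      coagulation K (μ s) g := by
    simp only [mul_sub]
    exact integral_sub (hd2'.integrable hφ (hmom s) (hmom s)) (hd2.integrable hφ (hmom s) (hmom s))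
  simp only [e1, e2, e3]
  ring

/-- The weighted distance of two kernels along a path. -/
def _root_.Smoluchowski.kernelDist (φ : Mass → ℝ) (p : ℝ) (K K' : Kern)
    (μ : ℝ → FiniteMeasure Mass) (T : ℝ) : ℝ :=
  ∫ s in (0 : ℝ)..T, ∫ z, wpow φ p z.1 * wpow φ p z.2 * |K' z.1 z.2 - K z.1 z.2|
    ∂((μ s : Measure Mass).prod (μ s : Measure Mass))

lemma dom2_kernel_difference (hS : MomentSolution φ q B K T μ₀ μ) (hK' : CoagKernel φ K') (p : ℝ) :
    Dom2 φ (p + 1) 1 (fun z => wpow φ p z.1 * wpow φ p z.2 * |K' z.1 z.2 - K z.1 z.2|) := by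
  have hφ := hS.weight
  refine ⟨(((hφ.measurable_wpow p).comp measurable_fst).mul
    ((hφ.measurable_wpow p).comp measurable_snd)).mul (hK'.measurable.sub hS.measurable).abs,
    fun x y => ?_⟩
  have h1 : |K' x y - K x y| ≤ φ x * φ y := abs_sub_le_of_nonneg_of_le (hK'.nonneg x y) (hK'.le x y)
    (hS.nonneg x y) (hS.le x y)
  have hx := hφ.wpow_nonneg p x
  have hy := hφ.wpow_nonneg p y
  rw [abs_mul, abs_abs, abs_of_nonneg (mul_nonneg hx hy), hφ.wpow_add_one, hφ.wpow_add_one]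
  calc _ ≤ wpow φ p x * wpow φ p y * (φ x * φ y) :=
        mul_le_mul_of_nonneg_left h1 (by positivity)
    _ = _ := by ring

lemma abs_difference_le (hS : MomentSolution φ q B K T μ₀ μ)
    (hS' : MomentSolution φ q B K' T μ₀ μ') (hp : 1 ≤ p) (hpq : p + 2 ≤ q)
    (hR : ∀ r, Moment φ (p + 1) R (μ r : Measure Mass))
    (hR' : ∀ r, Moment φ (p + 1) R (μ' r : Measure Mass)) (ht : t ∈ Icc 0 T) :
    Near φ p (growth p R T * bconst p * kernelDist φ p K K' μ T)
      (μ' t : Measure Mass) (μ t : Measure Mass) := by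
  intro C hC f hf
  have hφ := hS.weight
  have hP := hS.coagPath_average hS' (by linarith) hS'.toCoagKernel
  have hgr := growth_pos p R T
  have hb := bconst_pos p
  rw [hS.difference_average hS' hp hpq hC hf ht]
  have hdk := hS.dom2_kernel_difference hS'.toCoagKernel p
  set Ψ : ℝ → ℝ := fun s => ∫ z, wpow φ p z.1 * wpow φ p z.2 * |K' z.1 z.2 - K z.1 z.2|
    ∂((μ s : Measure Mass).prod (μ s : Measure Mass)) with hΨ
  have hΨ0 : ∀ s, 0 ≤ Ψ s := fun s => integral_nonneg fun z =>
    mul_nonneg (mul_nonneg (hφ.wpow_nonneg p _) (hφ.wpow_nonneg p _)) (abs_nonneg _)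
  have hΨI : IntervalIntegrable Ψ volume 0 T := by
    refine intervalIntegrable_of_bound ((hS.isMeasurablePath (by linarith)).measurable_integral_prod
      (α := ℝ) (F := fun _ z => wpow φ p z.1 * wpow φ p z.2 * |K' z.1 z.2 - K z.1 z.2|)
      (hdk.measurable.comp measurable_snd) measurable_id) hS.T_nonneg
      fun s _ => hdk.abs_integral_le hφ zero_le_one (hR s) (hR s)
  have hpt : ∀ s ∈ Ioc 0 t, ‖(1 / 2 : ℝ) * ∫ z, bracket (propagator K' (average μ μ') s t f) z.1 z.2 *
        (K' z.1 z.2 - K z.1 z.2) ∂((μ s : Measure Mass).prod (μ s : Measure Mass))‖ ≤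
        C * growth p R T * bconst p * Ψ s := by
    intro s hs
    have hd := dom_propagator_growth hφ hp hP hS'.le (fun r => moment_average (hR r) (hR' r)) hC hf
      hs.1.le hs.2 ht.2
    have h1 := norm_integral_le_of_norm_le (f := fun z : Mass × Mass =>
      bracket (propagator K' (average μ μ') s t f) z.1 z.2 * (K' z.1 z.2 - K z.1 z.2))
      (((hdk.integrable hφ (hR s) (hR s)).const_mul (C * growth p R T * bconst p)))
      (ae_of_all _ fun z => ?_)
    · rw [integral_const_mul] at h1
      rw [norm_mul]
      refine (mul_le_of_le_one_left (norm_nonneg _) (by norm_num)).trans h1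
    · rw [Real.norm_eq_abs, abs_mul, ← mul_assoc]
      exact mul_le_mul_of_nonneg_right (abs_bracket_le hφ (by linarith) (by positivity) hd.2 _ _)
        (abs_nonneg _)
  have hsub : IntervalIntegrable Ψ volume 0 t := hΨI.mono_set (by
    rw [uIcc_of_le hS.T_nonneg, uIcc_of_le ht.1]; exact Icc_subset_Icc_right ht.2)
  have h2 := intervalIntegral.norm_integral_le_of_norm_le ht.1
    (ae_of_all _ hpt) (hsub.const_mul (C * growth p R T * bconst p))
  have h3 : ∫ s in (0 : ℝ)..t, C * growth p R T * bconst p * Ψ s =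
      C * growth p R T * bconst p * ∫ s in (0 : ℝ)..t, Ψ s :=
    intervalIntegral.integral_const_mul _ _
  rw [h3, Real.norm_eq_abs] at h2
  refine h2.trans ?_
  rw [kernelDist, ← mul_assoc, ← mul_assoc]
  refine mul_le_mul_of_nonneg_left ?_ (by positivity)
  exact intervalIntegral.integral_mono_interval le_rfl ht.1 ht.2 (ae_of_all _ hΨ0) hΨI

/-- The integrand in the formula for the difference of two solutions along the propagator of the
first. -/
def _root_.Smoluchowski.selfForm (K K' : Kern) (μ μ' : ℝ → FiniteMeasure Mass) (t : ℝ)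
    (f : Mass → ℝ) (s : ℝ) : ℝ :=
  (1 / 2 : ℝ) * (∫ z, bracket (propagator K μ s t f) z.1 z.2 *
      (K' z.1 z.2 - K z.1 z.2) ∂((μ' s : Measure Mass).prod (μ' s : Measure Mass)) +
    ((∫ z, bracket (propagator K μ s t f) z.1 z.2 * K z.1 z.2
        ∂((μ' s : Measure Mass).prod (μ' s : Measure Mass)) -
      ∫ z, bracket (propagator K μ s t f) z.1 z.2 * K z.1 z.2
        ∂((μ' s : Measure Mass).prod (μ s : Measure Mass))) -
    (∫ z, bracket (propagator K μ s t f) z.1 z.2 * K z.1 z.2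
        ∂((μ s : Measure Mass).prod (μ' s : Measure Mass)) -
      ∫ z, bracket (propagator K μ s t f) z.1 z.2 * K z.1 z.2
        ∂((μ s : Measure Mass).prod (μ s : Measure Mass)))))

/-- The difference of two solutions, along the propagator of the first. -/
lemma difference_self (hS : MomentSolution φ q B K T μ₀ μ)
    (hS' : MomentSolution φ q B K' T μ₀ μ') (hp : 1 ≤ p) (hpq : p + 2 ≤ q) (hC : 0 ≤ C)
    (hf : Dom (wpow φ p) C f) (ht : t ∈ Icc 0 T) :
    IntervalIntegrable (selfForm K K' μ μ' t f) volume 0 t ∧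
    ∫ x, f x ∂(μ' t : Measure Mass) - ∫ x, f x ∂(μ t : Measure Mass) =
      ∫ s in (0 : ℝ)..t, selfForm K K' μ μ' t f s := by
  have hφ := hS.weight
  have hP := hS.coagPath (by linarith) hS.toCoagKernel
  have hmom : ∀ r, Moment φ (p + 1) B (μ r : Measure Mass) := fun r =>
    (hS.moment r).mono hφ (by linarith)
  have hmom' : ∀ r, Moment φ (p + 1) B (μ' r : Measure Mass) := fun r =>
    (hS'.moment r).mono hφ (by linarith)
  have hgr := growth_pos p B T
  have hI := (hS'.intervalIntegrable_test hp hpq hP hS.toCoagKernel hmom hC hf ht).sub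
    (hS.intervalIntegrable_test hp hpq hP hS.toCoagKernel hmom hC hf ht)
  rw [hS.difference hS' hp hpq hP hS.toCoagKernel hmom hC hf ht]
  suffices h : ∀ s ∈ Icc 0 t, ((1 / 2 : ℝ) * coagulation K' (μ' s) (propagator K μ s t f) -
      ∫ x, Lam K (μ s) (propagator K μ s t f) x ∂(μ' s : Measure Mass)) -
      ((1 / 2 : ℝ) * coagulation K (μ s) (propagator K μ s t f) -
      ∫ x, Lam K (μ s) (propagator K μ s t f) x ∂(μ s : Measure Mass)) =
      selfForm K K' μ μ' t f s by
    refine ⟨hI.congr fun s hs => ?_, intervalIntegral.integral_congr fun s hs => ?_⟩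
    · rw [uIoc_of_le ht.1] at hs
      exact h s ⟨hs.1.le, hs.2⟩
    · rw [uIcc_of_le ht.1] at hs
      exact h s hs
  intro s hs
  rw [selfForm]
  have hd := dom_propagator_growth hφ hp hP hS.le hmom hC hf hs.1 hs.2 ht.2
  set g := propagator K μ s t f with hg
  have hCg : 0 ≤ C * growth p B T := by positivity
  have hp0 : 0 ≤ p := by linarith
  have hd2' := dom2_bracket hφ hp0 hCg hd hS'.kernDom
  have hd2 := dom2_bracket hφ hp0 hCg hd hS.kernDom
  have e3 : ∫ z, bracket g z.1 z.2 * (K' z.1 z.2 - K z.1 z.2)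
      ∂((μ' s : Measure Mass).prod (μ' s : Measure Mass)) = coagulation K' (μ' s) g -
      ∫ z, bracket g z.1 z.2 * K z.1 z.2 ∂((μ' s : Measure Mass).prod (μ' s : Measure Mass)) := by
    simp only [mul_sub]
    exact integral_sub (hd2'.integrable hφ (hmom' s) (hmom' s))
      (hd2.integrable hφ (hmom' s) (hmom' s))
  simp only [e3, integral_Lam hφ hp0 hCg hd hS.kernDom (hmom' s) (hmom s),
    integral_Lam hφ hp0 hCg hd hS.kernDom (hmom s) (hmom s),
    integral_bracket_symm (α := (μ s : Measure Mass)) (β := (μ' s : Measure Mass)) hS.symm]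
  simp only [coagulation]
  ring

end MomentSolution

end

/-! ### Functionals given by signed measures -/

/-- A linear functional on the functions bounded by a multiple of `w`, of norm at most `a`, that is
continuous under dominated convergence. -/
structure DualFunctional (w : Mass → ℝ) (a : ℝ) (F : (Mass → ℝ) → ℝ) : Prop where
  add : ∀ C C' f g, 0 ≤ C → 0 ≤ C' → Dom w C f → Dom w C' g →
    F (fun x => f x + g x) = F f + F g
  smul : ∀ (c C : ℝ) f, 0 ≤ C → Dom w C f → F (fun x => c * f x) = c * F f
  bound : ∀ C f, 0 ≤ C → Dom w C f → |F f| ≤ C * a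
  tendsto : ∀ C (f : ℕ → Mass → ℝ) g, 0 ≤ C → (∀ n, Dom w C (f n)) →
    (∀ x, Tendsto (fun n => f n x) atTop (𝓝 (g x))) → Tendsto (fun n => F (f n)) atTop (𝓝 (F g))

lemma Dom.of_tendsto {w : Mass → ℝ} {C : ℝ} {f : ℕ → Mass → ℝ} {g : Mass → ℝ}
    (hf : ∀ n, Dom w C (f n)) (h : ∀ x, Tendsto (fun n => f n x) atTop (𝓝 (g x))) : Dom w C g :=
  ⟨measurable_of_tendsto_metrizable (fun n => (hf n).1) (tendsto_pi_nhds.2 h), fun x =>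
    le_of_tendsto (h x).abs (Eventually.of_forall fun n => (hf n).2 x)⟩

lemma Dom.const_mul {w : Mass → ℝ} {C : ℝ} {f : Mass → ℝ} (hf : Dom w C f) (c : ℝ) :
    Dom w (|c| * C) (fun x => c * f x) :=
  ⟨hf.1.const_mul c, fun x => by
    rw [abs_mul, mul_assoc]; exact mul_le_mul_of_nonneg_left (hf.2 x) (abs_nonneg c)⟩

lemma Dom.indicator {w : Mass → ℝ} {C : ℝ} {f : Mass → ℝ} (hf : Dom w C f) {A : Set Mass}
    (hA : MeasurableSet A) : Dom w C (A.indicator f) :=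
  ⟨hf.1.indicator hA, fun x => by
    by_cases hx : x ∈ A
    · rw [indicator_of_mem hx]; exact hf.2 x
    · rw [indicator_of_notMem hx, abs_zero]; exact (abs_nonneg _).trans (hf.2 x)⟩

lemma dom_one {w : Mass → ℝ} (hw : ∀ x, 1 ≤ w x) : Dom w 1 (fun _ => 1) :=
  ⟨measurable_const, fun x => by rw [abs_one, one_mul]; exact hw x⟩

namespace DualFunctional

variable {w w' : Mass → ℝ} {a b C : ℝ} {F G : (Mass → ℝ) → ℝ} {f : Mass → ℝ}

lemma sub_apply (hF : DualFunctional w a F) {C' : ℝ} (hC : 0 ≤ C) (hC' : 0 ≤ C') {g : Mass → ℝ}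
    (hf : Dom w C f) (hg : Dom w C' g) : F (fun x => f x - g x) = F f - F g := by
  have h1 := hF.add C (|(-1 : ℝ)| * C') f (fun x => (-1) * g x) hC (by positivity) hf
    (hg.const_mul (-1))
  rw [hF.smul (-1) C' g hC' hg] at h1
  have h2 : (fun x => f x - g x) = fun x => f x + (-1) * g x := by ext x; ring
  rw [h2, h1]; ring

lemma sub (hF : DualFunctional w a F) (hG : DualFunctional w b G) :
    DualFunctional w (a + b) (fun f => F f - G f) where
  add C C' f g hC hC' hf hg := by
    rw [hF.add C C' f g hC hC' hf hg, hG.add C C' f g hC hC' hf hg]; ring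
  smul c C f hC hf := by rw [hF.smul c C f hC hf, hG.smul c C f hC hf]; ring
  bound C f hC hf := (abs_sub _ _).trans (by
    have := hF.bound C f hC hf; have := hG.bound C f hC hf; linarith)
  tendsto C f g hC hf h := (hF.tendsto C f g hC hf h).sub (hG.tendsto C f g hC hf h)

lemma of_bound (hF : DualFunctional w a F) (h : ∀ C f, 0 ≤ C → Dom w C f → |F f| ≤ C * b) :
    DualFunctional w b F :=
  { hF with bound := h }

lemma mono (hF : DualFunctional w a F) (hw : ∀ x, w' x ≤ w x) : DualFunctional w' a F := by
  have h : ∀ {C : ℝ} {f : Mass → ℝ}, 0 ≤ C → Dom w' C f → Dom w C f := fun hC hf =>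
    ⟨hf.1, fun x => (hf.2 x).trans (mul_le_mul_of_nonneg_left (hw x) hC)⟩
  exact ⟨fun C C' f g hC hC' hf hg => hF.add C C' f g hC hC' (h hC hf) (h hC' hg),
    fun c C f hC hf => hF.smul c C f hC (h hC hf), fun C f hC hf => hF.bound C f hC (h hC hf),
    fun C f g hC hf hl => hF.tendsto C f g hC (fun n => h hC (hf n)) hl⟩

lemma map_zero (hF : DualFunctional w a F) : F (fun _ => 0) = 0 := by
  have h : Dom w 0 (fun _ => (0 : ℝ)) := ⟨measurable_const, fun x => by simp⟩
  have := hF.bound 0 _ le_rfl h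
  rw [zero_mul] at this
  exact abs_eq_zero.1 (le_antisymm this (abs_nonneg _))

/-- Multiplication by an indicator function. -/
lemma indicator (hF : DualFunctional w a F) {A : Set Mass} (hA : MeasurableSet A) :
    DualFunctional w a (fun f => F (A.indicator f)) where
  add C C' f g hC hC' hf hg := by
    rw [← hF.add C C' _ _ hC hC' (hf.indicator hA) (hg.indicator hA)]
    congr 1
    exact indicator_add A f g
  smul c C f hC hf := by
    rw [← hF.smul c C _ hC (hf.indicator hA)]
    congr 1
    ext x
    by_cases hx : x ∈ A <;> simp [hx]
  bound C f hC hf := hF.bound C _ hC (hf.indicator hA)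
  tendsto C f g hC hf h := hF.tendsto C _ _ hC (fun n => (hf n).indicator hA) fun x => by
    by_cases hx : x ∈ A
    · simpa only [indicator_of_mem hx] using h x
    · simpa only [indicator_of_notMem hx] using tendsto_const_nhds

lemma of_integral {α : Measure Mass} (hα : Integrable w α) (ha : ∫ x, w x ∂α ≤ a) :
    DualFunctional w a (fun f => ∫ x, f x ∂α) where
  add C C' f g hC hC' hf hg := integral_add
    ((hα.const_mul C).mono' hf.1.aestronglyMeasurable (ae_of_all _ hf.2))
    ((hα.const_mul C').mono' hg.1.aestronglyMeasurable (ae_of_all _ hg.2))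
  smul c C f _ _ := integral_const_mul c f
  bound C f hC hf := by
    have h1 := norm_integral_le_of_norm_le (f := f) (hα.const_mul C) (ae_of_all _ hf.2)
    rw [integral_const_mul, Real.norm_eq_abs] at h1
    exact h1.trans (mul_le_mul_of_nonneg_left ha hC)
  tendsto C f g hC hf h := tendsto_integral_of_dominated_convergence (fun x => C * w x)
    (fun n => (hf n).1.aestronglyMeasurable) (hα.const_mul C) (fun n => ae_of_all _ (hf n).2)
    (ae_of_all _ h)

section PositiveMeasure

variable {α : Measure Mass} [IsFiniteMeasure α]

lemma exists_dom_simpleFunc (hw : ∀ x, 1 ≤ w x) (s : SimpleFunc Mass ℝ) :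
    ∃ C, 0 ≤ C ∧ Dom w C s := by
  obtain ⟨C, hC⟩ := s.exists_forall_norm_le
  refine ⟨max C 0, le_max_right _ _, s.measurable, fun x => (hC x).trans ?_⟩
  calc C ≤ max C 0 * 1 := by rw [mul_one]; exact le_max_left _ _
    _ ≤ _ := mul_le_mul_of_nonneg_left (hw x) (le_max_right _ _)

lemma integral_simpleFunc_eq (hG : DualFunctional w a G) (hw : ∀ x, 1 ≤ w x)
    (hα : ∀ A, MeasurableSet A → α.real A = G (A.indicator fun _ => 1)) (s : SimpleFunc Mass ℝ) :
    ∫ x, s x ∂α = G s := by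
  induction s using SimpleFunc.induction with
  | const c hs =>
    rename_i A
    have h1 : ⇑(SimpleFunc.piecewise A hs (SimpleFunc.const _ c) (SimpleFunc.const _ 0)) =
        fun x => c * A.indicator (fun _ => (1 : ℝ)) x := by
      ext x
      by_cases hx : x ∈ A <;> simp [hx]
    rw [h1, hG.smul c 1 _ zero_le_one ((dom_one hw).indicator hs), integral_const_mul, ← hα A hs,
      integral_indicator hs]
    simp
  | add _ hf hg =>
    rename_i f g _
    obtain ⟨C, hC, hfC⟩ := exists_dom_simpleFunc hw f
    obtain ⟨C', hC', hgC⟩ := exists_dom_simpleFunc hw g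
    have h1 : ⇑(f + g) = fun x => f x + g x := rfl
    rw [h1, hG.add C C' _ _ hC hC' hfC hgC, integral_add (f.integrable_of_isFiniteMeasure)
      (g.integrable_of_isFiniteMeasure), hf, hg]

lemma lintegral_enorm_le (hG : DualFunctional w a G) (hw : ∀ x, 1 ≤ w x)
    (hα : ∀ A, MeasurableSet A → α.real A = G (A.indicator fun _ => 1)) (hC : 0 ≤ C)
    (hf : Dom w C f) : ∫⁻ x, ‖f x‖ₑ ∂α ≤ ENNReal.ofReal (G fun x => |f x|) := by
  set s := SimpleFunc.approxOn f hf.1 univ 0 (mem_univ _) with hs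
  have hlim : ∀ x, Tendsto (fun n => s n x) atTop (𝓝 (f x)) := fun x =>
    SimpleFunc.tendsto_approxOn hf.1 (mem_univ _) (by simp)
  have hd : ∀ n, Dom w (2 * C) (fun x => |s n x|) := fun n =>
    ⟨(s n).measurable.abs, fun x => by
      rw [abs_abs]
      have := SimpleFunc.norm_approxOn_zero_le hf.1 (mem_univ _) x n
      have h2 := hf.2 x
      rw [Real.norm_eq_abs, Real.norm_eq_abs] at this
      exact this.trans (by linarith)⟩
  have h1 : ∀ n, ∫⁻ x, ‖s n x‖ₑ ∂α = ENNReal.ofReal (G fun x => |s n x|) := fun n => by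
    have h2 := integral_simpleFunc_eq hG hw hα ((s n).map fun y => |y|)
    have h3 : ⇑((s n).map fun y => |y|) = fun x => |s n x| := rfl
    rw [h3] at h2
    rw [← h2, ofReal_integral_eq_lintegral_ofReal
      ((s n).integrable_of_isFiniteMeasure.abs) (ae_of_all _ fun x => abs_nonneg _)]
    refine lintegral_congr fun x => ?_
    rw [← Real.enorm_abs, Real.enorm_eq_ofReal (abs_nonneg _)]
  have h2 : Tendsto (fun n => ∫⁻ x, ‖s n x‖ₑ ∂α) atTop (𝓝 (ENNReal.ofReal (G fun x => |f x|))) := by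
    simp only [h1]
    exact (ENNReal.continuous_ofReal.tendsto _).comp
      (hG.tendsto (2 * C) _ _ (by positivity) hd fun x => (hlim x).abs)
  calc ∫⁻ x, ‖f x‖ₑ ∂α = ∫⁻ x, liminf (fun n => ‖s n x‖ₑ) atTop ∂α :=
        lintegral_congr fun x => ((hlim x).enorm.liminf_eq).symm
    _ ≤ liminf (fun n => ∫⁻ x, ‖s n x‖ₑ ∂α) atTop :=
        lintegral_liminf_le fun n => (s n).measurable.enorm
    _ = _ := h2.liminf_eq

lemma integral_eq (hG : DualFunctional w a G) (hw : ∀ x, 1 ≤ w x) (hwm : Measurable w)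
    (hα : ∀ A, MeasurableSet A → α.real A = G (A.indicator fun _ => 1)) (hC : 0 ≤ C)
    (hf : Dom w C f) : ∫ x, f x ∂α = G f := by
  have hwd : Dom w 1 w := ⟨hwm, fun x => by
    rw [one_mul, abs_of_nonneg (zero_le_one.trans (hw x))]⟩
  have hwi : Integrable w α := ⟨hwm.aestronglyMeasurable,
    (hG.lintegral_enorm_le hw hα zero_le_one hwd).trans_lt ENNReal.ofReal_lt_top⟩
  set s := SimpleFunc.approxOn f hf.1 univ 0 (mem_univ _) with hs
  have hlim : ∀ x, Tendsto (fun n => s n x) atTop (𝓝 (f x)) := fun x =>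
    SimpleFunc.tendsto_approxOn hf.1 (mem_univ _) (by simp)
  have hd : ∀ n, Dom w (2 * C) (s n) := fun n =>
    ⟨(s n).measurable, fun x => by
      have := SimpleFunc.norm_approxOn_zero_le hf.1 (mem_univ _) x n
      have h2 := hf.2 x
      rw [Real.norm_eq_abs, Real.norm_eq_abs] at this
      exact this.trans (by linarith)⟩
  have h1 := hG.tendsto (2 * C) _ _ (by positivity) hd hlim
  have h2 := (of_integral hwi le_rfl).tendsto (2 * C) _ _ (by positivity) hd hlim
  simp only [integral_simpleFunc_eq hG hw hα] at h2
  exact tendsto_nhds_unique h2 h1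

end PositiveMeasure

/-- The signed measure of a functional. -/
def toSignedMeasure (hF : DualFunctional w a F) (hw : ∀ x, 1 ≤ w x) : SignedMeasure Mass where
  measureOf' A := by
    classical exact if MeasurableSet A then F (A.indicator fun _ => 1) else 0
  empty' := by
    rw [if_pos MeasurableSet.empty, indicator_empty]
    exact hF.map_zero
  not_measurable' A hA := if_neg hA
  m_iUnion' A hA hdisj := by
    rw [if_pos (MeasurableSet.iUnion hA)]
    simp only [if_pos (hA _)]
    have hfin : ∀ S : Finset ℕ, ∑ i ∈ S, F ((A i).indicator fun _ => 1) =
        F ((⋃ i ∈ S, A i).indicator fun _ => 1) := by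
      intro S
      induction S using Finset.induction_on with
      | empty =>
        simp only [Finset.sum_empty, Finset.notMem_empty, iUnion_of_empty, iUnion_empty,
          indicator_empty]
        exact hF.map_zero.symm
      | insert i S hi ih =>
        have hm : MeasurableSet (⋃ j ∈ S, A j) := S.measurableSet_biUnion fun j _ => hA j
        rw [Finset.sum_insert hi, ih, ← hF.add 1 1 _ _ zero_le_one zero_le_one
          ((dom_one hw).indicator (hA i)) ((dom_one hw).indicator hm), Finset.set_biUnion_insert]
        have hd : Disjoint (A i) (⋃ j ∈ S, A j) := by
          simp only [disjoint_iUnion_right]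
          exact fun j hj => hdisj (fun h => hi (h ▸ hj))
        rw [indicator_union_of_disjoint hd]
    refine tendsto_of_seq_tendsto fun S hS => ?_
    simp only [Function.comp_def, hfin]
    rw [SummationFilter.unconditional_filter] at hS
    refine hF.tendsto 1 _ _ zero_le_one (fun n => (dom_one hw).indicator
      ((S n).measurableSet_biUnion fun j _ => hA j)) fun x => ?_
    refine tendsto_const_nhds.congr' ?_
    by_cases hx : x ∈ ⋃ i, A i
    · obtain ⟨i, hi⟩ := mem_iUnion.1 hx
      filter_upwards [hS.eventually_ge_atTop {i}] with n hn
      have : x ∈ ⋃ j ∈ S n, A j := mem_biUnion (Finset.singleton_subset_iff.1 hn) hi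
      rw [indicator_of_mem hx, indicator_of_mem this]
    · refine Eventually.of_forall fun n => ?_
      have : x ∉ ⋃ j ∈ S n, A j := fun h => hx (by
        simp only [mem_iUnion] at h ⊢
        obtain ⟨j, _, hj⟩ := h
        exact ⟨j, hj⟩)
      dsimp only
      rw [indicator_of_notMem hx, indicator_of_notMem this]

lemma toSignedMeasure_apply (hF : DualFunctional w a F) (hw : ∀ x, 1 ≤ w x) {A : Set Mass}
    (hA : MeasurableSet A) : hF.toSignedMeasure hw A = F (A.indicator fun _ => 1) :=
  if_pos hA

section

variable {ρ : SignedMeasure Mass}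

/-- The Jordan decomposition in terms of the functional. -/
lemma exists_jordan (hF : DualFunctional w a F) (hw : ∀ x, 1 ≤ w x) (hwm : Measurable w)
    (hρ : ∀ A, MeasurableSet A → ρ A = F (A.indicator fun _ => 1)) :
    ∃ A : Set Mass, MeasurableSet A ∧
      (∀ C f, 0 ≤ C → Dom w C f →
        ∫ x, f x ∂ρ.toJordanDecomposition.posPart = F (A.indicator f) ∧
        ∫ x, f x ∂ρ.toJordanDecomposition.negPart = -F (Aᶜ.indicator f)) ∧
      ∫⁻ x, ENNReal.ofReal (w x) ∂ρ.toJordanDecomposition.posPart ≤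
        ENNReal.ofReal (F (A.indicator w)) ∧
      ∫⁻ x, ENNReal.ofReal (w x) ∂ρ.toJordanDecomposition.negPart ≤
        ENNReal.ofReal (-F (Aᶜ.indicator w)) ∧
      0 ≤ F (A.indicator w) ∧ F (Aᶜ.indicator w) ≤ 0 := by
  obtain ⟨A, hA, hp, hn, e1, e2⟩ := ρ.toJordanDecomposition_spec
  have hw0 : ∀ x, 0 ≤ w x := fun x => zero_le_one.trans (hw x)
  have hP := hF.indicator hA
  have hN : DualFunctional w a (fun f => -F (Aᶜ.indicator f)) := by
    have h := hF.indicator hA.compl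
    refine ⟨fun C C' f g hC hC' hf hg => ?_, fun c C f hC hf => ?_, fun C f hC hf => ?_,
      fun C f g hC hf hl => (h.tendsto C f g hC hf hl).neg⟩
    · rw [h.add C C' f g hC hC' hf hg]; ring
    · rw [h.smul c C f hC hf]; ring
    · rw [abs_neg]; exact h.bound C f hC hf
  have hPα : ∀ B, MeasurableSet B → ρ.toJordanDecomposition.posPart.real B =
      F (A.indicator (B.indicator fun _ => 1)) := fun B hB => by
    rw [e1, SignedMeasure.toMeasureOfZeroLE_real_apply _ hp hA hB, hρ _ (hA.inter hB),
      indicator_indicator]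
  have hNα : ∀ B, MeasurableSet B → ρ.toJordanDecomposition.negPart.real B =
      -F (Aᶜ.indicator (B.indicator fun _ => 1)) := fun B hB => by
    rw [e2, SignedMeasure.toMeasureOfLEZero_real_apply _ hn hA.compl hB, hρ _ (hA.compl.inter hB),
      indicator_indicator]
  have hwd : Dom w 1 w := ⟨hwm, fun x => by rw [one_mul, abs_of_nonneg (hw0 x)]⟩
  have habs : (fun x => |w x|) = w := funext fun x => abs_of_nonneg (hw0 x)
  have hen : ∀ x, ‖w x‖ₑ = ENNReal.ofReal (w x) := fun x => Real.enorm_eq_ofReal (hw0 x)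
  have l1 := hP.lintegral_enorm_le hw hPα zero_le_one hwd
  have l2 := hN.lintegral_enorm_le hw hNα zero_le_one hwd
  simp only [habs, hen] at l1 l2
  have p1 := hP.integral_eq hw hwm hPα zero_le_one hwd
  have p2 := hN.integral_eq hw hwm hNα zero_le_one hwd
  refine ⟨A, hA, fun C f hC hf => ⟨hP.integral_eq hw hwm hPα hC hf,
    hN.integral_eq hw hwm hNα hC hf⟩, l1, l2, ?_, ?_⟩
  · rw [← p1]; exact integral_nonneg hw0
  · rw [← neg_nonneg, ← p2]; exact integral_nonneg hw0

lemma pairing_eq (hF : DualFunctional w a F) (hw : ∀ x, 1 ≤ w x) (hwm : Measurable w)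
    (hρ : ∀ A, MeasurableSet A → ρ A = F (A.indicator fun _ => 1)) (hC : 0 ≤ C) (hf : Dom w C f) :
    pairing f ρ = F f := by
  obtain ⟨A, hA, h, -⟩ := hF.exists_jordan hw hwm hρ
  obtain ⟨h1, h2⟩ := h C f hC hf
  rw [pairing, h1, h2, sub_neg_eq_add, ← hF.add C C _ _ hC hC (hf.indicator hA)
    (hf.indicator hA.compl)]
  congr 1
  exact indicator_self_add_compl A f

lemma lintegral_totalVariation_le (hF : DualFunctional w a F) (hw : ∀ x, 1 ≤ w x)
    (hwm : Measurable w) (hρ : ∀ A, MeasurableSet A → ρ A = F (A.indicator fun _ => 1)) :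
    ∫⁻ x, ENNReal.ofReal (w x) ∂ρ.totalVariation ≤ ENNReal.ofReal a := by
  obtain ⟨A, hA, -, l1, l2, s1, s2⟩ := hF.exists_jordan hw hwm hρ
  have hw0 : ∀ x, 0 ≤ w x := fun x => zero_le_one.trans (hw x)
  have hwd : Dom w 1 w := ⟨hwm, fun x => by rw [one_mul, abs_of_nonneg (hw0 x)]⟩
  rw [SignedMeasure.totalVariation, lintegral_add_measure]
  refine (add_le_add l1 l2).trans ?_
  rw [← ENNReal.ofReal_add s1 (neg_nonneg.2 s2), ← sub_eq_add_neg,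
    ← hF.sub_apply zero_le_one zero_le_one (hwd.indicator hA) (hwd.indicator hA.compl)]
  refine ENNReal.ofReal_le_ofReal ((le_abs_self _).trans ?_)
  refine (hF.bound 1 _ zero_le_one ⟨(hwm.indicator hA).sub (hwm.indicator hA.compl), fun x => ?_⟩).trans
    (one_mul a).le
  by_cases hx : x ∈ A <;> simp [hx, abs_of_nonneg (hw0 x)]

end

end DualFunctional

section

variable {φ : Mass → ℝ} {p a : ℝ} {F : (Mass → ℝ) → ℝ} {ρ : SignedMeasure Mass}

lemma normM_mono (hφ : IsWeight φ) {q : ℝ} (hpq : p ≤ q) : normM φ p ρ ≤ normM φ q ρ :=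
  lintegral_mono fun x => ENNReal.ofReal_le_ofReal (hφ.wpow_mono hpq x)

lemma DualFunctional.normM_le (hF : DualFunctional (wpow φ p) a F) (hφ : IsWeight φ) (hp : 0 ≤ p)
    (hρ : ∀ A, MeasurableSet A → ρ A = F (A.indicator fun _ => 1)) :
    normM φ p ρ ≤ ENNReal.ofReal a :=
  hF.lintegral_totalVariation_le (hφ.one_le_wpow hp) (hφ.measurable_wpow p) hρ

lemma DualFunctional.normTV_le (hF : DualFunctional (fun _ => 1) a F) (ha : 0 ≤ a)
    (hρ : ∀ A, MeasurableSet A → ρ A = F (A.indicator fun _ => 1)) : normTV ρ ≤ a := by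
  have := hF.lintegral_totalVariation_le (fun _ => le_rfl) measurable_const hρ
  rw [ENNReal.ofReal_one, lintegral_one] at this
  exact ENNReal.toReal_le_of_le_ofReal ha this

lemma MemB.exists_dom (hφ : IsWeight φ) {f : Mass → ℝ} (hf : MemB φ p f) :
    ∃ C, 0 ≤ C ∧ Dom (wpow φ p) C f := by
  obtain ⟨C, hC⟩ := hf.2
  refine ⟨max C 0, le_max_right _ _, hf.1, fun x => (hC x).trans ?_⟩
  exact mul_le_mul_of_nonneg_right (le_max_left _ _) (hφ.wpow_nonneg p x)

lemma Dom.memB {f : Mass → ℝ} {C : ℝ} (hf : Dom (wpow φ p) C f) : MemB φ p f := ⟨hf.1, C, hf.2⟩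

end

/-! ### The sensitivity functional -/

/-- `1/2 ∫_0^t (Λ^∂_s U_{s,t} f, μ_s) ds`. -/
def sensitivity (K G : Kern) (μ : ℝ → FiniteMeasure Mass) (t : ℝ) (f : Mass → ℝ) : ℝ :=
  (1 / 2 : ℝ) * ∫ s in (0 : ℝ)..t, sensIntegrand K G μ t f s

section

variable {K G G' : Kern} {T : ℝ} {μ₀ : FiniteMeasure Mass} {μ : ℝ → FiniteMeasure Mass}
  {φ : Mass → ℝ} {p q C D D' : ℝ} {B R : ℝ≥0} {f : Mass → ℝ} {t : ℝ}

namespace MomentSolution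

lemma dom_propagator (hS : MomentSolution φ q B K T μ₀ μ) (hp : 1 ≤ p) (hpq : p + 1 ≤ q)
    (hq : 2 ≤ q) (hC : 0 ≤ C) (hf : Dom (wpow φ p) C f) {s : ℝ} (hs : s ∈ Icc 0 t) (htT : t ≤ T) :
    Dom (wpow φ p) (C * growth p B T) (propagator K μ s t f) :=
  dom_propagator_growth hS.weight hp (hS.coagPath hq hS.toCoagKernel) hS.le
    (fun r => (hS.moment r).mono hS.weight hpq) hC hf hs.1 hs.2 htT

/-- The integrand as a bilinear form. -/
lemma sensIntegrand_eq (hS : MomentSolution φ q B K T μ₀ μ) (hp : 1 ≤ p) (hpq : p + 1 ≤ q)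
    (hG : KernDom φ D G) (hC : 0 ≤ C) (hf : Dom (wpow φ p) C f) {s : ℝ} (hs : s ∈ Icc 0 t)
    (htT : t ≤ T) : sensIntegrand K G μ t f s =
      ∫ z, bracket (propagator K μ s t f) z.1 z.2 * G z.1 z.2
        ∂((μ s : Measure Mass).prod (μ s : Measure Mass)) := by
  have hgr := growth_pos p B T
  have hm := (hS.moment s).mono hS.weight hpq
  exact integral_Lam hS.weight (by linarith) (by positivity)
    (hS.dom_propagator hp hpq (by linarith) hC hf hs htT) hG hm hm

lemma measurable_sensIntegrand (hS : MomentSolution φ q B K T μ₀ μ) (hq : 2 ≤ q)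
    (hG : Measurable fun z : Mass × Mass => G z.1 z.2) (hf : Measurable f) (t : ℝ) :
    Measurable (sensIntegrand K G μ t f) :=
  (hS.isMeasurablePath (by linarith)).measurable_integral (α := ℝ)
    (F := fun s => Lam G (μ s) (propagator K μ s t f)) (CoagPath.measurable_Lam
      (g := fun s => propagator K μ s t f) (hS.isMeasurablePath (by linarith)) hG
      ((hS.coagPath hq hS.toCoagKernel).measurable_propagator hf t)) measurable_id

lemma abs_sensIntegrand_le (hS : MomentSolution φ q B K T μ₀ μ) (hp : 1 ≤ p) (hpq : p + 1 ≤ q)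
    (hD : 0 ≤ D) (hG : KernDom φ D G) (hC : 0 ≤ C) (hf : Dom (wpow φ p) C f) {s : ℝ}
    (hs : s ∈ Icc 0 t) (htT : t ≤ T) :
    |sensIntegrand K G μ t f s| ≤ C * growth p B T * bconst p * D * (B * B) := by
  have hgr := growth_pos p B T
  have hm := (hS.moment s).mono hS.weight hpq
  rw [hS.sensIntegrand_eq hp hpq hG hC hf hs htT]
  exact abs_integral_bracket_le hS.weight (by linarith) (by positivity) hD
    (hS.dom_propagator hp hpq (by linarith) hC hf hs htT) hG hm hm

lemma intervalIntegrable_sensIntegrand (hS : MomentSolution φ q B K T μ₀ μ) (hp : 1 ≤ p)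
    (hpq : p + 1 ≤ q) (hD : 0 ≤ D) (hG : KernDom φ D G) (hC : 0 ≤ C) (hf : Dom (wpow φ p) C f)
    (ht : t ∈ Icc 0 T) : IntervalIntegrable (sensIntegrand K G μ t f) volume 0 t :=
  intervalIntegrable_of_bound (hS.measurable_sensIntegrand (by linarith) hG.measurable hf.1 t) ht.1
    fun _ hs => hS.abs_sensIntegrand_le hp hpq hD hG hC hf ⟨hs.1.le, hs.2⟩ ht.2

lemma sensIntegrand_add (hS : MomentSolution φ q B K T μ₀ μ) (hp : 1 ≤ p) (hpq : p + 1 ≤ q)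
    (hG : KernDom φ D G) {C' : ℝ} {g : Mass → ℝ} (hC : 0 ≤ C) (hC' : 0 ≤ C')
    (hf : Dom (wpow φ p) C f) (hg : Dom (wpow φ p) C' g) {s : ℝ} (hs : s ∈ Icc 0 t) (htT : t ≤ T) :
    sensIntegrand K G μ t (fun x => f x + g x) s =
      sensIntegrand K G μ t f s + sensIntegrand K G μ t g s := by
  have hφ := hS.weight
  have hP := hS.coagPath (by linarith) hS.toCoagKernel
  have hw := lyap_wpow hφ hp hP hS.le fun r => (hS.moment r).mono hφ hpq
  have hm := (hS.moment s).mono hφ hpq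
  have hgr := growth_pos p B T
  rw [hS.sensIntegrand_eq hp hpq hG (add_nonneg hC hC') (by
      have := hf.add hg
      exact this) hs htT,
    hS.sensIntegrand_eq hp hpq hG hC hf hs htT, hS.sensIntegrand_eq hp hpq hG hC' hg hs htT,
    ← integral_add]
  · refine integral_congr_ae (ae_of_all _ fun z => ?_)
    simp only [bracket, hw.propagator_add hP hC hC' hf hg hs.2]
    ring
  · exact integrable_bracket hφ (by linarith) (by positivity)
      (hS.dom_propagator hp hpq (by linarith) hC hf hs htT) hG hm hm
  · exact integrable_bracket hφ (by linarith) (by positivity)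
      (hS.dom_propagator hp hpq (by linarith) hC' hg hs htT) hG hm hm

lemma sensIntegrand_const_mul (a : ℝ) (f : Mass → ℝ) (s : ℝ) :
    sensIntegrand K G μ t (fun x => a * f x) s = a * sensIntegrand K G μ t f s := by
  have h1 : propagator K μ s t (fun x => a * f x) = fun x => a * propagator K μ s t f x :=
    funext fun x => propagator_const_mul a f s t x
  simp only [sensIntegrand, Lam, bracket, h1]
  rw [← integral_const_mul]
  congr 1
  ext x
  rw [← integral_const_mul]
  congr 1
  ext y
  ring

lemma tendsto_sensIntegrand (hS : MomentSolution φ q B K T μ₀ μ) (hp : 1 ≤ p) (hpq : p + 2 ≤ q)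
    (hG : KernDom φ D G) (hC : 0 ≤ C) {F : ℕ → Mass → ℝ} (hF : ∀ n, Dom (wpow φ p) C (F n))
    (hlim : ∀ x, Tendsto (fun n => F n x) atTop (𝓝 (f x))) {s : ℝ} (hs : s ∈ Icc 0 t)
    (htT : t ≤ T) : Tendsto (fun n => sensIntegrand K G μ t (F n) s) atTop
      (𝓝 (sensIntegrand K G μ t f s)) := by
  have hφ := hS.weight
  have hP := hS.coagPath (by linarith) hS.toCoagKernel
  have hw := lyap_wpow hφ hp hP hS.le fun r => (hS.moment r).mono hφ (by linarith)
  have hW := lyap_wpow hφ (p := p + 1) (by linarith) hP hS.le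
    fun r => (hS.moment r).mono hφ (by linarith)
  have hcon := controls_wpow hφ hP hS.le (fun r => (hS.moment r).mono hφ (by linarith)) p
  have hm := (hS.moment s).mono hφ (show p + 1 ≤ q by linarith)
  have hgr := growth_pos p B T
  have hlim' := hw.tendsto_propagator hW hP hcon hC hF hlim hs
  rw [hS.sensIntegrand_eq hp (by linarith) hG hC (Dom.of_tendsto hF hlim) hs htT]
  simp only [hS.sensIntegrand_eq hp (by linarith) hG hC (hF _) hs htT]
  have hd : ∀ n, Dom (wpow φ p) (C * growth p B T) (propagator K μ s t (F n)) := fun n =>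
    hS.dom_propagator hp (by linarith) (by linarith) hC (hF n) hs htT
  refine tendsto_integral_of_dominated_convergence (fun z : Mass × Mass =>
    C * growth p B T * bconst p * D * (wpow φ (p + 1) z.1 * wpow φ (p + 1) z.2))
    (fun n => ((measurable_bracket (hd n).1).mul hG.measurable).aestronglyMeasurable)
    ((integrable_wpow_prod hφ hm hm).const_mul _)
    (fun n => ae_of_all _ fun z => abs_bracket_mul_le hφ (by linarith) (by positivity) (hd n).2
      hG.abs_le z.1 z.2) (ae_of_all _ fun z => ?_)
  exact (((hlim' _).sub (hlim' _)).sub (hlim' _)).mul_const _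

/-- The bound for the sensitivity functional. -/
def _root_.Smoluchowski.sensBound (p : ℝ) (B : ℝ≥0) (T D : ℝ) : ℝ :=
  growth p B T * bconst p * D * (B * B) * T

lemma abs_sensitivity_le (hS : MomentSolution φ q B K T μ₀ μ) (hp : 1 ≤ p) (hpq : p + 1 ≤ q)
    (hD : 0 ≤ D) (hG : KernDom φ D G) (hC : 0 ≤ C) (hf : Dom (wpow φ p) C f) (ht : t ∈ Icc 0 T) :
    |sensitivity K G μ t f| ≤ C * sensBound p B T D := by
  have hgr := growth_pos p B T
  have hb := bconst_pos p
  have h1 := abs_intervalIntegral_le_const ht.1 (f := sensIntegrand K G μ t f) fun s hs =>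
    hS.abs_sensIntegrand_le hp hpq hD hG hC hf ⟨hs.1.le, hs.2⟩ ht.2
  rw [sensitivity, abs_mul, abs_of_pos (by norm_num : (0 : ℝ) < 1 / 2)]
  refine (mul_le_of_le_one_left (abs_nonneg _) (by norm_num)).trans (h1.trans ?_)
  calc _ ≤ C * growth p B T * bconst p * D * (B * B) * T :=
        mul_le_mul_of_nonneg_left (by linarith [ht.2]) (by positivity)
    _ = _ := by rw [sensBound]; ring

lemma dualFunctional_sensitivity (hS : MomentSolution φ q B K T μ₀ μ) (hp : 1 ≤ p) (hpq : p + 2 ≤ q)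
    (hD : 0 ≤ D) (hG : KernDom φ D G) (ht : t ∈ Icc 0 T) :
    DualFunctional (wpow φ p) (sensBound p B T D) (sensitivity K G μ t) where
  add C C' f g hC hC' hf hg := by
    rw [sensitivity, sensitivity, sensitivity, ← mul_add, ← intervalIntegral.integral_add
      (hS.intervalIntegrable_sensIntegrand hp (by linarith) hD hG hC hf ht)
      (hS.intervalIntegrable_sensIntegrand hp (by linarith) hD hG hC' hg ht)]
    congr 1
    refine intervalIntegral.integral_congr fun s hs => ?_
    rw [uIcc_of_le ht.1] at hs
    exact hS.sensIntegrand_add hp (by linarith) hG hC hC' hf hg hs ht.2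
  smul c C f _ _ := by
    simp only [sensitivity, sensIntegrand_const_mul, intervalIntegral.integral_const_mul]
    ring
  bound C f hC hf := hS.abs_sensitivity_le hp (by linarith) hD hG hC hf ht
  tendsto C f g hC hf h := by
    refine Tendsto.const_mul _ ?_
    refine intervalIntegral.tendsto_integral_filter_of_dominated_convergence
      (fun _ => C * growth p B T * bconst p * D * (B * B))
      (Eventually.of_forall fun n =>
        (hS.measurable_sensIntegrand (by linarith) hG.measurable (hf n).1 t).aestronglyMeasurable)
      (Eventually.of_forall fun n => ae_of_all _ fun s hs => ?_)
      intervalIntegrable_const (ae_of_all _ fun s hs => ?_)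
    · rw [uIoc_of_le ht.1] at hs
      exact hS.abs_sensIntegrand_le hp (by linarith) hD hG hC (hf n) ⟨hs.1.le, hs.2⟩ ht.2
    · rw [uIoc_of_le ht.1] at hs
      exact hS.tendsto_sensIntegrand hp hpq hG hC hf h ⟨hs.1.le, hs.2⟩ ht.2

lemma sensitivity_kern_add (hS : MomentSolution φ q B K T μ₀ μ) (hp : 1 ≤ p) (hpq : p + 1 ≤ q)
    (hD : 0 ≤ D) (hG : KernDom φ D G) (hD' : 0 ≤ D') (hG' : KernDom φ D' G') (hC : 0 ≤ C)
    (hf : Dom (wpow φ p) C f) (ht : t ∈ Icc 0 T) :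
    sensitivity K (fun x y => G x y + G' x y) μ t f =
      sensitivity K G μ t f + sensitivity K G' μ t f := by
  have hφ := hS.weight
  have hgr := growth_pos p B T
  have hGG : KernDom φ (D + D') (fun x y => G x y + G' x y) :=
    ⟨hG.measurable.add hG'.measurable, fun x y => (abs_add_le _ _).trans (by
      linarith [hG.abs_le x y, hG'.abs_le x y])⟩
  rw [sensitivity, sensitivity, sensitivity, ← mul_add, ← intervalIntegral.integral_add
    (hS.intervalIntegrable_sensIntegrand hp hpq hD hG hC hf ht)
    (hS.intervalIntegrable_sensIntegrand hp hpq hD' hG' hC hf ht)]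
  congr 1
  refine intervalIntegral.integral_congr fun s hs => ?_
  rw [uIcc_of_le ht.1] at hs
  have hm := (hS.moment s).mono hφ hpq
  have hd := hS.dom_propagator hp hpq (by linarith) hC hf hs ht.2
  rw [hS.sensIntegrand_eq hp hpq hGG hC hf hs ht.2, hS.sensIntegrand_eq hp hpq hG hC hf hs ht.2,
    hS.sensIntegrand_eq hp hpq hG' hC hf hs ht.2]
  simp only [mul_add]
  exact integral_add (integrable_bracket hφ (by linarith) (by positivity) hd hG hm hm)
    (integrable_bracket hφ (by linarith) (by positivity) hd hG' hm hm)

lemma sensitivity_kern_const_mul (a : ℝ) (f : Mass → ℝ) :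
    sensitivity K (fun x y => a * G x y) μ t f = a * sensitivity K G μ t f := by
  have : ∀ s, sensIntegrand K (fun x y => a * G x y) μ t f s = a * sensIntegrand K G μ t f s := by
    intro s
    simp only [sensIntegrand, Lam, mul_left_comm _ a, integral_const_mul]
  simp only [sensitivity, this, intervalIntegral.integral_const_mul]
  ring

end MomentSolution

/-! ### Derivatives of kernels -/

variable {d : ℕ} {𝒰 : Set (Param d)} {𝒦 : Param d → Kern} {ℓ : Param d}

namespace IsKernelFamily

lemma coagKernel (h : IsKernelFamily 𝒰 φ 𝒦) (hℓ : ℓ ∈ 𝒰) : CoagKernel φ (𝒦 ℓ) :=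
  ⟨h.measurable ℓ hℓ, h.nonneg ℓ hℓ, h.symm ℓ hℓ, h.le ℓ hℓ⟩

lemma hasFDerivAt (h : IsKernelFamily 𝒰 φ 𝒦) (h𝒰 : IsOpen 𝒰) (hℓ : ℓ ∈ 𝒰) (x y : Mass) :
    HasFDerivAt (fun ℓ' => 𝒦 ℓ' x y) (fderiv ℝ (fun ℓ' => 𝒦 ℓ' x y) ℓ) ℓ :=
  (((h.contDiffOn x y).differentiableOn two_ne_zero).differentiableAt
    (h𝒰.mem_nhds hℓ)).hasFDerivAt

lemma measurable_dKern (h : IsKernelFamily 𝒰 φ 𝒦) (h𝒰 : IsOpen 𝒰) (hℓ : ℓ ∈ 𝒰) (v : Param d) :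
    Measurable fun z : Mass × Mass => dKern 𝒦 ℓ v z.1 z.2 := by
  have hpos : Tendsto (fun n : ℕ => ‖((n : ℝ) + 1)‖) atTop atTop := by
    refine tendsto_norm_atTop_atTop.comp ?_
    exact tendsto_atTop_add_const_right _ _ tendsto_natCast_atTop_atTop
  have hU : ∀ᶠ n : ℕ in atTop, ℓ + ((n : ℝ) + 1)⁻¹ • v ∈ 𝒰 := by
    have h1 : Tendsto (fun n : ℕ => ℓ + ((n : ℝ) + 1)⁻¹ • v) atTop (𝓝 (ℓ + (0 : ℝ) • v)) := by
      refine tendsto_const_nhds.add (Tendsto.smul_const ?_ v)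
      exact (tendsto_atTop_add_const_right _ _ tendsto_natCast_atTop_atTop).inv_tendsto_atTop
    rw [zero_smul, add_zero] at h1
    exact h1.eventually (h𝒰.mem_nhds hℓ)
  obtain ⟨n₀, hn₀⟩ := eventually_atTop.1 hU
  refine measurable_of_tendsto_metrizable (f := fun (n : ℕ) (z : Mass × Mass) =>
    (((n + n₀ : ℕ) : ℝ) + 1) • (𝒦 (ℓ + ((((n + n₀ : ℕ) : ℝ) + 1))⁻¹ • v) z.1 z.2 - 𝒦 ℓ z.1 z.2))
    (fun n => by
      have h1 := h.measurable _ (hn₀ (n + n₀) (Nat.le_add_left _ _))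
      have h2 := h.measurable ℓ hℓ
      fun_prop)
    (tendsto_pi_nhds.2 fun z => ?_)
  exact ((h.hasFDerivAt h𝒰 hℓ z.1 z.2).lim v hpos).comp (tendsto_add_atTop_nat n₀)

lemma abs_dKern_le (h : IsKernelFamily 𝒰 φ 𝒦) (hℓ : ℓ ∈ 𝒰) (v : Param d) (x y : Mass) :
    |dKern 𝒦 ℓ v x y| ≤ ‖v‖ * (φ x * φ y) := by
  rw [mul_comm]
  exact (ContinuousLinearMap.le_opNorm _ v).trans
    (mul_le_mul_of_nonneg_right (h.norm_fderiv_le ℓ hℓ x y) (norm_nonneg v))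

lemma kernDom_dKern (h : IsKernelFamily 𝒰 φ 𝒦) (h𝒰 : IsOpen 𝒰) (hℓ : ℓ ∈ 𝒰) (v : Param d) :
    KernDom φ ‖v‖ (dKern 𝒦 ℓ v) :=
  ⟨h.measurable_dKern h𝒰 hℓ v, h.abs_dKern_le hℓ v⟩

end IsKernelFamily

/-- The signed measures of the sensitivity functionals depend linearly on the direction. -/
lemma MomentSolution.exists_sensitivity (hS : MomentSolution φ q B K T μ₀ μ) (hp : 1 ≤ p)
    (hpq : p + 2 ≤ q) (h𝒦 : IsKernelFamily 𝒰 φ 𝒦) (h𝒰 : IsOpen 𝒰) (hℓ : ℓ ∈ 𝒰) (ht : t ∈ Icc 0 T) :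
    ∃ σ : Param d →ₗ[ℝ] SignedMeasure Mass, ∀ v A, MeasurableSet A →
      σ v A = sensitivity K (dKern 𝒦 ℓ v) μ t (A.indicator fun _ => 1) := by
  have hφ := hS.weight
  have hF : ∀ v, DualFunctional (wpow φ p) _ (sensitivity K (dKern 𝒦 ℓ v) μ t) := fun v =>
    hS.dualFunctional_sensitivity hp hpq (norm_nonneg v) (h𝒦.kernDom_dKern h𝒰 hℓ v) ht
  have hw := hφ.one_le_wpow (p := p) (by linarith)
  refine ⟨⟨⟨fun v => (hF v).toSignedMeasure hw, fun v v' => ?_⟩, fun a v => ?_⟩, fun v A hA =>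
    (hF v).toSignedMeasure_apply hw hA⟩
  · ext A hA
    have hAd := (dom_one hw).indicator hA
    rw [add_apply, (hF _).toSignedMeasure_apply hw hA,
      (hF _).toSignedMeasure_apply hw hA, (hF _).toSignedMeasure_apply hw hA,
      ← hS.sensitivity_kern_add hp (by linarith) (norm_nonneg v) (h𝒦.kernDom_dKern h𝒰 hℓ v)
        (norm_nonneg v') (h𝒦.kernDom_dKern h𝒰 hℓ v') zero_le_one hAd ht]
    congr 1
    ext x y
    exact map_add _ v v'
  · ext A hA
    simp only [RingHom.id_apply]
    rw [smul_apply, (hF _).toSignedMeasure_apply hw hA,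
      (hF _).toSignedMeasure_apply hw hA, smul_eq_mul, ← sensitivity_kern_const_mul]
    congr 1
    ext x y
    exact map_smul _ a v

end

/-! ### Propagation of moments -/

lemma le_mul_exp_of_le_integral {y : ℝ → ℝ} (hy : Continuous y) (h0 : ∀ r, 0 ≤ y r) {a c T : ℝ}
    (ha : 0 ≤ a) (hc : 0 ≤ c) (h : ∀ t ∈ Icc 0 T, y t ≤ a + c * ∫ s in (0 : ℝ)..t, y s) :
    ∀ t ∈ Icc 0 T, y t ≤ a * Real.exp (c * t) := by
  intro t ht
  set f : ℝ → ℝ := fun t => a + c * ∫ s in (0 : ℝ)..t, y s with hf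
  have hd : ∀ x, HasDerivAt f (c * y x) x := fun x =>
    ((hy.integral_hasStrictDerivAt 0 x).hasDerivAt.const_mul c).const_add a
  have hfn : ∀ x ∈ Icc 0 T, 0 ≤ f x := fun x hx => add_nonneg ha
    (mul_nonneg hc (intervalIntegral.integral_nonneg hx.1 fun s _ => h0 s))
  have := norm_le_gronwallBound_of_norm_deriv_right_le (f := f) (f' := fun x => c * y x) (δ := a)
    (K := c) (ε := 0) (a := 0) (b := T) (fun x _ => (hd x).continuousAt.continuousWithinAt)
    (fun x _ => (hd x).hasDerivWithinAt) (by simp [hf, abs_of_nonneg ha]) (fun x hx => by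
      have hx' : x ∈ Icc 0 T := ⟨hx.1, hx.2.le⟩
      rw [Real.norm_eq_abs, Real.norm_eq_abs, abs_of_nonneg (hfn x hx'),
        abs_of_nonneg (mul_nonneg hc (h0 x)), add_zero]
      exact mul_le_mul_of_nonneg_left (h x hx') hc) t ht
  rw [gronwallBound_ε0, sub_zero] at this
  exact (h t ht).trans ((le_abs_self _).trans this)

lemma add_rpow_le {a b q : ℝ} (ha : 0 ≤ a) (hb : 0 ≤ b) (hq : 0 ≤ q) :
    (a + b) ^ q ≤ 2 ^ q * (a ^ q + b ^ q) := by
  have h1 : (a + b) ^ q ≤ (2 * max a b) ^ q := by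
    refine Real.rpow_le_rpow (by positivity) ?_ hq
    linarith [le_max_left a b, le_max_right a b]
  rw [Real.mul_rpow two_pos.le (le_max_of_le_left ha)] at h1
  refine h1.trans (mul_le_mul_of_nonneg_left ?_ (by positivity))
  have h2 := Real.rpow_nonneg ha q
  have h3 := Real.rpow_nonneg hb q
  rcases max_choice a b with h | h <;> rw [h] <;> linarith

lemma isWeight_const {c : ℝ} (hc : 1 ≤ c) : IsWeight fun _ => c :=
  ⟨measurable_const, fun _ => hc, fun _ _ => by linarith⟩

section

variable {K : Kern} {T : ℝ} {μ₀ : FiniteMeasure Mass} {μ : ℝ → FiniteMeasure Mass}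
  {φ : Mass → ℝ} {q M : ℝ} {A B R : ℝ≥0} {t : ℝ}

lemma moment_const (c q : ℝ) {α : Measure Mass} (h : α univ ≤ A) :
    Moment (fun _ => c) q ((c ^ q).toNNReal * A) α := by
  rw [Moment, lintegral_const, ENNReal.coe_mul]
  exact mul_le_mul_right h _

lemma IsSolution.measure_univ_le (h : IsSolution K T μ₀ μ) (hK : ∀ x y, 0 ≤ K x y)
    (ht : t ∈ Icc 0 T) : (μ t : Measure Mass) univ ≤ (μ₀ : Measure Mass) univ := by
  have h1 := h.weak_eq (fun _ => 1) measurable_const ⟨1, fun _ => by simp⟩ t ht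
  have h2 : ∫ s in (0 : ℝ)..t, coagulation K (μ s) (fun _ => 1) ≤ 0 := by
    rw [← neg_nonneg, ← intervalIntegral.integral_neg]
    refine intervalIntegral.integral_nonneg ht.1 fun s _ => ?_
    rw [coagulation, ← integral_neg]
    refine integral_nonneg fun z => ?_
    have := hK z.1 z.2
    simp only [bracket, Pi.zero_apply]
    linarith
  simp only [integral_const, smul_eq_mul, mul_one] at h1
  refine (ENNReal.toReal_le_toReal (measure_ne_top _ _) (measure_ne_top _ _)).1 ?_
  have : (μ t : Measure Mass).real univ ≤ (μ₀ : Measure Mass).real univ := by linarith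
  exact this

/-- The power of a truncated weight. -/
def truncPow (φ : Mass → ℝ) (q R : ℝ) (x : Mass) : ℝ := (min (φ x) R) ^ q

lemma bracket_truncPow_le (hφ : IsWeight φ) (hq : 0 ≤ q) {r : ℝ} (hr : 0 ≤ r) (x y : Mass) :
    bracket (truncPow φ q r) x y ≤ 2 ^ q * (truncPow φ q r x + truncPow φ q r y) := by
  have hx : 0 ≤ min (φ x) r := le_min (hφ.pos x).le hr
  have hy : 0 ≤ min (φ y) r := le_min (hφ.pos y).le hr
  have h1 : min (φ (x + y)) r ≤ min (φ x) r + min (φ y) r := by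
    rcases le_total r (φ x) with h | h
    · rw [min_eq_right h]
      linarith [min_le_right (φ (x + y)) r]
    rcases le_total r (φ y) with h' | h'
    · rw [min_eq_right h']
      linarith [min_le_right (φ (x + y)) r]
    rw [min_eq_left h, min_eq_left h']
    exact (min_le_left _ _).trans (hφ.subadd x y)
  have h2 : truncPow φ q r (x + y) ≤ 2 ^ q * (truncPow φ q r x + truncPow φ q r y) :=
    (Real.rpow_le_rpow (le_min (hφ.pos _).le hr) h1 hq).trans (add_rpow_le hx hy hq)
  have h3 : 0 ≤ truncPow φ q r x := Real.rpow_nonneg hx q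
  have h4 : 0 ≤ truncPow φ q r y := Real.rpow_nonneg hy q
  unfold bracket
  linarith

/-- For a bounded kernel moments stay bounded. -/
lemma IsSolution.exists_moment (h : IsSolution K T μ₀ μ) (hK : CoagKernel φ K)
    (hM : ∀ x y, K x y ≤ M) (hφ : IsWeight φ) (hT : 0 ≤ T) (hq : 0 ≤ q)
    (h0 : Moment φ q A (μ₀ : Measure Mass)) :
    ∃ B : ℝ≥0, ∀ t ∈ Icc 0 T, Moment φ q B (μ t : Measure Mass) := by
  set c : ℝ := max 1 M with hc
  have hc1 : 1 ≤ c := le_max_left _ _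
  have hKc : ∀ x y, K x y ≤ c := fun x y => (hM x y).trans (le_max_right _ _)
  have hK' : CoagKernel (fun _ => c) K := ⟨hK.measurable, hK.nonneg, hK.symm, fun x y => by
    have := hKc x y
    nlinarith⟩
  obtain ⟨m₀, hm₀⟩ : ∃ m : ℝ≥0, (μ₀ : Measure Mass) univ = m :=
    ⟨_, (ENNReal.coe_toNNReal (measure_ne_top _ _)).symm⟩
  have hmass : ∀ t ∈ Icc 0 T, (μ t : Measure Mass) univ ≤ m₀ := fun t ht =>
    (h.measure_univ_le hK.nonneg ht).trans hm₀.le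
  have hS : MomentSolution (fun _ => c) 4 _ K T μ₀ (freeze T μ) := h.momentSolution hK'
    (isWeight_const hc1) ⟨hT, le_rfl⟩ fun r hr => moment_const c 4 (hmass r hr)
  have hmass' : ∀ r, (freeze T μ r : Measure Mass).real univ ≤ m₀ := fun r =>
    ENNReal.toReal_le_coe_of_le_coe (hmass _ (clamp_mem hT r))
  set c' : ℝ := 2 ^ q * c * m₀ with hc'
  have hc'0 : 0 ≤ c' := by positivity
  have key : ∀ k : ℕ, ∀ t ∈ Icc 0 T,
      ∫ x, truncPow φ q k x ∂(freeze T μ t : Measure Mass) ≤ A * Real.exp (c' * t) := by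
    intro k
    have hwm : Measurable (truncPow φ q k) := (hφ.measurable.min measurable_const).pow_const q
    have hw0 : ∀ x, 0 ≤ truncPow φ q k x := fun x =>
      Real.rpow_nonneg (le_min (hφ.pos x).le k.cast_nonneg) q
    have hwb : ∀ x, truncPow φ q k x ≤ (k : ℝ) ^ q := fun x =>
      Real.rpow_le_rpow (le_min (hφ.pos x).le k.cast_nonneg) (min_le_right _ _) hq
    have hwB : ∃ C : ℝ, ∀ x, |truncPow φ q k x| ≤ C :=
      ⟨(k : ℝ) ^ q, fun x => by rw [abs_of_nonneg (hw0 x)]; exact hwb x⟩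
    have hwi : ∀ (α : FiniteMeasure Mass), Integrable (truncPow φ q k) (α : Measure Mass) :=
      fun α => Integrable.of_bound hwm.aestronglyMeasurable ((k : ℝ) ^ q) (ae_of_all _ fun x => by
        rw [Real.norm_eq_abs, abs_of_nonneg (hw0 x)]; exact hwb x)
    set y : ℝ → ℝ := fun r => ∫ x, truncPow φ q k x ∂(freeze T μ r : Measure Mass) with hy
    have hyc : Continuous y := hS.continuous_integral_bounded hwm hwB
    have hy0 : ∀ r, 0 ≤ y r := fun r => integral_nonneg hw0
    refine le_mul_exp_of_le_integral hyc hy0 A.2 hc'0 fun t ht => ?_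
    have hcoag : ∀ s, coagulation K (freeze T μ s) (truncPow φ q k) ≤ 2 * c' * y s := by
      intro s
      have hi1 : Integrable (fun z : Mass × Mass => truncPow φ q k z.1 * 1)
          ((freeze T μ s : Measure Mass).prod (freeze T μ s : Measure Mass)) :=
        (hwi _).mul_prod (integrable_const (1 : ℝ))
      have hi2 : Integrable (fun z : Mass × Mass => 1 * truncPow φ q k z.2)
          ((freeze T μ s : Measure Mass).prod (freeze T μ s : Measure Mass)) :=
        (integrable_const (1 : ℝ)).mul_prod (hwi _)
      have hle : coagulation K (freeze T μ s) (truncPow φ q k) ≤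
          ∫ z : Mass × Mass, 2 ^ q * c * (truncPow φ q k z.1 * 1 + 1 * truncPow φ q k z.2)
            ∂((freeze T μ s : Measure Mass).prod (freeze T μ s : Measure Mass)) := by
        have hb0 : ∀ x y, truncPow φ q k x * 1 + 1 * truncPow φ q k y =
            truncPow φ q k x + truncPow φ q k y := fun x y => by ring
        refine integral_mono ?_ ((hi1.add hi2).const_mul (2 ^ q * c)) fun z => ?_
        · have hwd : Dom (wpow (fun _ => c) 1) ((k : ℝ) ^ q) (truncPow φ q k) := ⟨hwm, fun x => by
            rw [IsWeight.wpow_one, abs_of_nonneg (hw0 x)]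
            exact (hwb x).trans (le_mul_of_one_le_right (by positivity) hc1)⟩
          have hm := (hS.moment s).mono hS.weight (show (1 : ℝ) + 1 ≤ 4 by norm_num)
          exact integrable_bracket hS.weight zero_le_one (by positivity) hwd hS.kernDom hm hm
        · have h1 := bracket_truncPow_le hφ hq (Nat.cast_nonneg k) z.1 z.2
          have h2 := hw0 z.1
          have h3 := hw0 z.2
          simp only [hb0]
          calc _ ≤ 2 ^ q * (truncPow φ q k z.1 + truncPow φ q k z.2) * K z.1 z.2 :=
                mul_le_mul_of_nonneg_right h1 (hK.nonneg _ _)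
            _ ≤ 2 ^ q * (truncPow φ q k z.1 + truncPow φ q k z.2) * c :=
                mul_le_mul_of_nonneg_left (hKc _ _) (by positivity)
            _ = _ := by ring
      rw [integral_const_mul, integral_add hi1 hi2,
        integral_prod_mul (truncPow φ q k) fun _ : Mass => (1 : ℝ),
        integral_prod_mul (fun _ : Mass => (1 : ℝ)) (truncPow φ q k)] at hle
      simp only [integral_const, smul_eq_mul, mul_one] at hle
      have h1 := mul_le_mul_of_nonneg_left (hmass' s) (hy0 s)
      have h2 : 2 ^ q * c * (y s * (freeze T μ s : Measure Mass).real univ +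
          (freeze T μ s : Measure Mass).real univ * y s) ≤ 2 ^ q * c * (2 * (y s * m₀)) :=
        mul_le_mul_of_nonneg_left (by linarith) (by positivity)
      refine (hle.trans h2).trans (le_of_eq ?_)
      rw [hc']; ring
    have hw := hS.weak_eq _ hwm hwB t ht
    have hi := (hS.intervalIntegrable _ hwm hwB).mono_set (c := 0) (d := t) (by
      rw [uIcc_of_le hT, uIcc_of_le ht.1]; exact Icc_subset_Icc_right ht.2)
    have h1 : ∫ s in (0 : ℝ)..t, coagulation K (freeze T μ s) (truncPow φ q k) ≤
        ∫ s in (0 : ℝ)..t, 2 * c' * y s :=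
      intervalIntegral.integral_mono_on ht.1 hi ((hyc.const_mul _).intervalIntegrable _ _)
        fun s _ => hcoag s
    rw [intervalIntegral.integral_const_mul] at h1
    have h2 : ∫ x, truncPow φ q k x ∂(μ₀ : Measure Mass) ≤ A := by
      refine (integral_mono (hwi μ₀) (h0.integrable hφ) fun x => ?_).trans (h0.integral_le hφ)
      exact Real.rpow_le_rpow (le_min (hφ.pos x).le k.cast_nonneg) (min_le_left _ _) hq
    simp only [hy]
    rw [hw]
    linarith
  refine ⟨A * (Real.exp (c' * T)).toNNReal, fun t ht => ?_⟩
  have hlim : Tendsto (fun k : ℕ => ∫⁻ x, ENNReal.ofReal (truncPow φ q k x)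
      ∂(freeze T μ t : Measure Mass)) atTop
      (𝓝 (∫⁻ x, ENNReal.ofReal (φ x ^ q) ∂(freeze T μ t : Measure Mass))) := by
    refine lintegral_tendsto_of_tendsto_of_monotone (fun k => ((hφ.measurable.min
      measurable_const).pow_const q).ennreal_ofReal.aemeasurable) (ae_of_all _ fun x k l hkl => ?_)
      (ae_of_all _ fun x => ?_)
    · refine ENNReal.ofReal_le_ofReal (Real.rpow_le_rpow (le_min (hφ.pos x).le k.cast_nonneg)
        (min_le_min_left _ (by exact_mod_cast hkl)) hq)
    · refine tendsto_const_nhds.congr' ?_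
      filter_upwards [eventually_ge_atTop ⌈φ x⌉₊] with k hk
      rw [truncPow, min_eq_left (Nat.ceil_le.1 hk)]
  rw [Moment, ← freeze_of_mem (μ := μ) ht]
  refine le_of_tendsto' hlim fun k => ?_
  have hwm : Measurable (truncPow φ q k) := (hφ.measurable.min measurable_const).pow_const q
  have hw0 : ∀ x, 0 ≤ truncPow φ q k x := fun x =>
    Real.rpow_nonneg (le_min (hφ.pos x).le k.cast_nonneg) q
  rw [← ofReal_integral_eq_lintegral_ofReal (Integrable.of_bound hwm.aestronglyMeasurable ((k : ℝ) ^ q)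
    (ae_of_all _ fun x => by
      rw [Real.norm_eq_abs, abs_of_nonneg (hw0 x)]
      exact Real.rpow_le_rpow (le_min (hφ.pos x).le k.cast_nonneg) (min_le_right _ _) hq))
    (ae_of_all _ hw0)]
  refine (ENNReal.ofReal_le_ofReal (key k t ht)).trans ?_
  rw [ENNReal.ofReal_mul A.coe_nonneg, ENNReal.ofReal_coe_nnreal, ENNReal.coe_mul]
  refine mul_le_mul_right (ENNReal.ofReal_le_ofReal (Real.exp_le_exp.2 ?_)) _
  exact mul_le_mul_of_nonneg_left ht.2 hc'0

namespace MomentSolution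

lemma wpow_three_bracket_le (hφ : IsWeight φ) (x y : Mass) (hK : 0 ≤ K x y)
    (hKφ : K x y ≤ φ x * φ y) : bracket (wpow φ 3) x y * K x y ≤
      3 * (wpow φ 3 x * wpow φ 2 y) + 3 * (wpow φ 2 x * wpow φ 3 y) := by
  have hx := hφ.pos x
  have hy := hφ.pos y
  have e3 : ∀ z, wpow φ 3 z = φ z ^ 3 := fun z => by rw [wpow]; norm_cast
  have e2 : ∀ z, wpow φ 2 z = φ z ^ 2 := fun z => by rw [wpow]; norm_cast
  simp only [bracket, e3, e2]
  have h1 : φ (x + y) ^ 3 ≤ (φ x + φ y) ^ 3 :=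
    pow_le_pow_left₀ (hφ.pos _).le (hφ.subadd x y) 3
  calc (φ (x + y) ^ 3 - φ x ^ 3 - φ y ^ 3) * K x y
      ≤ (3 * φ x ^ 2 * φ y + 3 * φ x * φ y ^ 2) * K x y :=
        mul_le_mul_of_nonneg_right (by nlinarith) hK
    _ ≤ (3 * φ x ^ 2 * φ y + 3 * φ x * φ y ^ 2) * (φ x * φ y) :=
        mul_le_mul_of_nonneg_left hKφ (by positivity)
    _ = _ := by ring

/-- The third moment is controlled by the second one. -/
lemma third_moment_le (hS : MomentSolution φ 4 B K T μ₀ μ)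
    (hR : ∀ r, Moment φ 2 R (μ r : Measure Mass)) (h0 : Moment φ 3 A (μ₀ : Measure Mass)) (r : ℝ) :
    Moment φ 3 (A * (Real.exp (3 * R * T)).toNNReal) (μ r : Measure Mass) := by
  have hφ := hS.weight
  have hw : Dom (wpow φ 3) 1 (wpow φ 3) := ⟨hφ.measurable_wpow 3, fun x => by
    rw [one_mul, abs_of_nonneg (hφ.wpow_nonneg 3 x)]⟩
  have hm3 : ∀ s, Moment φ 3 B (μ s : Measure Mass) := fun s => (hS.moment s).mono hφ (by norm_num)
  set y : ℝ → ℝ := fun r => ∫ x, wpow φ 3 x ∂(μ r : Measure Mass) with hy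
  have hyc : Continuous y := hS.continuous_integral (by norm_num) (by norm_num) zero_le_one hw
  have hy0 : ∀ r, 0 ≤ y r := fun r => integral_nonneg (hφ.wpow_nonneg 3)
  have hcoag : ∀ s, coagulation K (μ s) (wpow φ 3) ≤ 6 * R * y s := by
    intro s
    have hi1 : Integrable (fun z : Mass × Mass => wpow φ 3 z.1 * wpow φ 2 z.2)
        ((μ s : Measure Mass).prod (μ s : Measure Mass)) :=
      ((hm3 s).integrable hφ).mul_prod ((hR s).integrable hφ)
    have hi2 : Integrable (fun z : Mass × Mass => wpow φ 2 z.1 * wpow φ 3 z.2)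
        ((μ s : Measure Mass).prod (μ s : Measure Mass)) :=
      ((hR s).integrable hφ).mul_prod ((hm3 s).integrable hφ)
    have hm4 : Moment φ (3 + 1) B (μ s : Measure Mass) := (hS.moment s).mono hφ (by norm_num)
    have hle : coagulation K (μ s) (wpow φ 3) ≤
        ∫ z : Mass × Mass, (3 * (wpow φ 3 z.1 * wpow φ 2 z.2) + 3 * (wpow φ 2 z.1 * wpow φ 3 z.2))
          ∂((μ s : Measure Mass).prod (μ s : Measure Mass)) :=
      integral_mono (integrable_bracket hφ (by norm_num) zero_le_one hw hS.kernDom hm4 hm4)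
        ((hi1.const_mul 3).add (hi2.const_mul 3)) fun z =>
          wpow_three_bracket_le hφ z.1 z.2 (hS.nonneg _ _) (hS.le _ _)
    rw [integral_add (hi1.const_mul 3) (hi2.const_mul 3), integral_const_mul, integral_const_mul,
      integral_prod_mul, integral_prod_mul] at hle
    have h1 := mul_le_mul_of_nonneg_left ((hR s).integral_le hφ) (hy0 s)
    linarith
  have key : ∀ t ∈ Icc 0 T, y t ≤ A * Real.exp (3 * R * t) := by
    refine le_mul_exp_of_le_integral hyc hy0 A.2 (by positivity) fun t ht => ?_
    have hwk := hS.weak_eq_dom (by norm_num) (by norm_num) zero_le_one hw ht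
    have h1 : ∫ s in (0 : ℝ)..t, coagulation K (μ s) (wpow φ 3) ≤ ∫ s in (0 : ℝ)..t, 6 * R * y s :=
      intervalIntegral.integral_mono_on ht.1 (hS.intervalIntegrable_coagulation (by norm_num)
        (by norm_num) zero_le_one hw ht.1) ((hyc.const_mul _).intervalIntegrable _ _)
        fun s _ => hcoag s
    rw [intervalIntegral.integral_const_mul] at h1
    have h2 := h0.integral_le hφ
    simp only [hy] at hwk h1 ⊢
    rw [hwk]
    linarith
  refine Moment.of_integral_le hφ ((hm3 r).integrable hφ) ?_
  rw [hS.frozen r, NNReal.coe_mul, Real.coe_toNNReal _ (Real.exp_pos _).le]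
  have hcl := clamp_mem hS.T_nonneg r
  refine (key _ hcl).trans (mul_le_mul_of_nonneg_left (Real.exp_le_exp.2 ?_) A.2)
  exact mul_le_mul_of_nonneg_left hcl.2 (by positivity)

end MomentSolution

end

/-! ### Convergence of solutions -/

/-- A continuous function that stays strictly below a barrier as long as it is below it. -/
lemma lt_of_bootstrap {y : ℝ → ℝ} (hy : Continuous y) {R T : ℝ} (h0 : y 0 < R)
    (h : ∀ t ∈ Icc 0 T, (∀ r ∈ Icc 0 t, y r ≤ R) → y t < R) : ∀ t ∈ Icc 0 T, y t < R := by
  by_contra! hcon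
  obtain ⟨t₁, ht₁, hR⟩ := hcon
  set S : Set ℝ := Icc 0 T ∩ {t | R ≤ y t} with hS
  have hcl : IsClosed S := isClosed_Icc.inter (isClosed_le continuous_const hy)
  have hne : S.Nonempty := ⟨t₁, ht₁, hR⟩
  have hbb : BddBelow S := ⟨0, fun t ht => ht.1.1⟩
  have hmem : sInf S ∈ S := hcl.csInf_mem hne hbb
  set t₀ := sInf S with ht₀
  have hlt : ∀ r ∈ Ico 0 t₀, y r < R := fun r hr => by
    by_contra! hge
    exact (notMem_of_lt_csInf hr.2 hbb) ⟨⟨hr.1, hr.2.le.trans hmem.1.2⟩, hge⟩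
  have hpos : 0 < t₀ := by
    rcases hmem.1.1.eq_or_lt with h' | h'
    · have := hmem.2
      rw [← h'] at this
      exact absurd h0 (not_lt.2 this)
    · exact h'
  have hle : y t₀ ≤ R := by
    have h1 : Tendsto y (𝓝[<] t₀) (𝓝 (y t₀)) := hy.continuousAt.mono_left nhdsWithin_le_nhds
    refine le_of_tendsto h1 ?_
    filter_upwards [Ioo_mem_nhdsLT hpos] with r hr
    exact (hlt r ⟨hr.1.le, hr.2⟩).le
  refine absurd (h t₀ hmem.1 fun r hr => ?_) (not_lt.2 hmem.2)
  rcases hr.2.eq_or_lt with h' | h'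
  · rw [h']; exact hle
  · exact (hlt r ⟨hr.1, h'⟩).le

section

variable {K K' : Kern} {T : ℝ} {μ₀ : FiniteMeasure Mass} {μ μ' : ℝ → FiniteMeasure Mass}
  {φ : Mass → ℝ} {q κ δ : ℝ} {A B B' R : ℝ≥0} {t : ℝ}

lemma wpow_two_le (hφ : IsWeight φ) {Λ : ℝ} {x : Mass} (h : φ x ≤ Λ) :
    wpow φ 2 x ≤ Λ * wpow φ 1 x := by
  have : wpow φ 2 x = φ x * φ x := by rw [wpow, Real.rpow_two, sq]
  rw [this, IsWeight.wpow_one]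
  exact mul_le_mul_of_nonneg_right h (hφ.pos x).le

lemma wpow_two_le_of_lt (hφ : IsWeight φ) {Λ : ℝ} (hΛ : 0 < Λ) {x : Mass} (h : Λ ≤ φ x) :
    wpow φ 2 x ≤ Λ⁻¹ * wpow φ 3 x := by
  have h2 : wpow φ 3 x = wpow φ 2 x * φ x := by
    rw [← hφ.wpow_add_one]; norm_num
  rw [h2, inv_mul_eq_div, le_div_iff₀ hΛ]
  exact mul_le_mul_of_nonneg_left h (hφ.wpow_nonneg 2 x)

/-- Closeness for a smaller weight, with bounds for a higher moment, gives closeness. -/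
lemma Near.two_of_one (hφ : IsWeight φ) {α β : Measure Mass} (h : Near φ 1 δ α β)
    (hα : Moment φ 3 A α) (hβ : Moment φ 3 A β) {Λ : ℝ} (hΛ : 0 < Λ) :
    Near φ 2 (Λ * δ + 2 * A * Λ⁻¹) α β := by
  intro C hC f hf
  set S : Set Mass := {x | φ x ≤ Λ} with hS
  have hSm : MeasurableSet S := measurableSet_le hφ.measurable measurable_const
  have h1 : Dom (wpow φ 1) (C * Λ) (S.indicator f) := ⟨hf.1.indicator hSm, fun x => by
    by_cases hx : x ∈ S
    · rw [indicator_of_mem hx, mul_assoc]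
      exact (hf.2 x).trans (mul_le_mul_of_nonneg_left (wpow_two_le hφ hx) hC)
    · rw [indicator_of_notMem hx, abs_zero]
      exact mul_nonneg (mul_nonneg hC hΛ.le) (hφ.wpow_nonneg 1 x)⟩
  have h2 : Dom (wpow φ 3) (C * Λ⁻¹) (Sᶜ.indicator f) := ⟨hf.1.indicator hSm.compl, fun x => by
    by_cases hx : x ∈ S
    · rw [indicator_of_notMem (by simpa using hx), abs_zero]
      exact mul_nonneg (mul_nonneg hC (inv_nonneg.2 hΛ.le)) (hφ.wpow_nonneg 3 x)
    · rw [indicator_of_mem hx, mul_assoc]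
      exact (hf.2 x).trans (mul_le_mul_of_nonneg_left (wpow_two_le_of_lt hφ hΛ (not_le.1 hx).le) hC)⟩
  have h12 : f = fun x => S.indicator f x + Sᶜ.indicator f x := (indicator_self_add_compl S f).symm
  have e : ∀ {γ : Measure Mass}, Moment φ 3 A γ →
      ∫ x, f x ∂γ = ∫ x, S.indicator f x ∂γ + ∫ x, Sᶜ.indicator f x ∂γ := fun hγ => by
    conv_lhs => rw [h12]
    exact integral_add (h1.integrable hφ (hγ.mono hφ (by norm_num))) (h2.integrable hφ hγ)
  have b1 := h _ (mul_nonneg hC hΛ.le) _ h1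
  have b2 := h2.abs_integral_le hφ (mul_nonneg hC (inv_nonneg.2 hΛ.le)) hα
  have b3 := h2.abs_integral_le hφ (mul_nonneg hC (inv_nonneg.2 hΛ.le)) hβ
  rw [e hα, e hβ]
  have b4 : |(∫ x, S.indicator f x ∂α + ∫ x, Sᶜ.indicator f x ∂α) -
      (∫ x, S.indicator f x ∂β + ∫ x, Sᶜ.indicator f x ∂β)| ≤
      |∫ x, S.indicator f x ∂α - ∫ x, S.indicator f x ∂β| +
      (|∫ x, Sᶜ.indicator f x ∂α| + |∫ x, Sᶜ.indicator f x ∂β|) := by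
    rw [add_sub_add_comm]
    exact (abs_add_le _ _).trans (add_le_add le_rfl (abs_sub _ _))
  refine b4.trans ((add_le_add b1 (add_le_add b2 b3)).trans (le_of_eq ?_))
  ring

lemma Near.mono {α β : Measure Mass} {p δ' : ℝ} (h : Near φ p δ α β) (hδ : δ ≤ δ') :
    Near φ p δ' α β := fun C hC f hf =>
  (h C hC f hf).trans (mul_le_mul_of_nonneg_left hδ hC)

namespace MomentSolution

lemma mono (hS : MomentSolution φ q B K T μ₀ μ) {p : ℝ} (hpq : p ≤ q) :
    MomentSolution φ p B K T μ₀ μ :=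
  { hS with moment := fun r => (hS.moment r).mono hS.weight hpq }

lemma mono_const (hS : MomentSolution φ q B K T μ₀ μ) (h : B ≤ B') :
    MomentSolution φ q B' K T μ₀ μ :=
  { hS with moment := fun r => (hS.moment r).mono_const h }

lemma with_moment (hS : MomentSolution φ q B K T μ₀ μ) {p : ℝ}
    (h : ∀ r, Moment φ p A (μ r : Measure Mass)) : MomentSolution φ p A K T μ₀ μ :=
  { hS with moment := h }

lemma restrict (hS : MomentSolution φ q B K T μ₀ μ) {t₀ : ℝ} (ht₀ : t₀ ∈ Icc 0 T) :
    MomentSolution φ q B K t₀ μ₀ (freeze t₀ μ) :=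
  hS.toIsSolution.momentSolution hS.toCoagKernel hS.weight ht₀ fun r _ => hS.moment r

lemma kernelDist_integrable (hS : MomentSolution φ 4 B K T μ₀ μ) (hK' : CoagKernel φ K') :
    IntervalIntegrable (fun s => ∫ z, wpow φ 1 z.1 * wpow φ 1 z.2 * |K' z.1 z.2 - K z.1 z.2|
      ∂((μ s : Measure Mass).prod (μ s : Measure Mass))) volume 0 T := by
  have hdk := hS.dom2_kernel_difference hK' 1
  have hm : ∀ s, Moment φ (1 + 1) B (μ s : Measure Mass) := fun s =>
    (hS.moment s).mono hS.weight (by norm_num)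
  exact intervalIntegrable_of_bound ((hS.isMeasurablePath (by norm_num)).measurable_integral_prod
    (α := ℝ) (F := fun _ z => wpow φ 1 z.1 * wpow φ 1 z.2 * |K' z.1 z.2 - K z.1 z.2|)
    (hdk.measurable.comp measurable_snd) measurable_id) hS.T_nonneg
    fun s _ => hdk.abs_integral_le hS.weight zero_le_one (hm s) (hm s)

lemma kernelDist_restrict_le (hS : MomentSolution φ 4 B K T μ₀ μ) (hK' : CoagKernel φ K')
    {t₀ : ℝ} (ht₀ : t₀ ∈ Icc 0 T) :
    kernelDist φ 1 K K' (freeze t₀ μ) t₀ ≤ kernelDist φ 1 K K' μ T := by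
  have hφ := hS.weight
  have h1 : kernelDist φ 1 K K' (freeze t₀ μ) t₀ = kernelDist φ 1 K K' μ t₀ := by
    refine intervalIntegral.integral_congr fun s hs => ?_
    rw [uIcc_of_le ht₀.1] at hs
    simp only [freeze_of_mem hs]
  rw [h1]
  exact intervalIntegral.integral_mono_interval le_rfl ht₀.1 ht₀.2 (ae_of_all _ fun s =>
    integral_nonneg fun z => mul_nonneg (mul_nonneg (hφ.wpow_nonneg 1 _) (hφ.wpow_nonneg 1 _))
      (abs_nonneg _)) (hS.kernelDist_integrable hK')

/-- Two solutions whose second moments are bounded by `R` are close in the second moment. -/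
lemma near_two (hS : MomentSolution φ 4 B K T μ₀ μ) (hS' : MomentSolution φ 4 B' K' T μ₀ μ')
    (hR : ∀ r, Moment φ 2 R (μ r : Measure Mass)) (hR' : ∀ r, Moment φ 2 R (μ' r : Measure Mass))
    (h0 : Moment φ 3 A (μ₀ : Measure Mass)) {s : ℝ} (hs : 0 < s)
    (hκ : kernelDist φ 1 K K' μ T ≤ s ^ 2) (ht : t ∈ Icc 0 T) :
    Near φ 2 ((growth 1 R T * bconst 1 + 2 * (A * Real.exp (3 * R * T))) * s)
      (μ' t : Measure Mass) (μ t : Measure Mass) := by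
  have hφ := hS.weight
  have hgr := growth_pos 1 R T
  have hb := bconst_pos 1
  have h3 := hS.third_moment_le hR h0
  have h3' := hS'.third_moment_le hR' h0
  have hm : ∀ r, Moment φ (1 + 1) R (μ r : Measure Mass) := fun r => (hR r).mono hφ (by norm_num)
  have hm' : ∀ r, Moment φ (1 + 1) R (μ' r : Measure Mass) := fun r =>
    (hR' r).mono hφ (by norm_num)
  have h1 := (hS.with_moment h3).abs_difference_le (hS'.with_moment h3') (p := 1) le_rfl
    (by norm_num) hm hm' ht
  have h2 := h1.two_of_one hφ (h3' t) (h3 t) (inv_pos.2 hs)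
  refine h2.mono ?_
  rw [inv_inv, NNReal.coe_mul, Real.coe_toNNReal _ (Real.exp_pos _).le, add_mul]
  refine add_le_add ?_ (by rfl)
  rw [inv_mul_le_iff₀ hs]
  calc _ ≤ growth 1 R T * bconst 1 * s ^ 2 := mul_le_mul_of_nonneg_left hκ (by positivity)
    _ = _ := by ring

/-- The second moment of a solution stays bounded, if the kernel is close to that of a solution with
bounded moments. -/
lemma second_moment_le (hS : MomentSolution φ 4 B K T μ₀ μ)
    (hS' : MomentSolution φ 4 B' K' T μ₀ μ') {s : ℝ} (hs : 0 < s)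
    (hκ : kernelDist φ 1 K K' μ T ≤ s ^ 2)
    (hsmall : (growth 1 (B + 1) T * bconst 1 + 2 * (B * Real.exp (3 * (B + 1 : ℝ≥0) * T))) * s < 1)
    (r : ℝ) : Moment φ 2 (B + 1) (μ' r : Measure Mass) := by
  have hφ := hS.weight
  have hw : Dom (wpow φ 2) 1 (wpow φ 2) := ⟨hφ.measurable_wpow 2, fun x => by
    rw [one_mul, abs_of_nonneg (hφ.wpow_nonneg 2 x)]⟩
  have hm2 : ∀ s, Moment φ 2 B (μ s : Measure Mass) := fun s => (hS.moment s).mono hφ (by norm_num)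
  have hm2' : ∀ s, Moment φ 2 B' (μ' s : Measure Mass) := fun s =>
    (hS'.moment s).mono hφ (by norm_num)
  set y : ℝ → ℝ := fun r => ∫ x, wpow φ 2 x ∂(μ' r : Measure Mass) with hy
  have hyc : Continuous y := hS'.continuous_integral (by norm_num) (by norm_num) zero_le_one hw
  have h0 : Moment φ 3 B (μ₀ : Measure Mass) := hS.moment_init.mono hφ (by norm_num)
  have key : ∀ t ∈ Icc 0 T, y t < B + 1 := by
    refine lt_of_bootstrap hyc ?_ fun t ht hle => ?_
    · simp only [hy]
      rw [hS'.initial]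
      linarith [(h0.mono hφ (by norm_num : (2 : ℝ) ≤ 3)).integral_le hφ]
    · have hR' : ∀ r, Moment φ 2 (B + 1) (freeze t μ' r : Measure Mass) := fun r =>
        Moment.of_integral_le hφ ((hm2' _).integrable hφ) (by
          rw [NNReal.coe_add, NNReal.coe_one]
          exact hle _ (clamp_mem ht.1 r))
      have hR : ∀ r, Moment φ 2 (B + 1) (freeze t μ r : Measure Mass) := fun r =>
        (hm2 _).mono_const (by simp)
      have hn := (hS.restrict ht).near_two (hS'.restrict ht) hR hR' h0 hs
        ((hS.kernelDist_restrict_le hS'.toCoagKernel ht).trans hκ) (t := t) ⟨ht.1, le_rfl⟩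
      rw [freeze_of_mem ⟨ht.1, le_rfl⟩, freeze_of_mem ⟨ht.1, le_rfl⟩] at hn
      have h1 := hn 1 zero_le_one _ hw
      rw [one_mul] at h1
      have h2 : (growth 1 (B + 1) t * bconst 1 + 2 * (B * Real.exp (3 * (B + 1 : ℝ≥0) * t))) * s ≤
          (growth 1 (B + 1) T * bconst 1 + 2 * (B * Real.exp (3 * (B + 1 : ℝ≥0) * T))) * s := by
        have hb := bconst_pos 1
        unfold growth
        gcongr
        · exact ht.2
        · exact ht.2
      have h3 := (hm2 t).integral_le hφ
      have h4 := (abs_le.1 (h1.trans h2)).2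
      simp only [hy]
      linarith
  refine Moment.of_integral_le hφ ((hm2' r).integrable hφ) ?_
  rw [NNReal.coe_add, NNReal.coe_one, hS'.frozen r]
  exact (key _ (clamp_mem hS'.T_nonneg r)).le

/-- Kernels that converge pointwise converge in the weighted distance along a path. -/
lemma tendsto_kernelDist (hS : MomentSolution φ 4 B K T μ₀ μ) {KN : ℕ → Kern}
    (hKN : ∀ N, CoagKernel φ (KN N))
    (hlim : ∀ x y, Tendsto (fun N => KN N x y) atTop (𝓝 (K x y))) :
    Tendsto (fun N => kernelDist φ 1 K (KN N) μ T) atTop (𝓝 0) := by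
  have hφ := hS.weight
  have hm : ∀ s, Moment φ (1 + 1) B (μ s : Measure Mass) := fun s =>
    (hS.moment s).mono hS.weight (by norm_num)
  have hd := fun N => hS.dom2_kernel_difference (hKN N) 1
  have hinner : ∀ s, Tendsto (fun N => ∫ z, wpow φ 1 z.1 * wpow φ 1 z.2 *
      |KN N z.1 z.2 - K z.1 z.2| ∂((μ s : Measure Mass).prod (μ s : Measure Mass))) atTop
      (𝓝 0) := by
    intro s
    have := tendsto_integral_of_dominated_convergence
      (μ := (μ s : Measure Mass).prod (μ s : Measure Mass))
      (F := fun N (z : Mass × Mass) => wpow φ 1 z.1 * wpow φ 1 z.2 * |KN N z.1 z.2 - K z.1 z.2|)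
      (f := fun _ => 0)
      (fun z => 1 * (wpow φ (1 + 1) z.1 * wpow φ (1 + 1) z.2))
      (fun N => (hd N).measurable.aestronglyMeasurable)
      ((integrable_wpow_prod hφ (hm s) (hm s)).const_mul _)
      (fun N => ae_of_all _ fun z => (hd N).abs_le z.1 z.2) (ae_of_all _ fun z => by
        have h1 := ((hlim z.1 z.2).sub_const (K z.1 z.2)).abs.const_mul
          (wpow φ 1 z.1 * wpow φ 1 z.2)
        rwa [sub_self, abs_zero, mul_zero] at h1)
    rwa [integral_zero] at this
  have := intervalIntegral.tendsto_integral_filter_of_dominated_convergence (μ := volume)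
    (a := 0) (b := T) (l := atTop) (f := fun _ => (0 : ℝ))
    (F := fun N s => ∫ z, wpow φ 1 z.1 * wpow φ 1 z.2 *
      |KN N z.1 z.2 - K z.1 z.2| ∂((μ s : Measure Mass).prod (μ s : Measure Mass)))
    (fun _ => 1 * (B * B))
    (Eventually.of_forall fun N => (((hS.isMeasurablePath (by norm_num)).measurable_integral_prod
      (α := ℝ) (F := fun _ z => wpow φ 1 z.1 * wpow φ 1 z.2 * |KN N z.1 z.2 - K z.1 z.2|)
      ((hd N).measurable.comp measurable_snd) measurable_id)).aestronglyMeasurable)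
    (Eventually.of_forall fun N => ae_of_all _ fun s _ =>
      (hd N).abs_integral_le hφ zero_le_one (hm s) (hm s))
    intervalIntegrable_const (ae_of_all _ fun s _ => hinner s)
  rwa [intervalIntegral.integral_zero] at this

/-- Solutions converge, with their second moments, when the kernels converge. -/
lemma exists_near (hS : MomentSolution φ 4 B K T μ₀ μ) {KN : ℕ → Kern} {BN : ℕ → ℝ≥0}
    {μN : ℕ → ℝ → FiniteMeasure Mass} (hSN : ∀ N, MomentSolution φ 4 (BN N) (KN N) T μ₀ (μN N))
    (hlim : ∀ x y, Tendsto (fun N => KN N x y) atTop (𝓝 (K x y))) :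
    ∃ (R : ℝ≥0) (δ : ℕ → ℝ), B ≤ R ∧ Tendsto δ atTop (𝓝 0) ∧ (∀ N, 0 ≤ δ N) ∧
      ∀ᶠ N in atTop, (∀ r, Moment φ 3 R (μN N r : Measure Mass)) ∧
        ∀ t ∈ Icc 0 T, Near φ 2 (δ N) (μN N t : Measure Mass) (μ t : Measure Mass) := by
  have hφ := hS.weight
  have hgr := growth_pos 1 (B + 1) T
  have hb := bconst_pos 1
  set c : ℝ := growth 1 (B + 1) T * bconst 1 + 2 * (B * Real.exp (3 * (B + 1 : ℝ≥0) * T)) with hc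
  have hc0 : 0 ≤ c := by positivity
  set s : ℕ → ℝ := fun N => Real.sqrt (kernelDist φ 1 K (KN N) μ T + 1 / ((N : ℝ) + 1)) with hs
  have hκ0 : ∀ N, 0 ≤ kernelDist φ 1 K (KN N) μ T := fun N =>
    intervalIntegral.integral_nonneg hS.T_nonneg fun r _ => integral_nonneg fun z =>
      mul_nonneg (mul_nonneg (hφ.wpow_nonneg 1 _) (hφ.wpow_nonneg 1 _)) (abs_nonneg _)
  have hpos : ∀ N : ℕ, (0 : ℝ) < 1 / ((N : ℝ) + 1) := fun N => by positivity
  have hs0 : ∀ N, 0 < s N := fun N => Real.sqrt_pos.2 (by linarith [hκ0 N, hpos N])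
  have hss : ∀ N, kernelDist φ 1 K (KN N) μ T ≤ s N ^ 2 := fun N => by
    rw [hs, Real.sq_sqrt (by linarith [hκ0 N, hpos N])]
    linarith [hpos N]
  have hst : Tendsto s atTop (𝓝 0) := by
    have h1 := (hS.tendsto_kernelDist (fun N => (hSN N).toCoagKernel) hlim).add
      (tendsto_one_div_add_atTop_nhds_zero_nat (𝕜 := ℝ))
    rw [add_zero] at h1
    have h2 := (Real.continuous_sqrt.tendsto 0).comp h1
    rwa [Real.sqrt_zero] at h2
  have hδ : Tendsto (fun N => c * s N) atTop (𝓝 0) := by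
    have := hst.const_mul c
    rwa [mul_zero] at this
  have h0 : Moment φ 3 B (μ₀ : Measure Mass) := hS.moment_init.mono hφ (by norm_num)
  have hE : (1 : ℝ≥0) ≤ (Real.exp (3 * (B + 1 : ℝ≥0) * T)).toNNReal := by
    rw [Real.one_le_toNNReal]
    exact Real.one_le_exp (mul_nonneg (by positivity) hS.T_nonneg)
  refine ⟨B * (Real.exp (3 * (B + 1 : ℝ≥0) * T)).toNNReal, fun N => c * s N,
    le_mul_of_one_le_right zero_le hE, hδ, fun N => mul_nonneg hc0 (hs0 N).le, ?_⟩
  filter_upwards [hδ.eventually (gt_mem_nhds (zero_lt_one (α := ℝ)))] with N hN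
  have hR' := hS.second_moment_le (hSN N) (hs0 N) (hss N) hN
  have hR : ∀ r, Moment φ 2 (B + 1) (μ r : Measure Mass) := fun r =>
    ((hS.moment r).mono hφ (by norm_num)).mono_const (by simp)
  exact ⟨(hSN N).third_moment_le hR' h0, fun t ht => hS.near_two (hSN N) hR hR' h0 (hs0 N) (hss N) ht⟩

end MomentSolution

end

/-! ### Differentiability in the parameter -/

section

variable {K K' G : Kern} {T : ℝ} {μ₀ : FiniteMeasure Mass} {μ μ' : ℝ → FiniteMeasure Mass}
  {φ : Mass → ℝ} {p q C M η : ℝ} {A B R : ℝ≥0} {t : ℝ} {f g : Mass → ℝ}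

lemma dom2_bracket_of_bounded (hφ : IsWeight φ) (hp : 0 ≤ p) (hC : 0 ≤ C) (hf : Dom (wpow φ p) C f)
    (hG : Measurable fun z : Mass × Mass => G z.1 z.2) (hM : ∀ x y, |G x y| ≤ M) :
    Dom2 φ p (C * bconst p * M) (fun z => bracket f z.1 z.2 * G z.1 z.2) :=
  ⟨(measurable_bracket hf.1).mul hG, fun x y => by
    have hb := bconst_pos p
    have hx := hφ.wpow_nonneg p x
    have hy := hφ.wpow_nonneg p y
    rw [abs_mul]
    calc _ ≤ (C * bconst p * (wpow φ p x * wpow φ p y)) * M :=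
          mul_le_mul (abs_bracket_le hφ hp hC hf.2 x y) (hM x y) (abs_nonneg _) (by positivity)
      _ = _ := by ring⟩

namespace MomentSolution

lemma kernelDist_le_of_bounded (hS : MomentSolution φ 3 B K T μ₀ μ) (hK' : CoagKernel φ K')
    (hη : 0 ≤ η) (h : ∀ x y, |K' x y - K x y| ≤ η) :
    kernelDist φ 1 K K' μ T ≤ η * (B * B) * T := by
  have hφ := hS.weight
  have hm : ∀ s, Moment φ 1 B (μ s : Measure Mass) := fun s => (hS.moment s).mono hφ (by norm_num)
  have hd : Dom2 φ 1 η (fun z => wpow φ 1 z.1 * wpow φ 1 z.2 * |K' z.1 z.2 - K z.1 z.2|) :=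
    ⟨(hS.dom2_kernel_difference hK' 1).measurable, fun x y => by
      rw [abs_mul, abs_abs, mul_comm η, abs_of_nonneg (mul_nonneg (hφ.wpow_nonneg 1 x)
        (hφ.wpow_nonneg 1 y))]
      exact mul_le_mul_of_nonneg_left (h x y) (mul_nonneg (hφ.wpow_nonneg 1 x)
        (hφ.wpow_nonneg 1 y))⟩
  have := abs_intervalIntegral_le_const (s := 0) (t := T) (b := η * (B * B)) hS.T_nonneg
    (f := fun s => ∫ z, wpow φ 1 z.1 * wpow φ 1 z.2 * |K' z.1 z.2 - K z.1 z.2|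
      ∂((μ s : Measure Mass).prod (μ s : Measure Mass)))
    fun s _ => hd.abs_integral_le hφ hη (hm s) (hm s)
  rw [sub_zero] at this
  exact (le_abs_self _).trans this

/-- The constant in the bound for the distance of solutions with bounded kernels. -/
def _root_.Smoluchowski.lipConst (B : ℝ≥0) (T : ℝ) : ℝ :=
  growth 1 B T * bconst 1 * ((B * B) * T)

/-- The constant in the bound for the second order remainder. -/
def _root_.Smoluchowski.remainderConst (B : ℝ≥0) (T M : ℝ) : ℝ :=
  growth 1 B T * bconst 1 * M * (2 * B * (lipConst B T * M) + B * B + (lipConst B T * M) ^ 2) * T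

lemma near_of_bounded (hS : MomentSolution φ 3 B K T μ₀ μ) (hS' : MomentSolution φ 3 B K' T μ₀ μ')
    (hη : 0 ≤ η) (h : ∀ x y, |K' x y - K x y| ≤ η) (ht : t ∈ Icc 0 T) :
    Near φ 1 (lipConst B T * η) (μ' t : Measure Mass) (μ t : Measure Mass) := by
  have hφ := hS.weight
  have hgr := growth_pos 1 B T
  have hb := bconst_pos 1
  refine (hS.abs_difference_le hS' le_rfl (by norm_num) (fun r => (hS.moment r).mono hφ (by norm_num))
    (fun r => (hS'.moment r).mono hφ (by norm_num)) ht).mono ?_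
  calc _ ≤ growth 1 B T * bconst 1 * (η * (B * B) * T) :=
        mul_le_mul_of_nonneg_left (hS.kernelDist_le_of_bounded hS'.toCoagKernel hη h) (by positivity)
    _ = _ := by rw [lipConst]; ring

/-- The sensitivity functional is the first order term of the difference of two solutions. -/
lemma abs_remainder_le (hS : MomentSolution φ 3 B K T μ₀ μ)
    (hS' : MomentSolution φ 3 B K' T μ₀ μ') {D : ℝ} (hD : 0 ≤ D) (hG : KernDom φ D G) (hM : 0 ≤ M)
    (hη : 0 ≤ η) (hK : ∀ x y, |K x y| ≤ M) (h1 : ∀ x y, |K' x y - K x y| ≤ M * η)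
    (h2 : ∀ x y, |K' x y - K x y - G x y| ≤ M * η ^ 2) (ht : t ∈ Icc 0 T) (hC : 0 ≤ C)
    (hf : Dom (wpow φ 1) C f) :
    |∫ x, f x ∂(μ' t : Measure Mass) - ∫ x, f x ∂(μ t : Measure Mass) - sensitivity K G μ t f| ≤
      C * (remainderConst B T M * η ^ 2) := by
  have hφ := hS.weight
  have hgr := growth_pos 1 B T
  have hb := bconst_pos 1
  have hT := hS.T_nonneg
  have hl : 0 ≤ lipConst B T := by unfold lipConst; positivity
  obtain ⟨hI, he⟩ := hS.difference_self hS' (p := 1) le_rfl (by norm_num) hC hf ht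
  have hI2 := (hS.intervalIntegrable_sensIntegrand (p := 1) le_rfl (by norm_num) hD hG hC hf
    ht).const_mul (1 / 2)
  rw [he, sensitivity, ← intervalIntegral.integral_const_mul, ← intervalIntegral.integral_sub hI hI2]
  set δ := lipConst B T * (M * η) with hδ
  have hδ0 : 0 ≤ δ := by positivity
  set c : ℝ := C * growth 1 B T with hc
  have hc0 : 0 ≤ c := by positivity
  have hpt : ∀ s ∈ Ioc 0 t, |selfForm K K' μ μ' t f s - 1 / 2 * sensIntegrand K G μ t f s| ≤
      c * bconst 1 * M * (2 * B * (lipConst B T * M) + B * B + (lipConst B T * M) ^ 2) * η ^ 2 := by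
    intro s hs
    have hs' : s ∈ Icc 0 t := ⟨hs.1.le, hs.2⟩
    have hsT : s ∈ Icc 0 T := ⟨hs.1.le, hs.2.trans ht.2⟩
    have hd := hS.dom_propagator (p := 1) le_rfl (by norm_num) (by norm_num) hC hf hs' ht.2
    rw [hS.sensIntegrand_eq (p := 1) le_rfl (by norm_num) hG hC hf hs' ht.2, selfForm]
    set u := propagator K μ s t f with hu
    have hm : Moment φ 1 B (μ s : Measure Mass) := (hS.moment s).mono hφ (by norm_num)
    have hm' : Moment φ 1 B (μ' s : Measure Mass) := (hS'.moment s).mono hφ (by norm_num)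
    have hn := hS.near_of_bounded hS' (mul_nonneg hM hη) h1 hsT
    have d1 : Dom2 φ 1 (c * bconst 1 * (M * η)) (fun z => bracket u z.1 z.2 *
        (K' z.1 z.2 - K z.1 z.2)) :=
      dom2_bracket_of_bounded (G := fun x y => K' x y - K x y) hφ zero_le_one hc0 hd
        (hS'.measurable.sub hS.measurable) h1
    have d2 : Dom2 φ 1 (c * bconst 1 * (M * η ^ 2)) (fun z => bracket u z.1 z.2 *
        (K' z.1 z.2 - K z.1 z.2 - G z.1 z.2)) :=
      dom2_bracket_of_bounded (G := fun x y => K' x y - K x y - G x y) hφ zero_le_one hc0 hd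
        ((hS'.measurable.sub hS.measurable).sub hG.measurable) h2
    have d3 : Dom2 φ 1 (c * bconst 1 * M) (fun z => bracket u z.1 z.2 * K z.1 z.2) :=
      dom2_bracket_of_bounded hφ zero_le_one hc0 hd hS.measurable hK
    have b1 := hn.abs_diag_le hφ (by positivity) d1 hm' hm
    have b2 := d2.abs_integral_le hφ (by positivity) hm hm
    have b3 := hn.abs_second_difference_le hφ (by positivity) hδ0 d3 hm' hm
    have hm2 := (hS.moment s).mono hφ (show (1 : ℝ) + 1 ≤ 3 by norm_num)
    have e2 : ∫ z, bracket u z.1 z.2 * (K' z.1 z.2 - K z.1 z.2 - G z.1 z.2)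
        ∂((μ s : Measure Mass).prod (μ s : Measure Mass)) =
        ∫ z, bracket u z.1 z.2 * (K' z.1 z.2 - K z.1 z.2)
          ∂((μ s : Measure Mass).prod (μ s : Measure Mass)) -
        ∫ z, bracket u z.1 z.2 * G z.1 z.2
          ∂((μ s : Measure Mass).prod (μ s : Measure Mass)) := by
      rw [← integral_sub (d1.integrable hφ hm hm)
        (integrable_bracket hφ zero_le_one hc0 hd hG hm2 hm2)]
      simp only [mul_sub]
    rw [e2] at b2
    set X := ∫ z, bracket u z.1 z.2 * (K' z.1 z.2 - K z.1 z.2)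
      ∂((μ' s : Measure Mass).prod (μ' s : Measure Mass))
    set Y := ∫ z, bracket u z.1 z.2 * (K' z.1 z.2 - K z.1 z.2)
      ∂((μ s : Measure Mass).prod (μ s : Measure Mass))
    set Z := ∫ z, bracket u z.1 z.2 * G z.1 z.2 ∂((μ s : Measure Mass).prod (μ s : Measure Mass))
    set W := (∫ z, bracket u z.1 z.2 * K z.1 z.2
        ∂((μ' s : Measure Mass).prod (μ' s : Measure Mass)) -
      ∫ z, bracket u z.1 z.2 * K z.1 z.2
        ∂((μ' s : Measure Mass).prod (μ s : Measure Mass))) -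
      (∫ z, bracket u z.1 z.2 * K z.1 z.2
        ∂((μ s : Measure Mass).prod (μ' s : Measure Mass)) -
      ∫ z, bracket u z.1 z.2 * K z.1 z.2
        ∂((μ s : Measure Mass).prod (μ s : Measure Mass)))
    have e3 : 1 / 2 * (X + W) - 1 / 2 * Z = 1 / 2 * ((X - Y) + (Y - Z) + W) := by ring
    rw [e3, abs_mul, abs_of_pos (by norm_num : (0 : ℝ) < 1 / 2)]
    have b4 := abs_add_three (X - Y) (Y - Z) W
    refine (mul_le_of_le_one_left (abs_nonneg _) (by norm_num)).trans
      (b4.trans ((add_le_add (add_le_add b1 b2) b3).trans (le_of_eq ?_)))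
    rw [hδ]
    ring
  refine (abs_intervalIntegral_le_const ht.1 hpt).trans ?_
  calc _ ≤ c * bconst 1 * M * (2 * B * (lipConst B T * M) + B * B + (lipConst B T * M) ^ 2) *
        η ^ 2 * T := mul_le_mul_of_nonneg_left (by linarith [ht.2]) (by positivity)
    _ = _ := by rw [remainderConst, hc]; ring

end MomentSolution

variable {d : ℕ} {𝒰 : Set (Param d)} {𝒦 : Param d → Kern} {ℓ : Param d}

/-- Taylor's formula for a kernel in a bounded family. -/
lemma IsKernelFamily.taylor (h𝒦 : IsKernelFamily 𝒰 φ 𝒦) (h𝒰 : IsOpen 𝒰)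
    (hM : ∀ ℓ ∈ 𝒰, ∀ x y, |𝒦 ℓ x y| ≤ M ∧ ‖fderiv ℝ (fun ℓ' => 𝒦 ℓ' x y) ℓ‖ ≤ M ∧
      ‖fderiv ℝ (fderiv ℝ fun ℓ' => 𝒦 ℓ' x y) ℓ‖ ≤ M) (hM0 : 0 ≤ M) {h : Param d}
    (hball : Metric.closedBall ℓ ‖h‖ ⊆ 𝒰) (x y : Mass) :
    |𝒦 (ℓ + h) x y - 𝒦 ℓ x y| ≤ M * ‖h‖ ∧
      |𝒦 (ℓ + h) x y - 𝒦 ℓ x y - dKern 𝒦 ℓ h x y| ≤ M * ‖h‖ ^ 2 := by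
  set k : Param d → ℝ := fun ℓ' => 𝒦 ℓ' x y with hk
  have hconv := convex_closedBall ℓ ‖h‖
  have hℓ : ℓ ∈ Metric.closedBall ℓ ‖h‖ := Metric.mem_closedBall_self (norm_nonneg h)
  have hℓh : ℓ + h ∈ Metric.closedBall ℓ ‖h‖ := by simp
  have hdiff : ∀ z ∈ Metric.closedBall ℓ ‖h‖, DifferentiableAt ℝ k z := fun z hz =>
    (h𝒦.hasFDerivAt h𝒰 (hball hz) x y).differentiableAt
  have hdiff2 : ∀ z ∈ Metric.closedBall ℓ ‖h‖, DifferentiableAt ℝ (fderiv ℝ k) z := fun z hz =>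
    (((h𝒦.contDiffOn x y).fderiv_of_isOpen (m := 1) h𝒰 (by norm_num)).differentiableOn
      one_ne_zero).differentiableAt (h𝒰.mem_nhds (hball hz))
  have h1 := hconv.norm_image_sub_le_of_norm_fderiv_le hdiff
    (fun z hz => (hM z (hball hz) x y).2.1) hℓ hℓh
  have h2 : ∀ z ∈ Metric.closedBall ℓ ‖h‖, ‖fderiv ℝ k z - fderiv ℝ k ℓ‖ ≤ M * ‖h‖ := fun z hz =>
    (hconv.norm_image_sub_le_of_norm_fderiv_le hdiff2
      (fun z hz => (hM z (hball hz) x y).2.2) hℓ hz).trans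
      (mul_le_mul_of_nonneg_left (by rwa [← dist_eq_norm]) hM0)
  have h3 := hconv.norm_image_sub_le_of_norm_fderiv_le' hdiff h2 hℓ hℓh
  rw [add_sub_cancel_left, Real.norm_eq_abs] at h1 h3
  refine ⟨h1, h3.trans (le_of_eq ?_)⟩
  ring

/-- For a bounded family of kernels the solution is differentiable in the parameter. -/
lemma hasSensitivityAt (h𝒦 : IsKernelFamily 𝒰 φ 𝒦) (h𝒰 : IsOpen 𝒰) (hbdd : IsBoundedFamily 𝒰 𝒦)
    (hℓ : ℓ ∈ 𝒰) (hT : 0 ≤ T) {m : Param d → ℝ → FiniteMeasure Mass}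
    (hm : ∀ ℓ' ∈ 𝒰, IsSolution (𝒦 ℓ') T μ₀ (m ℓ')) (ht : t ∈ Icc 0 T)
    {σ : Param d →ₗ[ℝ] SignedMeasure Mass} (hσ : ∀ v A, MeasurableSet A →
      σ v A = sensitivity (𝒦 ℓ) (dKern 𝒦 ℓ v) (freeze T (m ℓ)) t (A.indicator fun _ => 1)) :
    HasSensitivityAt (fun ℓ' => m ℓ' t) σ ℓ := by
  obtain ⟨M, hM⟩ := hbdd
  have hM0 : 0 ≤ M := by
    let x : Mass := ⟨1, one_pos⟩
    exact (abs_nonneg _).trans (hM ℓ hℓ x x).1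
  set c : ℝ := max 1 M with hc
  have hc1 : 1 ≤ c := le_max_left _ _
  have hMc : M ≤ c * c := (le_max_right 1 M).trans (le_mul_of_one_le_right (by linarith) hc1)
  have hc𝒦 : IsKernelFamily 𝒰 (fun _ => c) 𝒦 := { h𝒦 with
    le := fun ℓ' hℓ' x y => (le_abs_self _).trans ((hM ℓ' hℓ' x y).1.trans hMc)
    norm_fderiv_le := fun ℓ' hℓ' x y => (hM ℓ' hℓ' x y).2.1.trans hMc }
  obtain ⟨m₀, hm₀⟩ : ∃ m : ℝ≥0, (μ₀ : Measure Mass) univ = m :=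
    ⟨_, (ENNReal.coe_toNNReal (measure_ne_top _ _)).symm⟩
  set B : ℝ≥0 := (c ^ (3 : ℝ)).toNNReal * m₀ with hB
  have hS : ∀ ℓ' ∈ 𝒰, MomentSolution (fun _ => c) 3 B (𝒦 ℓ') T μ₀ (freeze T (m ℓ')) :=
    fun ℓ' hℓ' => (hm ℓ' hℓ').momentSolution (hc𝒦.coagKernel hℓ') (isWeight_const hc1) ⟨hT, le_rfl⟩
      fun r hr => moment_const c 3
        (((hm ℓ' hℓ').measure_univ_le (h𝒦.nonneg ℓ' hℓ') hr).trans hm₀.le)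
  have hS0 := hS ℓ hℓ
  have hw1 : ∀ x : Mass, (1 : ℝ) ≤ wpow (fun _ => c) 1 x := fun x => by
    rw [IsWeight.wpow_one]; exact hc1
  obtain ⟨r, hr, hball⟩ := Metric.isOpen_iff.1 h𝒰 ℓ hℓ
  have hgr := growth_pos 1 B T
  have hb := bconst_pos 1
  have hrem : 0 ≤ remainderConst B T M := by
    unfold remainderConst lipConst; positivity
  have key : ∀ h : Param d, ‖h‖ < r →
      normTV ((m (ℓ + h) t : Measure Mass).toSignedMeasure -
        (m ℓ t : Measure Mass).toSignedMeasure - σ h) ≤ remainderConst B T M * ‖h‖ ^ 2 := by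
    intro h hh
    have hcb : Metric.closedBall ℓ ‖h‖ ⊆ 𝒰 := (Metric.closedBall_subset_ball hh).trans hball
    have hℓh : ℓ + h ∈ 𝒰 := hcb (by simp)
    have hS' := hS (ℓ + h) hℓh
    have htay := fun x y => h𝒦.taylor h𝒰 hM hM0 hcb x y
    have hG := hc𝒦.kernDom_dKern h𝒰 hℓ h
    have hF1 : ∀ α : FiniteMeasure Mass, DualFunctional (fun _ => 1) _
        (fun f => ∫ x, f x ∂(α : Measure Mass)) := fun α =>
      DualFunctional.of_integral (integrable_const (1 : ℝ)) le_rfl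
    have hF2 := (hS0.dualFunctional_sensitivity (p := 1) le_rfl (by norm_num) (norm_nonneg h) hG
      ht).mono hw1
    have hF := (((hF1 (m (ℓ + h) t)).sub (hF1 (m ℓ t))).sub hF2).of_bound
      (b := remainderConst B T M * ‖h‖ ^ 2) fun C f hC hf => by
        have hf' : Dom (wpow (fun _ => c) 1) C f := ⟨hf.1, fun x =>
          (hf.2 x).trans (mul_le_mul_of_nonneg_left (hw1 x) hC)⟩
        have := hS0.abs_remainder_le hS' (norm_nonneg h) hG hM0 (norm_nonneg h)
          (fun x y => (hM ℓ hℓ x y).1) (fun x y => (htay x y).1) (fun x y => (htay x y).2) ht hC hf'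
        rwa [freeze_of_mem ht, freeze_of_mem ht] at this
    refine hF.normTV_le (by positivity) fun A hA => ?_
    rw [sub_apply, sub_apply, Measure.toSignedMeasure_apply_measurable hA,
      Measure.toSignedMeasure_apply_measurable hA, hσ h A hA, integral_indicator hA,
      integral_indicator hA]
    simp
  have hO : (fun h : Param d => normTV ((m (ℓ + h) t : Measure Mass).toSignedMeasure -
      (m ℓ t : Measure Mass).toSignedMeasure - σ h)) =O[𝓝 0] fun h : Param d => ‖h‖ ^ 2 := by
    refine IsBigO.of_bound (remainderConst B T M) ?_
    filter_upwards [Metric.ball_mem_nhds (0 : Param d) hr] with h hh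
    rw [mem_ball_zero_iff] at hh
    rw [Real.norm_eq_abs, abs_of_nonneg (show 0 ≤ normTV _ from ENNReal.toReal_nonneg), Real.norm_eq_abs,
      abs_of_nonneg (by positivity)]
    exact key h hh
  exact hO.trans_isLittleO (isLittleO_norm_pow_id one_lt_two)

end

/-! ### Comparison of sensitivities -/

/-- A bound for the difference of the operators `Λ` of two paths. -/
def gapSource (φ : Mass → ℝ) (c δ : ℝ) (K K' : Kern) (μ : ℝ → FiniteMeasure Mass) (r : ℝ)
    (x : Mass) : ℝ≥0∞ :=
  ENNReal.ofReal (c * (wpow φ 2 x * δ +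
    ∫ y, wpow φ 1 x * wpow φ 1 y * |K' x y - K x y| ∂(μ r : Measure Mass)))

/-- A bound for the difference of the propagators of two paths. -/
def gap (φ : Mass → ℝ) (c δ : ℝ) (K K' : Kern) (μ : ℝ → FiniteMeasure Mass) (T : ℝ) :
    ℝ → Mass → ℝ≥0∞ :=
  potential K μ T (fullSource K μ T (fun _ => 0) (gapSource φ c δ K K' μ))

/-- A bound for the difference of the sensitivity integrands of two paths. -/
def sensGap (φ : Mass → ℝ) (c δ : ℝ) (R : ℝ≥0) (K K' Γ : Kern) (μ : ℝ → FiniteMeasure Mass) (T : ℝ)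
    (s : ℝ) : ℝ≥0∞ :=
  ENNReal.ofReal (2 * (c * R) * δ) +
    ENNReal.ofReal (c * ∫ z, wpow φ 1 z.1 * wpow φ 1 z.2 * Γ z.1 z.2
      ∂((μ s : Measure Mass).prod (μ s : Measure Mass))) +
    ∫⁻ z, (gap φ c δ K K' μ T s (z.1 + z.2) + gap φ c δ K K' μ T s z.1 + gap φ c δ K K' μ T s z.2) *
      ENNReal.ofReal (φ z.1 * φ z.2) ∂((μ s : Measure Mass).prod (μ s : Measure Mass))

section

variable {K K' G G' Γ : Kern} {T : ℝ} {μ₀ : FiniteMeasure Mass} {μ μ' : ℝ → FiniteMeasure Mass}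
  {φ : Mass → ℝ} {p q C δ c : ℝ} {R : ℝ≥0} {t : ℝ} {f g : Mass → ℝ}

lemma dom2_weighted (hφ : IsWeight φ) {D : ℝ}
    (hΓ : Measurable fun z : Mass × Mass => Γ z.1 z.2) (h : ∀ x y, |Γ x y| ≤ D * (φ x * φ y)) :
    Dom2 φ 2 D (fun z => wpow φ 1 z.1 * wpow φ 1 z.2 * Γ z.1 z.2) :=
  ⟨(((hφ.measurable_wpow 1).comp measurable_fst).mul
    ((hφ.measurable_wpow 1).comp measurable_snd)).mul hΓ, fun x y => by
    have hx := hφ.pos x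
    have hy := hφ.pos y
    have e : ∀ z, wpow φ 2 z = φ z * φ z := fun z => by rw [wpow, Real.rpow_two, sq]
    rw [IsWeight.wpow_one, IsWeight.wpow_one, e, e, abs_mul, abs_of_pos (mul_pos hx hy)]
    calc _ ≤ φ x * φ y * (D * (φ x * φ y)) := mul_le_mul_of_nonneg_left (h x y) (by positivity)
      _ = _ := by ring⟩

namespace MomentSolution

lemma dom2_weighted_difference (hS : MomentSolution φ q R K T μ₀ μ) (hK' : CoagKernel φ K') :
    Dom2 φ 2 1 (fun z => wpow φ 1 z.1 * wpow φ 1 z.2 * |K' z.1 z.2 - K z.1 z.2|) :=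
  dom2_weighted (Γ := fun x y => |K' x y - K x y|) hS.weight
    (hK'.measurable.sub hS.measurable).abs fun x y => by
      rw [abs_abs, one_mul]
      exact abs_sub_le_of_nonneg_of_le (hK'.nonneg x y) (hK'.le x y) (hS.nonneg x y) (hS.le x y)

lemma measurable_gapSource (hS : MomentSolution φ 3 R K T μ₀ μ) (hK' : CoagKernel φ K') (c δ : ℝ) :
    Measurable fun q : ℝ × Mass => gapSource φ c δ K K' μ q.1 q.2 := by
  have h1 : Measurable fun q : ℝ × Mass => ∫ y, wpow φ 1 q.2 * wpow φ 1 y * |K' q.2 y - K q.2 y|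
      ∂(μ q.1 : Measure Mass) := by
    refine (hS.isMeasurablePath (by norm_num)).measurable_integral (α := ℝ × Mass)
      (F := fun q y => wpow φ 1 q.2 * wpow φ 1 y * |K' q.2 y - K q.2 y|) ?_ measurable_fst
    exact (hS.dom2_weighted_difference hK').measurable.comp
      ((measurable_snd.comp measurable_fst).prodMk measurable_snd)
  have h2 : Measurable fun q : ℝ × Mass => wpow φ 2 q.2 :=
    (hS.weight.measurable_wpow 2).comp measurable_snd
  exact (((h2.mul_const δ).add h1).const_mul c).ennreal_ofReal

lemma gapSource_le (hS : MomentSolution φ 3 R K T μ₀ μ) (hK' : CoagKernel φ K') (hc : 0 ≤ c)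
    (hδ : δ ≤ 1) (r : ℝ) (x : Mass) : gapSource φ c δ K K' μ r x ≤
      ENNReal.ofReal (c * (1 + R)) * ENNReal.ofReal (wpow φ 2 x) := by
  have hφ := hS.weight
  have hm := (hS.moment r).mono hφ (show (2 : ℝ) ≤ 3 by norm_num)
  have hx := hφ.wpow_nonneg 2 x
  have h1 := ((hS.dom2_weighted_difference hK').dom_marginal hφ zero_le_one hm).2 x
  rw [← ENNReal.ofReal_mul (by positivity)]
  refine ENNReal.ofReal_le_ofReal ?_
  rw [mul_assoc]
  refine mul_le_mul_of_nonneg_left ?_ hc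
  have h2 := (le_abs_self _).trans h1
  have h3 := mul_le_mul_of_nonneg_left hδ hx
  linarith

lemma measurable_gap (hS : MomentSolution φ 3 R K T μ₀ μ) (hK' : CoagKernel φ K') (c δ : ℝ) :
    Measurable fun q : ℝ × Mass => gap φ c δ K K' μ T q.1 q.2 := by
  have hP := hS.coagPath (by norm_num) hS.toCoagKernel
  exact hP.measurable_potential T (hP.measurable_fullSource T (a := fun _ => 0) measurable_const
    (hS.measurable_gapSource hK' c δ))

lemma lyap_two (hS : MomentSolution φ 3 R K T μ₀ μ) :
    Lyap K μ (wpow φ 2) (2 * 2 ^ ((2 : ℝ) - 1) * R) :=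
  lyap_wpow hS.weight one_le_two (hS.coagPath (by norm_num) hS.toCoagKernel) hS.le fun r =>
    (hS.moment r).mono hS.weight (by norm_num)

lemma fullSource_gapSource_le (hS : MomentSolution φ 3 R K T μ₀ μ) (hK' : CoagKernel φ K')
    (hc : 0 ≤ c) (hδ : δ ≤ 1) (s : ℝ) (x : Mass) :
    fullSource K μ T (fun _ => 0) (gapSource φ c δ K K' μ) s x ≤
      ENNReal.ofReal (c * (1 + R)) * baseSource K μ T (wpow φ 2) s x :=
  fullSource_le ENNReal.ofReal_ne_top (fun _ => zero_le)
    (fun r x => hS.gapSource_le hK' hc hδ r x) s x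

/-- The bound for `gap`. -/
def _root_.Smoluchowski.gapConst (c : ℝ) (R : ℝ≥0) (T : ℝ) : ℝ :=
  c * (1 + R) * Real.exp ((2 * (2 * 2 ^ ((2 : ℝ) - 1) * R) + 1) * T)

lemma gap_le (hS : MomentSolution φ 3 R K T μ₀ μ) (hK' : CoagKernel φ K')
    (hc : 0 ≤ c) (hδ : δ ≤ 1) {s : ℝ} (hs : 0 ≤ s) (x : Mass) :
    gap φ c δ K K' μ T s x ≤ ENNReal.ofReal (gapConst c R T * wpow φ 2 x) := by
  have hP := hS.coagPath (by norm_num) hS.toCoagKernel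
  have hx := hS.weight.wpow_nonneg 2 x
  have h := hS.lyap_two.potential_le_superSol hP ENNReal.ofReal_ne_top
    (hS.fullSource_gapSource_le hK' hc hδ) s x
  refine h.trans ?_
  rw [superSol]
  split_ifs
  · rw [← ENNReal.ofReal_mul (by positivity), gapConst]
    refine ENNReal.ofReal_le_ofReal ?_
    rw [mul_assoc (c * (1 + R))]
    refine mul_le_mul_of_nonneg_left (mul_le_mul_of_nonneg_right (Real.exp_le_exp.2 ?_) hx)
      (by positivity)
    exact mul_le_mul_of_nonneg_left (by linarith) (by positivity)
  · rw [mul_zero]; exact zero_le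

lemma tendsto_gap (hS : MomentSolution φ 3 R K T μ₀ μ) {KN : ℕ → Kern}
    (hKN : ∀ N, CoagKernel φ (KN N)) (hc : 0 ≤ c) {δN : ℕ → ℝ} (hδ : ∀ N, δN N ≤ 1)
    (hδ0 : Tendsto δN atTop (𝓝 0)) (hlim : ∀ x y, Tendsto (fun N => KN N x y) atTop (𝓝 (K x y)))
    (s : ℝ) (x : Mass) : Tendsto (fun N => gap φ c (δN N) K (KN N) μ T s x) atTop (𝓝 0) := by
  have hφ := hS.weight
  have hP := hS.coagPath (by norm_num) hS.toCoagKernel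
  refine hS.lyap_two.tendsto_potential hP (fun N => hP.measurable_fullSource T measurable_const
    (hS.measurable_gapSource (hKN N) c (δN N))) (β := ENNReal.ofReal (c * (1 + R)))
    ENNReal.ofReal_ne_top
    (fun N => hS.fullSource_gapSource_le (hKN N) hc (hδ N)) (fun s x => ?_) s x
  refine hP.tendsto_fullSource (fun x => tendsto_const_nhds)
    (fun N => hS.measurable_gapSource (hKN N) c (δN N))
    (B := fun x => ENNReal.ofReal (c * (1 + R)) * ENNReal.ofReal (wpow φ 2 x))
    (fun x => ENNReal.mul_ne_top ENNReal.ofReal_ne_top ENNReal.ofReal_ne_top)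
    (fun N => hS.gapSource_le (hKN N) hc (hδ N)) (fun r x => ?_) s x
  have hm := (hS.moment r).mono hφ (show (2 : ℝ) ≤ 3 by norm_num)
  have hd := fun N => (hS.dom2_weighted_difference (hKN N)).section x
  have h1 : Tendsto (fun N => ∫ y, wpow φ 1 x * wpow φ 1 y * |KN N x y - K x y|
      ∂(μ r : Measure Mass)) atTop (𝓝 0) := by
    have := tendsto_integral_of_dominated_convergence (μ := (μ r : Measure Mass))
      (F := fun N y => wpow φ 1 x * wpow φ 1 y * |KN N x y - K x y|) (f := fun _ => 0)
      (fun y => 1 * wpow φ 2 x * wpow φ 2 y) (fun N => (hd N).1.aestronglyMeasurable)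
      ((hm.integrable hφ).const_mul _) (fun N => ae_of_all _ (hd N).2) (ae_of_all _ fun y => by
        have h1 := ((hlim x y).sub_const (K x y)).abs.const_mul (wpow φ 1 x * wpow φ 1 y)
        rwa [sub_self, abs_zero, mul_zero] at h1)
    rwa [integral_zero] at this
  have h2 := ((hδ0.const_mul (wpow φ 2 x)).add h1).const_mul c
  rw [mul_zero, add_zero, mul_zero] at h2
  have h3 := (ENNReal.continuous_ofReal.tendsto _).comp h2
  rwa [ENNReal.ofReal_zero] at h3

/-- The difference of the propagators of two close solutions. -/
lemma abs_propagator_sub_le_gap (hS : MomentSolution φ 3 R K T μ₀ μ)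
    (hS' : MomentSolution φ 3 R K' T μ₀ μ') (hδ1 : δ ≤ 1)
    (hn : ∀ t ∈ Icc 0 T, Near φ 2 δ (μ' t : Measure Mass) (μ t : Measure Mass))
    (hf : Dom (wpow φ 1) 1 f) (htT : t ≤ T) {s : ℝ} (hs : s ∈ Icc 0 t) (x : Mass) :
    ENNReal.ofReal |propagator K' μ' s t f x - propagator K μ s t f x| ≤
      gap φ (growth 1 R T * bconst 1) δ K K' μ T s x := by
  have hφ := hS.weight
  have hP := hS.coagPath (by norm_num) hS.toCoagKernel
  have hP' := hS'.coagPath (by norm_num) hS'.toCoagKernel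
  have hgr := growth_pos 1 R T
  have hb := bconst_pos 1
  have hm2 : ∀ r, Moment φ (1 + 1) R (μ r : Measure Mass) := fun r =>
    (hS.moment r).mono hφ (by norm_num)
  have hw := lyap_wpow hφ le_rfl hP hS.le hm2
  have hw' := lyap_wpow hφ le_rfl hP' hS'.le (p := 1) fun r => (hS'.moment r).mono hφ (by norm_num)
  have hcon := controls_wpow hφ hP hS.le (fun r => (hS.moment r).mono hφ (by norm_num)) 1
  rw [show (1 : ℝ) + 1 = 2 by norm_num] at hcon
  refine hw.propagator_difference hS.lyap_two hP hcon hw' hP' zero_le_one hf htT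
    (hS.measurable_gapSource hS'.toCoagKernel _ δ) (fun r hr x => ?_) (β := ENNReal.ofReal
      (growth 1 R T * bconst 1 * (1 + R))) ENNReal.ofReal_ne_top
    (fun r x => hS.gapSource_le hS'.toCoagKernel (by positivity) hδ1 r x) hs x
  have hr' : r ∈ Icc 0 t := ⟨hr.1.le, hr.2⟩
  have hd := hS'.dom_propagator (p := 1) le_rfl (by norm_num) (by norm_num) zero_le_one hf hr' htT
  set u := propagator K' μ' r t f
  have hd2 := dom2_bracket hφ zero_le_one (by positivity) hd hS'.kernDom
  have hd3 := dom2_bracket hφ zero_le_one (by positivity) hd hS.kernDom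
  rw [show (1 : ℝ) + 1 = 2 by norm_num] at hd2 hd3 hm2
  have h1 := hn r ⟨hr.1.le, hr.2.trans htT⟩ _ (mul_nonneg (by positivity) (hφ.wpow_nonneg 2 x)) _
    (hd2.section x)
  refine ENNReal.ofReal_le_ofReal ?_
  have hdd := (hS.dom2_weighted_difference hS'.toCoagKernel).section x
  have h2 : |∫ y, bracket u x y * K' x y ∂(μ r : Measure Mass) -
      ∫ y, bracket u x y * K x y ∂(μ r : Measure Mass)| ≤ growth 1 R T * bconst 1 *
      ∫ y, wpow φ 1 x * wpow φ 1 y * |K' x y - K x y| ∂(μ r : Measure Mass) := by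
    rw [← integral_sub ((hd2.section x).integrable hφ (hm2 r))
      ((hd3.section x).integrable hφ (hm2 r)), ← integral_const_mul, ← Real.norm_eq_abs]
    refine norm_integral_le_of_norm_le ((hdd.integrable hφ (hm2 r)).const_mul _)
      (ae_of_all _ fun y => ?_)
    rw [Real.norm_eq_abs, ← mul_sub, abs_mul, ← mul_assoc]
    refine mul_le_mul_of_nonneg_right ?_ (abs_nonneg _)
    have := abs_bracket_le hφ zero_le_one (by positivity) hd.2 x y
    rwa [one_mul] at this
  have h3 := abs_sub_le (∫ y, bracket u x y * K' x y ∂(μ' r : Measure Mass))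
    (∫ y, bracket u x y * K' x y ∂(μ r : Measure Mass))
    (∫ y, bracket u x y * K x y ∂(μ r : Measure Mass))
  refine (h3.trans (add_le_add h1 h2)).trans (le_of_eq ?_)
  ring

lemma measurable_sensGap (hS : MomentSolution φ 3 R K T μ₀ μ) (hK' : CoagKernel φ K')
    (hΓ : Measurable fun z : Mass × Mass => Γ z.1 z.2) (c δ : ℝ) :
    Measurable (sensGap φ c δ R K K' Γ μ T) := by
  have hφ := hS.weight
  have hmp := hS.isMeasurablePath (by norm_num)
  have hg := hS.measurable_gap hK' c δ
  have h1 : Measurable fun s => ENNReal.ofReal (c * ∫ z, wpow φ 1 z.1 * wpow φ 1 z.2 * Γ z.1 z.2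
      ∂((μ s : Measure Mass).prod (μ s : Measure Mass))) :=
    ((hmp.measurable_integral_prod (α := ℝ)
      (F := fun _ z => wpow φ 1 z.1 * wpow φ 1 z.2 * Γ z.1 z.2) (((((hφ.measurable_wpow 1).comp
      measurable_fst).mul ((hφ.measurable_wpow 1).comp measurable_snd)).mul hΓ).comp measurable_snd)
      measurable_id).const_mul c).ennreal_ofReal
  have h2 : Measurable fun s => ∫⁻ z, (gap φ c δ K K' μ T s (z.1 + z.2) + gap φ c δ K K' μ T s z.1 +
      gap φ c δ K K' μ T s z.2) * ENNReal.ofReal (φ z.1 * φ z.2)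
      ∂((μ s : Measure Mass).prod (μ s : Measure Mass)) := by
    refine hmp.measurable_lintegral_prod (α := ℝ) (F := fun s z =>
      (gap φ c δ K K' μ T s (z.1 + z.2) + gap φ c δ K K' μ T s z.1 + gap φ c δ K K' μ T s z.2) *
      ENNReal.ofReal (φ z.1 * φ z.2)) ?_ measurable_id
    have h1 : Measurable fun p : ℝ × Mass × Mass => (p.1, p.2.1 + p.2.2) := by fun_prop
    have h2 : Measurable fun p : ℝ × Mass × Mass => (p.1, p.2.1) := by fun_prop
    have h3 : Measurable fun p : ℝ × Mass × Mass => (p.1, p.2.2) := by fun_prop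
    have h4 : Measurable fun p : ℝ × Mass × Mass => φ p.2.1 * φ p.2.2 :=
      (hφ.measurable.comp (measurable_fst.comp measurable_snd)).mul
        (hφ.measurable.comp (measurable_snd.comp measurable_snd))
    exact (((hg.comp h1).add (hg.comp h2)).add (hg.comp h3)).mul h4.ennreal_ofReal
  exact (h1.const_add _).add h2

/-- The difference of the sensitivity integrands of two close solutions. -/
lemma abs_sensIntegrand_sub_le (hS : MomentSolution φ 3 R K T μ₀ μ)
    (hS' : MomentSolution φ 3 R K' T μ₀ μ') (hδ0 : 0 ≤ δ) (hδ1 : δ ≤ 1)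
    (hn : ∀ t ∈ Icc 0 T, Near φ 2 δ (μ' t : Measure Mass) (μ t : Measure Mass))
    (hG : KernDom φ 1 G) (hG' : KernDom φ 1 G') {D : ℝ}
    (hΓm : Measurable fun z : Mass × Mass => Γ z.1 z.2) (hΓD : ∀ x y, |Γ x y| ≤ D * (φ x * φ y))
    (hΓ : ∀ x y, |G' x y - G x y| ≤ Γ x y)
    (hf : Dom (wpow φ 1) 1 f) (htT : t ≤ T) {s : ℝ} (hs : s ∈ Icc 0 t) :
    ENNReal.ofReal |sensIntegrand K' G' μ' t f s - sensIntegrand K G μ t f s| ≤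
      sensGap φ (growth 1 R T * bconst 1) δ R K K' Γ μ T s := by
  have hφ := hS.weight
  have hgr := growth_pos 1 R T
  have hb := bconst_pos 1
  have hsT : s ∈ Icc 0 T := ⟨hs.1, hs.2.trans htT⟩
  have e12 : (1 : ℝ) + 1 = 2 := by norm_num
  have hm : Moment φ 2 R (μ s : Measure Mass) := (hS.moment s).mono hφ (by norm_num)
  have hm' : Moment φ 2 R (μ' s : Measure Mass) := (hS'.moment s).mono hφ (by norm_num)
  have hd := hS.dom_propagator (p := 1) le_rfl (by norm_num) (by norm_num) zero_le_one hf hs htT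
  have hd' := hS'.dom_propagator (p := 1) le_rfl (by norm_num) (by norm_num) zero_le_one hf hs htT
  have hgap := hS.abs_propagator_sub_le_gap hS' hδ1 hn hf htT hs
  rw [hS.sensIntegrand_eq (p := 1) le_rfl (by norm_num) hG zero_le_one hf hs htT,
    hS'.sensIntegrand_eq (p := 1) le_rfl (by norm_num) hG' zero_le_one hf hs htT]
  set u := propagator K μ s t f
  set u' := propagator K' μ' s t f
  have d1 := dom2_bracket hφ zero_le_one (by positivity) hd' hG'
  have d2 := dom2_bracket hφ zero_le_one (by positivity) hd' hG
  have d3 := dom2_bracket hφ zero_le_one (by positivity) hd hG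
  rw [e12] at d1 d2 d3
  set ν := (μ s : Measure Mass).prod (μ s : Measure Mass) with hν
  have i1 := (hn s hsT).abs_diag_le hφ (by positivity) d1 hm' hm
  have i2 : |∫ z, bracket u' z.1 z.2 * G' z.1 z.2 ∂ν - ∫ z, bracket u' z.1 z.2 * G z.1 z.2 ∂ν| ≤
      growth 1 R T * bconst 1 * ∫ z, wpow φ 1 z.1 * wpow φ 1 z.2 * Γ z.1 z.2 ∂ν := by
    rw [← integral_sub (d1.integrable hφ hm hm) (d2.integrable hφ hm hm), ← integral_const_mul,
      ← Real.norm_eq_abs]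
    refine norm_integral_le_of_norm_le (((dom2_weighted hφ hΓm hΓD).integrable hφ hm hm).const_mul _)
      (ae_of_all _ fun z => ?_)
    rw [Real.norm_eq_abs, ← mul_sub, abs_mul, ← mul_assoc]
    have := abs_bracket_le hφ zero_le_one (by positivity) hd'.2 z.1 z.2
    rw [one_mul] at this
    exact mul_le_mul this (hΓ _ _) (abs_nonneg _) (by
      have := hφ.wpow_nonneg 1 z.1
      have := hφ.wpow_nonneg 1 z.2
      positivity)
  have i3 : ENNReal.ofReal |∫ z, bracket u' z.1 z.2 * G z.1 z.2 ∂ν -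
      ∫ z, bracket u z.1 z.2 * G z.1 z.2 ∂ν| ≤
      ∫⁻ z, (gap φ (growth 1 R T * bconst 1) δ K K' μ T s (z.1 + z.2) +
        gap φ (growth 1 R T * bconst 1) δ K K' μ T s z.1 +
        gap φ (growth 1 R T * bconst 1) δ K K' μ T s z.2) * ENNReal.ofReal (φ z.1 * φ z.2) ∂ν := by
    rw [← integral_sub (d2.integrable hφ hm hm) (d3.integrable hφ hm hm),
      ← Real.enorm_eq_ofReal_abs]
    refine (enorm_integral_le_lintegral_enorm _).trans (lintegral_mono fun z => ?_)
    rw [← sub_mul, Real.enorm_eq_ofReal_abs, abs_mul, ENNReal.ofReal_mul (abs_nonneg _)]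
    refine mul_le_mul' ?_ (ENNReal.ofReal_le_ofReal ?_)
    · have h1 : |bracket u' z.1 z.2 - bracket u z.1 z.2| ≤
          |u' (z.1 + z.2) - u (z.1 + z.2)| + |u' z.1 - u z.1| + |u' z.2 - u z.2| := by
        have : bracket u' z.1 z.2 - bracket u z.1 z.2 = (u' (z.1 + z.2) - u (z.1 + z.2)) +
            -(u' z.1 - u z.1) + -(u' z.2 - u z.2) := by
          simp only [bracket]; ring
        rw [this]
        refine (abs_add_three _ _ _).trans ?_
        rw [abs_neg, abs_neg]
      refine (ENNReal.ofReal_le_ofReal h1).trans ?_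
      rw [ENNReal.ofReal_add (by positivity) (abs_nonneg _),
        ENNReal.ofReal_add (abs_nonneg _) (abs_nonneg _)]
      exact add_le_add (add_le_add (hgap _) (hgap _)) (hgap _)
    · have := hG.abs_le z.1 z.2
      rwa [one_mul] at this
  have i4 : |∫ z, bracket u' z.1 z.2 * G' z.1 z.2
        ∂((μ' s : Measure Mass).prod (μ' s : Measure Mass)) -
      ∫ z, bracket u z.1 z.2 * G z.1 z.2 ∂ν| ≤ (2 * (1 * growth 1 R T * bconst 1 * 1 * R) * δ +
      growth 1 R T * bconst 1 * ∫ z, wpow φ 1 z.1 * wpow φ 1 z.2 * Γ z.1 z.2 ∂ν) +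
      |∫ z, bracket u' z.1 z.2 * G z.1 z.2 ∂ν - ∫ z, bracket u z.1 z.2 * G z.1 z.2 ∂ν| := by
    have h1 := abs_sub_le (∫ z, bracket u' z.1 z.2 * G' z.1 z.2
        ∂((μ' s : Measure Mass).prod (μ' s : Measure Mass)))
      (∫ z, bracket u' z.1 z.2 * G' z.1 z.2 ∂ν) (∫ z, bracket u z.1 z.2 * G z.1 z.2 ∂ν)
    have h2 := abs_sub_le (∫ z, bracket u' z.1 z.2 * G' z.1 z.2 ∂ν)
      (∫ z, bracket u' z.1 z.2 * G z.1 z.2 ∂ν) (∫ z, bracket u z.1 z.2 * G z.1 z.2 ∂ν)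
    linarith
  have hpos : 0 ≤ growth 1 R T * bconst 1 * ∫ z, wpow φ 1 z.1 * wpow φ 1 z.2 * Γ z.1 z.2 ∂ν :=
    (abs_nonneg _).trans i2
  refine (ENNReal.ofReal_le_ofReal i4).trans ?_
  rw [ENNReal.ofReal_add (add_nonneg (by positivity) hpos) (abs_nonneg _),
    ENNReal.ofReal_add (by positivity) hpos, sensGap, one_mul, mul_one]
  exact add_le_add le_rfl i3

/-- The difference of the sensitivity functionals of two close solutions. -/
lemma abs_sensitivity_sub_le (hS : MomentSolution φ 3 R K T μ₀ μ)
    (hS' : MomentSolution φ 3 R K' T μ₀ μ') (hδ0 : 0 ≤ δ) (hδ1 : δ ≤ 1)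
    (hn : ∀ t ∈ Icc 0 T, Near φ 2 δ (μ' t : Measure Mass) (μ t : Measure Mass))
    (hG : KernDom φ 1 G) (hG' : KernDom φ 1 G') {D : ℝ}
    (hΓm : Measurable fun z : Mass × Mass => Γ z.1 z.2) (hΓD : ∀ x y, |Γ x y| ≤ D * (φ x * φ y))
    (hΓ : ∀ x y, |G' x y - G x y| ≤ Γ x y)
    (hf : Dom (wpow φ 1) 1 f) (ht : t ∈ Icc 0 T) :
    ENNReal.ofReal |sensitivity K' G' μ' t f - sensitivity K G μ t f| ≤
      ∫⁻ s in Ioc 0 T, sensGap φ (growth 1 R T * bconst 1) δ R K K' Γ μ T s := by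
  have hI' := hS'.intervalIntegrable_sensIntegrand (p := 1) le_rfl (by norm_num) zero_le_one hG'
    zero_le_one hf ht
  have hI := hS.intervalIntegrable_sensIntegrand (p := 1) le_rfl (by norm_num) zero_le_one hG
    zero_le_one hf ht
  rw [sensitivity, sensitivity, ← mul_sub, ← intervalIntegral.integral_sub hI' hI, abs_mul,
    abs_of_pos (by norm_num : (0 : ℝ) < 1 / 2)]
  refine (ENNReal.ofReal_le_ofReal (mul_le_of_le_one_left (abs_nonneg _) (by norm_num))).trans ?_
  rw [← Real.enorm_eq_ofReal_abs, intervalIntegral.integral_of_le ht.1]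
  refine (enorm_integral_le_lintegral_enorm _).trans ?_
  refine le_trans ?_ (lintegral_mono_set (Ioc_subset_Ioc_right ht.2))
  refine setLIntegral_mono' measurableSet_Ioc fun s hs => ?_
  rw [Real.enorm_eq_ofReal_abs]
  exact hS.abs_sensIntegrand_sub_le hS' hδ0 hδ1 hn hG hG' hΓm hΓD hΓ hf ht.2 ⟨hs.1.le, hs.2⟩

lemma gap_bracket_le (hS : MomentSolution φ 3 R K T μ₀ μ) (hK' : CoagKernel φ K')
    (hc : 0 ≤ c) (hδ : δ ≤ 1) {s : ℝ} (hs : 0 ≤ s) (z : Mass × Mass) :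
    (gap φ c δ K K' μ T s (z.1 + z.2) + gap φ c δ K K' μ T s z.1 + gap φ c δ K K' μ T s z.2) *
      ENNReal.ofReal (φ z.1 * φ z.2) ≤
      ENNReal.ofReal (gapConst c R T * bconst 2 * (wpow φ 3 z.1 * wpow φ 3 z.2)) := by
  have hφ := hS.weight
  have hg : 0 ≤ gapConst c R T := by unfold gapConst; positivity
  have h1 := hφ.pos z.1
  have h2 := hφ.pos z.2
  have w1 := hφ.one_le_wpow zero_le_two z.1
  have w2 := hφ.one_le_wpow zero_le_two z.2
  have w3 := hφ.wpow_nonneg 2 (z.1 + z.2)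
  have e : ∀ x, wpow φ 3 x = wpow φ 2 x * φ x := fun x => by
    rw [← hφ.wpow_add_one]; norm_num
  refine (mul_le_mul_left (add_le_add (add_le_add (hS.gap_le hK' hc hδ hs _)
    (hS.gap_le hK' hc hδ hs _)) (hS.gap_le hK' hc hδ hs _)) _).trans ?_
  rw [← ENNReal.ofReal_add (by positivity) (by positivity),
    ← ENNReal.ofReal_add (by positivity) (by positivity), ← ENNReal.ofReal_mul (by positivity)]
  refine ENNReal.ofReal_le_ofReal ?_
  have h3 := hφ.wpow_apply_add_le zero_le_two z.1 z.2
  have h4 : wpow φ 2 z.1 ≤ wpow φ 2 z.1 * wpow φ 2 z.2 := le_mul_of_one_le_right (by linarith) w2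
  have h5 : wpow φ 2 z.2 ≤ wpow φ 2 z.1 * wpow φ 2 z.2 := le_mul_of_one_le_left (by linarith) w1
  have h6 : wpow φ 2 (z.1 + z.2) + wpow φ 2 z.1 + wpow φ 2 z.2 ≤
      bconst 2 * (wpow φ 2 z.1 * wpow φ 2 z.2) := by
    unfold bconst; linarith
  rw [e, e]
  calc _ = gapConst c R T * (wpow φ 2 (z.1 + z.2) + wpow φ 2 z.1 + wpow φ 2 z.2) *
        (φ z.1 * φ z.2) := by ring
    _ ≤ gapConst c R T * (bconst 2 * (wpow φ 2 z.1 * wpow φ 2 z.2)) * (φ z.1 * φ z.2) := by gcongr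
    _ = _ := by ring

lemma lintegral_gap_bracket_le (hS : MomentSolution φ 3 R K T μ₀ μ) (hc : 0 ≤ c) (s : ℝ) :
    ∫⁻ z : Mass × Mass, ENNReal.ofReal (gapConst c R T * bconst 2 * (wpow φ 3 z.1 * wpow φ 3 z.2))
      ∂((μ s : Measure Mass).prod (μ s : Measure Mass)) ≤
      ENNReal.ofReal (gapConst c R T * bconst 2 * (R * R)) := by
  have hφ := hS.weight
  have hg : 0 ≤ gapConst c R T := by unfold gapConst; positivity
  have hb := bconst_pos 2
  rw [← ofReal_integral_eq_lintegral_ofReal ((integrable_wpow_prod hφ (hS.moment s)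
    (hS.moment s)).const_mul _) (ae_of_all _ fun z => by
      have := hφ.wpow_nonneg 3 z.1
      have := hφ.wpow_nonneg 3 z.2
      positivity), integral_const_mul]
  exact ENNReal.ofReal_le_ofReal (mul_le_mul_of_nonneg_left (integral_wpow_prod_le hφ (hS.moment s)
    (hS.moment s)) (by positivity))

/-- The bound for the difference of the sensitivities tends to zero. -/
lemma tendsto_lintegral_sensGap (hS : MomentSolution φ 3 R K T μ₀ μ) {KN : ℕ → Kern}
    (hKN : ∀ N, CoagKernel φ (KN N)) (hc : 0 ≤ c) {δN : ℕ → ℝ} (hδ : ∀ N, δN N ≤ 1)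
    (hδ0 : Tendsto δN atTop (𝓝 0)) (hlim : ∀ x y, Tendsto (fun N => KN N x y) atTop (𝓝 (K x y)))
    {Γ : ℕ → Kern} {D : ℝ} (hD : 0 ≤ D)
    (hΓm : ∀ N, Measurable fun z : Mass × Mass => Γ N z.1 z.2)
    (hΓD : ∀ N x y, |Γ N x y| ≤ D * (φ x * φ y))
    (hΓ : ∀ x y, Tendsto (fun N => Γ N x y) atTop (𝓝 0)) :
    Tendsto (fun N => ∫⁻ s in Ioc 0 T, sensGap φ c (δN N) R K (KN N) (Γ N) μ T s) atTop (𝓝 0) := by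
  have hφ := hS.weight
  have hm : ∀ s, Moment φ 2 R (μ s : Measure Mass) := fun s => (hS.moment s).mono hφ (by norm_num)
  have hgap := fun N => hS.measurable_gap (hKN N) c (δN N)
  set b : ℝ≥0∞ := ENNReal.ofReal (2 * (c * R) * 1) + ENNReal.ofReal (c * (D * (R * R))) +
    ENNReal.ofReal (gapConst c R T * bconst 2 * (R * R)) with hb
  have hpt : ∀ s ∈ Ioc 0 T, Tendsto (fun N => sensGap φ c (δN N) R K (KN N) (Γ N) μ T s) atTop
      (𝓝 0) := by
    intro s hs
    have t1 : Tendsto (fun N => ENNReal.ofReal (2 * (c * R) * δN N)) atTop (𝓝 0) := by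
      have := (ENNReal.continuous_ofReal.tendsto _).comp (hδ0.const_mul (2 * (c * (R : ℝ))))
      rwa [mul_zero, ENNReal.ofReal_zero] at this
    have t2 : Tendsto (fun N => ENNReal.ofReal (c * ∫ z, wpow φ 1 z.1 * wpow φ 1 z.2 * Γ N z.1 z.2
        ∂((μ s : Measure Mass).prod (μ s : Measure Mass)))) atTop (𝓝 0) := by
      have h1 := tendsto_integral_of_dominated_convergence
        (μ := (μ s : Measure Mass).prod (μ s : Measure Mass))
        (F := fun N (z : Mass × Mass) => wpow φ 1 z.1 * wpow φ 1 z.2 * Γ N z.1 z.2)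
        (f := fun _ => 0) (fun z => D * (wpow φ 2 z.1 * wpow φ 2 z.2))
        (fun N => (dom2_weighted hφ (hΓm N) (hΓD N)).measurable.aestronglyMeasurable)
        ((integrable_wpow_prod hφ (hm s) (hm s)).const_mul _)
        (fun N => ae_of_all _ fun z => (dom2_weighted hφ (hΓm N) (hΓD N)).abs_le z.1 z.2)
        (ae_of_all _ fun z => by
          have := (hΓ z.1 z.2).const_mul (wpow φ 1 z.1 * wpow φ 1 z.2)
          rwa [mul_zero] at this)
      rw [integral_zero] at h1
      have := (ENNReal.continuous_ofReal.tendsto _).comp (h1.const_mul c)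
      rwa [mul_zero, ENNReal.ofReal_zero] at this
    have t3 : Tendsto (fun N => ∫⁻ z, (gap φ c (δN N) K (KN N) μ T s (z.1 + z.2) +
        gap φ c (δN N) K (KN N) μ T s z.1 + gap φ c (δN N) K (KN N) μ T s z.2) *
        ENNReal.ofReal (φ z.1 * φ z.2) ∂((μ s : Measure Mass).prod (μ s : Measure Mass)))
        atTop (𝓝 0) := by
      have := tendsto_lintegral_of_dominated_convergence
        (μ := (μ s : Measure Mass).prod (μ s : Measure Mass))
        (F := fun N (z : Mass × Mass) => (gap φ c (δN N) K (KN N) μ T s (z.1 + z.2) +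
          gap φ c (δN N) K (KN N) μ T s z.1 + gap φ c (δN N) K (KN N) μ T s z.2) *
          ENNReal.ofReal (φ z.1 * φ z.2)) (f := fun _ => 0)
        (fun z => ENNReal.ofReal (gapConst c R T * bconst 2 * (wpow φ 3 z.1 * wpow φ 3 z.2)))
        (fun N => ?_) (fun N => ae_of_all _ (hS.gap_bracket_le (hKN N) hc (hδ N) hs.1.le))
        ((hS.lintegral_gap_bracket_le hc s).trans_lt ENNReal.ofReal_lt_top).ne
        (ae_of_all _ fun z => ?_)
      · rwa [lintegral_zero] at this
      · have hg : Measurable fun x => gap φ c (δN N) K (KN N) μ T s x :=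
          (hgap N).comp (measurable_const.prodMk measurable_id)
        have h1 : Measurable fun z : Mass × Mass => z.1 + z.2 := by fun_prop
        have h4 : Measurable fun z : Mass × Mass => φ z.1 * φ z.2 :=
          (hφ.measurable.comp measurable_fst).mul (hφ.measurable.comp measurable_snd)
        exact (((hg.comp h1).add (hg.comp measurable_fst)).add (hg.comp measurable_snd)).mul
          h4.ennreal_ofReal
      · have h1 := hS.tendsto_gap hKN hc hδ hδ0 hlim s
        have h2 := ENNReal.Tendsto.mul_const (b := ENNReal.ofReal (φ z.1 * φ z.2))
          (((h1 (z.1 + z.2)).add (h1 z.1)).add (h1 z.2)) (Or.inr ENNReal.ofReal_ne_top)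
        rwa [add_zero, add_zero, zero_mul] at h2
    have := (t1.add t2).add t3
    rwa [add_zero, add_zero] at this
  have hle : ∀ N, ∀ s ∈ Ioc 0 T, sensGap φ c (δN N) R K (KN N) (Γ N) μ T s ≤ b := by
    intro N s hs
    refine add_le_add (add_le_add (ENNReal.ofReal_le_ofReal ?_) (ENNReal.ofReal_le_ofReal ?_)) ?_
    · exact mul_le_mul_of_nonneg_left (hδ N) (by positivity)
    · refine mul_le_mul_of_nonneg_left ((le_abs_self _).trans ?_) hc
      exact (dom2_weighted hφ (hΓm N) (hΓD N)).abs_integral_le hφ hD (hm s) (hm s)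
    · exact (lintegral_mono fun z => hS.gap_bracket_le (hKN N) hc (hδ N) hs.1.le z).trans
        (hS.lintegral_gap_bracket_le hc s)
  have := tendsto_lintegral_of_dominated_convergence (μ := volume.restrict (Ioc 0 T))
    (F := fun N s => sensGap φ c (δN N) R K (KN N) (Γ N) μ T s) (f := fun _ => 0) (fun _ => b)
    (fun N => hS.measurable_sensGap (hKN N) (hΓm N) c (δN N))
    (fun N => (ae_restrict_iff' measurableSet_Ioc).2 (ae_of_all _ (hle N)))
    (by
      rw [lintegral_const, Measure.restrict_apply_univ, Real.volume_Ioc]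
      exact ENNReal.mul_ne_top (by finiteness) ENNReal.ofReal_ne_top)
    ((ae_restrict_iff' measurableSet_Ioc).2 (ae_of_all _ hpt))
  rwa [lintegral_zero] at this

end MomentSolution

end

/-! ### Dependence of the propagator on the path -/

section

variable {K G : Kern} {T : ℝ} {m m' : ℝ → FiniteMeasure Mass} {t : ℝ} {f : Mass → ℝ}

lemma cumRate_congr (h : ∀ r ∈ Icc 0 T, m r = m' r) {s : ℝ} (hs : s ∈ Icc 0 T) (x : Mass) :
    cumRate K m s x = cumRate K m' s x := by
  refine intervalIntegral.integral_congr fun r hr => ?_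
  rw [uIcc_of_le hs.1] at hr
  simp only [h r ⟨hr.1, hr.2.trans hs.2⟩]

lemma transportTerm_congr (h : ∀ r ∈ Icc 0 T, m r = m' r) (f : Mass → ℝ) (ht : t ≤ T) (n : ℕ) :
    ∀ s ∈ Icc 0 t, transportTerm K m n s t f = transportTerm K m' n s t f := by
  induction n with
  | zero =>
    intro s hs
    ext x
    rw [transportTerm, transportTerm, cumRate_congr h ⟨hs.1, hs.2.trans ht⟩,
      cumRate_congr h ⟨hs.1.trans hs.2, ht⟩]
  | succ n ih =>
    intro s hs
    ext x
    refine intervalIntegral.integral_congr fun r hr => ?_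
    rw [uIcc_of_le hs.2] at hr
    have hr0 : 0 ≤ r := hs.1.trans hr.1
    simp only [cumRate_congr h ⟨hs.1, hs.2.trans ht⟩, cumRate_congr h ⟨hr0, hr.2.trans ht⟩,
      h r ⟨hr0, hr.2.trans ht⟩, ih r ⟨hr0, hr.2⟩]

lemma transport_congr (h : ∀ r ∈ Icc 0 T, m r = m' r) (f : Mass → ℝ) (ht : t ≤ T) {s : ℝ}
    (hs : s ∈ Icc 0 t) : transport K m s t f = transport K m' s t f := by
  ext x
  exact tsum_congr fun n => congrFun (transportTerm_congr h f ht n s hs) x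

lemma propagatorTerm_congr (h : ∀ r ∈ Icc 0 T, m r = m' r) (f : Mass → ℝ) (ht : t ≤ T) (n : ℕ) :
    ∀ s ∈ Icc 0 t, propagatorTerm K m n s t f = propagatorTerm K m' n s t f := by
  induction n with
  | zero => exact fun s hs => transport_congr h f ht hs
  | succ n ih =>
    intro s hs
    ext x
    refine congrArg Neg.neg (intervalIntegral.integral_congr fun r hr => ?_)
    rw [uIcc_of_le hs.2] at hr
    have hr0 : 0 ≤ r := hs.1.trans hr.1
    simp only [h r ⟨hr0, hr.2.trans ht⟩, ih r ⟨hr0, hr.2⟩,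
      transport_congr h _ (hr.2.trans ht) ⟨hs.1, hr.1⟩]

lemma propagator_congr (h : ∀ r ∈ Icc 0 T, m r = m' r) (f : Mass → ℝ) (ht : t ≤ T) {s : ℝ}
    (hs : s ∈ Icc 0 t) : propagator K m s t f = propagator K m' s t f := by
  ext x
  exact tsum_congr fun n => congrFun (propagatorTerm_congr h f ht n s hs) x

lemma sensIntegrand_congr (h : ∀ r ∈ Icc 0 T, m r = m' r) (f : Mass → ℝ) (ht : t ≤ T) {s : ℝ}
    (hs : s ∈ Icc 0 t) : sensIntegrand K G m t f s = sensIntegrand K G m' t f s := by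
  rw [sensIntegrand, sensIntegrand, propagator_congr h f ht hs, h s ⟨hs.1, hs.2.trans ht⟩]

lemma PropagatorActsOn.congr {φ : Mass → ℝ} {p : ℝ} (hm : PropagatorActsOn φ p K m T)
    (h : ∀ r ∈ Icc 0 T, m r = m' r) : PropagatorActsOn φ p K m' T := by
  intro f hf s t hs hst ht
  have hst' : s ∈ Icc 0 t := ⟨hs, hst⟩
  have := hm f hf s t hs hst ht
  simpa only [transportTerm_congr h f ht _ s hst', propagatorTerm_congr h f ht _ s hst',
    propagator_congr h f ht hst'] using this

lemma IsRepresented.congr {φ : Mass → ℝ} {p : ℝ} {ρ : SignedMeasure Mass}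
    (hm : IsRepresented φ p K G m t ρ) (h : ∀ r ∈ Icc 0 T, m r = m' r) (ht : t ∈ Icc 0 T) :
    IsRepresented φ p K G m' t ρ := by
  refine ⟨hm.1, fun f hf => ?_⟩
  obtain ⟨h1, h2⟩ := hm.2 f hf
  refine ⟨h1.congr fun s hs => ?_, h2.trans ?_⟩
  · rw [uIoc_of_le ht.1] at hs
    exact sensIntegrand_congr h f ht.2 ⟨hs.1.le, hs.2⟩
  · congr 1
    refine intervalIntegral.integral_congr fun s hs => ?_
    rw [uIcc_of_le ht.1] at hs
    exact sensIntegrand_congr h f ht.2 hs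

end

/-! ### Convergence of the sensitivities -/

lemma DualFunctional.normM_le_of_unit {φ : Mass → ℝ} {p a : ℝ} {F : (Mass → ℝ) → ℝ}
    {ρ : SignedMeasure Mass} (hF : DualFunctional (wpow φ p) a F) (hφ : IsWeight φ) (hp : 0 ≤ p)
    (hρ : ∀ A, MeasurableSet A → ρ A = F (A.indicator fun _ => 1)) {b : ℝ≥0∞}
    (hb : ∀ f, Dom (wpow φ p) 1 f → ENNReal.ofReal |F f| ≤ b) : normM φ p ρ ≤ b := by
  rcases eq_or_ne b ∞ with rfl | hbt
  · exact le_top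
  have h : DualFunctional (wpow φ p) b.toReal F := hF.of_bound fun C f hC hf => by
    rcases hC.eq_or_lt with rfl | hC'
    · have := hF.bound 0 f le_rfl hf
      rwa [zero_mul] at this ⊢
    · have h1 : Dom (wpow φ p) 1 (fun x => C⁻¹ * f x) := by
        have := hf.const_mul C⁻¹
        rwa [abs_of_pos (inv_pos.2 hC'), inv_mul_cancel₀ hC'.ne'] at this
      have h2 := (ENNReal.ofReal_le_iff_le_toReal hbt).1 (hb _ h1)
      rw [hF.smul C⁻¹ C f hC hf, abs_mul, abs_of_pos (inv_pos.2 hC')] at h2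
      rwa [inv_mul_le_iff₀ hC'] at h2
  exact (h.normM_le hφ hp hρ).trans ENNReal.ofReal_toReal_le

section

variable {K K' G G' Γ : Kern} {T : ℝ} {μ₀ : FiniteMeasure Mass} {μ μ' : ℝ → FiniteMeasure Mass}
  {φ : Mass → ℝ} {p q δ : ℝ} {B R : ℝ≥0} {t : ℝ} {ρ ρ' : SignedMeasure Mass}

namespace MomentSolution

lemma propagatorActsOn (hS : MomentSolution φ q B K T μ₀ μ) (hp : 1 ≤ p) (hpq : p + 1 ≤ q) :
    PropagatorActsOn φ p K μ T := by
  intro f hf s t hs hst ht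
  have hφ := hS.weight
  obtain ⟨C, hC, hfC⟩ := hf.exists_dom hφ
  have hP := hS.coagPath (by linarith) hS.toCoagKernel
  have hw := lyap_wpow hφ hp hP hS.le fun r => (hS.moment r).mono hφ hpq
  exact ⟨hw.summable_transportTerm hP hC hfC hst, hw.summable_propagatorTerm hP hC hfC hst,
    (hw.dom_propagator hP hC hfC hst).memB⟩

lemma isRepresented (hS : MomentSolution φ q B K T μ₀ μ) (hp : 1 ≤ p) (hpq : p + 2 ≤ q) {D : ℝ}
    (hD : 0 ≤ D) (hG : KernDom φ D G) (ht : t ∈ Icc 0 T)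
    (hρ : ∀ A, MeasurableSet A → ρ A = sensitivity K G μ t (A.indicator fun _ => 1)) :
    IsRepresented φ p K G μ t ρ := by
  have hφ := hS.weight
  have hF := hS.dualFunctional_sensitivity hp hpq hD hG ht
  refine ⟨(normM_mono hφ hp).trans_lt
    ((hF.normM_le hφ (by linarith) hρ).trans_lt ENNReal.ofReal_lt_top), fun f hf => ?_⟩
  obtain ⟨C, hC, hfC⟩ := hf.exists_dom hφ
  exact ⟨hS.intervalIntegrable_sensIntegrand hp (by linarith) hD hG hC hfC ht,
    hF.pairing_eq (hφ.one_le_wpow (by linarith)) (hφ.measurable_wpow p) hρ hC hfC⟩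

/-- The distance of the sensitivities of two close solutions. -/
lemma normM_sub_le (hS : MomentSolution φ 3 R K T μ₀ μ)
    (hS' : MomentSolution φ 3 R K' T μ₀ μ') (hδ0 : 0 ≤ δ) (hδ1 : δ ≤ 1)
    (hn : ∀ t ∈ Icc 0 T, Near φ 2 δ (μ' t : Measure Mass) (μ t : Measure Mass))
    (hG : KernDom φ 1 G) (hG' : KernDom φ 1 G') {D : ℝ}
    (hΓm : Measurable fun z : Mass × Mass => Γ z.1 z.2) (hΓD : ∀ x y, |Γ x y| ≤ D * (φ x * φ y))
    (hΓ : ∀ x y, |G' x y - G x y| ≤ Γ x y) (ht : t ∈ Icc 0 T)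
    (hρ : ∀ A, MeasurableSet A → ρ A = sensitivity K G μ t (A.indicator fun _ => 1))
    (hρ' : ∀ A, MeasurableSet A → ρ' A = sensitivity K' G' μ' t (A.indicator fun _ => 1)) :
    normM φ 1 (ρ' - ρ) ≤
      ∫⁻ s in Ioc 0 T, sensGap φ (growth 1 R T * bconst 1) δ R K K' Γ μ T s := by
  have hF := hS.dualFunctional_sensitivity (p := 1) le_rfl (by norm_num) zero_le_one hG ht
  have hF' := hS'.dualFunctional_sensitivity (p := 1) le_rfl (by norm_num) zero_le_one hG' ht
  refine (hF'.sub hF).normM_le_of_unit hS.weight zero_le_one (fun A hA => ?_) fun f hf =>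
    hS.abs_sensitivity_sub_le hS' hδ0 hδ1 hn hG hG' hΓm hΓD hΓ hf ht
  rw [sub_apply, hρ A hA, hρ' A hA]

end MomentSolution

lemma KernDom.mono {D D' : ℝ} (hφ : IsWeight φ) (hG : KernDom φ D G) (h : D ≤ D') :
    KernDom φ D' G :=
  ⟨hG.measurable, fun x y => (hG.abs_le x y).trans
    (mul_le_mul_of_nonneg_right h (mul_pos (hφ.pos x) (hφ.pos y)).le)⟩

variable {d : ℕ} {𝒰 : Set (Param d)} {𝒦 𝒦' : Param d → Kern} {ℓ : Param d}

/-- A bound for the difference of the derivatives of two kernels in directions `v` with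
`‖v‖ ≤ 1`. -/
def derivGap (𝒦 𝒦' : Param d → Kern) (ℓ : Param d) : Kern := fun x y =>
  ∑ i, |dKern 𝒦' ℓ (EuclideanSpace.single i 1) x y - dKern 𝒦 ℓ (EuclideanSpace.single i 1) x y|

lemma abs_dKern_sub_le {v : Param d} (hv : ‖v‖ ≤ 1) (x y : Mass) :
    |dKern 𝒦' ℓ v x y - dKern 𝒦 ℓ v x y| ≤ derivGap 𝒦 𝒦' ℓ x y := by
  set A := fderiv ℝ (fun ℓ' => 𝒦' ℓ' x y) ℓ - fderiv ℝ (fun ℓ' => 𝒦 ℓ' x y) ℓ with hA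
  have h1 : A v = ∑ i, v i * A (EuclideanSpace.single i 1) := by
    conv_lhs => rw [← (EuclideanSpace.basisFun (Fin d) ℝ).sum_repr v]
    rw [map_sum]
    refine Finset.sum_congr rfl fun i _ => ?_
    rw [map_smul, EuclideanSpace.basisFun_repr, EuclideanSpace.basisFun_apply, smul_eq_mul]
  change |A v| ≤ ∑ i, |A (EuclideanSpace.single i 1)|
  rw [h1]
  refine (Finset.abs_sum_le_sum_abs _ _).trans (Finset.sum_le_sum fun i _ => ?_)
  rw [abs_mul]
  exact mul_le_of_le_one_left (abs_nonneg _) ((PiLp.norm_apply_le v i).trans hv)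

lemma measurable_derivGap (h : IsKernelFamily 𝒰 φ 𝒦) (h' : IsKernelFamily 𝒰 φ 𝒦')
    (h𝒰 : IsOpen 𝒰) (hℓ : ℓ ∈ 𝒰) : Measurable fun z : Mass × Mass => derivGap 𝒦 𝒦' ℓ z.1 z.2 :=
  Finset.measurable_fun_sum _ fun _ _ =>
    ((h'.measurable_dKern h𝒰 hℓ _).sub (h.measurable_dKern h𝒰 hℓ _)).abs

lemma abs_derivGap_le (h : IsKernelFamily 𝒰 φ 𝒦) (h' : IsKernelFamily 𝒰 φ 𝒦') (hℓ : ℓ ∈ 𝒰)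
    (x y : Mass) : |derivGap 𝒦 𝒦' ℓ x y| ≤ 2 * d * (φ x * φ y) := by
  refine (Finset.abs_sum_le_sum_abs _ _).trans ?_
  have : ∀ i ∈ (Finset.univ : Finset (Fin d)), |(|dKern 𝒦' ℓ (EuclideanSpace.single i 1) x y -
      dKern 𝒦 ℓ (EuclideanSpace.single i 1) x y|)| ≤ 2 * (φ x * φ y) := fun i _ => by
    have h1 := h.abs_dKern_le hℓ (EuclideanSpace.single i 1) x y
    have h2 := h'.abs_dKern_le hℓ (EuclideanSpace.single i 1) x y
    rw [PiLp.norm_single, norm_one, one_mul] at h1 h2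
    rw [abs_abs]
    exact (abs_sub _ _).trans (by linarith)
  refine (Finset.sum_le_card_nsmul _ _ _ this).trans (le_of_eq ?_)
  rw [Finset.card_univ, Fintype.card_fin, nsmul_eq_mul]
  ring

lemma tendsto_derivGap {𝒦N : ℕ → Param d → Kern} (h : KernelsConverge 𝒰 𝒦N 𝒦) (hℓ : ℓ ∈ 𝒰)
    (x y : Mass) : Tendsto (fun N => derivGap 𝒦 (𝒦N N) ℓ x y) atTop (𝓝 0) := by
  have h1 : ∀ i ∈ (Finset.univ : Finset (Fin d)), Tendsto (fun N =>
      |dKern (𝒦N N) ℓ (EuclideanSpace.single i 1) x y -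
        dKern 𝒦 ℓ (EuclideanSpace.single i 1) x y|) atTop (𝓝 0) := fun i _ => by
    have h2 := ((ContinuousLinearMap.apply ℝ ℝ (EuclideanSpace.single i 1 : Param d)).continuous.tendsto
      _).comp (h ℓ hℓ x y).2
    have h3 := (h2.sub_const (dKern 𝒦 ℓ (EuclideanSpace.single i 1) x y)).abs
    rwa [show ContinuousLinearMap.apply ℝ ℝ (EuclideanSpace.single i 1 : Param d)
      (fderiv ℝ (fun ℓ' => 𝒦 ℓ' x y) ℓ) = dKern 𝒦 ℓ (EuclideanSpace.single i 1) x y from rfl,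
      sub_self, abs_zero] at h3
  have := tendsto_finsetSum _ h1
  rwa [Finset.sum_const_zero] at this

/-- The sensitivities of the approximating solutions converge. -/
lemma tendsto_sensitivity (h𝒰 : IsOpen 𝒰) (h𝒦 : IsKernelFamily 𝒰 φ 𝒦) {𝒦N : ℕ → Param d → Kern}
    (h𝒦N : ∀ N, IsKernelFamily 𝒰 φ (𝒦N N)) (hlim : KernelsConverge 𝒰 𝒦N 𝒦) (hℓ : ℓ ∈ 𝒰)
    (hS : MomentSolution φ 4 B (𝒦 ℓ) T μ₀ μ) {BN : ℕ → ℝ≥0} {μN : ℕ → ℝ → FiniteMeasure Mass}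
    (hSN : ∀ N, MomentSolution φ 4 (BN N) (𝒦N N ℓ) T μ₀ (μN N))
    {σN : ℕ → ℝ → Param d →ₗ[ℝ] SignedMeasure Mass} {σ : ℝ → Param d →ₗ[ℝ] SignedMeasure Mass}
    (hσN : ∀ N, ∀ t ∈ Icc 0 T, ∀ v A, MeasurableSet A →
      σN N t v A = sensitivity (𝒦N N ℓ) (dKern (𝒦N N) ℓ v) (μN N) t (A.indicator fun _ => 1))
    (hσ : ∀ t ∈ Icc 0 T, ∀ v A, MeasurableSet A →
      σ t v A = sensitivity (𝒦 ℓ) (dKern 𝒦 ℓ v) μ t (A.indicator fun _ => 1)) :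
    Tendsto (fun N => ⨆ t ∈ Icc 0 T, ⨆ v ∈ Metric.closedBall (0 : Param d) 1,
      normM φ 1 (σN N t v - σ t v)) atTop (𝓝 0) := by
  have hφ := hS.weight
  obtain ⟨R, δ, hBR, hδ, hδ0, hev⟩ := hS.exists_near hSN fun x y => (hlim ℓ hℓ x y).1
  have hS3 : MomentSolution φ 3 R (𝒦 ℓ) T μ₀ μ := (hS.mono (by norm_num)).mono_const hBR
  have hδ' : Tendsto (fun N => min (δ N) 1) atTop (𝓝 0) := by
    have := hδ.min (tendsto_const_nhds (x := (1 : ℝ)))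
    rwa [min_eq_left zero_le_one] at this
  have hgr := growth_pos 1 R T
  have hb := bconst_pos 1
  have hz := hS3.tendsto_lintegral_sensGap (c := growth 1 R T * bconst 1)
    (fun N => (h𝒦N N).coagKernel hℓ) (by positivity) (fun N => min_le_right (δ N) 1) hδ'
    (fun x y => (hlim ℓ hℓ x y).1) (D := 2 * d) (by positivity)
    (fun N => measurable_derivGap h𝒦 (h𝒦N N) h𝒰 hℓ) (fun N => abs_derivGap_le h𝒦 (h𝒦N N) hℓ)
    (tendsto_derivGap hlim hℓ)
  refine tendsto_of_tendsto_of_tendsto_of_le_of_le' tendsto_const_nhds hz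
    (Eventually.of_forall fun _ => zero_le) ?_
  filter_upwards [hev, hδ.eventually_le_const one_pos] with N hN hδN
  rw [min_eq_left hδN]
  refine iSup₂_le fun t ht => iSup₂_le fun v hv => ?_
  rw [mem_closedBall_zero_iff] at hv
  exact hS3.normM_sub_le ((hSN N).with_moment hN.1) (hδ0 N) hδN hN.2
    ((h𝒦.kernDom_dKern h𝒰 hℓ v).mono hφ hv) (((h𝒦N N).kernDom_dKern h𝒰 hℓ v).mono hφ hv)
    (measurable_derivGap h𝒦 (h𝒦N N) h𝒰 hℓ) (abs_derivGap_le h𝒦 (h𝒦N N) hℓ)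
    (abs_dKern_sub_le hv) ht (hσ t ht v) (hσN N t ht v)

/-- `exists_sensitivity` for all times at once. -/
lemma MomentSolution.exists_sensitivity_path (hS : MomentSolution φ q B K T μ₀ μ) (hp : 1 ≤ p)
    (hpq : p + 2 ≤ q) (h𝒦 : IsKernelFamily 𝒰 φ 𝒦) (h𝒰 : IsOpen 𝒰) (hℓ : ℓ ∈ 𝒰) :
    ∃ σ : ℝ → Param d →ₗ[ℝ] SignedMeasure Mass, ∀ t ∈ Icc 0 T, ∀ v A, MeasurableSet A →
      σ t v A = sensitivity K (dKern 𝒦 ℓ v) μ t (A.indicator fun _ => 1) := by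
  have h : ∀ t, ∃ σ : Param d →ₗ[ℝ] SignedMeasure Mass, t ∈ Icc 0 T → ∀ v A, MeasurableSet A →
      σ v A = sensitivity K (dKern 𝒦 ℓ v) μ t (A.indicator fun _ => 1) := fun t => by
    by_cases ht : t ∈ Icc 0 T
    · obtain ⟨σ, hσ⟩ := hS.exists_sensitivity hp hpq h𝒦 h𝒰 hℓ ht
      exact ⟨σ, fun _ => hσ⟩
    · exact ⟨0, fun h => absurd h ht⟩
  choose σ hσ using h
  exact ⟨σ, hσ⟩

end

end Smoluchowski

end

theorem theorem12 {d : ℕ} (𝒰 : Set (Smoluchowski.Param d)) (h𝒰 : IsOpen 𝒰)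
    (φ : Smoluchowski.Mass → ℝ) (hφ : Smoluchowski.IsWeight φ)
    (K : Smoluchowski.Param d → Smoluchowski.Kern) (hK : Smoluchowski.IsKernelFamily 𝒰 φ K)
    (KN : ℕ → Smoluchowski.Param d → Smoluchowski.Kern)
    (hKN : ∀ N, Smoluchowski.IsKernelFamily 𝒰 φ (KN N))
    (hKN_bdd : ∀ N, Smoluchowski.IsBoundedFamily 𝒰 (KN N))
    (hKN_lim : Smoluchowski.KernelsConverge 𝒰 KN K)
    (ℓ : Smoluchowski.Param d) (hℓ : ℓ ∈ 𝒰) (ε : ℝ) (hε : 0 < ε) (T : ℝ) (hT : 0 ≤ T)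
    (μ₀ : FiniteMeasure Smoluchowski.Mass)
    -- the solution for the kernel `K ℓ`, on an interval where its moment is bounded
    (μ : ℝ → FiniteMeasure Smoluchowski.Mass) (hμ : Smoluchowski.IsSolution (K ℓ) T μ₀ μ)
    (hμ_moment : ∃ C : ℝ≥0, ∀ t ∈ Icc 0 T,
      ∫⁻ x, ENNReal.ofReal (φ x ^ (4 + ε)) ∂(μ t : Measure Smoluchowski.Mass) ≤ C)
    -- the solutions for the bounded kernels
    (μN : ℕ → Smoluchowski.Param d → ℝ → FiniteMeasure Smoluchowski.Mass)
    (hμN : ∀ N, ∀ ℓ' ∈ 𝒰, Smoluchowski.IsSolution (KN N ℓ') T μ₀ (μN N ℓ')) :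
    Smoluchowski.PropagatorActsOn φ (1 + ε) (K ℓ) μ T ∧
    ∃ (σN : ℕ → ℝ → Smoluchowski.Param d →ₗ[ℝ] SignedMeasure Smoluchowski.Mass)
      (σ : ℝ → Smoluchowski.Param d →ₗ[ℝ] SignedMeasure Smoluchowski.Mass),
      (∀ N, ∀ t ∈ Icc 0 T,
        Smoluchowski.HasSensitivityAt (fun ℓ' => μN N ℓ' t) (σN N t) ℓ ∧
        ∀ v, Smoluchowski.normM φ 1 (σN N t v) < ∞) ∧
      (∀ t ∈ Icc 0 T, ∀ v,
        Smoluchowski.IsRepresented φ (1 + ε) (K ℓ) (Smoluchowski.dKern K ℓ v) μ t (σ t v)) ∧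
      Tendsto (fun N => ⨆ t ∈ Icc 0 T, ⨆ v ∈ Metric.closedBall (0 : Smoluchowski.Param d) 1,
        Smoluchowski.normM φ 1 (σN N t v - σ t v)) atTop (𝓝 0) := by
  obtain ⟨B, hB⟩ := hμ_moment
  have hTT : T ∈ Icc 0 T := ⟨hT, le_rfl⟩
  have hS := hμ.momentSolution (hK.coagKernel hℓ) hφ hTT hB
  have hm0 : Smoluchowski.Moment φ (4 + ε) B (μ₀ : Measure Smoluchowski.Mass) := by
    have := hB 0 ⟨le_rfl, hT⟩
    rwa [hμ.initial] at this
  have hmN : ∀ N, ∃ BN : ℝ≥0, ∀ t ∈ Icc 0 T,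
      Smoluchowski.Moment φ 4 BN (μN N ℓ t : Measure Smoluchowski.Mass) := fun N => by
    obtain ⟨M, hM⟩ := hKN_bdd N
    exact (hμN N ℓ hℓ).exists_moment ((hKN N).coagKernel hℓ)
      (fun x y => (le_abs_self _).trans (hM ℓ hℓ x y).1) hφ hT (by norm_num)
      (hm0.mono hφ (by linarith))
  choose BN hBN using hmN
  have hSN := fun N => (hμN N ℓ hℓ).momentSolution ((hKN N).coagKernel hℓ) hφ hTT (hBN N)
  have hfr : ∀ r ∈ Icc 0 T, Smoluchowski.freeze T μ r = μ r := fun r hr =>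
    Smoluchowski.freeze_of_mem hr
  obtain ⟨σ, hσ⟩ := hS.exists_sensitivity_path (p := 1) le_rfl (by linarith) hK h𝒰 hℓ
  have hex := fun N =>
    (hSN N).exists_sensitivity_path (p := 1) le_rfl (by norm_num) (hKN N) h𝒰 hℓ
  choose σN hσN using hex
  refine ⟨(hS.propagatorActsOn (by linarith) (by linarith)).congr hfr, σN, σ,
    fun N t ht => ⟨?_, fun v => ?_⟩, fun t ht v => ?_, ?_⟩
  · exact Smoluchowski.hasSensitivityAt (hKN N) h𝒰 (hKN_bdd N) hℓ hT (hμN N) ht (hσN N t ht)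
  · exact ((hSN N).isRepresented (p := 1) le_rfl (by norm_num) (norm_nonneg v)
      ((hKN N).kernDom_dKern h𝒰 hℓ v) ht (hσN N t ht v)).1
  · exact (hS.isRepresented (by linarith) (by linarith) (norm_nonneg v)
      (hK.kernDom_dKern h𝒰 hℓ v) ht (hσ t ht v)).congr hfr ht
  · exact Smoluchowski.tendsto_sensitivity h𝒰 hK hKN hKN_lim hℓ (hS.mono (by linarith)) hSN hσN hσ
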